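/- **Setting.** Let $p$ be a prime, $K/\mathbb{Q}_p$ a finite extension with ring of integers $\mathcal{O}_K$, maximal ideal $\mathfrak{m}$, residue field $k$, ramification index $e$ and residue degree $f>1$; let $G_K\supset I_K$ be the absolute Galois group and the inertia group. Put $\Gamma=\mathrm{GL}_2(k)$, $\mathcal{K}=\mathrm{GL}_2(\mathcal{O}_K)$, $\mathcal{K}_1=1+\mathfrak{m}M_2(\mathcal{O}_K)$. Indices $i$ run over $\mathbb{Z}/f=\{0,\dots,f-1\}$. Fix $\sigma_{f-1}:k\hookrightarrow\overline{\mathbb{F}}_p$, put $\sigma_{f-1-i}=\sigma_{f-1}^{p^i}$, fix a root $\varpi$ with $\varpi^{p^f-1}$ a uniformizer of $K$, and let $\omega_i(g)=\sigma_i(g(\varpi)/\varpi)$. For $t\in\mathbb{Z}^f$ and $s\in[0,p-1]^f$ let $V_{t,s}=\bigotimes_i(\det^{t_i}\otimes\mathrm{Sym}^{s_i}k^2)\otimes_{k,\sigma_i}\overline{\mathbb{F}}_p$, a representation of $\Gamma$, also regarded as one of $\mathcal{K}$. It is *weakly regular* if all $s_i\le p-2$. **The sets $J^{AH}$.** Let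 $\chi_1,\chi_2:G_K\to\overline{\mathbb{F}}_p^\times$ be continuous characters. Say that $(\chi_1,\chi_2)$ is *admissible* for $V_{t,s}$ if there are $J\subset\mathbb{Z}/f$ and $x_i\in[0,e-1]$ such that on $I_K$ $$\chi_1=\prod_i\omega_i^{t_i}\prod_{i\in J}\omega_i^{s_i+1+x_i}\prod_{i\notin J}\omega_i^{x_i},\qquad \chi_2=\prod_i\omega_i^{t_i}\prod_{i\in J}\omega_i^{e-1-x_i}\prod_{i\notin J}\omega_i^{s_i+e-x_i}.$$ Then write $\chi_2|_{I_K}=\prod_i\omega_i^{t_i+m_i}$ with $m_i\in[0,p-1]$ not all $p-1$. Let $\mathcal{S}$ be the set of $a\in\mathbb{Z}^f$ with $\chi_2|_{I_K}=\prod_i\omega_i^{t_i+a_i}$ and $a_i\in[0,e-1]\cup[s_i+1,s_i+e]$ for all $i$. Let $v_i\in\mathbb{Z}^f$ have $-1$ in position $i$, $p$ in position $i+1$ and $0$ elsewhere. Let $A$ be the least subset of $\mathbb{Z}/f$ with $m+\sum_{i\in A}v_i\in\mathcal{S}$, and put $y=m+\sum_{i\in A}v_i$, $z_i=s_i+e-y_i$.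 Let $\mathcal{I}_i=[0,z_i-1]$ if $y_i\ge s_i+1$, and $\mathcal{I}_i=\{y_i\}\cup[s_i+1,z_i-1]$ otherwise (intervals of integers, possibly empty). Put $$\xi_i=(p^f-1)z_i+\sum_{j=0}^{f-1}(z_{i+j+1}-y_{i+j+1})p^{f-1-j}.$$ Let $n_i\in[0,p^f-1)$ be such that $\chi_2^{-1}\chi_1=\omega_i^{n_i}$ on $I_K$. Write $\chi_2^{-1}\chi_1=\prod_i\omega_i^{a_i}$ on $I_K$ with $a_i\in[1,p]$ not all $p$, let $f'$ be the size of the orbit of $(a_i)_i$ under cyclic shifts, and $f''=f/f'$. Then $J^{AH}_{V_{t,s}}(\chi_1,\chi_2)$ is the set of pairs $(m,\kappa)\in\mathbb{Z}\times\{0,\dots,f''-1\}$ for which there are an index $i$ and $u\in\mathcal{I}_i$ such that, $\nu$ being the $p$-adic valuation of $\xi_i-u(p^f-1)$, one has $m=(\xi_i-u(p^f-1))/p^\nu$, and such that $i_m+\kappa f'\equiv i-\nu\pmod f$, where $i_m\in\{0,\dots,f'-1\}$ is determined by $m\equiv n_{i_m}\pmod{p^f-1}$. **Type I intersections.** The pair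 $(\chi_1,\chi_2)$ *witnesses a type I intersection* for two weights if it is admissible for both, and $|J^{AH}(\chi_1,\chi_2)|$ is $ef$ for one of them and $ef-1$ for the other. The *families* witnessing the intersection are the pairs $(\chi_1|_{I_K},\chi_2|_{I_K})$ for the witnesses $(\chi_1,\chi_2)$. **Corollary.** Let $f>1$ and let $V=V_{d,s}$ and $V'=V_{d',s'}$ be non-isomorphic and weakly regular. Write $D=\sum_jp^{f-1-j}d_j$ and $D'=\sum_jp^{f-1-j}d'_j$. The following are equivalent. (A) There is a type I intersection for $V,V'$. (B) After possibly interchanging $V$ and $V'$, there is an index $j$ such that one of the following holds: 1. $s_j,s_{j-1}\in[0,p-2]$, $s'_j=p-2-s_j$, $s'_{j-1}=s_{j-1}+1$, $s'_i=s_i$ for $i\ne j,j-1$, and $D'\equiv D-(1+s'_j)p^{f-1-j}\pmod{p^f-1}$; 2. $e>1$, $s_j\le p-3$, $s'_j=s_j+2$, $s'_i=s_i$ for $i\neq j$, and $D'\equiv D-p^{f-1-j}\pmod{p^f-1}$. (C) $\mathrm{Ext}^1_{\overline{\mathbb{F}}_p[\Gamma]}(V,V')\ne0$, or $e>1$ and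 $\mathrm{Hom}_\Gamma(V,H^1(\mathcal{K}_1,V'))\neq0$ (continuous cohomology). (D) $\mathrm{Ext}^1_{\overline{\mathbb{F}}_p[\mathcal{K}]}(V,V')\ne0$ (extensions of smooth representations). Moreover, if there is a type I intersection for $V,V'$, then exactly one family witnesses it. Finally, when $f=2$, $s_1=\frac{p-1}2$, $s_0=\frac{p-3}2$, $s'_1=\frac{p-3}2$, $s'_0=\frac{p-1}2$, the conditions on $(s,s')$ in (B.1) hold with $j=1$ and those on the interchanged pair $(s',s)$ hold with $j=0$, but the two corresponding congruences between $D$ and $D'$ do not hold simultaneously. -/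

import Mathlib

open scoped TensorProduct

namespace SerreExt

/-! ### The field `K`, its integers, its residue field, and its absolute Galois group -/

section Field

variable (p : ℕ) [Fact p.Prime]

/-- The coefficient field: an algebraic closure of `𝔽_p`. -/
abbrev Fbar : Type := AlgebraicClosure (ZMod p)

theorem isIntegral_iff_spectralNorm_le_one (L : Type*) [Field L] [Algebra ℚ_[p] L]
    [Algebra ℤ_[p] L] [IsScalarTower ℤ_[p] ℚ_[p] L] [Algebra.IsAlgebraic ℚ_[p] L] (x : L) :
    IsIntegral ℤ_[p] x ↔ spectralNorm ℚ_[p] L x ≤ 1 := by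
  have hx : IsIntegral ℚ_[p] x := (Algebra.IsAlgebraic.isAlgebraic x).isIntegral
  unfold spectralNorm
  rw [spectralValue_le_one_iff (minpoly.monic hx)]
  constructor
  · intro h n
    have h2 := minpoly.isIntegrallyClosed_eq_field_fractions (S := L) ℚ_[p] L h
    simp only [Algebra.algebraMap_self, RingHom.id_apply] at h2
    rw [h2, Polynomial.coeff_map]
    exact ((minpoly ℤ_[p] x).coeff n).2
  · intro h
    have hl : minpoly ℚ_[p] x ∈ Polynomial.lifts (algebraMap ℤ_[p] ℚ_[p]) := by
      rw [Polynomial.lifts_iff_coeff_lifts]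
      intro n
      exact ⟨⟨_, h n⟩, rfl⟩
    obtain ⟨q, hq, -, hm⟩ := Polynomial.lifts_and_degree_eq_and_monic hl (minpoly.monic hx)
    refine ⟨q, hm, ?_⟩
    have h3 := minpoly.aeval ℚ_[p] x
    rw [← hq, Polynomial.aeval_map_algebraMap] at h3
    exact h3

/-- The integral closure of `ℤ_p` in an algebraic extension of `ℚ_p` is a local ring. -/
instance isLocalRing_integralClosure (L : Type*) [Field L] [Algebra ℚ_[p] L]
    [Algebra ℤ_[p] L] [IsScalarTower ℤ_[p] ℚ_[p] L] [Algebra.IsAlgebraic ℚ_[p] L] :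
    IsLocalRing (integralClosure ℤ_[p] L) := by
  have key : ∀ a : integralClosure ℤ_[p] L,
      a ∈ nonunits (integralClosure ℤ_[p] L) ↔ spectralNorm ℚ_[p] L (a : L) < 1 := by
    intro a
    have ha := (isIntegral_iff_spectralNorm_le_one p L (a : L)).1 a.2
    have hmul : ∀ x y : L, spectralNorm ℚ_[p] L (x * y) =
        spectralNorm ℚ_[p] L x * spectralNorm ℚ_[p] L y := fun x y => by
      simpa only [spectralMulAlgNorm_def] using map_mul (spectralMulAlgNorm ℚ_[p] L) x y
    rw [mem_nonunits_iff]
    constructor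
    · intro h
      by_contra hlt
      have h1 : spectralNorm ℚ_[p] L (a : L) = 1 := le_antisymm ha (not_lt.1 hlt)
      have h0 : (a : L) ≠ 0 := by
        intro h0
        rw [h0, spectralNorm_zero] at h1
        exact zero_ne_one h1
      have h2 : spectralNorm ℚ_[p] L ((a : L)⁻¹) = 1 := by
        have := hmul (a : L) ((a : L)⁻¹)
        rw [mul_inv_cancel₀ h0, h1, one_mul, spectralNorm_one] at this
        exact this.symm
      refine h (IsUnit.of_mul_eq_one
        (⟨(a : L)⁻¹, (isIntegral_iff_spectralNorm_le_one p L _).2 h2.le⟩ :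
          integralClosure ℤ_[p] L) ?_)
      ext
      exact mul_inv_cancel₀ h0
    · rintro h ⟨u, rfl⟩
      have h1 := (isIntegral_iff_spectralNorm_le_one p L _).1
        ((u⁻¹ : (integralClosure ℤ_[p] L)ˣ) : integralClosure ℤ_[p] L).2
      have h2 := hmul (u : integralClosure ℤ_[p] L)
        ((u⁻¹ : (integralClosure ℤ_[p] L)ˣ) : integralClosure ℤ_[p] L)
      rw [← MulMemClass.coe_mul, Units.mul_inv, OneMemClass.coe_one, spectralNorm_one] at h2
      have h3 := spectralNorm_nonneg (K := ℚ_[p])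
        (((u⁻¹ : (integralClosure ℤ_[p] L)ˣ) : integralClosure ℤ_[p] L) : L)
      rw [mul_comm] at h2
      exact absurd h2 (ne_of_gt (((mul_le_of_le_one_left (spectralNorm_nonneg _) h1).trans_lt h)))
  refine IsLocalRing.of_nonunits_add fun a b ha hb => ?_
  rw [key] at ha hb ⊢
  exact (isNonarchimedean_spectralNorm (K := ℚ_[p]) (L := L) (a : L) (b : L)).trans_lt
    (max_lt ha hb)

variable (K : Type*) [Field K] [Algebra ℚ_[p] K] [FiniteDimensional ℚ_[p] K]
  [Algebra ℤ_[p] K] [IsScalarTower ℤ_[p] ℚ_[p] K]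

instance isAlgebraic_algebraicClosure : Algebra.IsAlgebraic ℚ_[p] (AlgebraicClosure K) :=
  Algebra.IsAlgebraic.trans ℚ_[p] K (AlgebraicClosure K)

/-- The ring of integers `𝒪_K`. -/
abbrev OK : Type _ := integralClosure ℤ_[p] K

/-- The residue field `k` of `K`. -/
abbrev ResK : Type _ := IsLocalRing.ResidueField (OK p K)

/-- The ramification index `e(K/ℚ_p)`. -/
noncomputable def ramE : ℕ := (IsLocalRing.maximalIdeal (OK p K)).ramificationIdx ℤ_[p]

/-- The residue degree `f(K/ℚ_p)`. -/
noncomputable def resF : ℕ := (IsLocalRing.maximalIdeal (OK p K)).inertiaDeg ℤ_[p]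

/-- The group `Γ = GL₂(k)`. -/
abbrev GLk : Type _ := GL (Fin 2) (ResK p K)

/-- The group `𝒦 = GL₂(𝒪_K)`. -/
abbrev GLO : Type _ := GL (Fin 2) (OK p K)

/-- Reduction `GL₂(𝒪_K) → GL₂(k)`. -/
noncomputable def red : GLO p K →* GLk p K :=
  Matrix.GeneralLinearGroup.map (IsLocalRing.residue (OK p K))

/-- The principal congruence subgroup `𝒦_n = 1 + π^n M₂(𝒪_K)` of `GL₂(𝒪_K)` (for `n ≥ 1`), and
`𝒦_0 = GL₂(𝒪_K)`. -/
noncomputable def congrSub (n : ℕ) : Subgroup (GLO p K) :=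
  (Matrix.GeneralLinearGroup.map
    (Ideal.Quotient.mk (IsLocalRing.maximalIdeal (OK p K) ^ n))).ker

instance (n : ℕ) : (congrSub p K n).Normal := by
  unfold congrSub
  infer_instance

/-- The absolute Galois group of `K`. -/
abbrev GalK : Type _ := AlgebraicClosure K ≃ₐ[K] AlgebraicClosure K

/-- The inertia group `I_K`: the elements of `G_K` acting trivially on the integers of the
algebraic closure of `K` modulo the maximal ideal. -/
noncomputable def inertia : Subgroup (GalK K) :=
  (IsLocalRing.maximalIdeal (integralClosure ℤ_[p] (AlgebraicClosure K))).inertia (GalK K)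

/-- A continuous character `G_K → 𝔽̄_pˣ` (the target being discrete, this means that the kernel is
open). -/
structure GalChar where
  toHom : GalK K →* (Fbar p)ˣ
  isOpen_ker : IsOpen (toHom.ker : Set (GalK K))

end Field

/-! ### Representations, extensions, and the first cohomology of `𝒦₁` -/

section Ext

variable {F V W : Type} [Field F] [AddCommMonoid V] [Module F V] [AddCommMonoid W] [Module F W]

variable {H : Type*} [Group H]

/-- An extension `0 → W → E → V → 0` of the representation `ρ` on `V` by the representation `ρ'`
on `W`. -/
structure RepExtension (ρ : Representation F H V) (ρ' : Representation F H W) where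
  E : Type
  [addCommGroup : AddCommGroup E]
  [module : Module F E]
  rep : Representation F H E
  incl : ρ'.IntertwiningMap rep
  proj : rep.IntertwiningMap ρ
  incl_injective : Function.Injective incl
  proj_surjective : Function.Surjective proj
  exact : Function.Exact incl proj

attribute [instance] RepExtension.addCommGroup RepExtension.module

/-- The extension splits as an extension of representations. -/
def RepExtension.Splits {ρ : Representation F H V} {ρ' : Representation F H W}
    (X : RepExtension ρ ρ') : Prop :=
  ∃ r : ρ.IntertwiningMap X.rep, ∀ v, X.proj (r v) = v

/-- `Ext¹_{F[H]}(ρ, ρ') ≠ 0` for an abstract group `H` (Yoneda's description of `Ext¹`): some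
extension of `ρ` by `ρ'` does not split. -/
def ExtNeZero (ρ : Representation F H V) (ρ' : Representation F H W) : Prop :=
  ∃ X : RepExtension ρ ρ', ¬ X.Splits

end Ext

section SmoothExt

variable (p : ℕ) [Fact p.Prime]
variable (K : Type*) [Field K] [Algebra ℚ_[p] K] [FiniteDimensional ℚ_[p] K]
  [Algebra ℤ_[p] K] [IsScalarTower ℤ_[p] ℚ_[p] K]
variable {F V W : Type} [Field F] [AddCommMonoid V] [Module F V] [AddCommMonoid W] [Module F W]

/-- Smoothness of a representation of `GL₂(𝒪_K)`: every vector is fixed by an open subgroup (the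
`𝒦_n` form a basis of neighbourhoods of the identity). -/
def IsSmooth (ρ : Representation F (GLO p K) V) : Prop :=
  ∀ v, ∃ n, ∀ g ∈ congrSub p K n, ρ g v = v

/-- `Ext¹_{F[GL₂(𝒪_K)]}(ρ, ρ') ≠ 0`, extensions being taken among smooth representations: some
smooth extension of `ρ` by `ρ'` does not split. -/
def SmoothExtNeZero (ρ : Representation F (GLO p K) V) (ρ' : Representation F (GLO p K) W) :
    Prop :=
  ∃ X : RepExtension ρ ρ', IsSmooth p K X.rep ∧ ¬ X.Splits

/-- The inflation of a representation of `GL₂(k)` to `GL₂(𝒪_K)`. -/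
noncomputable def infl (ρ : Representation F (GLk p K) V) : Representation F (GLO p K) V :=
  MonoidHom.comp ρ (red p K)

end SmoothExt

section Cohomology

variable (p : ℕ) [Fact p.Prime]
variable (K : Type*) [Field K] [Algebra ℚ_[p] K] [FiniteDimensional ℚ_[p] K]
  [Algebra ℤ_[p] K] [IsScalarTower ℤ_[p] ℚ_[p] K]
variable {F W : Type} [Field F] [AddCommGroup W] [Module F W]
variable (ρ : Representation F (GLO p K) W)

/-- Continuous `1`-cocycles `𝒦₁ → W`, `W` being discrete. A function on the compact group `𝒦₁` is
continuous iff it is right invariant under some `𝒦_n`. -/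
def Z1 : Submodule F (congrSub p K 1 → W) where
  carrier := {c | (∀ g h, c (g * h) = c g + ρ g (c h)) ∧
    ∃ n, ∀ g h : congrSub p K 1, (h : GLO p K) ∈ congrSub p K n → c (g * h) = c g}
  add_mem' := by
    rintro a b ⟨ha, n, hn⟩ ⟨hb, m, hm⟩
    have hle : ∀ i j : ℕ, i ≤ j → congrSub p K j ≤ congrSub p K i := by
      intro i j hij g hg
      simp only [congrSub, MonoidHom.mem_ker] at hg ⊢
      have hf : (Ideal.Quotient.factor (Ideal.pow_le_pow_right hij)).comp
          (Ideal.Quotient.mk (IsLocalRing.maximalIdeal (OK p K) ^ j)) =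
          Ideal.Quotient.mk (IsLocalRing.maximalIdeal (OK p K) ^ i) := by
        ext x
        simp
      rw [← hf, Matrix.GeneralLinearGroup.map_comp, MonoidHom.comp_apply, hg, map_one]
    refine ⟨fun g h => ?_, max n m, fun g h hh => ?_⟩
    · simp only [Pi.add_apply, ha, hb, map_add]
      abel
    · simp only [Pi.add_apply]
      rw [hn g h (hle _ _ (le_max_left n m) hh), hm g h (hle _ _ (le_max_right n m) hh)]
  zero_mem' := ⟨by simp, 0, by simp⟩
  smul_mem' := by
    rintro r a ⟨ha, n, hn⟩
    refine ⟨fun g h => ?_, n, fun g h hh => ?_⟩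
    · simp only [Pi.smul_apply, ha, smul_add, map_smul]
    · simp only [Pi.smul_apply, hn g h hh]

/-- The continuous `1`-coboundaries `g ↦ g w - w`. -/
def B1 : Submodule F (Z1 p K ρ) where
  carrier := {c | ∃ w, ∀ g : congrSub p K 1, c.1 g = ρ g w - w}
  add_mem' := by
    rintro a b ⟨v, hv⟩ ⟨w, hw⟩
    refine ⟨v + w, fun g => ?_⟩
    simp only [Submodule.coe_add, Pi.add_apply, hv, hw, map_add]
    abel
  zero_mem' := ⟨0, by simp⟩
  smul_mem' := by
    rintro r a ⟨v, hv⟩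
    refine ⟨r • v, fun g => ?_⟩
    simp only [SetLike.val_smul, Pi.smul_apply, hv, map_smul, smul_sub]

/-- The continuous cohomology group `H¹(𝒦₁, W)`. -/
abbrev H1 : Type _ := Z1 p K ρ ⧸ B1 p K ρ

/-- The action of `x ∈ GL₂(𝒪_K)` on cocycles, `(x c)(g) = x c(x⁻¹ g x)`. -/
noncomputable def actZ1 (x : GLO p K) : Z1 p K ρ →ₗ[F] Z1 p K ρ where
  toFun c := ⟨fun g => ρ x (c.1 (MulAut.conjNormal x⁻¹ g)), by
    obtain ⟨hc, n, hn⟩ := c.2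
    refine ⟨fun g h => ?_, n, fun g h hh => ?_⟩
    · beta_reduce
      rw [map_mul, hc, map_add]
      rw [← Module.End.mul_apply, ← Module.End.mul_apply, ← map_mul, ← map_mul,
        MulAut.conjNormal_apply, inv_inv, ← mul_assoc, ← mul_assoc, mul_inv_cancel, one_mul]
    · beta_reduce
      rw [map_mul, hn]
      rw [MulAut.conjNormal_apply]
      exact Subgroup.Normal.conj_mem inferInstance _ hh _⟩
  map_add' a b := Subtype.ext <| funext fun g => map_add (ρ x) _ _
  map_smul' r a := Subtype.ext <| funext fun g => map_smul (ρ x) r _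

/-- The action of `GL₂(𝒪_K)` on `H¹(𝒦₁, W)`. When `W` is inflated from `GL₂(k)`, this action
factors through `GL₂(k)`. -/
noncomputable def H1rep : Representation F (GLO p K) (H1 p K ρ) where
  toFun x := (B1 p K ρ).mapQ (B1 p K ρ) (actZ1 p K ρ x) (by
    rintro c ⟨w, hw⟩
    refine ⟨ρ x w, fun g => ?_⟩
    change ρ x (c.1 (MulAut.conjNormal x⁻¹ g)) = _
    rw [hw, map_sub]
    congr 1
    rw [← Module.End.mul_apply, ← Module.End.mul_apply, ← map_mul, ← map_mul]
    congr 2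
    simp [mul_assoc])
  map_one' := by
    ext c
    simp only [LinearMap.coe_comp, Function.comp_apply, Submodule.mkQ_apply, Submodule.mapQ_apply,
      Module.End.one_apply]
    congr 1
    ext g
    simp [actZ1]
  map_mul' x y := by
    ext c
    simp only [LinearMap.coe_comp, Function.comp_apply, Submodule.mkQ_apply, Submodule.mapQ_apply,
      Module.End.mul_apply]
    congr 1
    ext g
    simp [actZ1]

end Cohomology

/-! ### Serre weights -/

section Weights

variable (p : ℕ) [Fact p.Prime]

/-- The algebra endomorphism of the polynomial ring with `X j ↦ ∑ i, M i j X i`. -/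
noncomputable def linSubst {F : Type} [Field F] (M : Matrix (Fin 2) (Fin 2) F) :
    MvPolynomial (Fin 2) F →ₐ[F] MvPolynomial (Fin 2) F :=
  MvPolynomial.aeval fun j => ∑ i, MvPolynomial.C (M i j) * MvPolynomial.X i

theorem linSubst_one {F : Type} [Field F] : linSubst (1 : Matrix (Fin 2) (Fin 2) F) = .id F _ := by
  apply MvPolynomial.algHom_ext
  intro j
  fin_cases j <;> simp [linSubst]

theorem linSubst_mul {F : Type} [Field F] (M N : Matrix (Fin 2) (Fin 2) F) :
    linSubst (M * N) = (linSubst M).comp (linSubst N) := by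
  apply MvPolynomial.algHom_ext
  intro j
  simp only [linSubst, MvPolynomial.aeval_X, AlgHom.comp_apply, map_mul,
    MvPolynomial.aeval_C, MvPolynomial.algebraMap_eq, Fin.sum_univ_two, Matrix.mul_apply, map_add]
  ring

theorem linSubst_mem {F : Type} [Field F] (M : Matrix (Fin 2) (Fin 2) F) (n : ℕ)
    (P : MvPolynomial (Fin 2) F) (hP : P ∈ MvPolynomial.homogeneousSubmodule (Fin 2) F n) :
    (linSubst M).toLinearMap P ∈ MvPolynomial.homogeneousSubmodule (Fin 2) F n := by
  rw [MvPolynomial.mem_homogeneousSubmodule] at hP ⊢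
  have := hP.aeval (fun j : Fin 2 => ∑ i : Fin 2, MvPolynomial.C (M i j) *
    (MvPolynomial.X i : MvPolynomial (Fin 2) F)) (n := 1) (fun j =>
      MvPolynomial.IsHomogeneous.sum _ _ _ fun i _ => MvPolynomial.isHomogeneous_C_mul_X _ _)
  rw [one_mul] at this
  exact this

/-- `Sym^n` of the standard two dimensional representation of `GL₂(F)`: homogeneous polynomials of
degree `n` in the standard basis vectors `X 0`, `X 1`, on which `g` acts through
`X j ↦ ∑ i, g i j X i`. -/
noncomputable def symRep (F : Type) [Field F] (n : ℕ) :
    Representation F (GL (Fin 2) F) (MvPolynomial.homogeneousSubmodule (Fin 2) F n) where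
  toFun g := (linSubst g.1).toLinearMap.restrict (linSubst_mem g.1 n)
  map_one' := by
    ext1 P
    apply Subtype.ext
    simp [linSubst_one]
  map_mul' g h := by
    ext1 P
    apply Subtype.ext
    simp [linSubst_mul]

variable {k : Type*} [Field k] {f : ℕ} [NeZero f]

/-- The embedding `σ_i : k → 𝔽̄_p`, `i ∈ {0, …, f - 1}`, where `σ_{f-1} = σ` and
`σ_{f-1-i} = σ_{f-1}^{p^i}`. -/
noncomputable def emb (σ : k →+* Fbar p) (i : ZMod f) : k →+* Fbar p :=
  (iterateFrobenius (Fbar p) p (f - 1 - i.val)).comp σ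

/-- The space `⨂_i Sym^{s_i} 𝔽̄_p²`. -/
abbrev WeightSpace (s : ZMod f → ℕ) : Type :=
  ⨂[Fbar p] i : ZMod f, MvPolynomial.homogeneousSubmodule (Fin 2) (Fbar p) (s i)

/-- The representation `⨂_i (det^{t_i} ⊗ Sym^{s_i} k²) ⊗_{k, σ_i} 𝔽̄_p` of `GL₂(k)`. -/
noncomputable def weightRep (σ : k →+* Fbar p) (t : ZMod f → ℤ) (s : ZMod f → ℕ) :
    Representation (Fbar p) (GL (Fin 2) k) (WeightSpace p s) :=
  PiTensorProduct.mapMonoidHom.comp <| MonoidHom.pi fun i =>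
    { toFun := fun g =>
        ((Matrix.GeneralLinearGroup.det (Matrix.GeneralLinearGroup.map (emb p σ i) g) ^ t i :
          (Fbar p)ˣ) : Fbar p) •
          symRep (Fbar p) (s i) (Matrix.GeneralLinearGroup.map (emb p σ i) g)
      map_one' := by simp
      map_mul' := fun g h => by
        simp only [map_mul, mul_zpow, Units.val_mul]
        rw [smul_mul_smul_comm] }

end Weights

/-! ### The sets `J^{AH}` and type I intersections -/

section TypeI

variable (p : ℕ) [Fact p.Prime]
variable (K : Type*) [Field K] [Algebra ℚ_[p] K] [FiniteDimensional ℚ_[p] K]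
  [Algebra ℤ_[p] K] [IsScalarTower ℤ_[p] ℚ_[p] K]
variable {f : ℕ} [NeZero f]
variable (σ : ResK p K →+* Fbar p) (ϖ : AlgebraicClosure K)

open Classical in
/-- The fundamental character `ω_i(g) = σ_i(g(ϖ)/ϖ)`, where `ϖ` is a `(p^f - 1)`-st root of a
uniformizer of `K`. The root of unity `g(ϖ)/ϖ` lies in `𝒪_K`, and is reduced to `k`. -/
noncomputable def omega (i : ZMod f) (g : GalK K) : Fbar p :=
  if h : ∃ a : OK p K, g ϖ = algebraMap K (AlgebraicClosure K) a * ϖ then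
    emb p σ i (IsLocalRing.residue (OK p K) h.choose)
  else 1

/-- `χ|_{I_K} = ∏_i ω_i^{a_i}|_{I_K}`. -/
def EqOnInertia (χ : GalChar p K) (a : ZMod f → ℤ) : Prop :=
  ∀ g ∈ inertia p K, (χ.toHom g : Fbar p) = ∏ i, omega p K σ ϖ i g ^ a i

variable (t : ZMod f → ℤ) (s : ZMod f → ℕ) (χ₁ χ₂ : GalChar p K)

/-- The shape of `(χ₁, χ₂)` on inertia that is needed for `V_{t,s}` to be a weight of some
extension of `χ₂` by `χ₁`. -/
def Screening : Prop :=
  ∃ (J : Finset (ZMod f)) (x : ZMod f → ℤ), (∀ i, 0 ≤ x i ∧ x i ≤ (ramE p K : ℤ) - 1) ∧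
    EqOnInertia p K σ ϖ χ₁ (fun i => t i + if i ∈ J then (s i : ℤ) + 1 + x i else x i) ∧
    EqOnInertia p K σ ϖ χ₂ (fun i => t i +
      if i ∈ J then (ramE p K : ℤ) - 1 - x i else (s i : ℤ) + ramE p K - x i)

/-- `χ₂|_{I_K} = ∏ ω_i^{t_i} ∏ ω_i^{m_i}` with `m_i ∈ [0, p - 1]`, not all equal to `p - 1`. -/
def IsDigits (m : ZMod f → ℤ) : Prop :=
  (∀ i, 0 ≤ m i ∧ m i ≤ (p : ℤ) - 1) ∧ (∃ i, m i ≠ (p : ℤ) - 1) ∧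
    EqOnInertia p K σ ϖ χ₂ (fun i => t i + m i)

/-- The set `𝒮`. -/
def SSet : Set (ZMod f → ℤ) :=
  {a | EqOnInertia p K σ ϖ χ₂ (fun i => t i + a i) ∧
    ∀ i, (0 ≤ a i ∧ a i ≤ (ramE p K : ℤ) - 1) ∨
      ((s i : ℤ) + 1 ≤ a i ∧ a i ≤ (s i : ℤ) + ramE p K)}

/-- The tuple `v_i` with `-1` in position `i` and `p` in position `i + 1`. -/
def vvec (i : ZMod f) : ZMod f → ℤ := Pi.single (i + 1) (p : ℤ) - Pi.single i 1

/-- `A` is the least subset with `m + ∑_{i ∈ A} v_i ∈ 𝒮`. -/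
def IsAmin (m : ZMod f → ℤ) (A : Finset (ZMod f)) : Prop :=
  IsLeast {B : Finset (ZMod f) | m + ∑ i ∈ B, vvec p i ∈ SSet p K σ ϖ t s χ₂} A

/-- `y` is the tuple `m + ∑_{i ∈ A_min} v_i`. -/
def IsY (y : ZMod f → ℤ) : Prop :=
  ∃ m A, IsDigits p K σ ϖ t χ₂ m ∧ IsAmin p K σ ϖ t s χ₂ m A ∧ y = m + ∑ i ∈ A, vvec p i

/-- `z_i = s_i + e - y_i`. -/
noncomputable def zOf (y : ZMod f → ℤ) : ZMod f → ℤ := fun i => (s i : ℤ) + ramE p K - y i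

/-- The set `𝓘_i`. -/
noncomputable def interval (y : ZMod f → ℤ) (i : ZMod f) : Set ℤ :=
  if (s i : ℤ) + 1 ≤ y i then Set.Icc 0 (zOf p K s y i - 1)
  else {y i} ∪ Set.Icc ((s i : ℤ) + 1) (zOf p K s y i - 1)

/-- `ξ_i = (p^f - 1) z_i + ∑_{j=0}^{f-1} (z_{i+j+1} - y_{i+j+1}) p^{f-1-j}`. -/
noncomputable def xi (y : ZMod f → ℤ) (i : ZMod f) : ℤ :=
  ((p : ℤ) ^ f - 1) * zOf p K s y i +
    ∑ j ∈ Finset.range f,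
      (zOf p K s y (i + j + 1) - y (i + j + 1)) * (p : ℤ) ^ (f - 1 - j)

/-- `a` is the tame signature of `χ₂⁻¹ χ₁`: `χ₂⁻¹ χ₁ = ∏ ω_i^{a_i}` on inertia, `a_i ∈ [1, p]`, not
all equal to `p`. -/
def IsTameSignature (a : ZMod f → ℤ) : Prop :=
  (∀ i, 1 ≤ a i ∧ a i ≤ p) ∧ (∃ i, a i ≠ p) ∧
    ∀ g ∈ inertia p K,
      (χ₁.toHom g : Fbar p) = χ₂.toHom g * ∏ i, omega p K σ ϖ i g ^ a i

/-- `n_i ∈ [0, p^f - 1)` is the exponent with `χ₂⁻¹ χ₁ = ω_i^{n_i}` on inertia. -/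
def IsTameExponent (n : ZMod f → ℤ) : Prop :=
  ∀ i, 0 ≤ n i ∧ n i < (p : ℤ) ^ f - 1 ∧
    ∀ g ∈ inertia p K, (χ₁.toHom g : Fbar p) = χ₂.toHom g * omega p K σ ϖ i g ^ n i

/-- The size `f'` of the orbit of a tuple under the cyclic shift. -/
noncomputable def orbitSize (a : ZMod f → ℤ) : ℕ :=
  Function.minimalPeriod (fun (b : ZMod f → ℤ) (i : ZMod f) => b (i + 1)) a

/-- The set `J^{AH}_{V_{t,s}}(χ₁, χ₂)` of pairs `(m, κ)`. Here `ν` is the `p`-adic valuation of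
`ξ_i - u (p^f - 1)`, so that `m` is the prime-to-`p` part of that integer. -/
def JAH : Set (ℤ × ℕ) :=
  {α | ∃ y a n : ZMod f → ℤ, IsY p K σ ϖ t s χ₂ y ∧ IsTameSignature p K σ ϖ χ₁ χ₂ a ∧
    IsTameExponent p K σ ϖ χ₁ χ₂ n ∧ α.2 < f / orbitSize a ∧
    ∃ i : ZMod f, ∃ u ∈ interval p K s y i, ∃ ν : ℕ,
      xi p K s y i - u * ((p : ℤ) ^ f - 1) = (p : ℤ) ^ ν * α.1 ∧ ¬ (p : ℤ) ∣ α.1 ∧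
      ∃ im < orbitSize a, α.1 ≡ n (im : ZMod f) [ZMOD (p : ℤ) ^ f - 1] ∧
        ((im + α.2 * orbitSize a : ℕ) : ZMod f) = i - (ν : ZMod f)}

variable (t' : ZMod f → ℤ) (s' : ZMod f → ℕ)

/-- `(χ₁, χ₂)` has the inertial shape required by both weights, and the sets `J^{AH}` have `e f`
elements for `V_{t,s}` and `e f - 1` elements for `V_{t',s'}`. -/
def WitnessOrdered : Prop :=
  Screening p K σ ϖ t s χ₁ χ₂ ∧ Screening p K σ ϖ t' s' χ₁ χ₂ ∧
    (JAH p K σ ϖ t s χ₁ χ₂).encard = (ramE p K * f : ℕ) ∧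
    (JAH p K σ ϖ t' s' χ₁ χ₂).encard + 1 = (ramE p K * f : ℕ)

/-- `(χ₁, χ₂)` witnesses a type I intersection for the unordered pair of weights `V_{t,s}`,
`V_{t',s'}`. -/
def WitnessTypeI : Prop :=
  WitnessOrdered p K σ ϖ t s χ₁ χ₂ t' s' ∨ WitnessOrdered p K σ ϖ t' s' χ₁ χ₂ t s

/-- The separated families witnessing a type I intersection: the pairs `(χ₁|_{I_K}, χ₂|_{I_K})`
for the witnesses `(χ₁, χ₂)`. -/
def typeIFamilies : Set ((inertia p K →* (Fbar p)ˣ) × (inertia p K →* (Fbar p)ˣ)) :=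
  {r | ∃ χ₁ χ₂ : GalChar p K, WitnessTypeI p K σ ϖ t s χ₁ χ₂ t' s' ∧
    r = (χ₁.toHom.comp (inertia p K).subtype, χ₂.toHom.comp (inertia p K).subtype)}

/-- There is a type I intersection for the pair `V_{t,s}`, `V_{t',s'}`. -/
def HasTypeI : Prop :=
  ∃ χ₁ χ₂ : GalChar p K, WitnessTypeI p K σ ϖ t s χ₁ χ₂ t' s'

end TypeI

/-! ### The numerical criteria -/

section Criteria

variable (p : ℕ) {f : ℕ} [NeZero f]

/-- `∑_j p^{f-1-j} d_j`. -/
def detExp (d : ZMod f → ℤ) : ℤ := ∑ j, (p : ℤ) ^ (f - 1 - j.val) * d j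

/-- The first condition on `(s, s')`, with distinguished index `j`. -/
def ShapeOne (j : ZMod f) (s s' : ZMod f → ℕ) : Prop :=
  s j + 2 ≤ p ∧ s (j - 1) + 2 ≤ p ∧ (s' j : ℤ) = p - s j - 2 ∧ s' (j - 1) = s (j - 1) + 1 ∧
    ∀ i, i ≠ j → i ≠ j - 1 → s' i = s i

/-- The first criterion, with distinguished index `j`. -/
def CritOne (j : ZMod f) (d : ZMod f → ℤ) (s : ZMod f → ℕ) (d' : ZMod f → ℤ) (s' : ZMod f → ℕ) :
    Prop :=
  ShapeOne p j s s' ∧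
    detExp p d' ≡ detExp p d - (1 + (s' j : ℤ)) * (p : ℤ) ^ (f - 1 - j.val) [ZMOD (p : ℤ) ^ f - 1]

/-- The second criterion (apart from the condition `e > 1`), with distinguished index `j`. -/
def CritTwo (j : ZMod f) (d : ZMod f → ℤ) (s : ZMod f → ℕ) (d' : ZMod f → ℤ) (s' : ZMod f → ℕ) :
    Prop :=
  s j + 3 ≤ p ∧ s' j = s j + 2 ∧ (∀ i, i ≠ j → s' i = s i) ∧
    detExp p d' ≡ detExp p d - (p : ℤ) ^ (f - 1 - j.val) [ZMOD (p : ℤ) ^ f - 1]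

end Criteria

end SerreExt

namespace SerreExt

section Carry

variable {f : ℕ} [NeZero f]

theorem ZMod.sum_eq_sum_range {M : Type*} [AddCommMonoid M] (F : ZMod f → M) :
    ∑ j, F j = ∑ l ∈ Finset.range f, F (l : ZMod f) := by
  refine Finset.sum_nbij' (fun j => j.val) (fun l => (l : ZMod f)) ?_ ?_ ?_ ?_ ?_
  · intro j _
    exact Finset.mem_range.2 (ZMod.val_lt j)
  · simp
  · intro j _
    exact ZMod.natCast_zmod_val j
  · intro l hl
    exact ZMod.val_cast_of_lt (Finset.mem_range.1 hl)
  · intro j _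
    rw [ZMod.natCast_zmod_val]

/-- The value `∑_l a_{i+l+1} p^{f-1-l}` of the tuple `a` read from position `i + 1` on. -/
def shiftSum (p : ℕ) (a : ZMod f → ℤ) (i : ZMod f) : ℤ :=
  ∑ l ∈ Finset.range f, a (i + l + 1) * (p : ℤ) ^ (f - 1 - l)

theorem mul_shiftSum (p : ℕ) (a : ZMod f → ℤ) (i : ZMod f) :
    (p : ℤ) * shiftSum p a i = ((p : ℤ) ^ f - 1) * a (i + 1) + shiftSum p a (i + 1) := by
  obtain ⟨n, rfl⟩ := Nat.exists_eq_succ_of_ne_zero (NeZero.ne f)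
  unfold shiftSum
  rw [Finset.sum_range_succ', Finset.sum_range_succ (n := n), mul_add, Finset.mul_sum]
  have h1 : (i + 1 + (n : ZMod (n + 1)) + 1 : ZMod (n + 1)) = i + 1 := by
    have : ((n + 1 : ℕ) : ZMod (n + 1)) = 0 := ZMod.natCast_self _
    push_cast at this
    linear_combination this
  have h2 : ∀ l ∈ Finset.range n,
      (p : ℤ) * (a (i + ((l + 1 : ℕ) : ZMod (n + 1)) + 1) * (p : ℤ) ^ (n + 1 - 1 - (l + 1))) =
        a (i + 1 + l + 1) * (p : ℤ) ^ (n + 1 - 1 - l) := by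
    intro l hl
    have hl := Finset.mem_range.1 hl
    have e1 : n + 1 - 1 - l = (n + 1 - 1 - (l + 1)) + 1 := by omega
    rw [e1, pow_succ]
    have e2 : (i + ((l + 1 : ℕ) : ZMod (n + 1)) + 1) = i + 1 + l + 1 := by push_cast; ring
    rw [e2]
    ring
  rw [Finset.sum_congr rfl h2]
  simp only [Nat.succ_eq_add_one] at h1 ⊢
  rw [h1]
  simp
  ring

theorem shiftSum_neg_one (p : ℕ) (a : ZMod f → ℤ) : shiftSum p a (-1) = detExp p a := by
  unfold shiftSum detExp
  rw [ZMod.sum_eq_sum_range]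
  refine Finset.sum_congr rfl fun l hl => ?_
  rw [ZMod.val_cast_of_lt (Finset.mem_range.1 hl)]
  rw [show (-1 + (l : ZMod f) + 1) = l by ring]
  ring

theorem forall_of_step_up {Q : ZMod f → Prop} (i : ZMod f) (h0 : Q i)
    (h : ∀ j, Q j → Q (j + 1)) (j : ZMod f) : Q j := by
  have key : ∀ k : ℕ, Q (i + k) := by
    intro k
    induction k with
    | zero => simpa using h0
    | succ k ih =>
      have := h _ ih
      rwa [show i + (k : ZMod f) + 1 = i + ((k + 1 : ℕ) : ZMod f) by push_cast; ring] at this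
  have := key (j - i).val
  rwa [ZMod.natCast_zmod_val, add_sub_cancel] at this

theorem detExp_add (p : ℕ) (a b : ZMod f → ℤ) : detExp p (a + b) = detExp p a + detExp p b := by
  simp [detExp, mul_add, Finset.sum_add_distrib]

theorem detExp_sub (p : ℕ) (a b : ZMod f → ℤ) : detExp p (a - b) = detExp p a - detExp p b := by
  simp [detExp, mul_sub, Finset.sum_sub_distrib]

theorem detExp_single (p : ℕ) (i : ZMod f) (x : ℤ) :
    detExp p (Pi.single i x) = (p : ℤ) ^ (f - 1 - i.val) * x := by
  unfold detExp
  rw [Finset.sum_eq_single i]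
  · simp
  · intro j _ hj
    simp [hj]
  · simp

theorem detExp_smul (p : ℕ) (x : ℤ) (a : ZMod f → ℤ) : detExp p (x • a) = x * detExp p a := by
  simp only [detExp, Pi.smul_apply, smul_eq_mul, Finset.mul_sum]
  exact Finset.sum_congr rfl fun j _ => by ring

/-- A tuple has value divisible by `p^f - 1` iff it is a combination of carries. -/
theorem exists_carry {p : ℕ} (hp : 1 < p) {a : ZMod f → ℤ} (h : ((p : ℤ) ^ f - 1) ∣ detExp p a) :
    ∃ c : ZMod f → ℤ, ∀ j, (p : ℤ) * c (j - 1) = c j + a j := by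
  have hq : (0 : ℤ) < (p : ℤ) ^ f - 1 := by
    have : (1 : ℤ) < (p : ℤ) ^ f := one_lt_pow₀ (by exact_mod_cast hp) (NeZero.ne f)
    omega
  have hall : ∀ j, ((p : ℤ) ^ f - 1) ∣ shiftSum p a j := by
    refine forall_of_step_up (-1) (by rwa [shiftSum_neg_one]) fun j hj => ?_
    have := mul_shiftSum p a j
    have e : shiftSum p a (j + 1) = (p : ℤ) * shiftSum p a j - ((p : ℤ) ^ f - 1) * a (j + 1) := by
      linarith
    rw [e]
    exact dvd_sub (hj.mul_left _) (Dvd.intro _ rfl)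
  choose c hc using hall
  refine ⟨c, fun j => ?_⟩
  have := mul_shiftSum p a (j - 1)
  rw [sub_add_cancel, hc, hc] at this
  have h2 : ((p : ℤ) ^ f - 1) * (p * c (j - 1)) = ((p : ℤ) ^ f - 1) * (c j + a j) := by
    rw [mul_add]; linarith
  exact mul_left_cancel₀ hq.ne' h2

theorem dvd_detExp_of_carry {p : ℕ} {a c : ZMod f → ℤ}
    (h : ∀ j, (p : ℤ) * c (j - 1) = c j + a j) : ((p : ℤ) ^ f - 1) ∣ detExp p a := by
  have ha : a = (fun j => (p : ℤ) * c (j - 1)) - c := by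
    ext j
    simp only [Pi.sub_apply]
    linarith [h j]
  have e : shiftSum p (fun j => (p : ℤ) * c (j - 1)) (-1) = (p : ℤ) * shiftSum p c (-1 - 1) := by
    unfold shiftSum
    rw [Finset.mul_sum]
    refine Finset.sum_congr rfl fun l _ => ?_
    beta_reduce
    rw [show (-1 + (l : ZMod f) + 1 - 1) = -1 - 1 + l + 1 by ring]
    ring
  rw [ha, detExp_sub, ← shiftSum_neg_one, ← shiftSum_neg_one, e, mul_shiftSum]
  rw [sub_add_cancel]
  ring_nf
  exact ⟨c (-1), by ring⟩

theorem carry_le {p : ℕ} {a c : ZMod f → ℤ} (h : ∀ j, (p : ℤ) * c (j - 1) = c j + a j) {A : ℤ}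
    (hA : ∀ j, a j ≤ A) (hp : 1 ≤ p) (j : ZMod f) : ((p : ℤ) - 1) * c j ≤ A := by
  obtain ⟨j0, hj0⟩ := Finite.exists_max c
  have h1 := h (j0 + 1)
  rw [add_sub_cancel_right] at h1
  have h2 := hA (j0 + 1)
  have h3 := hj0 (j0 + 1)
  have h4 : ((p : ℤ) - 1) * c j ≤ ((p : ℤ) - 1) * c j0 :=
    mul_le_mul_of_nonneg_left (hj0 j) (by have : (1 : ℤ) ≤ p := by exact_mod_cast hp
                                          omega)
  linarith

theorem le_carry {p : ℕ} {a c : ZMod f → ℤ} (h : ∀ j, (p : ℤ) * c (j - 1) = c j + a j) {A : ℤ}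
    (hA : ∀ j, A ≤ a j) (hp : 1 ≤ p) (j : ZMod f) : A ≤ ((p : ℤ) - 1) * c j := by
  have := carry_le (a := -a) (c := -c) (p := p) (A := -A) (fun j => by
    simp only [Pi.neg_apply]; linarith [h j]) (fun j => by simpa using hA j) hp j
  simp only [Pi.neg_apply] at this
  linarith

theorem carry_eq_zero {p : ℕ} {a c : ZMod f → ℤ} (h : ∀ j, (p : ℤ) * c (j - 1) = c j + a j)
    (hp : 1 < p) (h1 : ∀ j, a j ≤ p - 2) (h2 : ∀ j, -((p : ℤ) - 2) ≤ a j) (j : ZMod f) :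
    a j = 0 := by
  have hp' : (2 : ℤ) ≤ p := by exact_mod_cast hp
  have key : ∀ j, c j = 0 := by
    intro j
    have e1 := carry_le h h1 hp.le j
    have e2 := le_carry h h2 hp.le j
    have e3 : c j < 1 := by by_contra hh; nlinarith
    have e4 : -1 < c j := by by_contra hh; nlinarith
    omega
  have := h j
  rw [key, key] at this
  linarith

omit [NeZero f] in
theorem ne_sub_one (hf : 1 < f) (i : ZMod f) : i ≠ i - 1 := by
  have : Fact (1 < f) := ⟨hf⟩
  intro h
  have : (1 : ZMod f) = 0 := by linear_combination h
  exact one_ne_zero this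

omit [NeZero f] in
theorem ne_add_one (hf : 1 < f) (i : ZMod f) : i + 1 ≠ i := by
  have : Fact (1 < f) := ⟨hf⟩
  intro h
  have : (1 : ZMod f) = 0 := by linear_combination h
  exact one_ne_zero this

/-- A tuple with entries in `[0, p - 2]` is determined by its value modulo `p^f - 1`. -/
theorem eq_of_detExp_modEq {p : ℕ} (hp : 1 < p) {n n' : ZMod f → ℕ} (hn : ∀ i, n i + 2 ≤ p)
    (hn' : ∀ i, n' i + 2 ≤ p)
    (h : detExp p (fun i => (n i : ℤ)) ≡ detExp p (fun i => (n' i : ℤ)) [ZMOD (p : ℤ) ^ f - 1]) :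
    n = n' := by
  have h' := h.symm.dvd
  rw [← detExp_sub] at h'
  obtain ⟨c, hc⟩ := exists_carry hp h'
  ext i
  have := carry_eq_zero hc hp (fun j => by have := hn j; simp only [Pi.sub_apply]; omega)
    (fun j => by have := hn' j; simp only [Pi.sub_apply]; omega) i
  simp only [Pi.sub_apply] at this
  omega

/-- If all carries except possibly the one out of position `i - 1` vanish, the tuple is
supported on `i - 1` and `i`. -/
theorem carry_support {p : ℕ} {a c : ZMod f → ℤ} (hf : 1 < f)
    (h : ∀ j, (p : ℤ) * c (j - 1) = c j + a j) {i : ZMod f} (hc : ∀ j, j ≠ i - 1 → c j = 0) :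
    a i = p * c (i - 1) ∧ a (i - 1) = - c (i - 1) ∧ ∀ j, j ≠ i → j ≠ i - 1 → a j = 0 := by
  refine ⟨?_, ?_, fun j hj hj' => ?_⟩
  · have := h i
    rw [hc i (ne_sub_one hf i)] at this
    linarith
  · have := h (i - 1)
    rw [hc (i - 1 - 1) (ne_sub_one hf (i - 1)).symm] at this
    linarith
  · have := h j
    rw [hc j hj', hc (j - 1) (fun e => hj (sub_left_injective e))] at this
    linarith

theorem ge_of_mul_bound {p x b : ℤ} (hp : 0 < p) {y : ℤ} (h : p * x = y) (h2 : p * b < y) :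
    b < x := by
  by_contra hh
  have := mul_le_mul_of_nonneg_left (not_lt.1 hh) hp.le
  linarith

theorem shapeOne_of_carry {p : ℕ} (hp : 1 < p) (hf : 1 < f) {s s' : ZMod f → ℕ}
    (hs : ∀ i, s i + 2 ≤ p) (hs' : ∀ i, s' i + 2 ≤ p) {i : ZMod f}
    (h : ((p : ℤ) ^ f - 1) ∣ detExp p ((fun j => (s' j : ℤ)) - (fun j => (s j : ℤ)) -
      Pi.single i (2 * ((s' i : ℤ) + 1)))) : ShapeOne p i s s' := by
  obtain ⟨c, hc⟩ := exists_carry hp h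
  set a := (fun j => (s' j : ℤ)) - (fun j => (s j : ℤ)) - Pi.single i (2 * ((s' i : ℤ) + 1)) with ha
  have hsi := hs i
  have hsi' := hs' i
  have hp' : (2 : ℤ) ≤ p := by exact_mod_cast hp
  have ai : a i = -s' i - s i - 2 := by simp [ha]; ring
  have aj : ∀ j, j ≠ i → a j = s' j - s j := by intro j hj; simp [ha, hj]
  have up : ∀ j, a j ≤ p - 2 := by
    intro j
    have := hs' j
    by_cases hj : j = i
    · rw [hj, ai]; omega
    · rw [aj j hj]; omega
  have lo : ∀ j, -(2 * (p : ℤ) - 2) ≤ a j := by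
    intro j
    have := hs' j
    have := hs j
    by_cases hj : j = i
    · rw [hj, ai]; omega
    · rw [aj j hj]; omega
  have c0 : ∀ j, c j ≤ 0 := by
    intro j
    have e1 := carry_le hc up hp.le j
    by_contra hh
    nlinarith
  have c2 : ∀ j, -2 ≤ c j := by
    intro j
    have e1 := le_carry hc lo hp.le j
    by_contra hh
    nlinarith
  have c1 : ∀ j, j ≠ i → -1 ≤ c (j - 1) := by
    intro j hj
    have e := hc j
    have := aj j hj
    have := hs j
    have := hs' j
    have := c2 j
    have := ge_of_mul_bound (b := -2) (by omega) e (by omega)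
    omega
  have ci : -1 ≤ c i := by
    have := c1 (i + 1) (ne_add_one hf i)
    rwa [add_sub_cancel_right] at this
  have c1' : ∀ j, -1 ≤ c j := by
    intro j
    by_cases hj : j + 1 = i
    · have e := hc i
      have := hs i
      have := hs' i
      have := ge_of_mul_bound (b := -2) (by omega) e (by omega)
      rw [← hj, add_sub_cancel_right] at this
      omega
    · have := c1 (j + 1) hj
      rwa [add_sub_cancel_right] at this
  have cz : ∀ j, j ≠ i - 1 → c j = 0 := by
    intro j hj
    have hj' : j + 1 ≠ i := fun e => hj (by rw [← e, add_sub_cancel_right])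
    have e := hc (j + 1)
    rw [add_sub_cancel_right] at e
    have := aj _ hj'
    have := hs (j + 1)
    have := hs' (j + 1)
    have := c1' (j + 1)
    have := ge_of_mul_bound (b := -1) (by omega) e (by omega)
    have := c0 j
    omega
  obtain ⟨h1, h2, h3⟩ := carry_support hf hc cz
  have hx : c (i - 1) = -1 ∨ c (i - 1) = 0 := by
    have := c0 (i - 1)
    have := c1' (i - 1)
    omega
  have e1 := aj (i - 1) (ne_sub_one hf i).symm
  have hi := hs' (i - 1)
  rcases hx with hx | hx
  · rw [hx] at h1 h2
    refine ⟨hs i, hs _, by omega, by omega, fun j hj hj' => ?_⟩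
    have := h3 j hj hj'
    rw [aj j hj] at this
    omega
  · rw [hx] at h1
    omega

theorem of_carry_two {p : ℕ} (hp : 1 < p) (hf : 1 < f) {s s' : ZMod f → ℕ}
    (hs : ∀ i, s i + 2 ≤ p) (hs' : ∀ i, s' i + 2 ≤ p) {i : ZMod f}
    (h : ((p : ℤ) ^ f - 1) ∣ detExp p ((fun j => (s' j : ℤ)) - (fun j => (s j : ℤ)) -
      Pi.single i 2)) :
    (s' i = s i + 2 ∧ ∀ j, j ≠ i → s' j = s j) ∨ (ShapeOne p i s s' ∧ s' i = 0) := by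
  obtain ⟨c, hc⟩ := exists_carry hp h
  set a := (fun j => (s' j : ℤ)) - (fun j => (s j : ℤ)) - Pi.single i 2 with ha
  have hsi := hs i
  have hsi' := hs' i
  have hp' : (2 : ℤ) ≤ p := by exact_mod_cast hp
  have ai : a i = s' i - s i - 2 := by simp [ha]
  have aj : ∀ j, j ≠ i → a j = s' j - s j := by intro j hj; simp [ha, hj]
  have up : ∀ j, a j ≤ p - 2 := by
    intro j
    have := hs' j
    by_cases hj : j = i
    · rw [hj, ai]; omega
    · rw [aj j hj]; omega
  have lo : ∀ j, -(p : ℤ) ≤ a j := by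
    intro j
    have := hs j
    by_cases hj : j = i
    · rw [hj, ai]; omega
    · rw [aj j hj]; omega
  have c0 : ∀ j, c j ≤ 0 := by
    intro j
    have e1 := carry_le hc up hp.le j
    by_contra hh
    nlinarith
  have c2 : ∀ j, -2 ≤ c j := by
    intro j
    have e1 := le_carry hc lo hp.le j
    by_contra hh
    nlinarith
  have c1' : ∀ j, -1 ≤ c j := by
    intro j
    rcases hp'.eq_or_lt with hp2 | hp3
    · have e1 := hc (j + 1)
      rw [add_sub_cancel_right, ← hp2] at e1
      have := c2 (j + 1)
      have := hs (j + 1)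
      have := hs' (j + 1)
      by_cases hj : j + 1 = i
      · have e2 := hc (i + 1)
        rw [add_sub_cancel_right, aj _ (ne_add_one hf i), ← hp2] at e2
        have := c2 (i + 1)
        have := hs (i + 1)
        have := hs' (i + 1)
        rw [hj, ai] at e1
        omega
      · rw [aj _ hj] at e1
        omega
    · have e1 := le_carry hc lo hp.le j
      by_contra hh
      nlinarith
  have cz : ∀ j, j ≠ i - 1 → c j = 0 := by
    intro j hj
    have hj' : j + 1 ≠ i := fun e => hj (by rw [← e, add_sub_cancel_right])
    have e := hc (j + 1)
    rw [add_sub_cancel_right] at e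
    have := aj _ hj'
    have := hs (j + 1)
    have := hs' (j + 1)
    have := c1' (j + 1)
    have := ge_of_mul_bound (b := -1) (by omega) e (by omega)
    have := c0 j
    omega
  obtain ⟨h1, h2, h3⟩ := carry_support hf hc cz
  have hx : c (i - 1) = -1 ∨ c (i - 1) = 0 := by
    have := c0 (i - 1)
    have := c1' (i - 1)
    omega
  have e1 := aj (i - 1) (ne_sub_one hf i).symm
  have hi := hs' (i - 1)
  have hi := hs i
  rcases hx with hx | hx
  · right
    rw [hx] at h1 h2
    refine ⟨⟨hs i, hs _, by omega, by omega, fun j hj hj' => ?_⟩, by omega⟩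
    have := h3 j hj hj'
    rw [aj j hj] at this
    omega
  · left
    rw [hx] at h1 h2
    refine ⟨by omega, fun j hj => ?_⟩
    by_cases hj' : j = i - 1
    · rw [hj']; omega
    · have := h3 j hj hj'
      rw [aj j hj] at this
      omega

/-- The numerical part of the description of nonsplit extensions. -/
theorem of_carry_obstruction {p : ℕ} (hp : 1 < p) (hf : 1 < f) {s s' n : ZMod f → ℕ}
    (hs : ∀ i, s i + 2 ≤ p) (hs' : ∀ i, s' i + 2 ≤ p) (hn : ∀ i, n i ≤ s' i) {i : ZMod f}
    (hni : n i ≤ s i) (hnj : ∀ j, j ≠ i → s' j ≤ s j + n j) (hi : s' i + s i + 2 ≤ p + n i)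
    (h : ((p : ℤ) ^ f - 1) ∣ detExp p ((fun j => (s' j : ℤ)) - (fun j => (s j : ℤ)) -
      (2 : ℤ) • (fun j => (n j : ℤ)) + Pi.single i (2 * ((s i : ℤ) + 1)))) :
    s' i + s i + 2 = p ∧ n i = 0 ∧ (∀ j, j ≠ i → j ≠ i - 1 → s' j = s j ∧ n j = 0) ∧
      ((s' (i - 1) = s (i - 1) + 1 ∧ n (i - 1) = 1) ∨
        (s (i - 1) = s' (i - 1) + 1 ∧ n (i - 1) = 0)) := by
  obtain ⟨c, hc⟩ := exists_carry hp h
  set a := (fun j => (s' j : ℤ)) - (fun j => (s j : ℤ)) -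
      (2 : ℤ) • (fun j => (n j : ℤ)) + Pi.single i (2 * ((s i : ℤ) + 1)) with ha
  have hsi := hs i
  have hsi' := hs' i
  have hnii := hn i
  have hp' : (2 : ℤ) ≤ p := by exact_mod_cast hp
  have ai : a i = s' i + s i + 2 - 2 * n i := by simp [ha]; ring
  have aj : ∀ j, j ≠ i → a j = s' j - s j - 2 * n j := by intro j hj; simp [ha, hj]
  have up : ∀ j, a j ≤ p := by
    intro j
    have := hs' j
    have := hn j
    by_cases hj : j = i
    · rw [hj, ai]; omega
    · have := hnj j hj
      rw [aj j hj]; omega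
  have lo : ∀ j, -(2 * (p : ℤ) - 4) ≤ a j := by
    intro j
    have := hs j
    have := hs' j
    have := hn j
    by_cases hj : j = i
    · rw [hj, ai]; omega
    · rw [aj j hj]; omega
  have c0 : ∀ j, c j ≤ 2 := by
    intro j
    have e1 := carry_le hc up hp.le j
    by_contra hh
    nlinarith
  have c2 : ∀ j, -1 ≤ c j := by
    intro j
    have e1 := le_carry hc lo hp.le j
    by_contra hh
    nlinarith
  have cle : ∀ j, j ≠ i - 1 → (c j ≤ 1 ∧ 2 * c j ≤ c (j + 1) ∨ c j ≤ 0) := by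
    intro j hj
    have hj' : j + 1 ≠ i := fun e => hj (by rw [← e, add_sub_cancel_right])
    have e := hc (j + 1)
    rw [add_sub_cancel_right, aj _ hj'] at e
    have := hnj _ hj'
    have := c0 (j + 1)
    by_cases hcj : c j ≤ 0
    · right; exact hcj
    · left
      have h2 : 2 * c j ≤ p * c j := by nlinarith
      omega
  have c1' : ∀ j, c j ≤ 1 := by
    intro j
    rcases hp'.eq_or_lt with hp2 | hp3
    · have e1 := hc (j + 1)
      rw [add_sub_cancel_right, ← hp2] at e1
      by_cases hj : j + 1 = i
      · have h3 := cle i (ne_sub_one hf i)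
        have h4 := hs i
        have h5 := hs' i
        rw [hj, ai] at e1
        omega
      · have := cle j (fun e => hj (by rw [e, sub_add_cancel]))
        omega
    · have e1 := carry_le hc up hp.le j
      by_contra hh
      nlinarith
  have cz : ∀ j, j ≠ i - 1 → c j ≤ 0 := by
    intro j hj
    have := cle j hj
    have := c1' (j + 1)
    omega
  have ci1 : c (i - 1) = 1 := by
    have e := hc i
    rw [ai] at e
    have := c2 i
    have := ge_of_mul_bound (b := 0) (by omega) e (by omega)
    have := c1' (i - 1)
    omega
  have eqi := hc i
  rw [ci1, ai] at eqi
  have ci := cz i (ne_sub_one hf i)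
  have ci0 : c i = 0 := by omega
  have call : ∀ j, c j = 0 ∨ j = i - 1 := by
    refine forall_of_step_up i (Or.inl ci0) fun j hj => ?_
    rcases hj with hj | hj
    · by_cases hji : j + 1 = i - 1
      · exact Or.inr hji
      · left
        have hj1 : j ≠ i - 1 := fun e => by rw [e, ci1] at hj; omega
        have hj' : j + 1 ≠ i := fun e => hj1 (by rw [← e, add_sub_cancel_right])
        have e := hc (j + 1)
        rw [add_sub_cancel_right, aj _ hj', hj] at e
        have := hnj _ hj'
        have := cz _ hji
        omega
    · left
      rw [hj, sub_add_cancel, ci0]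
  obtain ⟨h1, h2, h3⟩ := carry_support hf hc (i := i) (fun j hj => (call j).resolve_right hj)
  rw [ci1] at h1 h2
  have e1 := aj (i - 1) (ne_sub_one hf i).symm
  have e2 := hnj (i - 1) (ne_sub_one hf i).symm
  have e3 := hn (i - 1)
  refine ⟨by omega, by omega, fun j hj hj' => ?_, by omega⟩
  have e4 := h3 j hj hj'
  rw [aj j hj] at e4
  have := hnj j hj
  have := hn j
  omega

end Carry

section LocalField

variable (p : ℕ) [Fact p.Prime]

theorem mem_maximalIdeal_iff_spectralNorm_lt_one (L : Type*) [Field L] [Algebra ℚ_[p] L]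
    [Algebra ℤ_[p] L] [IsScalarTower ℤ_[p] ℚ_[p] L] [Algebra.IsAlgebraic ℚ_[p] L]
    (a : integralClosure ℤ_[p] L) :
    a ∈ IsLocalRing.maximalIdeal (integralClosure ℤ_[p] L) ↔
      spectralNorm ℚ_[p] L (a : L) < 1 := by
  have ha := (isIntegral_iff_spectralNorm_le_one p L (a : L)).1 a.2
  have hmul : ∀ x y : L, spectralNorm ℚ_[p] L (x * y) =
      spectralNorm ℚ_[p] L x * spectralNorm ℚ_[p] L y := fun x y => by
    simpa only [spectralMulAlgNorm_def] using map_mul (spectralMulAlgNorm ℚ_[p] L) x y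
  rw [IsLocalRing.mem_maximalIdeal, mem_nonunits_iff]
  constructor
  · intro h
    by_contra hlt
    have h1 : spectralNorm ℚ_[p] L (a : L) = 1 := le_antisymm ha (not_lt.1 hlt)
    have h0 : (a : L) ≠ 0 := by
      intro h0
      rw [h0, spectralNorm_zero] at h1
      exact zero_ne_one h1
    have h2 : spectralNorm ℚ_[p] L ((a : L)⁻¹) = 1 := by
      have := hmul (a : L) ((a : L)⁻¹)
      rw [mul_inv_cancel₀ h0, h1, one_mul, spectralNorm_one] at this
      exact this.symm
    refine h (IsUnit.of_mul_eq_one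
      (⟨(a : L)⁻¹, (isIntegral_iff_spectralNorm_le_one p L _).2 h2.le⟩ :
        integralClosure ℤ_[p] L) ?_)
    ext
    exact mul_inv_cancel₀ h0
  · rintro h ⟨u, rfl⟩
    have h1 := (isIntegral_iff_spectralNorm_le_one p L _).1
      ((u⁻¹ : (integralClosure ℤ_[p] L)ˣ) : integralClosure ℤ_[p] L).2
    have h2 := hmul (u : integralClosure ℤ_[p] L)
      ((u⁻¹ : (integralClosure ℤ_[p] L)ˣ) : integralClosure ℤ_[p] L)
    rw [← MulMemClass.coe_mul, Units.mul_inv, OneMemClass.coe_one, spectralNorm_one] at h2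
    have h3 := spectralNorm_nonneg (K := ℚ_[p])
      (((u⁻¹ : (integralClosure ℤ_[p] L)ˣ) : integralClosure ℤ_[p] L) : L)
    rw [mul_comm] at h2
    exact absurd h2 (ne_of_gt (((mul_le_of_le_one_left (spectralNorm_nonneg _) h1).trans_lt h)))

variable (K : Type*) [Field K] [Algebra ℚ_[p] K] [FiniteDimensional ℚ_[p] K]
  [Algebra ℤ_[p] K] [IsScalarTower ℤ_[p] ℚ_[p] K]

instance finite_OK : Module.Finite ℤ_[p] (OK p K) := by
  have : CharZero ℚ_[p] := inferInstance
  exact IsIntegralClosure.finite ℤ_[p] ℚ_[p] K (OK p K)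

instance isDedekindDomain_OK : IsDedekindDomain (OK p K) :=
  IsIntegralClosure.isDedekindDomain ℤ_[p] ℚ_[p] K (OK p K)

theorem natCast_mem_maximalIdeal : (p : OK p K) ∈ IsLocalRing.maximalIdeal (OK p K) := by
  rw [mem_maximalIdeal_iff_spectralNorm_lt_one]
  have e : ((p : OK p K) : K) = algebraMap ℚ_[p] K (p : ℚ_[p]) := by simp
  rw [e, spectralNorm_extends]
  exact Padic.norm_p_lt_one

theorem natCast_ne_zero_OK : (p : OK p K) ≠ 0 := by
  intro h
  have h2 : ((p : OK p K) : K) = algebraMap ℚ_[p] K (p : ℚ_[p]) := by simp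
  rw [h] at h2
  have h3 : (p : ℚ_[p]) = 0 := by
    apply (algebraMap ℚ_[p] K).injective
    rw [← h2]; simp
  exact (Fact.out : p.Prime).ne_zero (by exact_mod_cast h3)

instance isDiscreteValuationRing_OK : IsDiscreteValuationRing (OK p K) := by
  have : IsPrincipalIdealRing (OK p K) := by
    have := (IsDiscreteValuationRing.TFAE (OK p K) (fun h => by
      have := natCast_mem_maximalIdeal p K
      rw [IsLocalRing.isField_iff_maximalIdeal_eq.1 h] at this
      exact natCast_ne_zero_OK p K this)).out 0 2
    exact (this.2 inferInstance).toIsPrincipalIdealRing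
  exact { not_a_field' := fun h => by
            have := natCast_mem_maximalIdeal p K
            rw [h] at this
            exact natCast_ne_zero_OK p K this }

instance liesOver_maximalIdeal_OK :
    (IsLocalRing.maximalIdeal (OK p K)).LiesOver (IsLocalRing.maximalIdeal ℤ_[p]) := by
  constructor
  symm
  exact IsLocalRing.eq_maximalIdeal
    (Ideal.isMaximal_comap_of_isIntegral_of_isMaximal (IsLocalRing.maximalIdeal (OK p K)))

theorem card_padicInt_residue : (IsLocalRing.maximalIdeal ℤ_[p]).cardQuot = p := by
  rw [Submodule.cardQuot_apply]
  have e : (ℤ_[p] ⧸ IsLocalRing.maximalIdeal ℤ_[p]) ≃ ZMod p :=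
    (PadicInt.residueField (p := p)).toEquiv
  rw [Nat.card_congr e, Nat.card_zmod]

theorem card_resK : Nat.card (ResK p K) = p ^ resF p K := by
  have := Ideal.cardQuot_pow_inertiaDeg (IsLocalRing.maximalIdeal ℤ_[p])
    (IsLocalRing.maximalIdeal (OK p K))
  rw [card_padicInt_residue] at this
  exact this.symm

instance finite_resK : Finite (ResK p K) := by
  apply Nat.finite_of_card_ne_zero
  rw [card_resK]
  exact pow_ne_zero _ (Fact.out : p.Prime).ne_zero

noncomputable instance fintype_resK : Fintype (ResK p K) := Fintype.ofFinite _

theorem ramE_spec : Ideal.span {(p : OK p K)} = IsLocalRing.maximalIdeal (OK p K) ^ ramE p K := by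
  obtain ⟨π, hπ⟩ := IsDiscreteValuationRing.exists_irreducible (OK p K)
  obtain ⟨n, u, hn⟩ := IsDiscreteValuationRing.eq_unit_mul_pow_irreducible
    (natCast_ne_zero_OK p K) hπ
  have hm := hπ.maximalIdeal_eq
  have hspan : Ideal.span {(p : OK p K)} = IsLocalRing.maximalIdeal (OK p K) ^ n := by
    rw [hm, Ideal.span_singleton_pow, hn, Ideal.span_singleton_mul_left_unit u.isUnit]
  have hmap : (IsLocalRing.maximalIdeal ℤ_[p]).map (algebraMap ℤ_[p] (OK p K)) =
      Ideal.span {(p : OK p K)} := by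
    rw [PadicInt.maximalIdeal_eq_span_p, Ideal.map_span, Set.image_singleton, map_natCast]
  have hne : (IsLocalRing.maximalIdeal ℤ_[p]).map (algebraMap ℤ_[p] (OK p K)) ≠ ⊥ := by
    rw [hmap, Ne, Ideal.span_singleton_eq_bot]
    exact natCast_ne_zero_OK p K
  have h1 := Ideal.ramificationIdx'_eq_ramificationIdx' (IsLocalRing.maximalIdeal ℤ_[p])
    (IsLocalRing.maximalIdeal (OK p K)) hne
  have h2 : Ideal.ramificationIdx' (IsLocalRing.maximalIdeal ℤ_[p])
    (IsLocalRing.maximalIdeal (OK p K)) = n := by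
    apply Ideal.ramificationIdx'_spec
    · rw [hmap, hspan]
    · rw [hmap, hspan]
      intro h
      have h3 := Ideal.pow_succ_lt_pow (P := IsLocalRing.maximalIdeal (OK p K))
        (IsDiscreteValuationRing.not_a_field (OK p K)) n
      exact absurd h h3.not_ge
  rw [hspan]
  congr 1
  rw [← h2, h1]
  rfl

theorem ramE_pos : 0 < ramE p K :=
  Ideal.ramificationIdx_pos _ _

theorem natCast_mem_sq (h : 1 < ramE p K) :
    (p : OK p K) ∈ IsLocalRing.maximalIdeal (OK p K) ^ 2 := by
  have h1 : (p : OK p K) ∈ Ideal.span {(p : OK p K)} := Ideal.mem_span_singleton_self _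
  rw [ramE_spec] at h1
  exact Ideal.pow_le_pow_right h h1

theorem mem_maximalIdeal_of_ramE_eq_one (h : ramE p K = 1) {x : OK p K}
    (hx : x ∈ IsLocalRing.maximalIdeal (OK p K)) : ∃ y, x = p * y := by
  have := ramE_spec p K
  rw [h, pow_one] at this
  rw [← this, Ideal.mem_span_singleton] at hx
  exact hx

omit [FiniteDimensional ℚ_[p] K] [IsScalarTower ℤ_[p] ℚ_[p] K] in
theorem pow_sub_pow_mem_pow_succ {R : Type*} [CommRing R] {I : Ideal R}
    (hp : (p : R) ∈ I) {x y : R} {n : ℕ} (hn : n ≠ 0) (h : x - y ∈ I ^ n) :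
    x ^ p - y ^ p ∈ I ^ (n + 1) := by
  have hx : x = y + (x - y) := by ring
  generalize hz : x - y = z at h hx
  obtain ⟨r, hr⟩ := exists_add_pow_prime_eq (Fact.out : p.Prime) y z
  rw [hx, hr]
  have e : y ^ p + z ^ p + p * y * z * r - y ^ p = z ^ p + (p * z) * (y * r) := by ring
  rw [e]
  refine Ideal.add_mem _ ?_ (Ideal.mul_mem_right _ _ ?_)
  · have h1 : z ^ p ∈ (I ^ n) ^ p := Ideal.pow_mem_pow h p
    rw [← pow_mul] at h1
    refine Ideal.pow_le_pow_right ?_ h1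
    have : 2 ≤ p := (Fact.out : p.Prime).two_le
    nlinarith [Nat.one_le_iff_ne_zero.2 hn]
  · rw [pow_succ, mul_comm (p : R)]
    exact Ideal.mul_mem_mul h hp

omit [FiniteDimensional ℚ_[p] K] [IsScalarTower ℤ_[p] ℚ_[p] K] in
theorem pow_pow_sub_pow_pow_mem {R : Type*} [CommRing R] {I : Ideal R}
    (hp : (p : R) ∈ I) {x y : R} {n : ℕ} (hn : n ≠ 0) (h : x - y ∈ I ^ n) (k : ℕ) :
    x ^ p ^ k - y ^ p ^ k ∈ I ^ (n + k) := by
  induction k with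
  | zero => simpa using h
  | succ k ih =>
    rw [pow_succ, pow_mul, pow_mul, ← add_assoc]
    exact pow_sub_pow_mem_pow_succ p hp (by omega) ih

theorem resF_pos : 0 < resF p K := Ideal.inertiaDeg_pos _ _

theorem teich_unique {x y : OK p K} (hx : x ^ p ^ resF p K = x) (hy : y ^ p ^ resF p K = y)
    (h : IsLocalRing.residue (OK p K) x = IsLocalRing.residue (OK p K) y) : x = y := by
  have h1 : ∀ n : ℕ, x - y ∈ IsLocalRing.maximalIdeal (OK p K) ^ (n + 1) := by
    intro n
    induction n with
    | zero =>
      rw [zero_add, pow_one, ← IsLocalRing.residue_eq_zero_iff, map_sub, h, sub_self]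
    | succ n ih =>
      have := pow_pow_sub_pow_pow_mem p (natCast_mem_maximalIdeal p K) (by omega) ih (resF p K)
      rw [hx, hy] at this
      exact Ideal.pow_le_pow_right (by have := resF_pos p K; omega) this
  have h2 : x - y ∈ (⨅ n : ℕ, IsLocalRing.maximalIdeal (OK p K) ^ n) := by
    rw [Ideal.mem_iInf]
    intro n
    exact Ideal.pow_le_pow_right (Nat.le_succ n) (h1 n)
  rw [Ideal.iInf_pow_eq_bot_of_isLocalRing _ (Ideal.IsPrime.ne_top inferInstance)] at h2
  exact sub_eq_zero.1 h2

theorem spectralNorm_le_pow {r : ℝ} (hr : 0 ≤ r)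
    (h : ∀ x ∈ IsLocalRing.maximalIdeal (OK p K), spectralNorm ℚ_[p] K (x : K) ≤ r) (n : ℕ)
    (x : OK p K) (hx : x ∈ IsLocalRing.maximalIdeal (OK p K) ^ n) :
    spectralNorm ℚ_[p] K (x : K) ≤ r ^ n := by
  let _ := spectralNorm.normedField ℚ_[p] K
  induction n generalizing x with
  | zero =>
    simpa using (isIntegral_iff_spectralNorm_le_one p K (x : K)).1 x.2
  | succ n ih =>
    rw [pow_succ] at hx
    refine Submodule.mul_induction_on hx ?_ ?_
    · intro a ha b hb
      have e : spectralNorm ℚ_[p] K ((a * b : OK p K) : K) =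
          spectralNorm ℚ_[p] K (a : K) * spectralNorm ℚ_[p] K (b : K) := norm_mul (a : K) (b : K)
      rw [e, pow_succ]
      exact mul_le_mul (ih a ha) (h b hb) (spectralNorm_nonneg _) (pow_nonneg hr n)
    · intro a b ha hb
      exact (isNonarchimedean_spectralNorm (K := ℚ_[p]) (L := K) (a : K) (b : K)).trans
        (max_le ha hb)

set_option maxHeartbeats 1000000 in
theorem exists_teich (l : ResK p K) :
    ∃ x : OK p K, x ^ p ^ resF p K = x ∧ IsLocalRing.residue (OK p K) x = l := by
  obtain ⟨π, hπ⟩ := IsDiscreteValuationRing.exists_irreducible (OK p K)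
  obtain ⟨x, hx⟩ := IsLocalRing.residue_surjective l
  set q := p ^ resF p K with hq
  set m := IsLocalRing.maximalIdeal (OK p K) with hm
  let _ := spectralNorm.normedField ℚ_[p] K
  let _ := spectralNorm.normedSpace ℚ_[p] K
  have : CompleteSpace K := spectralNorm.completeSpace ℚ_[p] K
  have hnorm : ∀ y : K, ‖y‖ = spectralNorm ℚ_[p] K y := fun _ => rfl
  set r := spectralNorm ℚ_[p] K (π : K) with hr
  have hπm : π ∈ m := by
    rw [hm, hπ.maximalIdeal_eq]
    exact Ideal.mem_span_singleton_self _
  have hr1 : r < 1 := (mem_maximalIdeal_iff_spectralNorm_lt_one p K π).1 hπm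
  have hr0 : 0 ≤ r := spectralNorm_nonneg _
  have hmr : ∀ y ∈ m, spectralNorm ℚ_[p] K (y : K) ≤ r := by
    intro y hy
    rw [hm, hπ.maximalIdeal_eq, Ideal.mem_span_singleton] at hy
    obtain ⟨z, rfl⟩ := hy
    have e : spectralNorm ℚ_[p] K ((π * z : OK p K) : K) =
        r * spectralNorm ℚ_[p] K (z : K) := norm_mul (π : K) (z : K)
    rw [e]
    exact mul_le_of_le_one_right hr0 ((isIntegral_iff_spectralNorm_le_one p K _).1 z.2)
  have hstep : ∀ n : ℕ, x ^ q ^ (n + 1) - x ^ q ^ n ∈ m ^ (n + 1) := by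
    have h0 : x ^ q - x ∈ m ^ 1 := by
      rw [pow_one, hm, ← IsLocalRing.residue_eq_zero_iff, map_sub, map_pow, hx, sub_eq_zero, hq,
        ← card_resK, Nat.card_eq_fintype_card]
      exact FiniteField.pow_card l
    intro n
    have := pow_pow_sub_pow_pow_mem p (natCast_mem_maximalIdeal p K) one_ne_zero h0
      (resF p K * n)
    rw [pow_mul p, ← hq, ← pow_mul, ← pow_succ'] at this
    refine Ideal.pow_le_pow_right ?_ this
    have := resF_pos p K
    nlinarith
  have hcau : CauchySeq (fun n : ℕ => ((x ^ q ^ n : OK p K) : K)) := by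
    refine cauchySeq_of_le_geometric r r hr1 fun n => ?_
    rw [dist_eq_norm, norm_sub_rev, hnorm]
    have := spectralNorm_le_pow p K hr0 hmr (n + 1) _ (hstep n)
    rw [pow_succ' r, AddSubgroupClass.coe_sub] at this
    exact this
  obtain ⟨t, ht⟩ := cauchySeq_tendsto_of_complete hcau
  have hle : ∀ n : ℕ, ‖((x ^ q ^ n : OK p K) : K)‖ ≤ 1 := fun n =>
    (isIntegral_iff_spectralNorm_le_one p K _).1 (x ^ q ^ n).2
  have ht1 : ‖t‖ ≤ 1 := le_of_tendsto (ht.norm) (Filter.Eventually.of_forall hle)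
  have htint : IsIntegral ℤ_[p] t := (isIntegral_iff_spectralNorm_le_one p K t).2 ht1
  refine ⟨⟨t, htint⟩, ?_, ?_⟩
  · apply Subtype.ext
    have h1 : Filter.Tendsto (fun n : ℕ => ((x ^ q ^ n : OK p K) : K) ^ q) Filter.atTop
        (nhds (t ^ q)) := ht.pow q
    have h2 : Filter.Tendsto (fun n : ℕ => ((x ^ q ^ (n + 1) : OK p K) : K)) Filter.atTop
        (nhds t) := ht.comp (Filter.tendsto_add_atTop_nat 1)
    have h3 : (fun n : ℕ => ((x ^ q ^ (n + 1) : OK p K) : K)) =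
        fun n : ℕ => ((x ^ q ^ n : OK p K) : K) ^ q := by
      funext n
      rw [pow_succ, pow_mul]
      rfl
    rw [h3] at h2
    exact tendsto_nhds_unique h1 h2
  · rw [← hx, ← sub_eq_zero, ← map_sub, IsLocalRing.residue_eq_zero_iff,
      mem_maximalIdeal_iff_spectralNorm_lt_one]
    have hx0 : ∀ n : ℕ, x ^ q ^ n - x ∈ m := by
      intro n
      induction n with
      | zero => simp
      | succ n ih =>
        have h1 := Ideal.pow_le_self (Nat.succ_ne_zero n) (hstep n)
        have := m.add_mem h1 ih
        rwa [sub_add_sub_cancel] at this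
    have h4 : Filter.Tendsto (fun n : ℕ => ‖((x ^ q ^ n : OK p K) : K) - (x : K)‖) Filter.atTop
        (nhds ‖t - (x : K)‖) := (ht.sub_const _).norm
    have h5 : ‖t - (x : K)‖ ≤ r :=
      le_of_tendsto h4 (Filter.Eventually.of_forall fun n => by
      have := hmr _ (hx0 n)
      rw [AddSubgroupClass.coe_sub] at this
      exact this)
    exact h5.trans_lt hr1

/-- The Teichmüller lift. -/
noncomputable def teich : ResK p K →* OK p K where
  toFun l := (exists_teich p K l).choose
  map_one' := teich_unique p K (exists_teich p K 1).choose_spec.1 (one_pow _)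
    ((exists_teich p K 1).choose_spec.2.trans (map_one _).symm)
  map_mul' a b := teich_unique p K (exists_teich p K (a * b)).choose_spec.1
    (by rw [mul_pow, (exists_teich p K a).choose_spec.1, (exists_teich p K b).choose_spec.1])
    (by rw [map_mul, (exists_teich p K a).choose_spec.2, (exists_teich p K b).choose_spec.2,
          (exists_teich p K (a * b)).choose_spec.2])

theorem residue_teich (l : ResK p K) : IsLocalRing.residue (OK p K) (teich p K l) = l :=
  (exists_teich p K l).choose_spec.2

theorem teich_pow (l : ResK p K) : teich p K l ^ p ^ resF p K = teich p K l :=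
  (exists_teich p K l).choose_spec.1

end LocalField

open scoped Pointwise in
/-- An automorphism of a residue ring of `B` that fixes the images of the invariants of a profinite
group acting on `B` is induced by an element of this group. -/
theorem exists_smul_eq_of_profinite {G B : Type*} [Group G] [TopologicalSpace G]
    [IsTopologicalGroup G] [CompactSpace G] [TotallyDisconnectedSpace G] [CommRing B]
    [TopologicalSpace B] [DiscreteTopology B] [MulSemiringAction G B] [ContinuousSMul G B]
    (Q : Ideal B) [Q.IsPrime] (T : (B ⧸ Q) ≃+* (B ⧸ Q))
    (hT : ∀ b : B, (∀ g : G, g • b = b) →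
      T (Ideal.Quotient.mk Q b) = Ideal.Quotient.mk Q b) :
    ∃ g : G, ∀ b : B, Ideal.Quotient.mk Q (g • b) = T (Ideal.Quotient.mk Q b) := by
  let A := FixedPoints.subalgebra ℤ B G
  have : Algebra.IsInvariant A B G := ⟨fun b hb => ⟨⟨b, hb⟩, rfl⟩⟩
  let P : Ideal A := Q.under A
  have : Q.LiesOver P := ⟨rfl⟩
  let T' : (B ⧸ Q) ≃ₐ[A ⧸ P] (B ⧸ Q) := AlgEquiv.ofRingEquiv (f := T) fun x => by
    obtain ⟨a, rfl⟩ := Ideal.Quotient.mk_surjective x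
    exact hT a a.2
  obtain ⟨g, hg⟩ := Ideal.Quotient.stabilizerHom_surjective_of_profinite (G := G) P Q T'
  exact ⟨g, fun b => congrArg (fun F => F (Ideal.Quotient.mk Q b)) hg⟩

section Kummer

variable (p : ℕ) [Fact p.Prime]
variable (K : Type*) [Field K] [Algebra ℚ_[p] K] [FiniteDimensional ℚ_[p] K]
  [Algebra ℤ_[p] K] [IsScalarTower ℤ_[p] ℚ_[p] K]

include p in
omit [FiniteDimensional ℚ_[p] K] [Algebra ℤ_[p] K] [IsScalarTower ℤ_[p] ℚ_[p] K] in
theorem charZero_of_padicAlgebra : CharZero K :=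
  charZero_of_injective_algebraMap (algebraMap ℚ_[p] K).injective

instance isFractionRing_OK : IsFractionRing (OK p K) K :=
  integralClosure.isFractionRing_of_finite_extension ℚ_[p] K

theorem two_le_card_resK : 2 ≤ p ^ resF p K := by
  have h1 := (Fact.out : p.Prime).two_le
  calc 2 ≤ p ^ 1 := by simpa using h1
    _ ≤ p ^ resF p K := Nat.pow_le_pow_right (by omega) (resF_pos p K)

theorem teich_ne_zero {l : ResK p K} (hl : l ≠ 0) : teich p K l ≠ 0 := by
  intro h
  apply hl
  rw [← residue_teich p K l, h, map_zero]

theorem teich_pow_sub_one {l : ResK p K} (hl : l ≠ 0) :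
    teich p K l ^ (p ^ resF p K - 1) = 1 := by
  have h := teich_pow p K l
  have h2 := two_le_card_resK p K
  have e : p ^ resF p K = (p ^ resF p K - 1) + 1 := by omega
  rw [e, pow_succ] at h
  exact mul_right_cancel₀ (teich_ne_zero p K hl) (h.trans (one_mul _).symm)

theorem exists_teich_of_pow_eq_one {z : AlgebraicClosure K} (hz : z ^ (p ^ resF p K - 1) = 1) :
    ∃ l : ResK p K, l ≠ 0 ∧ z = algebraMap K (AlgebraicClosure K) (teich p K l) := by
  classical
  have h2 := two_le_card_resK p K
  set N := p ^ resF p K - 1 with hN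
  let φ : ResK p K → AlgebraicClosure K := fun l =>
    algebraMap K (AlgebraicClosure K) (teich p K l)
  have hinj : Function.Injective φ := by
    intro a b hab
    have h3 : teich p K a = teich p K b :=
      Subtype.ext ((algebraMap K (AlgebraicClosure K)).injective hab)
    rw [← residue_teich p K a, h3, residue_teich]
  let S : Finset (AlgebraicClosure K) := (Finset.univ.erase (0 : ResK p K)).image φ
  have hsub : S ⊆ (Polynomial.nthRoots N (1 : AlgebraicClosure K)).toFinset := by
    intro w hw
    obtain ⟨l, hl, rfl⟩ := Finset.mem_image.1 hw
    rw [Multiset.mem_toFinset, Polynomial.mem_nthRoots (by omega)]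
    have := teich_pow_sub_one p K (Finset.ne_of_mem_erase hl)
    change algebraMap K (AlgebraicClosure K) (teich p K l) ^ N = 1
    rw [← map_pow, ← SubmonoidClass.coe_pow, this]
    simp
  have hcard : S.card = N := by
    rw [Finset.card_image_of_injective _ hinj, Finset.card_erase_of_mem (Finset.mem_univ _),
      Finset.card_univ, ← Nat.card_eq_fintype_card, card_resK]
  have heq := Finset.eq_of_subset_of_card_le hsub (by
    rw [hcard]
    exact (Multiset.toFinset_card_le _).trans (Polynomial.card_nthRoots N _))
  have hz' : z ∈ S := by
    rw [heq, Multiset.mem_toFinset, Polynomial.mem_nthRoots (by omega)]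
    exact hz
  obtain ⟨l, hl, rfl⟩ := Finset.mem_image.1 hz'
  exact ⟨l, Finset.ne_of_mem_erase hl, rfl⟩

variable {p K} {ϖ : AlgebraicClosure K} {π : OK p K}

theorem root_ne_zero (hπ : Irreducible π)
    (hϖ : ϖ ^ (p ^ resF p K - 1) = algebraMap K (AlgebraicClosure K) (π : K)) : ϖ ≠ 0 := by
  rintro rfl
  have h2 := two_le_card_resK p K
  rw [zero_pow (by omega)] at hϖ
  have h3 := (algebraMap K (AlgebraicClosure K)).injective (hϖ.symm.trans (map_zero _).symm)
  exact hπ.ne_zero (Subtype.ext h3)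

theorem exists_kummer (hπ : Irreducible π)
    (hϖ : ϖ ^ (p ^ resF p K - 1) = algebraMap K (AlgebraicClosure K) (π : K)) (g : GalK K) :
    ∃ l : ResK p K, l ≠ 0 ∧ g ϖ = algebraMap K (AlgebraicClosure K) (teich p K l) * ϖ := by
  have h0 := root_ne_zero hπ hϖ
  have h1 : (g ϖ / ϖ) ^ (p ^ resF p K - 1) = 1 := by
    rw [div_pow, ← map_pow, hϖ, AlgEquiv.commutes, div_self]
    rw [← hϖ]
    exact pow_ne_zero _ h0
  obtain ⟨l, hl, h⟩ := exists_teich_of_pow_eq_one p K h1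
  exact ⟨l, hl, by rw [← h, div_mul_cancel₀ _ h0]⟩

/-- The Kummer character `G_K → kˣ`, `g ↦ g(ϖ)/ϖ`. -/
noncomputable def kummer (hπ : Irreducible π)
    (hϖ : ϖ ^ (p ^ resF p K - 1) = algebraMap K (AlgebraicClosure K) (π : K)) :
    GalK K →* (ResK p K)ˣ :=
  MonoidHom.mk' (fun g => Units.mk0 _ (exists_kummer hπ hϖ g).choose_spec.1) (by
    intro g h
    apply Units.ext
    simp only [Units.val_mul, Units.val_mk0]
    have hg := (exists_kummer hπ hϖ g).choose_spec.2
    have hh := (exists_kummer hπ hϖ h).choose_spec.2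
    have hgh : g (h ϖ) = _ := (exists_kummer hπ hϖ (g * h)).choose_spec.2
    rw [hh, map_mul, AlgEquiv.commutes, hg, ← mul_assoc, ← map_mul] at hgh
    have h1 := mul_right_cancel₀ (root_ne_zero hπ hϖ) hgh
    have h2 := (algebraMap K (AlgebraicClosure K)).injective h1
    rw [← MulMemClass.coe_mul, ← map_mul] at h2
    have h3 := Subtype.ext h2
    have h4 := congrArg (IsLocalRing.residue (OK p K)) h3
    rw [residue_teich, residue_teich] at h4
    rw [← h4, mul_comm])

theorem kummer_spec (hπ : Irreducible π)
    (hϖ : ϖ ^ (p ^ resF p K - 1) = algebraMap K (AlgebraicClosure K) (π : K)) (g : GalK K) :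
    g ϖ = algebraMap K (AlgebraicClosure K) (teich p K (kummer hπ hϖ g)) * ϖ :=
  (exists_kummer hπ hϖ g).choose_spec.2

theorem residue_eq_kummer (hπ : Irreducible π)
    (hϖ : ϖ ^ (p ^ resF p K - 1) = algebraMap K (AlgebraicClosure K) (π : K)) (g : GalK K)
    {a : OK p K} (ha : g ϖ = algebraMap K (AlgebraicClosure K) a * ϖ) :
    IsLocalRing.residue (OK p K) a = kummer hπ hϖ g := by
  rw [kummer_spec hπ hϖ] at ha
  have h1 := mul_right_cancel₀ (root_ne_zero hπ hϖ) ha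
  have h2 := Subtype.ext ((algebraMap K (AlgebraicClosure K)).injective h1)
  rw [← h2, residue_teich]

theorem isOpen_ker_kummer (hπ : Irreducible π)
    (hϖ : ϖ ^ (p ^ resF p K - 1) = algebraMap K (AlgebraicClosure K) (π : K)) :
    IsOpen ((kummer hπ hϖ).ker : Set (GalK K)) := by
  have hfd : FiniteDimensional K (IntermediateField.adjoin K {ϖ}) :=
    IntermediateField.adjoin.finiteDimensional (Algebra.IsIntegral.isIntegral ϖ)
  refine Subgroup.isOpen_mono (H₁ := (IntermediateField.adjoin K {ϖ}).fixingSubgroup) ?_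
    (IntermediateField.fixingSubgroup_isOpen _)
  intro g hg
  rw [IntermediateField.mem_fixingSubgroup_iff] at hg
  have h1 := hg ϖ (IntermediateField.mem_adjoin_simple_self K ϖ)
  have h2 := residue_eq_kummer hπ hϖ g (a := 1) (by
    rw [h1]; simp)
  rw [MonoidHom.mem_ker]
  apply Units.ext
  rw [← h2, map_one, Units.val_one]

theorem minpoly_root (hπ : Irreducible π)
    (hϖ : ϖ ^ (p ^ resF p K - 1) = algebraMap K (AlgebraicClosure K) (π : K)) :
    minpoly K ϖ = Polynomial.X ^ (p ^ resF p K - 1) - Polynomial.C (π : K) := by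
  have h2 := two_le_card_resK p K
  set N := p ^ resF p K - 1 with hN
  have hN0 : N ≠ 0 := by omega
  have hmon : (Polynomial.X ^ N - Polynomial.C π : Polynomial (OK p K)).Monic :=
    Polynomial.monic_X_pow_sub_C π hN0
  have hπm : π ∈ IsLocalRing.maximalIdeal (OK p K) := by
    rw [hπ.maximalIdeal_eq]
    exact Ideal.mem_span_singleton_self _
  have hirr : Irreducible (Polynomial.X ^ N - Polynomial.C π : Polynomial (OK p K)) := by
    refine Polynomial.IsEisensteinAt.irreducible (𝓟 := IsLocalRing.maximalIdeal (OK p K))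
      ⟨?_, ?_, ?_⟩ inferInstance hmon.isPrimitive ?_
    · rw [hmon.leadingCoeff]
      exact fun h => (Ideal.ne_top_iff_one _).1 (Ideal.IsPrime.ne_top inferInstance) h
    · intro n hn
      rw [Polynomial.natDegree_X_pow_sub_C] at hn
      rw [Polynomial.coeff_sub, Polynomial.coeff_X_pow, if_neg hn.ne, Polynomial.coeff_C, zero_sub]
      split_ifs
      · exact neg_mem hπm
      · simp
    · rw [Polynomial.coeff_sub, Polynomial.coeff_X_pow, if_neg hN0.symm, Polynomial.coeff_C_zero,
        zero_sub, neg_mem_iff, hπ.maximalIdeal_eq, Ideal.span_singleton_pow,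
        Ideal.mem_span_singleton]
      intro h
      have h3 : π * π ∣ π * 1 := by rwa [← sq, mul_one]
      exact hπ.not_isUnit (isUnit_of_dvd_one ((mul_dvd_mul_iff_left hπ.ne_zero).1 h3))
    · rw [Polynomial.natDegree_X_pow_sub_C]
      omega
  rw [hmon.irreducible_iff_irreducible_map_fraction_map (K := K)] at hirr
  have e : Polynomial.map (algebraMap (OK p K) K)
      (Polynomial.X ^ N - Polynomial.C π : Polynomial (OK p K)) =
      Polynomial.X ^ N - Polynomial.C (π : K) := by simp
  rw [e] at hirr
  refine (minpoly.eq_of_irreducible_of_monic hirr ?_ (Polynomial.monic_X_pow_sub_C _ hN0)).symm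
  simp [hϖ]

theorem exists_gal_root (hπ : Irreducible π)
    (hϖ : ϖ ^ (p ^ resF p K - 1) = algebraMap K (AlgebraicClosure K) (π : K)) {l : ResK p K}
    (hl : l ≠ 0) :
    ∃ g : GalK K, g ϖ = algebraMap K (AlgebraicClosure K) (teich p K l) * ϖ := by
  refine minpoly.exists_algEquiv_of_root' (Algebra.IsAlgebraic.isAlgebraic ϖ) ?_
  rw [minpoly_root hπ hϖ]
  have := teich_pow_sub_one p K hl
  rw [map_sub, map_pow, Polynomial.aeval_X, Polynomial.aeval_C, mul_pow, hϖ, ← map_pow,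
    ← SubmonoidClass.coe_pow, this]
  simp

theorem spectralNorm_mul (L : Type*) [Field L] [Algebra ℚ_[p] L] [Algebra.IsAlgebraic ℚ_[p] L]
    (x y : L) : spectralNorm ℚ_[p] L (x * y) =
      spectralNorm ℚ_[p] L x * spectralNorm ℚ_[p] L y := by
  simpa only [spectralMulAlgNorm_def] using map_mul (spectralMulAlgNorm ℚ_[p] L) x y

theorem spectralNorm_algebraMap_closure (a : K) :
    spectralNorm ℚ_[p] (AlgebraicClosure K) (algebraMap K (AlgebraicClosure K) a) =
      spectralNorm ℚ_[p] K a :=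
  (spectralNorm.eq_of_tower (K := ℚ_[p]) (L := AlgebraicClosure K) a).symm

theorem spectralNorm_eq_zero {L : Type*} [Field L] [Algebra ℚ_[p] L]
    [Algebra.IsAlgebraic ℚ_[p] L] {x : L} (h : spectralNorm ℚ_[p] L x = 0) : x = 0 := by
  rw [← spectralMulAlgNorm_def] at h
  exact (map_eq_zero_iff_eq_zero (spectralMulAlgNorm ℚ_[p] L)).1 h

theorem spectralNorm_pow' (L : Type*) [Field L] [Algebra ℚ_[p] L] [Algebra.IsAlgebraic ℚ_[p] L]
    (x : L) (n : ℕ) : spectralNorm ℚ_[p] L (x ^ n) = spectralNorm ℚ_[p] L x ^ n := by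
  simpa only [spectralMulAlgNorm_def] using map_pow (spectralMulAlgNorm ℚ_[p] L) x n

/-- No element of `K` has absolute value strictly between that of the uniformizer and `1`. -/
theorem spectralNorm_le_uniformizer (hπ : Irreducible π) {b : K}
    (hb : spectralNorm ℚ_[p] K b < 1) :
    spectralNorm ℚ_[p] K b ≤ spectralNorm ℚ_[p] K (π : K) := by
  have hi := (isIntegral_iff_spectralNorm_le_one p K b).2 hb.le
  have hm := (mem_maximalIdeal_iff_spectralNorm_lt_one p K ⟨b, hi⟩).2 hb
  rw [hπ.maximalIdeal_eq, Ideal.mem_span_singleton] at hm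
  obtain ⟨z, hz⟩ := hm
  have e : b = (π : K) * (z : K) := by
    have := congrArg (fun t : OK p K => (t : K)) hz
    simpa using this
  rw [e, spectralNorm_mul]
  exact mul_le_of_le_one_right (spectralNorm_nonneg _)
    ((isIntegral_iff_spectralNorm_le_one p K _).1 z.2)

section

variable (hπ : Irreducible π)
  (hϖ : ϖ ^ (p ^ resF p K - 1) = algebraMap K (AlgebraicClosure K) (π : K))

include hπ hϖ

theorem spectralNorm_root_pow :
    spectralNorm ℚ_[p] (AlgebraicClosure K) ϖ ^ (p ^ resF p K - 1) =
      spectralNorm ℚ_[p] K (π : K) := by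
  rw [← spectralNorm_pow', hϖ, spectralNorm_algebraMap_closure]

theorem spectralNorm_root_lt_one : spectralNorm ℚ_[p] (AlgebraicClosure K) ϖ < 1 := by
  by_contra h
  have h1 := spectralNorm_root_pow hπ hϖ
  have h2 := one_le_pow₀ (not_lt.1 h) (n := p ^ resF p K - 1)
  rw [h1] at h2
  have hπm : π ∈ IsLocalRing.maximalIdeal (OK p K) := by
    rw [hπ.maximalIdeal_eq]
    exact Ideal.mem_span_singleton_self _
  have := (mem_maximalIdeal_iff_spectralNorm_lt_one p K π).1 hπm
  linarith

theorem spectralNorm_root_pos : 0 < spectralNorm ℚ_[p] (AlgebraicClosure K) ϖ :=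
  lt_of_le_of_ne (spectralNorm_nonneg _)
    fun h => root_ne_zero hπ hϖ (spectralNorm_eq_zero h.symm)

theorem spectralNorm_ne_root_pow {b : K} {d : ℕ} (hd : 0 < d) (hdN : d < p ^ resF p K - 1) :
    spectralNorm ℚ_[p] K b ≠ spectralNorm ℚ_[p] (AlgebraicClosure K) ϖ ^ d := by
  intro h
  have h0 := spectralNorm_root_pos hπ hϖ
  have h1 := spectralNorm_root_lt_one hπ hϖ
  have h2 : spectralNorm ℚ_[p] K b < 1 := by
    rw [h]
    exact pow_lt_one₀ h0.le h1 hd.ne'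
  have h3 := spectralNorm_le_uniformizer hπ h2
  rw [← spectralNorm_root_pow hπ hϖ, h] at h3
  exact absurd h3 (pow_lt_pow_right_of_lt_one₀ h0 h1 hdN).not_ge

theorem exists_sub_mem_of_mem_adjoin {x : AlgebraicClosure K}
    (hx : x ∈ IntermediateField.adjoin K {ϖ})
    (hx1 : spectralNorm ℚ_[p] (AlgebraicClosure K) x ≤ 1) :
    ∃ a : OK p K, spectralNorm ℚ_[p] (AlgebraicClosure K)
      (x - algebraMap K (AlgebraicClosure K) a) < 1 := by
  have hq := two_le_card_resK p K
  set N := p ^ resF p K - 1 with hN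
  have h0 := spectralNorm_root_pos hπ hϖ
  have h1 := spectralNorm_root_lt_one hπ hϖ
  have hx' : x ∈ Algebra.adjoin K {ϖ} := by
    rw [← IntermediateField.adjoin_simple_toSubalgebra_of_isAlgebraic
      (Algebra.IsAlgebraic.isAlgebraic ϖ)]
    exact hx
  rw [Algebra.adjoin_singleton_eq_range_aeval] at hx'
  obtain ⟨g0, hg0⟩ := hx'
  have hmin := minpoly_root hπ hϖ
  rw [← hN] at hmin
  have hmon : (minpoly K ϖ).Monic := minpoly.monic (Algebra.IsIntegral.isIntegral ϖ)
  set g := g0 %ₘ minpoly K ϖ with hg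
  have hgx : Polynomial.aeval ϖ g = x := by
    rw [hg, Polynomial.aeval_modByMonic_eq_self_of_root (minpoly.aeval K ϖ)]
    exact hg0
  have hdeg : g.natDegree < N := by
    have hne : minpoly K ϖ ≠ 1 := minpoly.ne_one K ϖ
    have := Polynomial.natDegree_modByMonic_lt g0 hmon hne
    rwa [hmin, Polynomial.natDegree_X_pow_sub_C, ← hmin] at this
  rw [Polynomial.aeval_eq_sum_range' hdeg] at hgx
  let nrm := spectralNorm ℚ_[p] (AlgebraicClosure K)
  let t : ℕ → AlgebraicClosure K := fun i => g.coeff i • ϖ ^ i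
  have ht : ∀ i, nrm (t i) = spectralNorm ℚ_[p] K (g.coeff i) * nrm ϖ ^ i := by
    intro i
    simp only [nrm, t, Algebra.smul_def, spectralNorm_mul, spectralNorm_algebraMap_closure,
      spectralNorm_pow']
  have hna : IsNonarchimedean nrm :=
    isNonarchimedean_spectralNorm (K := ℚ_[p]) (L := AlgebraicClosure K)
  have hdist : ∀ i j, i < j → j < N → nrm (t i) = nrm (t j) → nrm (t i) = 0 := by
    intro i j hij hj h
    by_contra hne
    have hci : spectralNorm ℚ_[p] K (g.coeff i) ≠ 0 := fun e => hne (by rw [ht, e, zero_mul])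
    have hcj : spectralNorm ℚ_[p] K (g.coeff j) ≠ 0 := fun e => by
      rw [ht j, e, zero_mul] at h; exact hne h
    have hcj0 : g.coeff j ≠ 0 := fun e => hcj (by rw [e, spectralNorm_zero])
    rw [ht, ht] at h
    refine spectralNorm_ne_root_pow hπ hϖ (b := g.coeff i / g.coeff j) (d := j - i) (by omega)
      (by omega) ?_
    have e1 : spectralNorm ℚ_[p] K (g.coeff i / g.coeff j) * spectralNorm ℚ_[p] K (g.coeff j) =
        spectralNorm ℚ_[p] K (g.coeff i) := by
      rw [← spectralNorm_mul, div_mul_cancel₀ _ hcj0]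
    have e2 : nrm ϖ ^ j = nrm ϖ ^ (j - i) * nrm ϖ ^ i := by
      rw [← pow_add]; congr 1; omega
    rw [← e1, e2] at h
    have e3 : nrm ϖ ^ i ≠ 0 := (pow_pos h0 i).ne'
    apply mul_right_cancel₀ hcj
    apply mul_right_cancel₀ e3
    rw [h]
    ring
  have hle : ∀ i ∈ Finset.range N, nrm (t i) ≤ 1 := by
    obtain ⟨k, hk, hmax⟩ := Finset.exists_max_image (Finset.range N) (fun i => nrm (t i))
      ⟨0, Finset.mem_range.2 (by omega)⟩
    intro i hi
    refine (hmax i hi).trans ?_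
    by_contra hgt
    rw [not_le] at hgt
    have := IsNonarchimedean.apply_sum_eq_of_lt hna
      (fun a => (spectralNorm_neg (Algebra.IsAlgebraic.isAlgebraic a)).symm) hk (l := t)
      (fun j hj hjk => by
        refine lt_of_le_of_ne (hmax j hj) fun e => ?_
        rcases lt_or_gt_of_ne hjk with hlt | hlt
        · have := hdist j k hlt (Finset.mem_range.1 hk) e
          rw [e] at this
          linarith
        · have := hdist k j hlt (Finset.mem_range.1 hj) e.symm
          linarith)
    rw [hgx] at this
    rw [← this] at hgt
    exact absurd hx1 hgt.not_ge
  have ha0 : IsIntegral ℤ_[p] (g.coeff 0) := by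
    rw [isIntegral_iff_spectralNorm_le_one]
    have := hle 0 (Finset.mem_range.2 (by omega))
    rwa [ht, pow_zero, mul_one] at this
  refine ⟨⟨g.coeff 0, ha0⟩, ?_⟩
  have hsum : x - algebraMap K (AlgebraicClosure K) (g.coeff 0) =
      ∑ i ∈ (Finset.range N).erase 0, t i := by
    rw [← hgx, ← Finset.add_sum_erase _ t (Finset.mem_range.2 (show 0 < N by omega))]
    simp [t, Algebra.smul_def]
  change nrm (x - algebraMap K (AlgebraicClosure K) (g.coeff 0)) < 1
  rw [hsum]
  rcases ((Finset.range N).erase 0).eq_empty_or_nonempty with he | he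
  · rw [he, Finset.sum_empty]
    simp [nrm, spectralNorm_zero]
  · obtain ⟨i, hi, hile⟩ := IsNonarchimedean.finset_image_add_of_nonempty hna t he
    refine hile.trans_lt ?_
    have hi0 := Finset.ne_of_mem_erase hi
    have hiN := Finset.mem_range.1 (Finset.mem_of_mem_erase hi)
    refine lt_of_le_of_ne (hle i (Finset.mem_of_mem_erase hi)) fun e => ?_
    have hc0 : g.coeff i ≠ 0 := by
      intro h
      rw [ht, h, spectralNorm_zero, zero_mul] at e
      exact zero_ne_one e
    refine spectralNorm_ne_root_pow hπ hϖ (b := (g.coeff i)⁻¹) (d := i) (by omega) hiN ?_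
    rw [ht] at e
    have e1 : spectralNorm ℚ_[p] K (g.coeff i)⁻¹ * spectralNorm ℚ_[p] K (g.coeff i) = 1 := by
      rw [← spectralNorm_mul, inv_mul_cancel₀ hc0, spectralNorm_one]
    have hci : spectralNorm ℚ_[p] K (g.coeff i) ≠ 0 := fun h => hc0 (spectralNorm_eq_zero h)
    apply mul_right_cancel₀ hci
    rw [e1, ← e, mul_comm]

theorem ringEquiv_maximalIdeal {B : Type*} [CommRing B] [IsLocalRing B] (τ : B ≃+* B) {b : B}
    (hb : b ∈ IsLocalRing.maximalIdeal B) : τ b ∈ IsLocalRing.maximalIdeal B := by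
  rw [IsLocalRing.mem_maximalIdeal, mem_nonunits_iff] at hb ⊢
  rwa [MulEquiv.isUnit_map]

set_option maxHeartbeats 1000000 in
/-- Inertia surjects onto `kˣ` under the Kummer character. -/
theorem exists_inertia_kummer (l : (ResK p K)ˣ) : ∃ g ∈ inertia p K, kummer hπ hϖ g = l := by
  have : CharZero K := charZero_of_padicAlgebra p K
  obtain ⟨τ, hτ⟩ := exists_gal_root hπ hϖ l.ne_zero
  let E := IntermediateField.adjoin K {ϖ}
  have hfd : FiniteDimensional K E :=
    IntermediateField.adjoin.finiteDimensional (Algebra.IsIntegral.isIntegral ϖ)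
  let G' : Subgroup (GalK K) := E.fixingSubgroup
  have hclosed : IsClosed (G' : Set (GalK K)) := IntermediateField.fixingSubgroup_isClosed E
  have : CompactSpace G' := isCompact_iff_compactSpace.1 hclosed.isCompact
  let B := integralClosure ℤ_[p] (AlgebraicClosure K)
  let _ : TopologicalSpace B := ⊥
  have : DiscreteTopology B := ⟨rfl⟩
  have : ContinuousSMul G' B := by
    rw [continuousSMul_iff_stabilizer_isOpen]
    intro b
    have h1 := stabilizer_isOpen_of_isIntegral (K := K) (b : AlgebraicClosure K)
    have h2 : (MulAction.stabilizer G' b : Set G') =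
        Subtype.val ⁻¹' (MulAction.stabilizer (GalK K) (b : AlgebraicClosure K) :
          Set (GalK K)) := by
      ext g
      simp only [SetLike.mem_coe, MulAction.mem_stabilizer_iff, Set.mem_preimage]
      exact Subtype.ext_iff
    rw [h2]
    exact h1.preimage continuous_subtype_val
  let Q := IsLocalRing.maximalIdeal B
  let τB : B ≃+* B := MulSemiringAction.toRingEquiv (GalK K) B τ
  have hQ : Q = Q.map (τB : B →+* B) := by
    ext b
    constructor
    · intro hb
      have h1 := Ideal.mem_map_of_mem (τB : B →+* B) (ringEquiv_maximalIdeal hπ hϖ τB.symm hb)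
      simpa using h1
    · intro hb
      refine (Ideal.map_le_iff_le_comap.2 ?_) hb
      intro c hc
      exact ringEquiv_maximalIdeal hπ hϖ τB hc
  let T : (B ⧸ Q) ≃+* (B ⧸ Q) := Ideal.quotientEquiv Q Q τB hQ
  have hT : ∀ a : B, (∀ g : G', g • a = a) →
      T (Ideal.Quotient.mk Q a) = Ideal.Quotient.mk Q a := by
    intro a hfix
    change Ideal.Quotient.mk Q (τ • a) = Ideal.Quotient.mk Q a
    have hmem : (a : AlgebraicClosure K) ∈ E := by
      rw [← InfiniteGalois.fixedField_fixingSubgroup E, IntermediateField.mem_fixedField_iff]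
      intro g hg
      have := hfix ⟨g, hg⟩
      exact congrArg Subtype.val this
    have hint := (isIntegral_iff_spectralNorm_le_one p (AlgebraicClosure K) _).1 a.2
    obtain ⟨c, hc⟩ := exists_sub_mem_of_mem_adjoin hπ hϖ hmem hint
    let c' : B := ⟨algebraMap K (AlgebraicClosure K) c, c.2.map (IsScalarTower.toAlgHom ℤ_[p] K _)⟩
    have hc1 : a - c' ∈ Q :=
      (mem_maximalIdeal_iff_spectralNorm_lt_one p (AlgebraicClosure K) (a - c')).2 hc
    have hc2 : τ • (a - c') ∈ Q := ringEquiv_maximalIdeal hπ hϖ τB hc1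
    have hc3 : τ • c' = c' := Subtype.ext (τ.commutes (c : K))
    rw [Ideal.Quotient.eq]
    rw [smul_sub, hc3] at hc2
    have := Q.sub_mem hc2 hc1
    rwa [sub_sub_sub_cancel_right] at this
  obtain ⟨g', hg'⟩ := exists_smul_eq_of_profinite (G := G') Q T hT
  have hkey : ∀ b : B, (g' : GalK K) • b - τ • b ∈ Q := by
    intro b
    exact Ideal.Quotient.eq.1 (hg' b)
  refine ⟨τ * (g' : GalK K)⁻¹, ?_, ?_⟩
  · change ∀ x : B, (τ * (g' : GalK K)⁻¹) • x - x ∈ Q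
    intro x
    have := hkey ((g' : GalK K)⁻¹ • x)
    rw [smul_inv_smul] at this
    rw [mul_smul, ← neg_mem_iff, neg_sub]
    exact this
  · apply Units.ext
    rw [← residue_eq_kummer hπ hϖ _ (a := teich p K l), residue_teich]
    have h1 : (g' : GalK K)⁻¹ ∈ G' := G'.inv_mem g'.2
    have h2 : (g' : GalK K)⁻¹ ϖ = ϖ :=
      (IntermediateField.mem_fixingSubgroup_iff _ _).1 h1 ϖ
        (IntermediateField.mem_adjoin_simple_self K ϖ)
    rw [AlgEquiv.mul_apply, h2, hτ]

end

end Kummer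

section Exponents

variable {p : ℕ} [Fact p.Prime]
variable {K : Type*} [Field K] [Algebra ℚ_[p] K] [FiniteDimensional ℚ_[p] K]
  [Algebra ℤ_[p] K] [IsScalarTower ℤ_[p] ℚ_[p] K]
variable {f : ℕ} [NeZero f] {ϖ : AlgebraicClosure K} {π : OK p K}

/-- The fundamental character `ω_{f-1}` of level `f`, as a character of `G_K`. -/
noncomputable def fundChar (hπ : Irreducible π)
    (hϖ : ϖ ^ (p ^ resF p K - 1) = algebraMap K (AlgebraicClosure K) (π : K))
    (σ : ResK p K →+* Fbar p) : GalK K →* (Fbar p)ˣ :=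
  (Units.map (σ : ResK p K →* Fbar p)).comp (kummer hπ hϖ)

/-- `χ|_{I_K} = ω_{f-1}^n`. -/
def HasExp (hπ : Irreducible π)
    (hϖ : ϖ ^ (p ^ resF p K - 1) = algebraMap K (AlgebraicClosure K) (π : K))
    (σ : ResK p K →+* Fbar p) (χ : GalChar p K) (n : ℤ) : Prop :=
  ∀ g ∈ inertia p K, χ.toHom g = fundChar hπ hϖ σ g ^ n

variable (hπ : Irreducible π)
  (hϖ : ϖ ^ (p ^ resF p K - 1) = algebraMap K (AlgebraicClosure K) (π : K))
  (σ : ResK p K →+* Fbar p)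

include hπ hϖ

theorem omega_eq (i : ZMod f) (g : GalK K) :
    omega p K σ ϖ i g = (fundChar hπ hϖ σ g : Fbar p) ^ p ^ (f - 1 - i.val) := by
  have h : ∃ a : OK p K, g ϖ = algebraMap K (AlgebraicClosure K) a * ϖ :=
    ⟨_, kummer_spec hπ hϖ g⟩
  unfold omega
  rw [dif_pos h, residue_eq_kummer hπ hϖ g h.choose_spec]
  simp [emb, fundChar, iterateFrobenius_def]

theorem omega_zpow (i : ZMod f) (g : GalK K) (n : ℤ) :
    omega p K σ ϖ i g ^ n =
      ((fundChar hπ hϖ σ g ^ ((p : ℤ) ^ (f - 1 - i.val) * n) : (Fbar p)ˣ) : Fbar p) := by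
  rw [omega_eq hπ hϖ, Units.val_zpow_eq_zpow_val, zpow_mul, ← zpow_natCast]
  push_cast
  rfl

theorem prod_omega_zpow (a : ZMod f → ℤ) (g : GalK K) :
    ∏ i, omega p K σ ϖ i g ^ a i =
      ((fundChar hπ hϖ σ g ^ detExp p a : (Fbar p)ˣ) : Fbar p) := by
  simp only [omega_zpow hπ hϖ]
  rw [← Units.coe_prod]
  congr 1
  unfold detExp
  classical
  induction (Finset.univ : Finset (ZMod f)) using Finset.induction_on with
  | empty => simp
  | insert a s ha ih => rw [Finset.prod_insert ha, Finset.sum_insert ha, ih, zpow_add]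

theorem eqOnInertia_iff (χ : GalChar p K) (a : ZMod f → ℤ) :
    EqOnInertia p K σ ϖ χ a ↔ HasExp hπ hϖ σ χ (detExp p a) := by
  unfold EqOnInertia HasExp
  refine forall₂_congr fun g _ => ?_
  rw [prod_omega_zpow hπ hϖ, Units.val_inj]

theorem fundChar_zpow_eq_iff (m n : ℤ) :
    (∀ g ∈ inertia p K, fundChar hπ hϖ σ g ^ m = fundChar hπ hϖ σ g ^ n) ↔
      m ≡ n [ZMOD (p : ℤ) ^ resF p K - 1] := by
  have h2 := two_le_card_resK p K
  have hcard : Nat.card (ResK p K)ˣ = p ^ resF p K - 1 := by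
    rw [Nat.card_units, card_resK]
  have hc : ((p ^ resF p K - 1 : ℕ) : ℤ) = (p : ℤ) ^ resF p K - 1 := by
    push_cast [Nat.cast_sub (show 1 ≤ p ^ resF p K by omega)]
    rfl
  have hinj : Function.Injective (Units.map (σ : ResK p K →* Fbar p)) :=
    Units.map_injective σ.injective
  constructor
  · intro h
    obtain ⟨l, hl⟩ := IsCyclic.exists_generator (α := (ResK p K)ˣ)
    obtain ⟨g, hg, rfl⟩ := exists_inertia_kummer hπ hϖ l
    have := h g hg
    simp only [fundChar, MonoidHom.comp_apply] at this
    rw [← map_zpow (Units.map (σ : ResK p K →* Fbar p)),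
      ← map_zpow (Units.map (σ : ResK p K →* Fbar p))] at this
    have := zpow_eq_zpow_iff_modEq.1 (hinj this)
    rwa [orderOf_eq_card_of_forall_mem_zpowers hl, hcard, hc] at this
  · intro h g _
    simp only [fundChar, MonoidHom.comp_apply]
    rw [← map_zpow (Units.map (σ : ResK p K →* Fbar p)),
      ← map_zpow (Units.map (σ : ResK p K →* Fbar p)), zpow_eq_zpow_iff_modEq.2]
    refine h.of_dvd ?_
    rw [← hc, ← hcard]
    exact_mod_cast orderOf_dvd_natCard _

variable {σ} in
theorem HasExp.iff {χ : GalChar p K} {m n : ℤ} (hm : HasExp hπ hϖ σ χ m) :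
    HasExp hπ hϖ σ χ n ↔ m ≡ n [ZMOD (p : ℤ) ^ resF p K - 1] := by
  rw [← fundChar_zpow_eq_iff hπ hϖ σ]
  exact forall₂_congr fun g hg => by rw [hm g hg]

theorem exists_hasExp (n : ℤ) : ∃ χ : GalChar p K, HasExp hπ hϖ σ χ n := by
  refine ⟨⟨(zpowGroupHom n).comp (fundChar hπ hϖ σ), ?_⟩, fun g _ => rfl⟩
  refine Subgroup.isOpen_mono (H₁ := (kummer hπ hϖ).ker) ?_ (isOpen_ker_kummer hπ hϖ)
  intro g hg
  rw [MonoidHom.mem_ker] at hg ⊢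
  simp [fundChar, hg]

theorem restrict_eq_iff {χ χ' : GalChar p K} {m m' : ℤ} (hm : HasExp hπ hϖ σ χ m)
    (hm' : HasExp hπ hϖ σ χ' m') :
    χ.toHom.comp (inertia p K).subtype = χ'.toHom.comp (inertia p K).subtype ↔
      m ≡ m' [ZMOD (p : ℤ) ^ resF p K - 1] := by
  rw [← fundChar_zpow_eq_iff hπ hϖ σ, MonoidHom.ext_iff]
  constructor
  · intro h g hg
    rw [← hm g hg, ← hm' g hg]
    exact h ⟨g, hg⟩
  · rintro h ⟨g, hg⟩
    change χ.toHom g = χ'.toHom g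
    rw [hm g hg, hm' g hg, h g hg]

variable {σ} in
theorem forall_eq_mul_zpow_iff {χ₁ χ₂ : GalChar p K} {n₁ n₂ : ℤ} (h₁ : HasExp hπ hϖ σ χ₁ n₁)
    (h₂ : HasExp hπ hϖ σ χ₂ n₂) (a : ℤ) :
    (∀ g ∈ inertia p K, (χ₁.toHom g : Fbar p) =
      χ₂.toHom g * ((fundChar hπ hϖ σ g ^ a : (Fbar p)ˣ) : Fbar p)) ↔
      n₁ ≡ n₂ + a [ZMOD (p : ℤ) ^ resF p K - 1] := by
  rw [← fundChar_zpow_eq_iff hπ hϖ σ]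
  refine forall₂_congr fun g hg => ?_
  rw [h₁ g hg, h₂ g hg, zpow_add, ← Units.val_mul, Units.val_inj]

variable {σ} in
theorem isTameSignature_iff {χ₁ χ₂ : GalChar p K} {n₁ n₂ : ℤ} (h₁ : HasExp hπ hϖ σ χ₁ n₁)
    (h₂ : HasExp hπ hϖ σ χ₂ n₂) (a : ZMod f → ℤ) :
    IsTameSignature p K σ ϖ χ₁ χ₂ a ↔ (∀ i, 1 ≤ a i ∧ a i ≤ p) ∧ (∃ i, a i ≠ p) ∧
      n₁ ≡ n₂ + detExp p a [ZMOD (p : ℤ) ^ resF p K - 1] := by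
  unfold IsTameSignature
  rw [← forall_eq_mul_zpow_iff hπ hϖ h₁ h₂]
  simp only [prod_omega_zpow hπ hϖ]

variable {σ} in
theorem isTameExponent_iff {χ₁ χ₂ : GalChar p K} {n₁ n₂ : ℤ} (h₁ : HasExp hπ hϖ σ χ₁ n₁)
    (h₂ : HasExp hπ hϖ σ χ₂ n₂) (n : ZMod f → ℤ) :
    IsTameExponent p K σ ϖ χ₁ χ₂ n ↔ ∀ i, 0 ≤ n i ∧ n i < (p : ℤ) ^ f - 1 ∧
      n₁ ≡ n₂ + (p : ℤ) ^ (f - 1 - i.val) * n i [ZMOD (p : ℤ) ^ resF p K - 1] := by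
  unfold IsTameExponent
  simp only [← forall_eq_mul_zpow_iff hπ hϖ h₁ h₂, omega_zpow hπ hϖ]

end Exponents

section Digits

variable {f : ℕ} [NeZero f]

theorem pow_sub_one_pos {p : ℕ} (hp : 1 < p) : (0 : ℤ) < (p : ℤ) ^ f - 1 := by
  have : (1 : ℤ) < (p : ℤ) ^ f := one_lt_pow₀ (by exact_mod_cast hp) (NeZero.ne f)
  omega

theorem detExp_const (p : ℕ) (x : ℤ) :
    ((p : ℤ) - 1) * detExp p (fun _ : ZMod f => x) = ((p : ℤ) ^ f - 1) * x := by
  have := mul_shiftSum p (fun _ : ZMod f => x) (-1)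
  have e : shiftSum p (fun _ : ZMod f => x) (-1 + 1) = shiftSum p (fun _ : ZMod f => x) (-1) := rfl
  rw [e, shiftSum_neg_one] at this
  linarith

theorem digits_unique {p : ℕ} (hp : 1 < p) {b : ℤ} {m m' : ZMod f → ℤ}
    (hm : ∀ i, b ≤ m i ∧ m i ≤ b + p - 1) (hm1 : ∃ i, m i ≠ b + p - 1)
    (hm' : ∀ i, b ≤ m' i ∧ m' i ≤ b + p - 1) (hm1' : ∃ i, m' i ≠ b + p - 1)
    (h : detExp p m ≡ detExp p m' [ZMOD (p : ℤ) ^ f - 1]) : m = m' := by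
  have key : ∀ m m' : ZMod f → ℤ, (∀ i, b ≤ m i ∧ m i ≤ b + p - 1) → (∃ i, m i ≠ b + p - 1) →
      (∀ i, b ≤ m' i ∧ m' i ≤ b + p - 1) → ∀ c : ZMod f → ℤ,
      (∀ j, (p : ℤ) * c (j - 1) = c j + (m - m') j) → ∀ j, c j ≤ 0 := by
    intro m m' hm hm1 hm' c hc
    by_contra! hpos
    obtain ⟨j, hj⟩ := hpos
    have hle : ∀ i, c i ≤ 1 := fun i => by
      have h1 := carry_le hc (A := p - 1) (fun j => by
        have := hm j
        have := hm' j
        simp only [Pi.sub_apply]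
        linarith) hp.le i
      have h2 : (0 : ℤ) < (p : ℤ) - 1 := by
        have : (1 : ℤ) < p := by exact_mod_cast hp
        linarith
      by_contra hcon
      have := mul_le_mul_of_nonneg_left (show (2 : ℤ) ≤ c i by omega) h2.le
      linarith
    have hall := forall_of_step_up (Q := fun i => 1 ≤ c i) j (by omega) (fun i hi => by
      have h1 := hc (i + 1)
      rw [add_sub_cancel_right] at h1
      have h2 := hm (i + 1)
      have h3 := hm' (i + 1)
      simp only [Pi.sub_apply] at h1
      have h4 := hle i
      have h5 : c i = 1 := by omega
      rw [h5] at h1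
      linarith)
    obtain ⟨i, hi⟩ := hm1
    apply hi
    have h1 := hc i
    have h2 := hall i
    have h3 := hall (i - 1)
    have h4 := hle i
    have h5 := hle (i - 1)
    have h6 := hm i
    have h7 := hm' i
    rw [show c (i - 1) = 1 by omega] at h1
    simp only [Pi.sub_apply] at h1
    linarith
  have h' := h.symm.dvd
  rw [← detExp_sub] at h'
  obtain ⟨c, hc⟩ := exists_carry hp h'
  have h1 := key m m' hm hm1 hm' c hc
  have h2 := key m' m hm' hm1' hm (-c) (fun j => by
    have := hc j
    simp only [Pi.sub_apply, Pi.neg_apply] at this ⊢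
    linarith)
  have hz : ∀ j, c j = 0 := fun j => by
    have := h1 j
    have := h2 j
    simp only [Pi.neg_apply] at this
    omega
  ext j
  have := hc j
  rw [hz, hz] at this
  simp only [Pi.sub_apply] at this
  linarith

theorem sum_digits (p N n : ℕ) :
    ∑ l ∈ Finset.range n, N / p ^ l % p * p ^ l = N % p ^ n := by
  induction n with
  | zero => simp [Nat.mod_one]
  | succ n ih =>
    rw [Finset.sum_range_succ, ih, Nat.mod_pow_succ, mul_comm (p ^ n)]

theorem exists_digits {p : ℕ} (hp : 1 < p) (b N : ℤ) :
    ∃ m : ZMod f → ℤ, (∀ i, b ≤ m i ∧ m i ≤ b + p - 1) ∧ (∃ i, m i ≠ b + p - 1) ∧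
      N ≡ detExp p m [ZMOD (p : ℤ) ^ f - 1] := by
  have hq := pow_sub_one_pos (f := f) hp
  set M := N - detExp p (fun _ : ZMod f => b) with hM
  obtain ⟨n, hn⟩ := Int.eq_ofNat_of_zero_le (Int.emod_nonneg M hq.ne')
  have hlt : (n : ℤ) < (p : ℤ) ^ f - 1 := hn ▸ Int.emod_lt_of_pos M hq
  have hp0 : 0 < p := by omega
  let m : ZMod f → ℤ := fun i => ((n / p ^ (f - 1 - i.val) % p : ℕ) : ℤ)
  have hme : detExp p m = n := by
    have h1 : n % p ^ f = n := Nat.mod_eq_of_lt (by zify; linarith)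
    unfold detExp
    rw [ZMod.sum_eq_sum_range, ← Finset.sum_range_reflect, ← h1, ← sum_digits p n f, Nat.cast_sum]
    refine Finset.sum_congr rfl fun l hl => ?_
    have hl' := Finset.mem_range.1 hl
    simp only [m]
    rw [ZMod.val_cast_of_lt (by omega), show f - 1 - (f - 1 - l) = l by omega]
    push_cast
    ring
  have hbnd : ∀ i, m i < p := fun i => by
    simp only [m]
    exact_mod_cast Nat.mod_lt _ hp0
  refine ⟨fun i => b + m i, fun i => ⟨?_, ?_⟩, ?_, ?_⟩
  · have : (0 : ℤ) ≤ m i := Int.natCast_nonneg _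
    linarith
  · have := hbnd i
    linarith
  · by_contra! hall
    have h1 : m = fun _ => (p : ℤ) - 1 := by
      ext i
      have := hall i
      linarith
    have h2 := detExp_const (f := f) p ((p : ℤ) - 1)
    rw [← h1, hme] at h2
    have h3 : (0 : ℤ) < (p : ℤ) - 1 := by
      have : (1 : ℤ) < p := by exact_mod_cast hp
      linarith
    have h4 : (n : ℤ) = (p : ℤ) ^ f - 1 := mul_left_cancel₀ h3.ne' (by linarith)
    omega
  · have h1 : detExp p (fun i => b + m i) = detExp p (fun _ : ZMod f => b) + detExp p m :=
      detExp_add p (fun _ : ZMod f => b) m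
    rw [h1, hme, ← hn]
    have : M % ((p : ℤ) ^ f - 1) ≡ M [ZMOD (p : ℤ) ^ f - 1] := Int.mod_modEq _ _
    have := (this.symm.add_left (detExp p fun _ : ZMod f => b))
    rwa [hM, add_sub_cancel] at this

theorem mul_shiftSum_modEq (p : ℕ) (a : ZMod f → ℤ) (i : ZMod f) :
    (p : ℤ) * shiftSum p a i ≡ shiftSum p a (i + 1) [ZMOD (p : ℤ) ^ f - 1] := by
  rw [mul_shiftSum]
  exact (Int.modEq_iff_dvd.2 ⟨-a (i + 1), by ring⟩)

theorem pow_mul_shiftSum_modEq (p : ℕ) (a : ZMod f → ℤ) (i : ZMod f) (k : ℕ) :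
    (p : ℤ) ^ k * shiftSum p a i ≡ shiftSum p a (i + k) [ZMOD (p : ℤ) ^ f - 1] := by
  induction k with
  | zero => simp [Int.ModEq.refl]
  | succ k ih =>
    have h1 := (ih.mul_left (p : ℤ)).trans (mul_shiftSum_modEq p a (i + k))
    rw [pow_succ', mul_assoc]
    push_cast
    rwa [← add_assoc]

theorem isCoprime_pow_sub_one (p k : ℕ) : IsCoprime ((p : ℤ) ^ k) ((p : ℤ) ^ f - 1) := by
  apply IsCoprime.pow_left
  obtain ⟨n, hn⟩ := Nat.exists_eq_succ_of_ne_zero (NeZero.ne f)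
  exact ⟨(p : ℤ) ^ n, -1, by rw [hn, pow_succ]; ring⟩

theorem modEq_of_pow_mul {p k : ℕ} {a b : ℤ}
    (h : (p : ℤ) ^ k * a ≡ (p : ℤ) ^ k * b [ZMOD (p : ℤ) ^ f - 1]) :
    a ≡ b [ZMOD (p : ℤ) ^ f - 1] := by
  have h1 := h.dvd
  rw [← mul_sub] at h1
  exact Int.modEq_iff_dvd.2 ((isCoprime_pow_sub_one p k).symm.dvd_of_dvd_mul_left h1)

theorem add_cast_sub_val (i : ZMod f) : i + ((f - 1 - i.val : ℕ) : ZMod f) = -1 := by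
  have h1 := ZMod.val_lt i
  have h2 : ((i.val + (f - 1 - i.val) + 1 : ℕ) : ZMod f) = 0 := by
    rw [show i.val + (f - 1 - i.val) + 1 = f by omega, ZMod.natCast_self]
  push_cast at h2
  rw [ZMod.natCast_zmod_val] at h2
  linear_combination h2

/-- The numbers `n_i` and the tuples `a` describing the same character. -/
theorem modEq_shiftSum {p : ℕ} {a : ZMod f → ℤ} {i : ZMod f} {x : ℤ}
    (h : (p : ℤ) ^ (f - 1 - i.val) * x ≡ detExp p a [ZMOD (p : ℤ) ^ f - 1]) :
    x ≡ shiftSum p a i [ZMOD (p : ℤ) ^ f - 1] := by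
  apply modEq_of_pow_mul (k := f - 1 - i.val)
  refine h.trans ?_
  have := (pow_mul_shiftSum_modEq p a i (f - 1 - i.val)).symm
  rwa [add_cast_sub_val, shiftSum_neg_one] at this

theorem shiftSum_shift (p : ℕ) (a : ZMod f → ℤ) (i k : ZMod f) :
    shiftSum p (fun j => a (j + k)) i = shiftSum p a (i + k) := by
  unfold shiftSum
  refine Finset.sum_congr rfl fun l _ => ?_
  beta_reduce
  rw [show i + l + 1 + k = i + k + l + 1 by ring]

omit [NeZero f] in
theorem iterate_shift (a : ZMod f → ℤ) (k : ℕ) :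
    (fun (b : ZMod f → ℤ) (i : ZMod f) => b (i + 1))^[k] a = fun i => a (i + k) := by
  induction k with
  | zero => simp
  | succ k ih =>
    rw [Function.iterate_succ_apply', ih]
    ext i
    push_cast
    congr 1
    ring

theorem isPeriodicPt_shift (a : ZMod f → ℤ) :
    Function.IsPeriodicPt (fun (b : ZMod f → ℤ) (i : ZMod f) => b (i + 1)) f a := by
  unfold Function.IsPeriodicPt Function.IsFixedPt
  rw [iterate_shift]
  simp

theorem orbitSize_dvd (a : ZMod f → ℤ) : orbitSize a ∣ f :=
  (isPeriodicPt_shift a).minimalPeriod_dvd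

theorem orbitSize_pos (a : ZMod f → ℤ) : 0 < orbitSize a :=
  (isPeriodicPt_shift a).minimalPeriod_pos (Nat.pos_of_ne_zero (NeZero.ne f))

theorem apply_add_orbitSize (a : ZMod f → ℤ) (κ : ℕ) (i : ZMod f) :
    a (i + ((κ * orbitSize a : ℕ) : ZMod f)) = a i := by
  have h := (Function.isPeriodicPt_minimalPeriod
    (fun (b : ZMod f → ℤ) (i : ZMod f) => b (i + 1)) a).const_mul κ
  unfold Function.IsPeriodicPt Function.IsFixedPt at h
  rw [iterate_shift] at h
  exact congrFun h i

theorem eq_of_shift_eq {a : ZMod f → ℤ} {k l : ℕ} (hk : k < orbitSize a) (hl : l < orbitSize a)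
    (h : ∀ i, a (i + k) = a (i + l)) : k = l := by
  refine Function.iterate_injOn_Iio_minimalPeriod hk hl ?_
  simp only [iterate_shift]
  ext i
  exact h i

end Digits

section Count

variable {f : ℕ} [NeZero f]

/-- The integer `ξ_i - u (p^f - 1)`. -/
def xiSub (p : ℕ) (z y : ZMod f → ℤ) (i : ZMod f) (u : ℤ) : ℤ :=
  ((p : ℤ) ^ f - 1) * (z i - u) + shiftSum p (z - y) i

theorem mul_xiSub (p : ℕ) (z y : ZMod f → ℤ) (i : ZMod f) (u : ℤ) :
    (p : ℤ) * xiSub p z y i u = xiSub p z y (i + 1) (y (i + 1) - p * (z i - u)) := by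
  unfold xiSub
  rw [mul_add, mul_shiftSum]
  simp only [Pi.sub_apply]
  ring

theorem xiSub_injective {p : ℕ} (hp : 1 < p) {z y : ZMod f → ℤ} {i : ZMod f} {u u' : ℤ}
    (h : xiSub p z y i u = xiSub p z y i u') : u = u' := by
  have hq := pow_sub_one_pos (f := f) hp
  unfold xiSub at h
  have := mul_left_cancel₀ hq.ne' (add_right_cancel h)
  linarith

theorem exists_pow_mul_xiSub {p : ℕ} {z y : ZMod f → ℤ} (hz : ∀ j, 0 ≤ z j)
    (hy : ∀ j, y j ≤ p - 1) {i : ZMod f} {u : ℤ} (hu : u < z i) (k : ℕ) :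
    ∃ u', (p : ℤ) ^ k * xiSub p z y i u = xiSub p z y (i + k) u' ∧ u' < z (i + k) ∧
      (k ≠ 0 → u' < 0) := by
  induction k with
  | zero => exact ⟨u, by simp, by simpa using hu, fun h => absurd rfl h⟩
  | succ k ih =>
    obtain ⟨u', h1, h2, -⟩ := ih
    have e : i + ((k + 1 : ℕ) : ZMod f) = i + k + 1 := by push_cast; ring
    have hneg : y (i + k + 1) - p * (z (i + k) - u') < 0 := by
      have := hy (i + k + 1)
      have h3 : (p : ℤ) * 1 ≤ p * (z (i + k) - u') :=
        mul_le_mul_of_nonneg_left (by omega) (by positivity)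
      linarith
    refine ⟨y (i + k + 1) - p * (z (i + k) - u'), ?_, ?_, fun _ => hneg⟩
    · rw [pow_succ', mul_assoc, h1, mul_xiSub, e]
    · rw [e]
      exact hneg.trans_le (hz _)

theorem xiSub_ne_zero {p : ℕ} (hp : 1 < p) {z y : ZMod f → ℤ} (hz : ∀ j, 0 ≤ z j)
    (hy : ∀ j, y j ≤ p - 1) {i : ZMod f} {u : ℤ} (hu : u < z i) (hu0 : 0 ≤ u) :
    xiSub p z y i u ≠ 0 := by
  intro h
  obtain ⟨u', h1, -, h3⟩ := exists_pow_mul_xiSub hz hy hu f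
  rw [h, mul_zero, ZMod.natCast_self, add_zero, ← h] at h1
  have := xiSub_injective hp h1
  have := h3 (NeZero.ne f)
  omega

theorem eq_of_pow_mul_xiSub {p : ℕ} (hp : 1 < p) {z y : ZMod f → ℤ} (hz : ∀ j, 0 ≤ z j)
    (hy : ∀ j, y j ≤ p - 1) {i : ZMod f} {u u' : ℤ} (hu : u < z i) (hu0 : 0 ≤ u') {k : ℕ}
    (h : (p : ℤ) ^ k * xiSub p z y i u = xiSub p z y (i + k) u') : k = 0 ∧ u = u' := by
  obtain ⟨v, h1, -, h3⟩ := exists_pow_mul_xiSub hz hy hu k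
  have h4 := xiSub_injective hp (h1.symm.trans h)
  by_cases hk : k = 0
  · subst hk
    refine ⟨rfl, ?_⟩
    simp only [pow_zero, one_mul, Nat.cast_zero, add_zero] at h
    exact xiSub_injective hp h
  · have := h3 hk
    omega

end Count

section JSet

variable {p : ℕ} [Fact p.Prime]
variable {K : Type*} [Field K] [Algebra ℚ_[p] K] [FiniteDimensional ℚ_[p] K]
  [Algebra ℤ_[p] K] [IsScalarTower ℤ_[p] ℚ_[p] K]
variable {f : ℕ} [NeZero f] {ϖ : AlgebraicClosure K} {π : OK p K}
variable (hf : f = resF p K) (hπ : Irreducible π)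
  (hϖ : ϖ ^ (p ^ resF p K - 1) = algebraMap K (AlgebraicClosure K) (π : K))
  {σ : ResK p K →+* Fbar p} {χ₁ χ₂ : GalChar p K} {N₁ N₂ : ℤ} {t : ZMod f → ℤ} {s : ZMod f → ℕ}

theorem xi_sub (y : ZMod f → ℤ) (i : ZMod f) (u : ℤ) :
    xi p K s y i - u * ((p : ℤ) ^ f - 1) = xiSub p (zOf p K s y) y i u := by
  unfold xi xiSub shiftSum
  simp only [Pi.sub_apply]
  ring

/-- The possible range of the entries of the elements of `𝒮`. -/
def InRange (p : ℕ) [Fact p.Prime] (K : Type*) [Field K] [Algebra ℚ_[p] K]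
    [FiniteDimensional ℚ_[p] K] [Algebra ℤ_[p] K] [IsScalarTower ℤ_[p] ℚ_[p] K]
    (s : ZMod f → ℕ) (y : ZMod f → ℤ) : Prop :=
  ∀ i, (0 ≤ y i ∧ y i ≤ (ramE p K : ℤ) - 1) ∨
    ((s i : ℤ) + 1 ≤ y i ∧ y i ≤ (s i : ℤ) + ramE p K)

include hπ hϖ

theorem mem_SSet_iff (h₂ : HasExp hπ hϖ σ χ₂ N₂) (y : ZMod f → ℤ) :
    y ∈ SSet p K σ ϖ t s χ₂ ↔
      N₂ ≡ detExp p t + detExp p y [ZMOD (p : ℤ) ^ resF p K - 1] ∧ InRange p K s y := by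
  unfold SSet InRange
  rw [Set.mem_setOf_eq, eqOnInertia_iff hπ hϖ, h₂.iff]
  change _ ≡ detExp p (t + y) [ZMOD _] ∧ _ ↔ _
  rw [detExp_add]

include hf

theorem isY_unique (h₂ : HasExp hπ hϖ σ χ₂ N₂) {y y' : ZMod f → ℤ}
    (hy : IsY p K σ ϖ t s χ₂ y) (hy' : IsY p K σ ϖ t s χ₂ y') : y = y' := by
  have hp := (Fact.out : p.Prime).one_lt
  obtain ⟨m, A, ⟨h1, h2, h3⟩, hA, rfl⟩ := hy
  obtain ⟨m', A', ⟨h1', h2', h3'⟩, hA', rfl⟩ := hy'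
  rw [eqOnInertia_iff hπ hϖ, h₂.iff] at h3 h3'
  have h4 := h3.symm.trans h3'
  change detExp p (t + m) ≡ detExp p (t + m') [ZMOD _] at h4
  rw [detExp_add, detExp_add, ← hf] at h4
  obtain rfl := digits_unique (b := 0) hp (by simpa using h1) (by simpa using h2)
    (by simpa using h1') (by simpa using h2') (Int.ModEq.add_left_cancel' _ h4)
  rw [hA.unique hA']

omit hf in
theorem IsY.modEq (h₂ : HasExp hπ hϖ σ χ₂ N₂) {y : ZMod f → ℤ}
    (hy : IsY p K σ ϖ t s χ₂ y) :
    N₂ ≡ detExp p t + detExp p y [ZMOD (p : ℤ) ^ resF p K - 1] ∧ InRange p K s y := by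
  obtain ⟨m, A, -, hA, rfl⟩ := hy
  exact (mem_SSet_iff hπ hϖ h₂ _).1 hA.1

omit hf in
theorem isY_of_small (h₂ : HasExp hπ hϖ σ χ₂ N₂) {y : ZMod f → ℤ}
    (h : N₂ ≡ detExp p t + detExp p y [ZMOD (p : ℤ) ^ resF p K - 1]) (hr : InRange p K s y)
    (h0 : ∀ i, 0 ≤ y i ∧ y i ≤ (p : ℤ) - 1) (h1 : ∃ i, y i ≠ (p : ℤ) - 1) :
    IsY p K σ ϖ t s χ₂ y := by
  refine ⟨y, ∅, ⟨h0, h1, ?_⟩, ⟨?_, fun B _ => Finset.empty_subset B⟩, by simp⟩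
  · rw [eqOnInertia_iff hπ hϖ, h₂.iff]
    change _ ≡ detExp p (t + y) [ZMOD _]
    rwa [detExp_add]
  · rw [Set.mem_setOf_eq, Finset.sum_empty, add_zero, mem_SSet_iff hπ hϖ h₂]
    exact ⟨h, hr⟩

theorem isTameSignature_unique (h₁ : HasExp hπ hϖ σ χ₁ N₁) (h₂ : HasExp hπ hϖ σ χ₂ N₂)
    {a a' : ZMod f → ℤ} (ha : IsTameSignature p K σ ϖ χ₁ χ₂ a)
    (ha' : IsTameSignature p K σ ϖ χ₁ χ₂ a') : a = a' := by
  rw [isTameSignature_iff hπ hϖ h₁ h₂] at ha ha'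
  obtain ⟨h1, h2, h3⟩ := ha
  obtain ⟨h1', h2', h3'⟩ := ha'
  have h4 := h3.symm.trans h3'
  rw [← hf] at h4
  exact digits_unique (b := 1) (Fact.out : p.Prime).one_lt (by simpa using h1) (by simpa using h2)
    (by simpa using h1') (by simpa using h2') (Int.ModEq.add_left_cancel' _ h4)

omit hπ hϖ hf in
theorem interval_finite (y : ZMod f → ℤ) (i : ZMod f) : (interval p K s y i).Finite := by
  unfold interval
  split_ifs
  · exact Set.finite_Icc _ _
  · exact (Set.finite_singleton _).union (Set.finite_Icc _ _)

omit hπ hϖ hf in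
theorem ncard_interval {y : ZMod f → ℤ} (hy : InRange p K s y) (i : ZMod f) :
    ((interval_finite (p := p) (K := K) (s := s) y i).toFinset.card : ℤ) =
      if (s i : ℤ) + 1 ≤ y i then (s i : ℤ) + ramE p K - y i else (ramE p K : ℤ) - y i := by
  rw [← Set.ncard_eq_toFinset_card _ (interval_finite y i)]
  have h := hy i
  unfold interval zOf
  split_ifs with hi
  · rw [← Finset.coe_Icc, Set.ncard_coe_finset, Int.card_Icc]
    omega
  · rw [Set.singleton_union, Set.ncard_insert_of_notMem (by simp; omega) (Set.finite_Icc _ _),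
      ← Finset.coe_Icc, Set.ncard_coe_finset, Int.card_Icc]
    omega

omit hπ hϖ hf in
theorem bounds_of_mem_interval {y : ZMod f → ℤ} (hy : InRange p K s y) {i : ZMod f} {u : ℤ}
    (hu : u ∈ interval p K s y i) : 0 ≤ u ∧ u < zOf p K s y i := by
  have h := hy i
  unfold interval zOf at *
  split_ifs at hu with hi
  · rw [Set.mem_Icc] at hu
    omega
  · simp only [Set.singleton_union, Set.mem_insert_iff, Set.mem_Icc] at hu
    omega

/-- The pairs `(i, u)` with `u ∈ 𝓘_i`. -/
noncomputable def pairs (p : ℕ) [Fact p.Prime] (K : Type*) [Field K] [Algebra ℚ_[p] K]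
    [FiniteDimensional ℚ_[p] K] [Algebra ℤ_[p] K] [IsScalarTower ℤ_[p] ℚ_[p] K]
    (s : ZMod f → ℕ) (y : ZMod f → ℤ) : Finset (Σ _ : ZMod f, ℤ) :=
  Finset.univ.sigma fun i => (interval_finite (p := p) (K := K) (s := s) y i).toFinset

omit hπ hϖ hf in
theorem mem_pairs {y : ZMod f → ℤ} {x : Σ _ : ZMod f, ℤ} :
    x ∈ pairs p K s y ↔ x.2 ∈ interval p K s y x.1 := by
  simp [pairs]

theorem encard_JAH_le (h₁ : HasExp hπ hϖ σ χ₁ N₁) (h₂ : HasExp hπ hϖ σ χ₂ N₂) {y : ZMod f → ℤ}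
    (hy : IsY p K σ ϖ t s χ₂ y) :
    (JAH p K σ ϖ t s χ₁ χ₂).encard ≤ (pairs p K s y).card := by
  have hp0 : Prime (p : ℤ) := Nat.prime_iff_prime_int.1 Fact.out
  rw [← Set.encard_coe_eq_coe_finsetCard]
  have key : ∀ α ∈ JAH p K σ ϖ t s χ₁ χ₂, ∃ x ∈ pairs p K s y, ∃ a : ZMod f → ℤ,
      IsTameSignature p K σ ϖ χ₁ χ₂ a ∧ ∃ ν im : ℕ,
      xiSub p (zOf p K s y) y x.1 x.2 = (p : ℤ) ^ ν * α.1 ∧ ¬ (p : ℤ) ∣ α.1 ∧ im < orbitSize a ∧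
        im + α.2 * orbitSize a < f ∧
        ((im + α.2 * orbitSize a : ℕ) : ZMod f) = x.1 - (ν : ZMod f) := by
    rintro α ⟨y', a, n, hy', ha, -, hα, i, u, hu, ν, h1, h2, im, him, -, h3⟩
    obtain rfl := isY_unique hf hπ hϖ h₂ hy hy'
    refine ⟨⟨i, u⟩, mem_pairs.2 hu, a, ha, ν, im, by rw [← h1, xi_sub], h2, him, ?_, h3⟩
    calc im + α.2 * orbitSize a < orbitSize a + α.2 * orbitSize a := by omega
      _ = (α.2 + 1) * orbitSize a := by ring
      _ ≤ f / orbitSize a * orbitSize a := Nat.mul_le_mul_right _ hα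
      _ ≤ f := Nat.div_mul_le_self _ _
  choose! F hF using key
  refine Set.encard_le_encard_of_injOn (f := F) (fun α hα => (hF α hα).1) ?_
  intro α hα β hβ hαβ
  obtain ⟨-, a, ha, ν, im, h1, h2, h3, h4, h5⟩ := hF α hα
  obtain ⟨-, a', ha', ν', im', h1', h2', h3', h4', h5'⟩ := hF β hβ
  obtain rfl := isTameSignature_unique hf hπ hϖ h₁ h₂ ha ha'
  rw [← hαβ] at h1' h5'
  have hm : ν = ν' ∧ α.1 = β.1 := by
    have e := h1.symm.trans h1'
    have hpe : (p : ℤ) ≠ 0 := hp0.ne_zero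
    rcases lt_trichotomy ν ν' with h | h | h
    · exfalso
      apply h2
      obtain ⟨k, rfl⟩ := Nat.exists_eq_add_of_lt h
      rw [pow_succ, pow_add] at e
      have := mul_left_cancel₀ (pow_ne_zero ν hpe) (e.trans (by ring :
        _ = (p : ℤ) ^ ν * (p * ((p : ℤ) ^ k * β.1))))
      exact ⟨_, this⟩
    · subst h
      exact ⟨rfl, mul_left_cancel₀ (pow_ne_zero ν hpe) e⟩
    · exfalso
      apply h2'
      obtain ⟨k, rfl⟩ := Nat.exists_eq_add_of_lt h
      rw [pow_succ, pow_add] at e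
      have := mul_left_cancel₀ (pow_ne_zero ν' hpe) (e.symm.trans (by ring :
        _ = (p : ℤ) ^ ν' * (p * ((p : ℤ) ^ k * α.1))))
      exact ⟨_, this⟩
  obtain ⟨rfl, hm⟩ := hm
  have h6 := h5.trans h5'.symm
  have h7 := congrArg ZMod.val h6
  rw [ZMod.val_cast_of_lt h4, ZMod.val_cast_of_lt h4'] at h7
  refine Prod.ext hm ?_
  have h8 := congrArg (· / orbitSize a) h7
  simp only [Nat.add_mul_div_right _ _ (orbitSize_pos a), Nat.div_eq_of_lt h3,
    Nat.div_eq_of_lt h3', zero_add] at h8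
  exact h8

theorem le_encard_JAH (h₁ : HasExp hπ hϖ σ χ₁ N₁) (h₂ : HasExp hπ hϖ σ χ₂ N₂) {y : ZMod f → ℤ}
    (hy : IsY p K σ ϖ t s χ₂ y) (hyp : ∀ i, y i ≤ (p : ℤ) - 1)
    (hN : N₁ ≡ N₂ + detExp p (zOf p K s y - y) [ZMOD (p : ℤ) ^ resF p K - 1]) :
    (pairs p K s y).card ≤ (JAH p K σ ϖ t s χ₁ χ₂).encard := by
  have hp := (Fact.out : p.Prime).one_lt
  have hp0 : Prime (p : ℤ) := Nat.prime_iff_prime_int.1 Fact.out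
  have hr := (IsY.modEq hπ hϖ h₂ hy).2
  have hz : ∀ j, 0 ≤ zOf p K s y j := fun j => by
    have := hr j
    unfold zOf
    omega
  obtain ⟨a, ha0, ha1, ha2⟩ := exists_digits (f := f) hp 1 (N₁ - N₂)
  simp only [add_sub_cancel_left] at ha0 ha1
  have hNa : N₁ ≡ N₂ + detExp p a [ZMOD (p : ℤ) ^ f - 1] := by
    have := ha2.add_left N₂
    rwa [add_sub_cancel] at this
  have haz : detExp p (zOf p K s y - y) ≡ detExp p a [ZMOD (p : ℤ) ^ f - 1] := by
    rw [← hf] at hN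
    exact Int.ModEq.add_left_cancel' N₂ (hN.symm.trans hNa)
  have ha : IsTameSignature p K σ ϖ χ₁ χ₂ a := by
    rw [isTameSignature_iff hπ hϖ h₁ h₂, ← hf]
    exact ⟨ha0, ha1, hNa⟩
  let n : ZMod f → ℤ := fun i => shiftSum p a i % ((p : ℤ) ^ f - 1)
  have hn : ∀ i, n i ≡ shiftSum p a i [ZMOD (p : ℤ) ^ f - 1] := fun i => Int.mod_modEq _ _
  have hq := pow_sub_one_pos (f := f) hp
  have hnT : IsTameExponent p K σ ϖ χ₁ χ₂ n := by
    rw [isTameExponent_iff hπ hϖ h₁ h₂, ← hf]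
    refine fun i => ⟨Int.emod_nonneg _ hq.ne', Int.emod_lt_of_pos _ hq, hNa.trans ?_⟩
    refine Int.ModEq.add_left _ (((hn i).mul_left _).trans ?_).symm
    have := pow_mul_shiftSum_modEq p a i (f - 1 - i.val)
    rwa [add_cast_sub_val, shiftSum_neg_one] at this
  have hza : ∀ i, shiftSum p (zOf p K s y - y) i ≡ shiftSum p a i [ZMOD (p : ℤ) ^ f - 1] := by
    intro i
    refine modEq_shiftSum (Int.ModEq.trans ?_ haz)
    have := pow_mul_shiftSum_modEq p (zOf p K s y - y) i (f - 1 - i.val)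
    rwa [add_cast_sub_val, shiftSum_neg_one] at this
  have key : ∀ x ∈ pairs p K s y, ∃ α ∈ JAH p K σ ϖ t s χ₁ χ₂, ∃ ν im : ℕ,
      xiSub p (zOf p K s y) y x.1 x.2 = (p : ℤ) ^ ν * α.1 ∧ im < orbitSize a ∧
        α.1 ≡ n (im : ZMod f) [ZMOD (p : ℤ) ^ f - 1] ∧
        ((im + α.2 * orbitSize a : ℕ) : ZMod f) = x.1 - (ν : ZMod f) := by
    rintro ⟨i, u⟩ hx
    have hu := mem_pairs.1 hx
    have hb := bounds_of_mem_interval hr hu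
    have h0 := xiSub_ne_zero hp hz hyp hb.2 hb.1
    obtain ⟨m, hm1, hm2⟩ :=
      (FiniteMultiplicity.of_prime_left hp0 h0).exists_eq_pow_mul_and_not_dvd
    set ν := multiplicity (p : ℤ) (xiSub p (zOf p K s y) y i u) with hν
    set j := i - (ν : ZMod f) with hj
    have hval : j.val % orbitSize a + j.val / orbitSize a * orbitSize a = j.val := by
      rw [mul_comm]
      exact Nat.mod_add_div _ _
    have him : j.val % orbitSize a < orbitSize a := Nat.mod_lt _ (orbitSize_pos a)
    have hcong : m ≡ n ((j.val % orbitSize a : ℕ) : ZMod f) [ZMOD (p : ℤ) ^ f - 1] := by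
      have e1 : (p : ℤ) ^ ν * m ≡ (p : ℤ) ^ ν * shiftSum p a j [ZMOD (p : ℤ) ^ f - 1] := by
        rw [← hm1]
        have e2 : xiSub p (zOf p K s y) y i u ≡ shiftSum p (zOf p K s y - y) i
            [ZMOD (p : ℤ) ^ f - 1] :=
          Int.modEq_iff_dvd.2 ⟨-(zOf p K s y i - u), by unfold xiSub; ring⟩
        refine (e2.trans (hza i)).trans ?_
        have := (pow_mul_shiftSum_modEq p a j ν).symm
        rwa [hj, sub_add_cancel] at this
      refine (modEq_of_pow_mul e1).trans (Int.ModEq.trans ?_ (hn _).symm)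
      have e3 : j = ((j.val % orbitSize a : ℕ) : ZMod f) +
          ((j.val / orbitSize a * orbitSize a : ℕ) : ZMod f) := by
        rw [← Nat.cast_add, hval, ZMod.natCast_zmod_val]
      have e4 : (fun i => a (i + ((j.val / orbitSize a * orbitSize a : ℕ) : ZMod f))) = a :=
        funext (apply_add_orbitSize a _)
      have e5 := shiftSum_shift p a ((j.val % orbitSize a : ℕ) : ZMod f)
        ((j.val / orbitSize a * orbitSize a : ℕ) : ZMod f)
      rw [e4, ← e3] at e5
      rw [e5]
    have hcast : ((j.val % orbitSize a + j.val / orbitSize a * orbitSize a : ℕ) : ZMod f) = j := by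
      rw [hval, ZMod.natCast_zmod_val]
    refine ⟨(m, j.val / orbitSize a), ⟨y, a, n, hy, ha, hnT,
      Nat.div_lt_div_of_lt_of_dvd (orbitSize_dvd a) (ZMod.val_lt j), i, u, hu, ν, ?_, hm2,
      _, him, hcong, hcast⟩, ν, _, hm1, him, hcong, hcast⟩
    rw [xi_sub]
    exact hm1
  rw [← Set.encard_coe_eq_coe_finsetCard]
  choose! F hF using key
  refine Set.encard_le_encard_of_injOn (f := F) (fun x hx => (hF x hx).1) ?_
  have wlog_key : ∀ x ∈ pairs p K s y, ∀ x' ∈ pairs p K s y, F x = F x' → ∀ (ν : ℕ) (k : ℕ)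
      (α : ℤ), xiSub p (zOf p K s y) y x.1 x.2 = (p : ℤ) ^ ν * α →
      xiSub p (zOf p K s y) y x'.1 x'.2 = (p : ℤ) ^ (ν + k) * α →
      x.1 - (ν : ZMod f) = x'.1 - ((ν + k : ℕ) : ZMod f) → x = x' := by
    rintro ⟨i, u⟩ hx ⟨i', u'⟩ hx' hxx ν k α h1 h2 h3
    simp only at h1 h2 h3
    have hb := bounds_of_mem_interval hr (mem_pairs.1 hx)
    have hb' := bounds_of_mem_interval hr (mem_pairs.1 hx')
    obtain rfl : i' = i + (k : ZMod f) := by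
      push_cast at h3
      linear_combination -h3
    obtain ⟨rfl, rfl⟩ := eq_of_pow_mul_xiSub hp hz hyp hb.2 hb'.1 (k := k) (by
      rw [h1, h2]
      ring)
    simp
  intro x hx x' hx' hxx
  obtain ⟨-, ν, im, h1, h3, h4, h5⟩ := hF x hx
  obtain ⟨-, ν', im', h1', h3', h4', h5'⟩ := hF x' hx'
  rw [← hxx] at h1' h4' h5'
  have him : im = im' := by
    have e1 := (((hn _).symm.trans h4.symm).trans h4').trans (hn _)
    have e2 : ∀ k : ZMod f, detExp p (fun j => a (j + (k + 1))) = shiftSum p a k := fun k => by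
      rw [← shiftSum_neg_one, shiftSum_shift, neg_add_cancel_comm_assoc]
    rw [← e2, ← e2] at e1
    have hex : ∀ k : ZMod f, ∃ i, a (i + (k + 1)) ≠ 1 + p - 1 := fun k => by
      obtain ⟨i, hi⟩ := ha1
      exact ⟨i - (k + 1), by simpa using hi⟩
    have e3 := digits_unique (b := 1) hp (fun i => by simpa using ha0 _) (hex _)
      (fun i => by simpa using ha0 _) (hex _) e1
    refine eq_of_shift_eq h3 h3' fun i => ?_
    have := congrFun e3 (i - 1)
    rwa [show i - 1 + ((im : ZMod f) + 1) = i + im by ring,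
      show i - 1 + ((im' : ZMod f) + 1) = i + im' by ring] at this
  subst him
  have h6 := h5.symm.trans h5'
  rcases le_total ν ν' with h | h
  · obtain ⟨k, rfl⟩ := Nat.exists_eq_add_of_le h
    exact wlog_key x hx x' hx' hxx ν k _ h1 h1' h6
  · obtain ⟨k, rfl⟩ := Nat.exists_eq_add_of_le h
    exact (wlog_key x' hx' x hx hxx.symm ν' k _ h1' h1 h6.symm).symm

end JSet

section TypeIClassification

variable {p : ℕ} [Fact p.Prime]
variable {K : Type*} [Field K] [Algebra ℚ_[p] K] [FiniteDimensional ℚ_[p] K]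
  [Algebra ℤ_[p] K] [IsScalarTower ℤ_[p] ℚ_[p] K]
variable {f : ℕ} [NeZero f] {ϖ : AlgebraicClosure K} {π : OK p K}
variable (hf : f = resF p K) (hπ : Irreducible π)
  (hϖ : ϖ ^ (p ^ resF p K - 1) = algebraMap K (AlgebraicClosure K) (π : K))
  {σ : ResK p K →+* Fbar p} {χ₁ χ₂ : GalChar p K} {N₁ N₂ : ℤ}
  {t t' d d' : ZMod f → ℤ} {s s' : ZMod f → ℕ}

theorem card_pairs {y : ZMod f → ℤ} (hy : InRange p K s y) :
    ((pairs p K s y).card : ℤ) =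
      ∑ i, if (s i : ℤ) + 1 ≤ y i then (s i : ℤ) + ramE p K - y i else (ramE p K : ℤ) - y i := by
  unfold pairs
  rw [Finset.card_sigma, Nat.cast_sum]
  exact Finset.sum_congr rfl fun i _ => ncard_interval hy i

include hπ hϖ

/-- The exponents of a pair of characters of the shape required by a weight. -/
theorem Screening.exists_exponents (h : Screening p K σ ϖ t s χ₁ χ₂) :
    ∃ N₁ N₂ : ℤ, HasExp hπ hϖ σ χ₁ N₁ ∧ HasExp hπ hϖ σ χ₂ N₂ ∧
      N₁ + N₂ = 2 * detExp p t + detExp p (fun i => (s i : ℤ) + ramE p K) := by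
  obtain ⟨J, x, -, h1, h2⟩ := h
  rw [eqOnInertia_iff hπ hϖ] at h1 h2
  refine ⟨_, _, h1, h2, ?_⟩
  rw [← detExp_add, ← detExp_smul, ← detExp_add]
  congr 1
  ext i
  simp only [Pi.add_apply, Pi.smul_apply, smul_eq_mul]
  split_ifs <;> ring

theorem Screening.modEq (h : Screening p K σ ϖ t s χ₁ χ₂) (h₁ : HasExp hπ hϖ σ χ₁ N₁)
    (h₂ : HasExp hπ hϖ σ χ₂ N₂) :
    N₁ + N₂ ≡ 2 * detExp p t + detExp p (fun i => (s i : ℤ) + ramE p K)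
      [ZMOD (p : ℤ) ^ resF p K - 1] := by
  obtain ⟨M₁, M₂, h3, h4, h5⟩ := h.exists_exponents hπ hϖ
  rw [← h5]
  exact ((h₁.iff hπ hϖ).1 h3).add ((h₂.iff hπ hϖ).1 h4)

theorem Screening.modEq_sub (h : Screening p K σ ϖ t s χ₁ χ₂) (h₁ : HasExp hπ hϖ σ χ₁ N₁)
    (h₂ : HasExp hπ hϖ σ χ₂ N₂) {y : ZMod f → ℤ}
    (hy : N₂ ≡ detExp p t + detExp p y [ZMOD (p : ℤ) ^ resF p K - 1]) :
    N₁ ≡ N₂ + detExp p (zOf p K s y - y) [ZMOD (p : ℤ) ^ resF p K - 1] := by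
  have h3 := h.modEq hπ hϖ h₁ h₂
  have h4 := h3.sub (hy.add hy)
  have e : zOf p K s y = (fun i => (s i : ℤ) + ramE p K) - y := rfl
  rw [e, detExp_sub, detExp_sub]
  have h5 := h4.add_left N₂
  set a := detExp p (fun i => (s i : ℤ) + ramE p K)
  rw [show N₂ + (N₁ + N₂ - (N₂ + N₂)) = N₁ by ring] at h5
  rw [show N₂ + (a - detExp p y - detExp p y) = N₂ + (2 * detExp p t + a -
    (detExp p t + detExp p y + (detExp p t + detExp p y))) by ring]
  exact h5

theorem Screening.intro {J : Finset (ZMod f)} {x : ZMod f → ℤ}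
    (hx : ∀ i, 0 ≤ x i ∧ x i ≤ (ramE p K : ℤ) - 1) (h₁ : HasExp hπ hϖ σ χ₁ N₁)
    (h₂ : HasExp hπ hϖ σ χ₂ N₂)
    (h3 : N₂ ≡ detExp p t + detExp p (fun i =>
      if i ∈ J then (ramE p K : ℤ) - 1 - x i else (s i : ℤ) + ramE p K - x i)
      [ZMOD (p : ℤ) ^ resF p K - 1])
    (h4 : N₁ + N₂ ≡ 2 * detExp p t + detExp p (fun i => (s i : ℤ) + ramE p K)
      [ZMOD (p : ℤ) ^ resF p K - 1]) : Screening p K σ ϖ t s χ₁ χ₂ := by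
  refine ⟨J, x, hx, ?_, ?_⟩
  · rw [eqOnInertia_iff hπ hϖ, h₁.iff]
    have h5 := h4.sub h3
    have e : (fun i => t i + if i ∈ J then (s i : ℤ) + 1 + x i else x i) =
        (2 : ℤ) • t + (fun i => (s i : ℤ) + ramE p K) - (t + (fun i =>
          if i ∈ J then (ramE p K : ℤ) - 1 - x i else (s i : ℤ) + ramE p K - x i)) := by
      ext i
      simp only [Pi.add_apply, Pi.sub_apply, Pi.smul_apply, smul_eq_mul]
      split_ifs <;> ring
    rw [e, detExp_sub, detExp_add, detExp_add, detExp_smul]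
    simpa using h5
  · rw [eqOnInertia_iff hπ hϖ, h₂.iff]
    change _ ≡ detExp p (t + _) [ZMOD _]
    rwa [detExp_add]

include hf

omit hf hπ hϖ in
theorem exists_isY_of_nonempty (h : (JAH p K σ ϖ t s χ₁ χ₂).Nonempty) :
    ∃ y, IsY p K σ ϖ t s χ₂ y :=
  let ⟨_, y, _, _, hy, _⟩ := h
  ⟨y, hy⟩

theorem encard_JAH (hS : Screening p K σ ϖ t s χ₁ χ₂) (h₁ : HasExp hπ hϖ σ χ₁ N₁)
    (h₂ : HasExp hπ hϖ σ χ₂ N₂) {y : ZMod f → ℤ} (hy : IsY p K σ ϖ t s χ₂ y)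
    (hyp : ∀ i, y i ≤ (p : ℤ) - 1) :
    (JAH p K σ ϖ t s χ₁ χ₂).encard = (pairs p K s y).card :=
  le_antisymm (encard_JAH_le hf hπ hϖ h₁ h₂ hy) (le_encard_JAH hf hπ hϖ h₁ h₂ hy hyp
    (hS.modEq_sub hπ hϖ h₁ h₂ (IsY.modEq hπ hϖ h₂ hy).1))

/-- The number of pairs is maximal exactly for `y = 0`. -/
theorem isY_zero_of_encard (h₁ : HasExp hπ hϖ σ χ₁ N₁)
    (h₂ : HasExp hπ hϖ σ χ₂ N₂)
    (h : (JAH p K σ ϖ t s χ₁ χ₂).encard = (ramE p K * f : ℕ)) :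
    N₂ ≡ detExp p t [ZMOD (p : ℤ) ^ resF p K - 1] := by
  have he := ramE_pos p K
  have hne : (JAH p K σ ϖ t s χ₁ χ₂).Nonempty := by
    rw [← Set.encard_pos, h]
    exact_mod_cast Nat.mul_pos he (Nat.pos_of_ne_zero (NeZero.ne f))
  obtain ⟨y, hy⟩ := exists_isY_of_nonempty hne
  have hle := encard_JAH_le hf hπ hϖ h₁ h₂ hy
  obtain ⟨hy1, hr⟩ := IsY.modEq hπ hϖ h₂ hy
  rw [h] at hle
  have hle' : ((ramE p K * f : ℕ) : ℤ) ≤ (pairs p K s y).card := by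
    exact_mod_cast hle
  rw [card_pairs hr] at hle'
  have hbnd : ∀ i ∈ Finset.univ, (if (s i : ℤ) + 1 ≤ y i then (s i : ℤ) + ramE p K - y i
      else (ramE p K : ℤ) - y i) ≤ ramE p K := fun i _ => by
    have := hr i
    split_ifs <;> omega
  have hsum : ∑ _i : ZMod f, (ramE p K : ℤ) = ((ramE p K * f : ℕ) : ℤ) := by
    simp [ZMod.card, mul_comm]
  have heq := (Finset.sum_eq_sum_iff_of_le hbnd).1 (le_antisymm (Finset.sum_le_sum hbnd)
    (by rw [hsum]; exact hle'))
  have hy0 : y = 0 := by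
    ext i
    have h1 := heq i (Finset.mem_univ i)
    have := hr i
    simp only [Pi.zero_apply]
    split_ifs at h1 <;> omega
  have : detExp p (0 : ZMod f → ℤ) = 0 := by simp [detExp]
  rw [hy0, this, add_zero] at hy1
  exact hy1

theorem exists_single_of_encard (hf1 : 1 < f) (hS : Screening p K σ ϖ t s χ₁ χ₂)
    (h₁ : HasExp hπ hϖ σ χ₁ N₁) (h₂ : HasExp hπ hϖ σ χ₂ N₂)
    (h : (JAH p K σ ϖ t s χ₁ χ₂).encard + 1 = (ramE p K * f : ℕ)) :
    ∃ i c, ((c = 1 ∧ 1 ≤ s i ∧ 1 < ramE p K) ∨ c = (s i : ℤ) + 1) ∧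
      N₂ ≡ detExp p t + detExp p (Pi.single i c) [ZMOD (p : ℤ) ^ resF p K - 1] := by
  have he := ramE_pos p K
  have hne : (JAH p K σ ϖ t s χ₁ χ₂).Nonempty := by
    rw [Set.nonempty_iff_ne_empty]
    intro h0
    rw [h0, Set.encard_empty, zero_add] at h
    have h' : 1 = ramE p K * f := by exact_mod_cast h
    have : 1 * 2 ≤ ramE p K * f := Nat.mul_le_mul he hf1
    omega
  obtain ⟨y, hy⟩ := exists_isY_of_nonempty hne
  have hle := encard_JAH_le hf hπ hϖ h₁ h₂ hy
  obtain ⟨hy1, hr⟩ := IsY.modEq hπ hϖ h₂ hy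
  have hle2 := add_le_add_left hle 1
  rw [h] at hle2
  have hle' : ((ramE p K * f : ℕ) : ℤ) ≤ (pairs p K s y).card + 1 := by
    exact_mod_cast hle2
  rw [card_pairs hr] at hle'
  set F : ZMod f → ℤ := fun i => if (s i : ℤ) + 1 ≤ y i then (s i : ℤ) + ramE p K - y i
      else (ramE p K : ℤ) - y i with hF
  have hbnd : ∀ i, F i ≤ ramE p K := fun i => by
    have := hr i
    simp only [hF]
    split_ifs <;> omega
  have hsum : ∑ i : ZMod f, ((ramE p K : ℤ) - F i) ≤ 1 := by
    rw [Finset.sum_sub_distrib]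
    have : ∑ _i : ZMod f, (ramE p K : ℤ) = ((ramE p K * f : ℕ) : ℤ) := by
      simp [ZMod.card, mul_comm]
    linarith
  have hzero_iff : ∀ i, F i = ramE p K → y i = 0 := fun i h1 => by
    have := hr i
    simp only [hF] at h1
    split_ifs at h1 <;> omega
  have hex : ∃ i, F i ≠ ramE p K := by
    by_contra! hall
    have hy0 : ∀ i, y i = 0 := fun i => hzero_iff i (hall i)
    have h5 := encard_JAH hf hπ hϖ hS h₁ h₂ hy (fun i => by
      have := (Fact.out : p.Prime).one_lt
      rw [hy0]
      omega)
    have h6 : ((pairs p K s y).card : ℤ) = ((ramE p K * f : ℕ) : ℤ) := by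
      rw [card_pairs hr]
      change ∑ i, F i = _
      rw [Finset.sum_congr rfl fun i _ => hall i]
      simp [ZMod.card, mul_comm]
    rw [h5, Nat.cast_injective h6] at h
    have h7 : ramE p K * f + 1 = ramE p K * f := by exact_mod_cast h
    omega
  obtain ⟨i, hi⟩ := hex
  have hnn : ∀ j ∈ Finset.univ, 0 ≤ (ramE p K : ℤ) - F j := fun j _ => by
    have := hbnd j
    omega
  have hothers : ∀ j, j ≠ i → F j = ramE p K := by
    intro j hj
    have h1 := Finset.add_sum_erase Finset.univ (fun j => (ramE p K : ℤ) - F j)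
      (Finset.mem_univ i)
    have h2 := Finset.single_le_sum (f := fun j => (ramE p K : ℤ) - F j)
      (s := Finset.univ.erase i) (fun j _ => hnn j (Finset.mem_univ j))
      (Finset.mem_erase.2 ⟨hj, Finset.mem_univ j⟩)
    have h3 := hbnd i
    have h4 := hbnd j
    omega
  have hFi : F i = ramE p K - 1 := by
    have h1 := Finset.single_le_sum hnn (Finset.mem_univ i)
    have h3 := hbnd i
    omega
  refine ⟨i, y i, ?_, ?_⟩
  · have := hr i
    simp only [hF] at hFi
    split_ifs at hFi <;> omega
  · have : y = Pi.single i (y i) := by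
      ext j
      by_cases hj : j = i
      · subst hj
        simp
      · rw [Pi.single_eq_of_ne hj]
        exact hzero_iff j (hothers j hj)
    rw [← this]
    exact hy1

/-- One direction of the classification of type I intersections. -/
theorem WitnessOrdered.criteria (hf1 : 1 < f) (hs : ∀ i, s i + 2 ≤ p) (hs' : ∀ i, s' i + 2 ≤ p)
    (h : WitnessOrdered p K σ ϖ d s χ₁ χ₂ d' s') :
    (∃ j, CritOne p j d s d' s') ∨ (1 < ramE p K ∧ ∃ j, CritTwo p j d s d' s') := by
  obtain ⟨hS, hS', hJ, hJ'⟩ := h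
  have hp := (Fact.out : p.Prime).one_lt
  obtain ⟨N₁, N₂, h₁, h₂, hN⟩ := hS.exists_exponents hπ hϖ
  have e1 := isY_zero_of_encard hf hπ hϖ h₁ h₂ hJ
  obtain ⟨i, c, hc, e2⟩ := exists_single_of_encard hf hπ hϖ hf1 hS' h₁ h₂ hJ'
  have e3 := hS'.modEq hπ hϖ h₁ h₂
  rw [hN, ← hf] at e3
  rw [← hf] at e1 e2
  have e4 := e1.symm.trans e2
  have hexp : ∀ r : ZMod f → ℕ, detExp p (fun i => (r i : ℤ) + ramE p K) =
      detExp p (fun i => (r i : ℤ)) + detExp p (fun _ : ZMod f => (ramE p K : ℤ)) :=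
    fun r => detExp_add p (fun i => (r i : ℤ)) _
  have e5 : ((p : ℤ) ^ f - 1) ∣ detExp p ((fun j => (s' j : ℤ)) - (fun j => (s j : ℤ)) -
      Pi.single i (2 * c)) := by
    rw [detExp_sub, detExp_sub]
    have h2 : detExp p (Pi.single i (2 * c)) = 2 * detExp p (Pi.single i c) := by
      rw [detExp_single, detExp_single]
      ring
    rw [h2]
    rw [hexp, hexp] at e3
    have h3 := (Int.modEq_iff_dvd.1 e3)
    have h4 := (Int.modEq_iff_dvd.1 e4)
    have h5 := dvd_add h3 ((h4.mul_left 2).neg_right)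
    ring_nf at h5 ⊢
    exact h5
  have e6 : detExp p d' ≡ detExp p d - c * (p : ℤ) ^ (f - 1 - i.val) [ZMOD (p : ℤ) ^ f - 1] := by
    rw [detExp_single] at e4
    have := (e4.symm.sub_right (c * (p : ℤ) ^ (f - 1 - i.val)))
    rwa [mul_comm ((p : ℤ) ^ (f - 1 - i.val)) c, add_sub_cancel_right] at this
  rcases hc with ⟨rfl, hc1, hc2⟩ | rfl
  · rcases of_carry_two hp hf1 hs hs' e5 with ⟨h1, h2⟩ | ⟨-, h2⟩
    · right
      refine ⟨hc2, i, ?_, h1, h2, by simpa using e6⟩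
      have := hs' i
      omega
    · omega
  · left
    refine ⟨i, shapeOne_of_carry hp hf1 hs hs' e5, ?_⟩
    rwa [add_comm (1 : ℤ)]

omit [Fact p.Prime] hf hπ hϖ in
theorem ShapeOne.dvd (hf1 : 1 < f) {j : ZMod f} (h : ShapeOne p j s s') :
    ((p : ℤ) ^ f - 1) ∣ detExp p ((fun j => (s' j : ℤ)) - (fun j => (s j : ℤ)) -
      Pi.single j (2 * ((s' j : ℤ) + 1))) := by
  obtain ⟨h1, h2, h3, h4, h5⟩ := h
  have hj := ne_sub_one hf1 j
  refine dvd_detExp_of_carry (c := -Pi.single (j - 1) 1) fun i => ?_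
  simp only [Pi.neg_apply, Pi.sub_apply]
  by_cases hi : i = j
  · subst hi
    rw [Pi.single_eq_same, Pi.single_eq_same, Pi.single_eq_of_ne hj]
    linarith
  · have hij : i - 1 ≠ j - 1 := fun h => hi (sub_left_injective h)
    rw [Pi.single_eq_of_ne hij, Pi.single_eq_of_ne hi]
    by_cases hi' : i = j - 1
    · subst hi'
      rw [Pi.single_eq_same, h4]
      push_cast
      ring
    · rw [Pi.single_eq_of_ne hi', h5 i hi hi']
      simp

/-- The characters with exponents `D + |s + e|` and `D` witness an intersection. -/
theorem witnessOrdered_of_exponents (hf1 : 1 < f) {j : ZMod f} {c : ℤ} (hs' : s' j + 2 ≤ p)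
    (hc : (c = 1 ∧ 1 ≤ s' j ∧ 1 < ramE p K) ∨ c = (s' j : ℤ) + 1)
    (hd : detExp p d' ≡ detExp p d - c * (p : ℤ) ^ (f - 1 - j.val) [ZMOD (p : ℤ) ^ f - 1])
    (hss : ((p : ℤ) ^ f - 1) ∣ detExp p ((fun j => (s' j : ℤ)) - (fun j => (s j : ℤ)) -
      Pi.single j (2 * c)))
    (h₁ : HasExp hπ hϖ σ χ₁ (detExp p d + detExp p (fun i => (s i : ℤ) + ramE p K)))
    (h₂ : HasExp hπ hϖ σ χ₂ (detExp p d)) :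
    WitnessOrdered p K σ ϖ d s χ₁ χ₂ d' s' := by
  have hp := (Fact.out : p.Prime).one_lt
  have he := ramE_pos p K
  have hzero : detExp p (0 : ZMod f → ℤ) = 0 := by simp [detExp]
  have hS : Screening p K σ ϖ d s χ₁ χ₂ := by
    refine Screening.intro hπ hϖ (J := Finset.univ) (x := fun _ => (ramE p K : ℤ) - 1)
      (fun i => by omega) h₁ h₂ ?_ ?_
    · simp only [Finset.mem_univ, if_true, sub_self]
      change _ ≡ _ + detExp p 0 [ZMOD _]
      rw [hzero, add_zero]
    · rw [show detExp p d + detExp p (fun i => (s i : ℤ) + ramE p K) + detExp p d =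
        2 * detExp p d + detExp p (fun i => (s i : ℤ) + ramE p K) by ring]
  have hd2 : detExp p d ≡ detExp p d' + detExp p (Pi.single j c) [ZMOD (p : ℤ) ^ f - 1] := by
    rw [detExp_single]
    have := hd.symm.add_right (c * (p : ℤ) ^ (f - 1 - j.val))
    rwa [sub_add_cancel, mul_comm c] at this
  have hexp : ∀ r : ZMod f → ℕ, detExp p (fun i => (r i : ℤ) + ramE p K) =
      detExp p (fun i => (r i : ℤ)) + detExp p (fun _ : ZMod f => (ramE p K : ℤ)) :=
    fun r => detExp_add p (fun i => (r i : ℤ)) _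
  have hS' : Screening p K σ ϖ d' s' χ₁ χ₂ := by
    have hsum : detExp p d + detExp p (fun i => (s i : ℤ) + ramE p K) + detExp p d ≡
        2 * detExp p d' + detExp p (fun i => (s' i : ℤ) + ramE p K)
        [ZMOD (p : ℤ) ^ resF p K - 1] := by
      rw [← hf, hexp, hexp]
      have h2 : detExp p (Pi.single j (2 * c)) = 2 * detExp p (Pi.single j c) := by
        rw [detExp_single, detExp_single]
        ring
      rw [detExp_sub, detExp_sub, h2] at hss
      apply Int.modEq_iff_dvd.2
      have h3 := dvd_add hss (hd2.dvd.mul_left 2)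
      ring_nf at h3 ⊢
      exact h3
    rcases hc with ⟨rfl, hc1, hc2⟩ | rfl
    · refine Screening.intro hπ hϖ (J := Finset.univ)
        (x := fun i => (ramE p K : ℤ) - 1 - (Pi.single j 1 : ZMod f → ℤ) i)
        (fun i => ?_) h₁ h₂ ?_ hsum
      · by_cases hi : i = j
        · subst hi
          rw [Pi.single_eq_same]
          omega
        · rw [Pi.single_eq_of_ne hi]
          omega
      · simp only [Finset.mem_univ, if_true, sub_sub_cancel]
        rw [← hf]
        exact hd2
    · refine Screening.intro hπ hϖ (J := Finset.univ.erase j)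
        (x := fun i => (ramE p K : ℤ) - 1) (fun i => by omega) h₁ h₂ ?_ hsum
      rw [← hf]
      convert hd2 using 3
      ext i
      by_cases hi : i = j
      · subst hi
        simp
        ring
      · simp [hi]
  have hY : IsY p K σ ϖ d s χ₂ 0 := by
    refine isY_of_small hπ hϖ h₂ (by rw [hzero, add_zero]) (fun i => Or.inl ?_)
      (fun i => ?_) ⟨0, ?_⟩ <;> simp only [Pi.zero_apply] <;> omega
  have hY' : IsY p K σ ϖ d' s' χ₂ (Pi.single j c) := by
    refine isY_of_small hπ hϖ h₂ (by rwa [← hf]) (fun i => ?_) (fun i => ?_) ⟨j + 1, ?_⟩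
    · by_cases hi : i = j
      · subst hi
        rw [Pi.single_eq_same]
        omega
      · rw [Pi.single_eq_of_ne hi]
        omega
    · by_cases hi : i = j
      · subst hi
        rw [Pi.single_eq_same]
        omega
      · rw [Pi.single_eq_of_ne hi]
        omega
    · rw [Pi.single_eq_of_ne (ne_add_one hf1 j)]
      omega
  refine ⟨hS, hS', ?_, ?_⟩
  · rw [encard_JAH hf hπ hϖ hS h₁ h₂ hY (fun i => by simp only [Pi.zero_apply]; omega)]
    have : ((pairs p K s 0).card : ℤ) = ((ramE p K * f : ℕ) : ℤ) := by
      rw [card_pairs (IsY.modEq hπ hϖ h₂ hY).2, Finset.sum_congr rfl (g := fun _ => (ramE p K : ℤ))]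
      · simp [ZMod.card, mul_comm]
      · intro i _
        simp only [Pi.zero_apply]
        split_ifs <;> omega
    rw [Nat.cast_injective this]
  · rw [encard_JAH hf hπ hϖ hS' h₁ h₂ hY' (fun i => by
      by_cases hi : i = j
      · subst hi
        rw [Pi.single_eq_same]
        omega
      · rw [Pi.single_eq_of_ne hi]
        omega)]
    have : ((pairs p K s' (Pi.single j c)).card : ℤ) + 1 = ((ramE p K * f : ℕ) : ℤ) := by
      rw [card_pairs (IsY.modEq hπ hϖ h₂ hY').2, Finset.sum_congr rfl
        (g := fun i => (ramE p K : ℤ) - (Pi.single j 1 : ZMod f → ℤ) i)]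
      · rw [Finset.sum_sub_distrib]
        simp [ZMod.card, mul_comm]
      · intro i _
        by_cases hi : i = j
        · subst hi
          rw [Pi.single_eq_same, Pi.single_eq_same]
          split_ifs <;> omega
        · rw [Pi.single_eq_of_ne hi, Pi.single_eq_of_ne hi]
          split_ifs <;> omega
    exact_mod_cast this

omit [Fact p.Prime] hf hπ hϖ in
theorem dvd_of_shape_two {j : ZMod f} (h1 : s' j = s j + 2) (h2 : ∀ i, i ≠ j → s' i = s i) :
    ((p : ℤ) ^ f - 1) ∣ detExp p ((fun j => (s' j : ℤ)) - (fun j => (s j : ℤ)) -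
      Pi.single j (2 * 1)) := by
  have : (fun j => (s' j : ℤ)) - (fun j => (s j : ℤ)) - Pi.single j (2 * 1) = 0 := by
    ext i
    by_cases hi : i = j
    · subst hi
      simp [h1]
    · simp [h2 i hi, hi]
  rw [this]
  simp [detExp]

theorem exists_witnessOrdered (hf1 : 1 < f) (hs' : ∀ i, s' i + 2 ≤ p)
    (h : (∃ j, CritOne p j d s d' s') ∨ (1 < ramE p K ∧ ∃ j, CritTwo p j d s d' s')) :
    ∃ χ₁ χ₂ : GalChar p K, WitnessOrdered p K σ ϖ d s χ₁ χ₂ d' s' := by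
  obtain ⟨χ₁, h₁⟩ := exists_hasExp hπ hϖ σ
    (detExp p d + detExp p (fun i => (s i : ℤ) + ramE p K))
  obtain ⟨χ₂, h₂⟩ := exists_hasExp hπ hϖ σ (detExp p d)
  refine ⟨χ₁, χ₂, ?_⟩
  rcases h with ⟨j, h1, h2⟩ | ⟨he, j, h1, h2, h3, h4⟩
  · refine witnessOrdered_of_exponents hf hπ hϖ hf1 (hs' j) (Or.inr rfl) ?_ (h1.dvd hf1) h₁ h₂
    rwa [add_comm]
  · exact witnessOrdered_of_exponents hf hπ hϖ hf1 (hs' j) (Or.inl ⟨rfl, by omega, he⟩)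
      (by simpa using h4) (dvd_of_shape_two h2 h3) h₁ h₂

theorem hasTypeI_iff (hf1 : 1 < f) (hs : ∀ i, s i + 2 ≤ p) (hs' : ∀ i, s' i + 2 ≤ p) :
    HasTypeI p K σ ϖ d s d' s' ↔
      ((∃ j, CritOne p j d s d' s' ∨ CritOne p j d' s' d s) ∨
        (1 < ramE p K ∧ ∃ j, CritTwo p j d s d' s' ∨ CritTwo p j d' s' d s)) := by
  constructor
  · rintro ⟨χ₁, χ₂, h | h⟩
    · rcases WitnessOrdered.criteria hf hπ hϖ hf1 hs hs' h with ⟨j, h⟩ | ⟨he, j, h⟩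
      · exact Or.inl ⟨j, Or.inl h⟩
      · exact Or.inr ⟨he, j, Or.inl h⟩
    · rcases WitnessOrdered.criteria hf hπ hϖ hf1 hs' hs h with ⟨j, h⟩ | ⟨he, j, h⟩
      · exact Or.inl ⟨j, Or.inr h⟩
      · exact Or.inr ⟨he, j, Or.inr h⟩
  · have h1 := fun h => exists_witnessOrdered (σ := σ) (d := d) (d' := d') (s := s) hf hπ hϖ hf1
      hs' h
    have h2 := fun h => exists_witnessOrdered (σ := σ) (d := d') (d' := d) (s := s') hf hπ hϖ hf1
      hs h
    rintro (⟨j, h | h⟩ | ⟨he, j, h | h⟩)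
    · obtain ⟨χ₁, χ₂, h⟩ := h1 (Or.inl ⟨j, h⟩)
      exact ⟨χ₁, χ₂, Or.inl h⟩
    · obtain ⟨χ₁, χ₂, h⟩ := h2 (Or.inl ⟨j, h⟩)
      exact ⟨χ₁, χ₂, Or.inr h⟩
    · obtain ⟨χ₁, χ₂, h⟩ := h1 (Or.inr ⟨he, j, h⟩)
      exact ⟨χ₁, χ₂, Or.inl h⟩
    · obtain ⟨χ₁, χ₂, h⟩ := h2 (Or.inr ⟨he, j, h⟩)
      exact ⟨χ₁, χ₂, Or.inr h⟩

omit hf hπ hϖ in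
/-- For `f = 2` the two orders of the first criterion are incompatible. -/
theorem not_critOne_symm {j : ZMod f} (hj : ∀ i, i = j ∨ i = j - 1) (h1 : 2 * s j + 1 = p)
    (h2 : 2 * s (j - 1) + 3 = p) (h1' : 2 * s' j + 3 = p) (h2' : 2 * s' (j - 1) + 1 = p) :
    ¬ (CritOne p j d s d' s' ∧ CritOne p (j - 1) d' s' d s) := by
  have hp := (Fact.out : p.Prime).one_lt
  rintro ⟨⟨-, h3⟩, -, h4⟩
  have h5 : ((p : ℤ) ^ f - 1) ∣ detExp p (fun i : ZMod f => (s' j : ℤ) + 1) := by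
    have hne : j ≠ j - 1 := by
      intro h
      rw [← h] at h2
      omega
    have e : (fun i : ZMod f => (s' j : ℤ) + 1) =
        Pi.single j (1 + (s' j : ℤ)) + Pi.single (j - 1) (1 + (s (j - 1) : ℤ)) := by
      ext i
      rw [Pi.add_apply]
      rcases hj i with rfl | rfl
      · rw [Pi.single_eq_same, Pi.single_eq_of_ne hne]
        ring
      · rw [Pi.single_eq_same, Pi.single_eq_of_ne hne.symm]
        omega
    rw [e, detExp_add, detExp_single, detExp_single]
    have := dvd_add h3.dvd h4.dvd
    have h6 := this.neg_right
    ring_nf at h6 ⊢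
    exact h6
  obtain ⟨c, hc⟩ := exists_carry hp h5
  have h6 := carry_le hc (A := (s' j : ℤ) + 1) (fun _ => le_rfl) hp.le 0
  have h7 := le_carry hc (A := (s' j : ℤ) + 1) (fun _ => le_rfl) hp.le 0
  have h8 : 2 * (((p : ℤ) - 1) * c 0) = p - 1 := by omega
  have h9 : ((p : ℤ) - 1) * (2 * c 0 - 1) = 0 := by linarith
  rcases mul_eq_zero.1 h9 with h | h <;> omega

omit hf hπ hϖ in
theorem criteria_antisymm (hf1 : 1 < f)
    (h : (∃ j, CritOne p j d s d' s') ∨ ∃ j, CritTwo p j d s d' s') :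
    ¬ ((∃ j, CritOne p j d' s' d s) ∨ ∃ j, CritTwo p j d' s' d s) := by
  rintro h'
  rcases h with ⟨j, h⟩ | ⟨j, -, h2, h3, -⟩ <;> rcases h' with ⟨j', h'⟩ | ⟨j', -, h2', h3', -⟩
  · obtain ⟨-, -, h3, h4, h5⟩ := h.1
    obtain ⟨-, -, h3', h4', h5'⟩ := h'.1
    have hjj : j ≠ j' := by
      rintro rfl
      omega
    have e1 : j - 1 = j' := by
      by_contra hne
      have : j - 1 ≠ j' - 1 := fun h => hjj (sub_left_injective h)
      have := h5' _ hne this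
      omega
    have e2 : j' - 1 = j := by
      by_contra hne
      have : j' - 1 ≠ j - 1 := fun h => hjj (sub_left_injective h).symm
      have := h5 _ hne this
      omega
    subst e1
    have hall : ∀ i, i = j ∨ i = j - 1 := by
      refine forall_of_step_up j (Or.inl rfl) ?_
      rintro i (rfl | rfl)
      · right
        linear_combination -e2
      · left
        ring
    rw [e2] at h4'
    exact not_critOne_symm hall (by omega) (by omega) (by omega) (by omega) ⟨h, h'⟩
  · obtain ⟨-, -, h3, h4, h5⟩ := h.1
    by_cases hj : j - 1 = j'
    · rw [← hj] at h2'
      omega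
    · have := h3' _ hj
      omega
  · obtain ⟨-, -, h3', h4', h5'⟩ := h'.1
    by_cases hj : j' - 1 = j
    · rw [← hj] at h2
      omega
    · have := h3 _ hj
      omega
  · by_cases hj : j = j'
    · subst hj
      omega
    · have := h3' _ hj
      omega

theorem restrict_eq_of_witnessOrdered {χ₁' χ₂' : GalChar p K}
    (h : WitnessOrdered p K σ ϖ d s χ₁ χ₂ d' s') (h' : WitnessOrdered p K σ ϖ d s χ₁' χ₂' d' s') :
    χ₁.toHom.comp (inertia p K).subtype = χ₁'.toHom.comp (inertia p K).subtype ∧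
      χ₂.toHom.comp (inertia p K).subtype = χ₂'.toHom.comp (inertia p K).subtype := by
  obtain ⟨hS, -, hJ, -⟩ := h
  obtain ⟨hS', -, hJ', -⟩ := h'
  obtain ⟨N₁, N₂, h₁, h₂, hN⟩ := hS.exists_exponents hπ hϖ
  obtain ⟨M₁, M₂, h₁', h₂', hM⟩ := hS'.exists_exponents hπ hϖ
  have e1 := isY_zero_of_encard hf hπ hϖ h₁ h₂ hJ
  have e2 := isY_zero_of_encard hf hπ hϖ h₁' h₂' hJ'
  have e3 := e1.trans e2.symm
  refine ⟨(restrict_eq_iff hπ hϖ σ h₁ h₁').2 ?_, (restrict_eq_iff hπ hϖ σ h₂ h₂').2 e3⟩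
  have e4 : N₁ + N₂ ≡ M₁ + M₂ [ZMOD (p : ℤ) ^ resF p K - 1] := by rw [hN, hM]
  exact Int.ModEq.add_right_cancel e3 e4

theorem ncard_typeIFamilies (hf1 : 1 < f) (hs : ∀ i, s i + 2 ≤ p) (hs' : ∀ i, s' i + 2 ≤ p)
    (h : HasTypeI p K σ ϖ d s d' s') : (typeIFamilies p K σ ϖ d s d' s').ncard = 1 := by
  obtain ⟨χ₁, χ₂, h⟩ := h
  rw [Set.ncard_eq_one]
  refine ⟨(χ₁.toHom.comp (inertia p K).subtype, χ₂.toHom.comp (inertia p K).subtype),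
    Set.eq_singleton_iff_unique_mem.2 ⟨⟨χ₁, χ₂, h, rfl⟩, ?_⟩⟩
  rintro _ ⟨χ₁', χ₂', h', rfl⟩
  have hcrit : ∀ {χ₁ χ₂ χ₁' χ₂' : GalChar p K}, WitnessOrdered p K σ ϖ d s χ₁ χ₂ d' s' →
      ¬ WitnessOrdered p K σ ϖ d' s' χ₁' χ₂' d s := by
    intro χ₁ χ₂ χ₁' χ₂' h h'
    exact criteria_antisymm hf1
      ((WitnessOrdered.criteria hf hπ hϖ hf1 hs hs' h).imp_right fun h => h.2)
      ((WitnessOrdered.criteria hf hπ hϖ hf1 hs' hs h').imp_right fun h => h.2)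
  rcases h with h | h <;> rcases h' with h' | h'
  · have := restrict_eq_of_witnessOrdered hf hπ hϖ h' h
    rw [this.1, this.2]
  · exact absurd h' (hcrit h)
  · exact absurd h (hcrit h')
  · have := restrict_eq_of_witnessOrdered hf hπ hϖ h' h
    rw [this.1, this.2]

omit [NeZero f] hf hπ hϖ in
theorem shapes_of_two [NeZero f] (hf2 : f = 2) (h1 : 2 * s 1 + 1 = p) (h0 : 2 * s 0 + 3 = p)
    (h1' : 2 * s' 1 + 3 = p) (h0' : 2 * s' 0 + 1 = p) :
    ShapeOne p 1 s s' ∧ ShapeOne p 0 s' s ∧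
      ¬ (CritOne p 1 d s d' s' ∧ CritOne p 0 d' s' d s) := by
  subst hf2
  have hp2 := (Fact.out : p.Prime).two_le
  have e0 : (0 : ZMod 2) - 1 = 1 := by decide
  have e1 : (1 : ZMod 2) - 1 = 0 := by decide
  have hall : ∀ i : ZMod 2, i = 1 ∨ i = 0 := by decide
  refine ⟨⟨by omega, by rw [e1]; omega, by omega, by rw [e1]; omega, fun i h h' => ?_⟩,
    ⟨by omega, by rw [e0]; omega, by omega, by rw [e0]; omega, fun i h h' => ?_⟩, ?_⟩
  · rw [e1] at h'
    rcases hall i with h2 | h2 <;> contradiction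
  · rw [e0] at h'
    rcases hall i with h2 | h2 <;> contradiction
  · have := not_critOne_symm (d := d) (d' := d') (s := s) (s' := s') (j := (1 : ZMod 2))
      (by rwa [e1]) h1 (by rwa [e1]) h1' (by rwa [e1])
    rwa [e1] at this

end TypeIClassification

section Elements

variable {R : Type*} [CommRing R]

/-- The upper unipotent matrix with entry `x`. -/
def upper (x : R) : GL (Fin 2) R :=
  ⟨!![1, x; 0, 1], !![1, -x; 0, 1], by
    ext i j; fin_cases i <;> fin_cases j <;> simp [Matrix.mul_apply], by
    ext i j; fin_cases i <;> fin_cases j <;> simp [Matrix.mul_apply]⟩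

/-- The lower unipotent matrix with entry `x`. -/
def lower (x : R) : GL (Fin 2) R :=
  ⟨!![1, 0; x, 1], !![1, 0; -x, 1], by
    ext i j; fin_cases i <;> fin_cases j <;> simp [Matrix.mul_apply], by
    ext i j; fin_cases i <;> fin_cases j <;> simp [Matrix.mul_apply]⟩

/-- The diagonal matrix with entries `a` and `b`. -/
def torus (a b : Rˣ) : GL (Fin 2) R :=
  ⟨!![(a : R), 0; 0, (b : R)], !![((a⁻¹ : Rˣ) : R), 0; 0, ((b⁻¹ : Rˣ) : R)], by
    ext i j; fin_cases i <;> fin_cases j <;> simp [Matrix.mul_apply], by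
    ext i j; fin_cases i <;> fin_cases j <;> simp [Matrix.mul_apply]⟩

@[simp] theorem coe_upper (x : R) : (upper x : Matrix (Fin 2) (Fin 2) R) = !![1, x; 0, 1] := rfl

@[simp] theorem coe_lower (x : R) : (lower x : Matrix (Fin 2) (Fin 2) R) = !![1, 0; x, 1] := rfl

@[simp] theorem coe_torus (a b : Rˣ) :
    (torus a b : Matrix (Fin 2) (Fin 2) R) = !![(a : R), 0; 0, (b : R)] := rfl

theorem upper_add (x y : R) : upper (x + y) = upper x * upper y := by
  apply Units.ext
  ext i j
  fin_cases i <;> fin_cases j <;> simp [Matrix.mul_apply, add_comm]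

theorem lower_add (x y : R) : lower (x + y) = lower x * lower y := by
  apply Units.ext
  ext i j
  fin_cases i <;> fin_cases j <;> simp [Matrix.mul_apply]

theorem upper_zero : upper (0 : R) = 1 := by
  apply Units.ext
  ext i j
  fin_cases i <;> fin_cases j <;> simp

theorem lower_zero : lower (0 : R) = 1 := by
  apply Units.ext
  ext i j
  fin_cases i <;> fin_cases j <;> simp

theorem torus_mul (a b a' b' : Rˣ) : torus (a * a') (b * b') = torus a b * torus a' b' := by
  apply Units.ext
  ext i j
  fin_cases i <;> fin_cases j <;> simp [Matrix.mul_apply]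

theorem torus_mul_upper (a b : Rˣ) (x : R) :
    torus a b * upper x = upper (a * x * (b⁻¹ : Rˣ)) * torus a b := by
  apply Units.ext
  ext i j
  fin_cases i <;> fin_cases j <;> simp [Matrix.mul_apply]

theorem torus_mul_lower (a b : Rˣ) (x : R) :
    torus a b * lower x = lower (b * x * (a⁻¹ : Rˣ)) * torus a b := by
  apply Units.ext
  ext i j
  fin_cases i <;> fin_cases j <;> simp [Matrix.mul_apply]

variable {S : Type*} [CommRing S] (φ : R →+* S)

theorem map_upper (x : R) : Matrix.GeneralLinearGroup.map φ (upper x) = upper (φ x) := by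
  apply Units.ext
  ext i j
  fin_cases i <;> fin_cases j <;> simp

theorem map_lower (x : R) : Matrix.GeneralLinearGroup.map φ (lower x) = lower (φ x) := by
  apply Units.ext
  ext i j
  fin_cases i <;> fin_cases j <;> simp

theorem map_torus (a b : Rˣ) : Matrix.GeneralLinearGroup.map φ (torus a b) =
    torus (Units.map (φ : R →* S) a) (Units.map (φ : R →* S) b) := by
  apply Units.ext
  ext i j
  fin_cases i <;> fin_cases j <;> simp

theorem det_upper (x : R) : Matrix.GeneralLinearGroup.det (upper x) = 1 := by
  apply Units.ext
  simp [Matrix.det_fin_two]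

theorem det_lower (x : R) : Matrix.GeneralLinearGroup.det (lower x) = 1 := by
  apply Units.ext
  simp [Matrix.det_fin_two]

theorem det_torus (a b : Rˣ) : Matrix.GeneralLinearGroup.det (torus a b) = a * b := by
  apply Units.ext
  simp [Matrix.det_fin_two]

end Elements

section Sym

variable {F : Type} [Field F]

/-- The monomial `x^a y^{N-a}` in `Sym^N`; it is zero if `N < a`. -/
noncomputable def symMono (F : Type) [Field F] (N a : ℕ) :
    MvPolynomial.homogeneousSubmodule (Fin 2) F N :=
  if h : a ≤ N then ⟨MvPolynomial.X 0 ^ a * MvPolynomial.X 1 ^ (N - a), by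
    have := ((MvPolynomial.isHomogeneous_X F (0 : Fin 2)).pow a).mul
      ((MvPolynomial.isHomogeneous_X F (1 : Fin 2)).pow (N - a))
    rw [MvPolynomial.mem_homogeneousSubmodule]
    convert this using 1
    omega⟩ else 0

theorem coe_symMono {N a : ℕ} (h : a ≤ N) :
    (symMono F N a : MvPolynomial (Fin 2) F) =
      MvPolynomial.X 0 ^ a * MvPolynomial.X 1 ^ (N - a) := by
  rw [symMono, dif_pos h]

theorem symMono_eq_zero {N a : ℕ} (h : N < a) : symMono F N a = 0 := by
  rw [symMono, dif_neg (by omega)]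

theorem coe_symMono_eq_monomial {N a : ℕ} (h : a ≤ N) :
    (symMono F N a : MvPolynomial (Fin 2) F) =
      MvPolynomial.monomial (Finsupp.single 0 a + Finsupp.single 1 (N - a)) 1 := by
  rw [coe_symMono h, MvPolynomial.X_pow_eq_monomial, MvPolynomial.X_pow_eq_monomial,
    MvPolynomial.monomial_mul, one_mul]

/-- The basis of monomials of `Sym^N`. -/
noncomputable def symBasis (F : Type) [Field F] (N : ℕ) :
    Module.Basis (Fin (N + 1)) F (MvPolynomial.homogeneousSubmodule (Fin 2) F N) :=
  Module.Basis.mk (v := fun a : Fin (N + 1) => symMono F N a) (by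
    refine LinearIndependent.of_comp (Submodule.subtype _) ?_
    have h := (MvPolynomial.basisMonomials (Fin 2) F).linearIndependent
    have h2 := h.comp (fun a : Fin (N + 1) => Finsupp.single (0 : Fin 2) (a : ℕ) +
      Finsupp.single 1 (N - a)) (fun a b hab => by
        have := DFunLike.congr_fun hab 0
        simpa [Fin.val_inj] using this)
    have e : (⇑(MvPolynomial.homogeneousSubmodule (Fin 2) F N).subtype ∘
        fun a : Fin (N + 1) => symMono F N a) = (⇑(MvPolynomial.basisMonomials (Fin 2) F) ∘
        fun a : Fin (N + 1) => Finsupp.single 0 (a : ℕ) + Finsupp.single 1 (N - a)) := by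
      ext1 a
      simp only [Function.comp_apply, Submodule.subtype_apply, MvPolynomial.coe_basisMonomials]
      exact coe_symMono_eq_monomial (by omega)
    rw [e]
    exact h2) (by
    rintro ⟨P, hP⟩ -
    rw [MvPolynomial.mem_homogeneousSubmodule] at hP
    have : (⟨P, hP⟩ : MvPolynomial.homogeneousSubmodule (Fin 2) F N) =
        ∑ d ∈ P.support, P.coeff d • symMono F N (d 0) := by
      apply Subtype.ext
      rw [Submodule.coe_sum]
      change P = _
      conv_lhs => rw [P.as_sum]
      refine Finset.sum_congr rfl fun d hd => ?_
      have hdeg : d.degree = N := by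
        rw [Finsupp.degree_eq_weight_one]
        exact hP (MvPolynomial.mem_support_iff.1 hd)
      have hd2 : d 0 + d 1 = N := by
        rw [← hdeg, Finsupp.degree_eq_sum, Fin.sum_univ_two]
      rw [Submodule.coe_smul, coe_symMono_eq_monomial (by omega), MvPolynomial.smul_monomial,
        smul_eq_mul, mul_one]
      have e : Finsupp.single 0 (d 0) + Finsupp.single 1 (N - d 0) = d := by
        ext i
        fin_cases i
        · simp
        · simp only [Fin.mk_one, Finsupp.coe_add, Pi.add_apply, Finsupp.single_eq_same]
          rw [Finsupp.single_eq_of_ne (by decide)]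
          omega
      rw [e]
    rw [this]
    refine Submodule.sum_mem _ fun d _ => Submodule.smul_mem _ _ ?_
    by_cases hd : d 0 ≤ N
    · exact Submodule.subset_span ⟨⟨d 0, by omega⟩, rfl⟩
    · rw [symMono_eq_zero (by omega)]
      exact Submodule.zero_mem _)

theorem symBasis_apply (N : ℕ) (a : Fin (N + 1)) : symBasis F N a = symMono F N a := by
  simp [symBasis]

theorem coe_symRep_apply (N : ℕ) (g : GL (Fin 2) F)
    (P : MvPolynomial.homogeneousSubmodule (Fin 2) F N) :
    (symRep F N g P : MvPolynomial (Fin 2) F) = linSubst g.1 P := rfl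

theorem symRep_upper (N n : ℕ) (x : F) :
    symRep F N (upper x) (symMono F N n) =
      ∑ a ∈ Finset.range (N + 1), (((N - n).choose a : F) * x ^ a) • symMono F N (n + a) := by
  by_cases hn : n ≤ N
  · apply Subtype.ext
    rw [coe_symRep_apply, coe_symMono hn, Submodule.coe_sum]
    have hsub : Finset.range (N - n + 1) ⊆ Finset.range (N + 1) := by
      intro a
      simp only [Finset.mem_range]
      omega
    rw [← Finset.sum_subset hsub (fun a _ ha => by
      rw [Nat.choose_eq_zero_of_lt (by simpa using ha)]
      simp)]
    simp only [linSubst, map_mul, map_pow, MvPolynomial.aeval_X, Fin.sum_univ_two, coe_upper,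
      Matrix.of_apply, Matrix.cons_val', Matrix.cons_val_zero, Matrix.cons_val_one,
      MvPolynomial.C_1, MvPolynomial.C_0, zero_mul, one_mul, add_zero]
    rw [add_pow, Finset.mul_sum]
    refine Finset.sum_congr rfl fun a ha => ?_
    have ha' := Finset.mem_range.1 ha
    rw [Submodule.coe_smul, coe_symMono (by omega), MvPolynomial.smul_eq_C_mul]
    simp only [mul_pow, pow_add, map_mul, map_pow, map_natCast]
    rw [show N - (n + a) = N - n - a by omega]
    ring
  · rw [symMono_eq_zero (by omega), map_zero]
    symm
    refine Finset.sum_eq_zero fun a _ => ?_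
    rw [symMono_eq_zero (by omega), smul_zero]

theorem symRep_lower {N n : ℕ} (hn : n ≤ N) (x : F) :
    symRep F N (lower x) (symMono F N n) =
      ∑ a ∈ Finset.range (N + 1), ((n.choose a : F) * x ^ a) • symMono F N (n - a) := by
  apply Subtype.ext
  rw [coe_symRep_apply, coe_symMono hn, Submodule.coe_sum]
  have hsub : Finset.range (n + 1) ⊆ Finset.range (N + 1) := by
    intro a
    simp only [Finset.mem_range]
    omega
  rw [← Finset.sum_subset hsub (fun a _ ha => by
    rw [Nat.choose_eq_zero_of_lt (by simpa using ha)]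
    simp)]
  simp only [linSubst, map_mul, map_pow, MvPolynomial.aeval_X, Fin.sum_univ_two, coe_lower,
    Matrix.of_apply, Matrix.cons_val', Matrix.cons_val_zero, Matrix.cons_val_one,
    MvPolynomial.C_1, MvPolynomial.C_0, zero_mul, one_mul, zero_add, Matrix.cons_val_fin_one]
  rw [add_comm (MvPolynomial.X 0), add_pow, Finset.sum_mul]
  refine Finset.sum_congr rfl fun a ha => ?_
  have ha' := Finset.mem_range.1 ha
  rw [Submodule.coe_smul, coe_symMono (by omega), MvPolynomial.smul_eq_C_mul]
  simp only [mul_pow, map_mul, map_pow, map_natCast]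
  rw [show N - (n - a) = N - n + a by omega, pow_add]
  ring

theorem symRep_torus (N n : ℕ) (a b : Fˣ) :
    symRep F N (torus a b) (symMono F N n) =
      ((a : F) ^ n * (b : F) ^ (N - n)) • symMono F N n := by
  by_cases hn : n ≤ N
  · apply Subtype.ext
    rw [coe_symRep_apply, Submodule.coe_smul, coe_symMono hn, MvPolynomial.smul_eq_C_mul]
    simp only [linSubst, map_mul, map_pow, MvPolynomial.aeval_X, Fin.sum_univ_two, coe_torus,
      Matrix.of_apply, Matrix.cons_val', Matrix.cons_val_zero, Matrix.cons_val_one,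
      MvPolynomial.C_0, zero_mul, zero_add, Matrix.cons_val_fin_one, add_zero, mul_pow]
    ring
  · rw [symMono_eq_zero (by omega), map_zero, smul_zero]

end Sym

section Weight

variable {p : ℕ} [Fact p.Prime] {k : Type*} [Field k] {f : ℕ} [NeZero f]

/-- The exponent `∑_i p^{f-1-i} n_i`, as a natural number. -/
def natExp (p : ℕ) (n : ZMod f → ℕ) : ℕ := ∑ i, p ^ (f - 1 - i.val) * n i

theorem cast_natExp (p : ℕ) (n : ZMod f → ℕ) :
    ((natExp p n : ℕ) : ℤ) = detExp p (fun i => (n i : ℤ)) := by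
  simp [natExp, detExp]

theorem natExp_add (p : ℕ) (n m : ZMod f → ℕ) : natExp p (n + m) = natExp p n + natExp p m := by
  simp [natExp, mul_add, Finset.sum_add_distrib]

theorem natExp_single (p : ℕ) (i : ZMod f) (a : ℕ) :
    natExp p (Pi.single i a) = p ^ (f - 1 - i.val) * a := by
  unfold natExp
  rw [Finset.sum_eq_single i]
  · simp
  · intro j _ hj
    simp [hj]
  · simp

/-- The vector `⨂ x^{n_i} y^{N_i - n_i}`; it is zero unless `n ≤ N`. -/
noncomputable def mono (p : ℕ) [Fact p.Prime] (N n : ZMod f → ℕ) : WeightSpace p N :=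
  ⨂ₜ[Fbar p] i, symMono (Fbar p) (N i) (n i)

theorem mono_eq_zero {N n : ZMod f → ℕ} {i : ZMod f} (h : N i < n i) : mono p N n = 0 :=
  (PiTensorProduct.tprod (Fbar p)).map_coord_zero i (symMono_eq_zero h)

/-- The basis of monomials. -/
noncomputable def weightBasis (p : ℕ) [Fact p.Prime] (N : ZMod f → ℕ) :
    Module.Basis (Π i, Fin (N i + 1)) (Fbar p) (WeightSpace p N) :=
  Basis.piTensorProduct fun i => symBasis (Fbar p) (N i)

theorem weightBasis_apply (N : ZMod f → ℕ) (n : Π i, Fin (N i + 1)) :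
    weightBasis p N n = mono p N (fun i => n i) := by
  unfold weightBasis mono
  rw [Basis.piTensorProduct_apply]
  simp only [symBasis_apply]

theorem mono_ne_zero {N n : ZMod f → ℕ} (h : ∀ i, n i ≤ N i) : mono p N n ≠ 0 := by
  have := (weightBasis p N).ne_zero (fun i => ⟨n i, Nat.lt_succ_of_le (h i)⟩)
  rwa [weightBasis_apply] at this

/-- The linear form dual to a monomial. -/
noncomputable def monoCoeff {N : ZMod f → ℕ} (v : WeightSpace p N) (n : ZMod f → ℕ) : Fbar p :=
  if h : ∀ i, n i ≤ N i then
    (weightBasis p N).repr v (fun i => ⟨n i, Nat.lt_succ_of_le (h i)⟩) else 0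

/-- The exponents of the monomials. -/
noncomputable def box (N : ZMod f → ℕ) : Finset (ZMod f → ℕ) :=
  Fintype.piFinset fun i => Finset.range (N i + 1)

theorem mem_box {N n : ZMod f → ℕ} : n ∈ box N ↔ ∀ i, n i ≤ N i := by
  simp [box, Nat.lt_succ_iff]

theorem span_mono (N : ZMod f → ℕ) :
    Submodule.span (Fbar p) (Set.range fun n : ZMod f → ℕ => mono p N n) = ⊤ := by
  rw [eq_top_iff, ← (weightBasis p N).span_eq]
  refine Submodule.span_mono ?_
  rintro _ ⟨n, rfl⟩
  exact ⟨_, (weightBasis_apply N n).symm⟩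

theorem hom_ext_mono {M : Type*} [AddCommMonoid M] [Module (Fbar p) M] {N : ZMod f → ℕ}
    {φ ψ : WeightSpace p N →ₗ[Fbar p] M}
    (h : ∀ n, (∀ i, n i ≤ N i) → φ (mono p N n) = ψ (mono p N n)) : φ = ψ := by
  refine (weightBasis p N).ext fun n => ?_
  rw [weightBasis_apply]
  exact h _ fun i => Nat.lt_succ_iff.1 (n i).2

theorem sum_monoCoeff {N : ZMod f → ℕ} (v : WeightSpace p N) :
    v = ∑ n ∈ box N, monoCoeff v n • mono p N n := by
  classical
  conv_lhs => rw [← (weightBasis p N).sum_repr v]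
  refine Finset.sum_bij' (fun n _ => fun i => (n i : ℕ))
    (fun n hn => fun i => ⟨n i, Nat.lt_succ_of_le (mem_box.1 hn i)⟩) ?_ ?_ ?_ ?_ ?_
  · intro n _
    exact mem_box.2 fun i => Nat.lt_succ_iff.1 (n i).2
  · intro n _
    exact Finset.mem_univ _
  · intro n _
    rfl
  · intro n _
    rfl
  · intro n _
    rw [weightBasis_apply, monoCoeff, dif_pos fun i => Nat.lt_succ_iff.1 (n i).2]

theorem monoCoeff_mono {N n m : ZMod f → ℕ} (hn : ∀ i, n i ≤ N i) :
    monoCoeff (mono p N n) m = if m = n then 1 else 0 := by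
  classical
  have h1 : mono p N n = weightBasis p N (fun i => ⟨n i, Nat.lt_succ_of_le (hn i)⟩) := by
    rw [weightBasis_apply]
  rw [monoCoeff, h1, Module.Basis.repr_self]
  by_cases hm : m = n
  · subst hm
    rw [dif_pos hn, Finsupp.single_eq_same, if_pos rfl]
  · rw [if_neg hm]
    split_ifs with h2
    · rw [Finsupp.single_apply, if_neg]
      intro h
      apply hm
      ext i
      exact (congrArg Fin.val (congrFun h i)).symm
    · rfl

theorem monoCoeff_add {N : ZMod f → ℕ} (v w : WeightSpace p N) (n : ZMod f → ℕ) :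
    monoCoeff (v + w) n = monoCoeff v n + monoCoeff w n := by
  unfold monoCoeff
  split_ifs <;> simp

theorem monoCoeff_smul {N : ZMod f → ℕ} (c : Fbar p) (v : WeightSpace p N) (n : ZMod f → ℕ) :
    monoCoeff (c • v) n = c * monoCoeff v n := by
  unfold monoCoeff
  split_ifs <;> simp

/-- The linear form dual to a monomial. -/
noncomputable def monoCoeffHom {N : ZMod f → ℕ} (n : ZMod f → ℕ) :
    WeightSpace p N →ₗ[Fbar p] Fbar p where
  toFun v := monoCoeff v n
  map_add' v w := monoCoeff_add v w n
  map_smul' c v := monoCoeff_smul c v n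

theorem eq_smul_mono {N n : ZMod f → ℕ} {v : WeightSpace p N}
    (h : ∀ m, (∀ i, m i ≤ N i) → monoCoeff v m ≠ 0 → m = n) :
    v = monoCoeff v n • mono p N n := by
  classical
  conv_lhs => rw [sum_monoCoeff v]
  by_cases hn : ∀ i, n i ≤ N i
  · rw [Finset.sum_eq_single n]
    · intro m hm hmn
      by_cases h0 : monoCoeff v m = 0
      · rw [h0, zero_smul]
      · exact absurd (h m (mem_box.1 hm) h0) hmn
    · intro h1
      exact absurd (mem_box.2 hn) h1
  · rw [monoCoeff, dif_neg hn, zero_smul]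
    refine Finset.sum_eq_zero fun m hm => ?_
    by_cases h0 : monoCoeff v m = 0
    · rw [h0, zero_smul]
    · exact absurd (h m (mem_box.1 hm) h0 ▸ mem_box.1 hm) hn

theorem emb_apply (σ : k →+* Fbar p) (i : ZMod f) (x : k) :
    emb p σ i x = σ x ^ p ^ (f - 1 - i.val) := by
  simp [emb, iterateFrobenius_def]

theorem prod_emb_pow (σ : k →+* Fbar p) (n : ZMod f → ℕ) (x : k) :
    ∏ i, emb p σ i x ^ n i = σ x ^ natExp p n := by
  simp only [emb_apply, ← pow_mul]
  rw [Finset.prod_pow_eq_pow_sum]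
  rfl

theorem prod_emb_zpow (σ : k →+* Fbar p) (t : ZMod f → ℤ) (x : kˣ) :
    ∏ i, emb p σ i (x : k) ^ t i = σ x ^ detExp p t := by
  have hx : σ x ≠ 0 := (Units.map (σ : k →* Fbar p) x).ne_zero
  unfold detExp
  classical
  induction (Finset.univ : Finset (ZMod f)) using Finset.induction_on with
  | empty => simp
  | insert a s ha ih =>
    rw [Finset.prod_insert ha, Finset.sum_insert ha, ih, zpow_add₀ hx, zpow_mul, emb_apply,
      ← zpow_natCast]
    push_cast
    rfl

theorem weightRep_tprod (σ : k →+* Fbar p) (t : ZMod f → ℤ) (s : ZMod f → ℕ) (g : GL (Fin 2) k)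
    (v : Π i, MvPolynomial.homogeneousSubmodule (Fin 2) (Fbar p) (s i)) :
    weightRep p σ t s g (⨂ₜ[Fbar p] i, v i) =
      σ (Matrix.GeneralLinearGroup.det g : k) ^ detExp p t •
        ⨂ₜ[Fbar p] i, symRep (Fbar p) (s i) (Matrix.GeneralLinearGroup.map (emb p σ i) g) (v i) := by
  rw [← prod_emb_zpow, ← MultilinearMap.map_smul_univ]
  change PiTensorProduct.map _ _ = _
  rw [PiTensorProduct.map_tprod]
  congr 1
  ext1 i
  have hd : ((Matrix.GeneralLinearGroup.det (Matrix.GeneralLinearGroup.map (emb p σ i) g) ^ t i :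
      (Fbar p)ˣ) : Fbar p) = emb p σ i (Matrix.GeneralLinearGroup.det g : k) ^ t i := by
    rw [Units.val_zpow_eq_zpow_val, Matrix.GeneralLinearGroup.map_det]
    rfl
  rw [← hd]
  rfl

theorem map_zpow_eq_of_modEq (σ : k →+* Fbar p) [Finite k] (hk : Nat.card k = p ^ f)
    {m n : ℤ} (h : m ≡ n [ZMOD (p : ℤ) ^ f - 1]) (x : kˣ) : σ x ^ m = σ x ^ n := by
  have h1 : orderOf x ∣ p ^ f - 1 := by
    rw [← hk, ← Nat.card_units]
    exact orderOf_dvd_natCard _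
  have h2 : x ^ m = x ^ n := by
    rw [zpow_eq_zpow_iff_modEq]
    refine h.of_dvd ?_
    have h3 : ((p ^ f - 1 : ℕ) : ℤ) = (p : ℤ) ^ f - 1 := by
      rw [Nat.cast_sub (Nat.one_le_pow _ _ (Fact.out : p.Prime).pos)]
      push_cast
      rfl
    rw [← h3]
    exact_mod_cast h1
  rw [← map_zpow₀, ← map_zpow₀, ← Units.val_zpow_eq_zpow_val, ← Units.val_zpow_eq_zpow_val, h2]

theorem weightRep_congr (σ : k →+* Fbar p) {t t' : ZMod f → ℤ} (s : ZMod f → ℕ) [Finite k]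
    (hk : Nat.card k = p ^ f) (h : detExp p t ≡ detExp p t' [ZMOD (p : ℤ) ^ f - 1])
    (g : GL (Fin 2) k) : weightRep p σ t s g = weightRep p σ t' s g := by
  have h1 := map_zpow_eq_of_modEq σ hk h (Matrix.GeneralLinearGroup.det g)
  apply PiTensorProduct.ext
  apply MultilinearMap.ext
  intro v
  rw [LinearMap.compMultilinearMap_apply, LinearMap.compMultilinearMap_apply, weightRep_tprod,
    weightRep_tprod, h1]

theorem weightRep_upper (σ : k →+* Fbar p) (t : ZMod f → ℤ) (N n : ZMod f → ℕ) (x : k) :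
    weightRep p σ t N (upper x) (mono p N n) =
      ∑ a ∈ box N, ((∏ i, ((N i - n i).choose (a i) : Fbar p)) * σ x ^ natExp p a) •
        mono p N (n + a) := by
  unfold mono
  rw [weightRep_tprod, det_upper, Units.val_one, map_one, one_zpow, one_smul]
  simp only [map_upper, symRep_upper]
  rw [MultilinearMap.map_sum_finset]
  refine Finset.sum_congr rfl fun a _ => ?_
  rw [MultilinearMap.map_smul_univ, Finset.prod_mul_distrib, prod_emb_pow]
  rfl

theorem weightRep_lower (σ : k →+* Fbar p) (t : ZMod f → ℤ) {N n : ZMod f → ℕ}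
    (hn : ∀ i, n i ≤ N i) (x : k) :
    weightRep p σ t N (lower x) (mono p N n) =
      ∑ a ∈ box N, ((∏ i, ((n i).choose (a i) : Fbar p)) * σ x ^ natExp p a) •
        mono p N (n - a) := by
  unfold mono
  rw [weightRep_tprod, det_lower, Units.val_one, map_one, one_zpow, one_smul]
  simp only [map_lower]
  have : (fun i => symRep (Fbar p) (N i) (lower (emb p σ i x)) (symMono (Fbar p) (N i) (n i))) =
      fun i => ∑ a ∈ Finset.range (N i + 1), (((n i).choose a : Fbar p) * emb p σ i x ^ a) •
        symMono (Fbar p) (N i) (n i - a) := funext fun i => symRep_lower (hn i) _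
  rw [this, MultilinearMap.map_sum_finset]
  refine Finset.sum_congr rfl fun a _ => ?_
  rw [MultilinearMap.map_smul_univ, Finset.prod_mul_distrib, prod_emb_pow]
  rfl

theorem weightRep_torus (σ : k →+* Fbar p) (t : ZMod f → ℤ) (N : ZMod f → ℕ) {n : ZMod f → ℕ}
    (hn : ∀ i, n i ≤ N i) (a b : kˣ) :
    weightRep p σ t N (torus a b) (mono p N n) =
      (σ a ^ (detExp p t + natExp p n) * σ b ^ (detExp p t + natExp p N - natExp p n)) •
        mono p N n := by
  have ha : σ a ≠ 0 := (Units.map (σ : k →* Fbar p) a).ne_zero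
  have hb : σ b ≠ 0 := (Units.map (σ : k →* Fbar p) b).ne_zero
  unfold mono
  rw [weightRep_tprod, det_torus]
  simp only [map_torus, symRep_torus]
  rw [MultilinearMap.map_smul_univ, smul_smul]
  congr 1
  simp only [Units.coe_map, MonoidHom.coe_coe]
  rw [Finset.prod_mul_distrib, prod_emb_pow]
  have h1 : ∏ i, emb p σ i (b : k) ^ (N i - n i) = σ b ^ natExp p (N - n) := prod_emb_pow σ _ _
  have h2 : natExp p N = natExp p (N - n) + natExp p n := by
    rw [← natExp_add]
    congr 1
    ext i
    simp [hn i]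
  rw [h1, Units.val_mul, map_mul, mul_zpow, zpow_add₀ ha, h2]
  push_cast
  rw [← add_assoc, add_sub_cancel_right, zpow_add₀ hb]
  simp only [zpow_natCast]
  ring

end Weight

section Mode

variable {p : ℕ} [Fact p.Prime] {k : Type*} [Field k] [Fintype k] {f : ℕ} [NeZero f]

/-- The operator `∑_λ σ_i(λ)⁻¹ u(λ)`. -/
noncomputable def modeOp (σ : k →+* Fbar p) (i : ZMod f) {A : Type*} [AddCommMonoid A]
    [Module (Fbar p) A] (u : k → A) : A :=
  ∑ x : k, (emb p σ i x)⁻¹ • u x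

theorem sum_emb_inv_mul_pow (σ : k →+* Fbar p) (hk : Fintype.card k = p ^ f) (i : ZMod f) (m : ℕ) :
    ∑ x : k, (emb p σ i x)⁻¹ * σ x ^ m =
      if m ≡ p ^ (f - 1 - i.val) [MOD p ^ f - 1] then -1 else 0 := by
  classical
  have hp := (Fact.out : p.Prime).one_lt
  have hle : p ^ (f - 1 - i.val) ≤ p ^ f - 1 := by
    have h1 : p ^ (f - 1 - i.val) < p ^ f :=
      Nat.pow_lt_pow_right hp (by have := Nat.pos_of_ne_zero (NeZero.ne f); omega)
    omega
  have h1 : ∑ x : k, (emb p σ i x)⁻¹ * σ x ^ m =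
      ∑ x : kˣ, σ ((x : k) ^ (m + (p ^ f - 1 - p ^ (f - 1 - i.val)))) := by
    have h0 : (emb p σ i (0 : k))⁻¹ * σ 0 ^ m = 0 := by simp
    rw [← Finset.add_sum_erase _ _ (Finset.mem_univ (0 : k)), h0, zero_add]
    symm
    refine Finset.sum_bij (fun (x : kˣ) _ => (x : k)) (fun x _ => by simp)
      (fun x _ y _ h => Units.ext h) (fun y hy => ⟨Units.mk0 y (Finset.ne_of_mem_erase hy),
        Finset.mem_univ _, rfl⟩) fun x _ => ?_
    have hx : σ x ≠ 0 := (Units.map (σ : k →* Fbar p) x).ne_zero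
    have h2 : σ x ^ (p ^ f - 1) = 1 := by
      rw [← map_pow, ← hk, FiniteField.pow_card_sub_one_eq_one _ x.ne_zero, map_one]
    rw [emb_apply, map_pow, pow_add, mul_comm]
    congr 1
    rw [eq_comm, inv_eq_iff_eq_inv, eq_comm, inv_eq_of_mul_eq_one_left]
    rw [← pow_add, Nat.add_sub_cancel' hle, h2]
  rw [h1, ← map_sum, FiniteField.sum_pow_units, hk]
  have h3 : p ^ f - 1 ∣ m + (p ^ f - 1 - p ^ (f - 1 - i.val)) ↔
      m ≡ p ^ (f - 1 - i.val) [MOD p ^ f - 1] := by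
    rw [← Nat.modEq_zero_iff_dvd]
    constructor
    · intro h
      have h4 := h.add_right (p ^ (f - 1 - i.val))
      rw [add_assoc, Nat.sub_add_cancel hle, zero_add] at h4
      simpa [Nat.ModEq] using h4
    · intro h
      have h4 := h.add_right (p ^ f - 1 - p ^ (f - 1 - i.val))
      rw [Nat.add_sub_cancel' hle] at h4
      simpa [Nat.ModEq] using h4
  simp only [h3]
  split_ifs <;> simp

theorem modeOp_upper (σ : k →+* Fbar p) (hk : Fintype.card k = p ^ f) (t : ZMod f → ℤ)
    {N : ZMod f → ℕ} {i : ZMod f} {α : ZMod f → ℕ}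
    (hα : natExp p α ≡ p ^ (f - 1 - i.val) [MOD p ^ f - 1])
    (huniq : ∀ a, (∀ l, a l ≤ N l) → natExp p a ≡ p ^ (f - 1 - i.val) [MOD p ^ f - 1] → a = α)
    (n : ZMod f → ℕ) :
    modeOp σ i (fun x => weightRep p σ t N (upper x) (mono p N n)) =
      -(∏ l, ((N l - n l).choose (α l) : Fbar p)) • mono p N (n + α) := by
  unfold modeOp
  simp only [weightRep_upper, Finset.smul_sum, smul_smul]
  rw [Finset.sum_comm]
  have h1 : ∀ a ∈ box N, ∑ x : k, ((emb p σ i x)⁻¹ *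
      ((∏ l, ((N l - n l).choose (a l) : Fbar p)) * σ x ^ natExp p a)) • mono p N (n + a) =
      if a = α then -(∏ l, ((N l - n l).choose (α l) : Fbar p)) • mono p N (n + α) else 0 := by
    intro a ha
    rw [← Finset.sum_smul]
    have h2 : ∑ x : k, (emb p σ i x)⁻¹ *
        ((∏ l, ((N l - n l).choose (a l) : Fbar p)) * σ x ^ natExp p a) =
        (∏ l, ((N l - n l).choose (a l) : Fbar p)) *
          ∑ x : k, (emb p σ i x)⁻¹ * σ x ^ natExp p a := by
      rw [Finset.mul_sum]
      exact Finset.sum_congr rfl fun x _ => by ring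
    rw [h2, sum_emb_inv_mul_pow σ hk]
    split_ifs with h3 h4 h4
    · subst h4
      rw [mul_neg_one]
    · exact absurd (huniq a (mem_box.1 ha) h3) h4
    · exact absurd (h4 ▸ hα) h3
    · rw [mul_zero, zero_smul]
  rw [Finset.sum_congr rfl h1, Finset.sum_ite_eq']
  split_ifs with h
  · rfl
  · rw [mem_box] at h
    push Not at h
    obtain ⟨l, hl⟩ := h
    rw [Finset.prod_eq_zero (Finset.mem_univ l), neg_zero, zero_smul]
    rw [Nat.choose_eq_zero_of_lt (by omega), Nat.cast_zero]

theorem modeOp_lower (σ : k →+* Fbar p) (hk : Fintype.card k = p ^ f) (t : ZMod f → ℤ)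
    {N : ZMod f → ℕ} {i : ZMod f} {α : ZMod f → ℕ}
    (hα : natExp p α ≡ p ^ (f - 1 - i.val) [MOD p ^ f - 1])
    (huniq : ∀ a, (∀ l, a l ≤ N l) → natExp p a ≡ p ^ (f - 1 - i.val) [MOD p ^ f - 1] → a = α)
    {n : ZMod f → ℕ} (hn : ∀ l, n l ≤ N l) :
    modeOp σ i (fun x => weightRep p σ t N (lower x) (mono p N n)) =
      -(∏ l, ((n l).choose (α l) : Fbar p)) • mono p N (n - α) := by
  unfold modeOp
  simp only [weightRep_lower σ t hn, Finset.smul_sum, smul_smul]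
  rw [Finset.sum_comm]
  have h1 : ∀ a ∈ box N, ∑ x : k, ((emb p σ i x)⁻¹ *
      ((∏ l, ((n l).choose (a l) : Fbar p)) * σ x ^ natExp p a)) • mono p N (n - a) =
      if a = α then -(∏ l, ((n l).choose (α l) : Fbar p)) • mono p N (n - α) else 0 := by
    intro a ha
    rw [← Finset.sum_smul]
    have h2 : ∑ x : k, (emb p σ i x)⁻¹ *
        ((∏ l, ((n l).choose (a l) : Fbar p)) * σ x ^ natExp p a) =
        (∏ l, ((n l).choose (a l) : Fbar p)) *
          ∑ x : k, (emb p σ i x)⁻¹ * σ x ^ natExp p a := by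
      rw [Finset.mul_sum]
      exact Finset.sum_congr rfl fun x _ => by ring
    rw [h2, sum_emb_inv_mul_pow σ hk]
    split_ifs with h3 h4 h4
    · subst h4
      rw [mul_neg_one]
    · exact absurd (huniq a (mem_box.1 ha) h3) h4
    · exact absurd (h4 ▸ hα) h3
    · rw [mul_zero, zero_smul]
  rw [Finset.sum_congr rfl h1, Finset.sum_ite_eq']
  split_ifs with h
  · rfl
  · rw [mem_box] at h
    push Not at h
    obtain ⟨l, hl⟩ := h
    rw [Finset.prod_eq_zero (Finset.mem_univ l), neg_zero, zero_smul]
    rw [Nat.choose_eq_zero_of_lt (by have := hn l; omega), Nat.cast_zero]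

end Mode

section Fourier

variable {p : ℕ} [Fact p.Prime] {k : Type*} [Field k] [Fintype k] {f : ℕ} [NeZero f]

theorem exists_natCast_eq_sum_frobenius (σ : k →+* Fbar p) (hk : Fintype.card k = p ^ f) (x : k) :
    ∃ n : ℕ, (n : k) = ∑ l ∈ Finset.range f, x ^ p ^ l := by
  have hchar : CharP k p := (RingHom.charP_iff σ σ.injective p).2 inferInstance
  let _ : Algebra (ZMod p) k := ZMod.algebra k p
  have h1 := FiniteField.algebraMap_trace_eq_sum_pow (ZMod p) k x
  have h2 : Module.finrank (ZMod p) k = f := by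
    have := Module.card_eq_pow_finrank (K := ZMod p) (V := k)
    rw [hk, ZMod.card] at this
    exact (Nat.pow_right_injective (Fact.out : p.Prime).two_le this).symm
  rw [h2, Nat.card_zmod] at h1
  refine ⟨(Algebra.trace (ZMod p) k x).val, ?_⟩
  rw [← h1, ← map_natCast (algebraMap (ZMod p) k), ZMod.natCast_zmod_val]

theorem sum_inv_mul_trace (σ : k →+* Fbar p) (hk : Fintype.card k = p ^ f) (hf : 1 < f) :
    ∑ x : k, x⁻¹ * ∑ l ∈ Finset.range f, x ^ p ^ l = -1 := by
  have hp := (Fact.out : p.Prime).one_lt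
  have hval : (-1 : ZMod f).val = f - 1 := by
    obtain ⟨n, rfl⟩ := Nat.exists_eq_succ_of_ne_zero (NeZero.ne f)
    simp [ZMod.val_neg_one]
  apply σ.injective
  simp only [Finset.mul_sum]
  rw [Finset.sum_comm, map_sum, Finset.sum_eq_single 0]
  · have h := sum_emb_inv_mul_pow σ hk (-1) 1
    rw [if_pos (by rw [hval, Nat.sub_self, pow_zero])] at h
    simp only [emb_apply, hval, Nat.sub_self, pow_zero, pow_one] at h
    simpa using h
  · intro l hl hl0
    have h := sum_emb_inv_mul_pow σ hk (-1) (p ^ l)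
    have hl' := Finset.mem_range.1 hl
    rw [if_neg] at h
    · simp only [emb_apply, hval, Nat.sub_self, pow_zero, pow_one] at h
      simpa using h
    · rw [hval, Nat.sub_self, pow_zero]
      intro hmod
      have h1 : 1 < p ^ l := Nat.one_lt_pow hl0 hp
      have h2 : p ^ l * 2 ≤ p ^ f := by
        calc p ^ l * 2 ≤ p ^ l * p := Nat.mul_le_mul_left _ hp
          _ = p ^ (l + 1) := (pow_succ _ _).symm
          _ ≤ p ^ f := Nat.pow_le_pow_right (by omega) hl'
      have := Nat.ModEq.eq_of_lt_of_lt hmod (by omega) (by omega)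
      omega
  · intro h
    exact absurd (Finset.mem_range.2 (by omega)) h

theorem sum_emb_eq (σ : k →+* Fbar p) (x : k) :
    ∑ i : ZMod f, emb p σ i x = σ (∑ l ∈ Finset.range f, x ^ p ^ l) := by
  rw [ZMod.sum_eq_sum_range, map_sum, ← Finset.sum_range_reflect]
  refine Finset.sum_congr rfl fun l hl => ?_
  have hl' := Finset.mem_range.1 hl
  rw [emb_apply, ZMod.val_cast_of_lt (by omega), show f - 1 - (f - 1 - l) = l by omega, map_pow]

/-- An additive map on `k` is recovered from its semilinear components. -/
theorem eq_neg_sum_emb_smul (σ : k →+* Fbar p) (hk : Fintype.card k = p ^ f) (hf : 1 < f)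
    {B : Type*} [AddCommGroup B] [Module (Fbar p) B] (θ : k →+ B) (x : k) :
    θ x = -∑ i : ZMod f, emb p σ i x • modeOp σ i θ := by
  by_cases hx : x = 0
  · subst hx
    simp
  have h1 : ∑ i : ZMod f, emb p σ i x • modeOp σ i θ =
      ∑ y : k, σ (∑ l ∈ Finset.range f, (x * y⁻¹) ^ p ^ l) • θ y := by
    unfold modeOp
    simp only [Finset.smul_sum, smul_smul]
    rw [Finset.sum_comm]
    refine Finset.sum_congr rfl fun y _ => ?_
    rw [← Finset.sum_smul, ← sum_emb_eq]
    simp only [map_mul, map_inv₀]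
  let e : k ≃ k := Function.Involutive.toPerm (fun y => x * y⁻¹) (fun y => by
    by_cases hy : y = 0
    · simp [hy]
    · field_simp)
  have h2 : ∑ y : k, σ (∑ l ∈ Finset.range f, (x * y⁻¹) ^ p ^ l) • θ y =
      ∑ y : k, σ (∑ l ∈ Finset.range f, y ^ p ^ l) • θ (x * y⁻¹) := by
    rw [← Equiv.sum_comp e]
    refine Finset.sum_congr rfl fun y _ => ?_
    have he : x * (e y)⁻¹ = y := e.left_inv y
    rw [he]
    rfl
  have h3 : ∀ y : k, σ (∑ l ∈ Finset.range f, y ^ p ^ l) • θ (x * y⁻¹) =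
      θ (x * (y⁻¹ * ∑ l ∈ Finset.range f, y ^ p ^ l)) := fun y => by
    obtain ⟨n, hn⟩ := exists_natCast_eq_sum_frobenius σ hk y
    rw [← hn, map_natCast, Nat.cast_smul_eq_nsmul, ← map_nsmul, nsmul_eq_mul]
    congr 1
    ring
  rw [h1, h2, Finset.sum_congr rfl fun y _ => h3 y, ← map_sum, ← Finset.mul_sum,
    sum_inv_mul_trace σ hk hf, mul_neg_one, map_neg, neg_neg]

theorem sum_emb_inv (σ : k →+* Fbar p) (hk : Fintype.card k = p ^ f) (hf : 1 < f) (i : ZMod f) :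
    ∑ x : k, (emb p σ i x)⁻¹ = 0 := by
  have hp := (Fact.out : p.Prime).one_lt
  have h := sum_emb_inv_mul_pow σ hk i 0
  simp only [pow_zero, mul_one] at h
  rw [h, if_neg]
  intro hmod
  have h1 : p ^ (f - 1 - i.val) * 2 ≤ p ^ f := by
    calc p ^ (f - 1 - i.val) * 2 ≤ p ^ (f - 1 - i.val) * p := Nat.mul_le_mul_left _ hp
      _ = p ^ (f - 1 - i.val + 1) := (pow_succ _ _).symm
      _ ≤ p ^ f := Nat.pow_le_pow_right (by omega) (by omega)
  have h3 : 1 ≤ p ^ (f - 1 - i.val) := Nat.one_le_pow _ _ (by omega)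
  have h4 : 2 ^ 2 ≤ p ^ f :=
    (Nat.pow_le_pow_left hp 2).trans (Nat.pow_le_pow_right (by omega) hf)
  have := Nat.ModEq.eq_of_lt_of_lt hmod (by omega) (by omega)
  omega

end Fourier

section Generation

variable {p : ℕ} [Fact p.Prime] {k : Type*} [Field k] [Fintype k] {f : ℕ} [NeZero f]
variable {O : Type*} [AddCommGroup O] (res : O →+ k) (sec : k → O)

theorem unipotent_generation_comm (σ : k →+* Fbar p) (hk : Fintype.card k = p ^ f) (hf : 1 < f)
    (hsec : ∀ l, res (sec l) = l) {A : Type*} [CommRing A] [Algebra (Fbar p) A]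
    [Module.Finite (Fbar p) A] (u : O → A) (hu : ∀ x y, u (x + y) = u x * u y)
    (hker : ∀ x, res x = 0 → u x = 1 ∨ ∃ y, x = p • y) (hnil : ∀ x, IsNilpotent (u x - 1))
    (htop : Algebra.adjoin (Fbar p) (Set.range u) = ⊤) :
    Algebra.adjoin (Fbar p) (Set.range fun i : ZMod f => modeOp σ i (fun l => u (sec l))) = ⊤ := by
  set X : ZMod f → A := fun i => modeOp σ i (fun l => u (sec l)) with hX
  let I : Ideal A := Ideal.span (Set.range fun x => u x - 1)
  let J : Ideal A := Ideal.span (Set.range X)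
  have hnoeth : IsNoetherianRing A := IsNoetherianRing.of_finite (Fbar p) A
  have hInil : I ≤ nilradical A := Ideal.span_le.2 (by
    rintro _ ⟨x, rfl⟩
    exact mem_nilradical.2 (hnil x))
  have hXI : ∀ i, X i = modeOp σ i (fun l => u (sec l) - 1) := fun i => by
    simp only [hX, modeOp, smul_sub, Finset.sum_sub_distrib]
    rw [← Finset.sum_smul, sum_emb_inv σ hk hf, zero_smul, sub_zero]
  have hXmem : ∀ i, X i ∈ I := fun i => by
    rw [hXI]
    refine Ideal.sum_mem _ fun l _ => ?_
    rw [Algebra.smul_def]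
    exact I.mul_mem_left _ (Ideal.subset_span ⟨_, rfl⟩)
  have hIJ : I ≤ J ⊔ I • I := by
    let θ : O →+ A ⧸ (I • I) := AddMonoidHom.mk' (fun x => Ideal.Quotient.mk _ (u x - 1)) (by
      intro x y
      rw [← map_add, Ideal.Quotient.eq, hu]
      have : u x * u y - 1 - (u x - 1 + (u y - 1)) = (u x - 1) * (u y - 1) := by ring
      rw [this]
      exact Ideal.mul_mem_mul (Ideal.subset_span ⟨_, rfl⟩) (Ideal.subset_span ⟨_, rfl⟩))
    have hθker : ∀ x, res x = 0 → θ x = 0 := by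
      intro x hx
      rcases hker x hx with h | ⟨y, rfl⟩
      · change Ideal.Quotient.mk _ (u x - 1) = 0
        rw [h, sub_self, map_zero]
      · rw [map_nsmul, nsmul_eq_mul]
        have : ((p : ℕ) : A ⧸ (I • I)) = 0 := by
          rw [← map_natCast (Ideal.Quotient.mk (I • I)), ← map_natCast (algebraMap (Fbar p) A),
            CharP.cast_eq_zero, map_zero, map_zero]
        rw [this, zero_mul]
    have hθres : ∀ x y, res x = res y → θ x = θ y := fun x y h => by
      rw [← sub_eq_zero, ← map_sub]
      exact hθker _ (by rw [map_sub, h, sub_self])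
    let θ' : k →+ A ⧸ (I • I) := AddMonoidHom.mk' (fun l => θ (sec l)) (fun l m => by
      rw [← map_add]
      exact hθres _ _ (by simp [hsec]))
    refine Ideal.span_le.2 ?_
    rintro _ ⟨x, rfl⟩
    have h1 : θ x = θ' (res x) := hθres _ _ (hsec _).symm
    rw [eq_neg_sum_emb_smul σ hk hf θ'] at h1
    have h2 : ∀ i, modeOp σ i θ' = Ideal.Quotient.mk (I • I) (X i) := fun i => by
      rw [hXI]
      unfold modeOp
      rw [map_sum]
      refine Finset.sum_congr rfl fun l _ => ?_
      rw [← Ideal.Quotient.mkₐ_eq_mk (Fbar p), map_smul]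
      rfl
    simp only [h2] at h1
    have h3 : -∑ i : ZMod f, emb p σ i (res x) • Ideal.Quotient.mk (I • I) (X i) =
        Ideal.Quotient.mk (I • I) (-∑ i : ZMod f, emb p σ i (res x) • X i) := by
      rw [← Ideal.Quotient.mkₐ_eq_mk (Fbar p), map_neg, map_sum]
      simp only [map_smul]
    rw [h3] at h1
    have h4 := Ideal.Quotient.eq.1 h1
    have h5 : -∑ i : ZMod f, emb p σ i (res x) • X i ∈ J := by
      refine J.neg_mem (J.sum_mem fun i _ => ?_)
      rw [Algebra.smul_def]
      exact J.mul_mem_left _ (Ideal.subset_span ⟨i, rfl⟩)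
    have h6 := (J ⊔ I • I).add_mem (Ideal.mem_sup_right h4) (Ideal.mem_sup_left h5)
    rwa [sub_add_cancel] at h6
  have hIJ' : I ≤ J := Submodule.le_of_le_smul_of_le_jacobson_bot
    (IsNoetherian.noetherian I) (hInil.trans Ideal.radical_le_jacobson) hIJ
  let S := Algebra.adjoin (Fbar p) (Set.range X)
  have hfin : Module.Finite S A := Module.Finite.of_restrictScalars_finite (Fbar p) S A
  let XS : ZMod f → S := fun i => ⟨X i, Algebra.subset_adjoin ⟨i, rfl⟩⟩
  let JS : Ideal S := Ideal.span (Set.range XS)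
  have hJSnil : JS ≤ nilradical S := Ideal.span_le.2 (by
    rintro _ ⟨i, rfl⟩
    obtain ⟨n, hn⟩ := mem_nilradical.1 (hInil (hXmem i))
    exact mem_nilradical.2 ⟨n, Subtype.ext hn⟩)
  have hdec : ∀ a : A, ∃ c : Fbar p, a - algebraMap (Fbar p) A c ∈ I := by
    intro a
    have ha : a ∈ Algebra.adjoin (Fbar p) (Set.range u) := htop ▸ Algebra.mem_top
    induction ha using Algebra.adjoin_induction with
    | mem x hx =>
      obtain ⟨y, rfl⟩ := hx
      exact ⟨1, by rw [map_one]; exact Ideal.subset_span ⟨y, rfl⟩⟩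
    | algebraMap c => exact ⟨c, by simp⟩
    | add x y _ _ hx hy =>
      obtain ⟨c, hc⟩ := hx
      obtain ⟨d, hd⟩ := hy
      refine ⟨c + d, ?_⟩
      rw [map_add, add_sub_add_comm]
      exact I.add_mem hc hd
    | mul x y _ _ hx hy =>
      obtain ⟨c, hc⟩ := hx
      obtain ⟨d, hd⟩ := hy
      refine ⟨c * d, ?_⟩
      have : x * y - algebraMap (Fbar p) A (c * d) = y * (x - algebraMap (Fbar p) A c) +
          algebraMap (Fbar p) A c * (y - algebraMap (Fbar p) A d) := by
        rw [map_mul]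
        ring
      rw [this]
      exact I.add_mem (I.mul_mem_left _ hc) (I.mul_mem_left _ hd)
  have hle : (⊤ : Submodule S A) ≤ LinearMap.range (Algebra.linearMap S A) := by
    refine Submodule.le_of_le_smul_of_le_jacobson_bot (I := JS) (Module.Finite.fg_top)
      (hJSnil.trans Ideal.radical_le_jacobson) ?_
    intro a _
    obtain ⟨c, hc⟩ := hdec a
    have h1 : ∀ b ∈ J, b ∈ JS • (⊤ : Submodule S A) := by
      intro b hb
      induction hb using Submodule.span_induction with
      | mem x hx =>
        obtain ⟨i, rfl⟩ := hx
        have := Submodule.smul_mem_smul (I := JS) (N := (⊤ : Submodule S A))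
          (Ideal.subset_span ⟨i, rfl⟩ : XS i ∈ JS) (Submodule.mem_top (x := (1 : A)))
        rw [Algebra.smul_def, mul_one] at this
        exact this
      | zero => exact Submodule.zero_mem _
      | add x y _ _ hx hy => exact Submodule.add_mem _ hx hy
      | smul r x _ hx =>
        refine Submodule.smul_induction_on hx (fun s hs n _ => ?_) (fun x y hx hy => ?_)
        · have : r • s • n = s • (r * n) := by
            rw [smul_eq_mul, mul_smul_comm]
          rw [this]
          exact Submodule.smul_mem_smul hs Submodule.mem_top
        · rw [smul_add]
          exact Submodule.add_mem _ hx hy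
    have h2 := h1 _ (hIJ' hc)
    have h3 : algebraMap (Fbar p) A c ∈ LinearMap.range (Algebra.linearMap S A) :=
      ⟨algebraMap (Fbar p) S c, rfl⟩
    have := Submodule.add_mem_sup h3 h2
    rwa [add_sub_cancel] at this
  rw [eq_top_iff]
  intro a _
  obtain ⟨s, rfl⟩ := hle (Submodule.mem_top (x := a))
  exact s.2

open scoped IsMulCommutative in
/-- Unipotent operators lie in the algebra generated by their modes. -/
theorem unipotent_mem_adjoin (σ : k →+* Fbar p) (hk : Fintype.card k = p ^ f) (hf : 1 < f)
    (hsec : ∀ l, res (sec l) = l) {A : Type*} [Ring A] [Algebra (Fbar p) A]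
    [Module.Finite (Fbar p) A] (u : O → A) (hu : ∀ x y, u (x + y) = u x * u y)
    (hker : ∀ x, res x = 0 → u x = 1 ∨ ∃ y, x = p • y) (hnil : ∀ x, IsNilpotent (u x - 1))
    (x : O) :
    u x ∈ Algebra.adjoin (Fbar p)
      (Set.range fun i : ZMod f => modeOp σ i (fun l => u (sec l))) := by
  have hcomm : ∀ a ∈ Set.range u, ∀ b ∈ Set.range u, a * b = b * a := by
    rintro _ ⟨x, rfl⟩ _ ⟨y, rfl⟩
    rw [← hu, ← hu, add_comm]
  let A' := Algebra.adjoin (Fbar p) (Set.range u)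
  have : IsMulCommutative A' := Algebra.isMulCommutative_adjoin (Fbar p) hcomm
  let u' : O → A' := fun x => ⟨u x, Algebra.subset_adjoin ⟨x, rfl⟩⟩
  have hfin : Module.Finite (Fbar p) A' := by
    have : IsNoetherian (Fbar p) A := inferInstance
    exact Module.Finite.of_injective A'.val.toLinearMap Subtype.val_injective
  have htop : Algebra.adjoin (Fbar p) (Set.range u') = ⊤ := by
    rw [← Algebra.adjoin_adjoin_coe_preimage (R := Fbar p) (s := Set.range u)]
    congr 1
    ext a
    constructor
    · rintro ⟨y, rfl⟩
      exact ⟨y, rfl⟩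
    · rintro ⟨y, hy⟩
      exact ⟨y, Subtype.ext hy⟩
  have key := unipotent_generation_comm (A := A') res sec σ hk hf hsec u'
    (fun x y => Subtype.ext (hu x y)) (fun x hx => (hker x hx).imp (fun h => Subtype.ext h) id)
    (fun x => by
      obtain ⟨n, hn⟩ := hnil x
      exact ⟨n, Subtype.ext hn⟩) htop
  have h1 : u' x ∈ Algebra.adjoin (Fbar p)
      (Set.range fun i : ZMod f => modeOp σ i (fun l => u' (sec l))) := key ▸ Algebra.mem_top
  have h2 : A'.val (u' x) ∈ (Algebra.adjoin (Fbar p)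
      (Set.range fun i : ZMod f => modeOp σ i (fun l => u' (sec l)))).map A'.val :=
    Subalgebra.mem_map.2 ⟨u' x, h1, rfl⟩
  rw [AlgHom.map_adjoin, ← Set.range_comp] at h2
  have h3 : (A'.val ∘ fun i : ZMod f => modeOp σ i (fun l => u' (sec l))) =
      fun i : ZMod f => modeOp σ i (fun l => u (sec l)) := by
    ext1 i
    simp only [Function.comp_apply, modeOp, map_sum, map_smul]
    rfl
  rwa [h3] at h2

end Generation

section SmallWeights

variable {p : ℕ} [Fact p.Prime] {k : Type*} [Field k] [Fintype k] {f : ℕ} [NeZero f]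

theorem cast_pow_sub_one (p f : ℕ) [Fact p.Prime] :
    ((p ^ f - 1 : ℕ) : ℤ) = (p : ℤ) ^ f - 1 := by
  rw [Nat.cast_sub (Nat.one_le_pow _ _ (Fact.out : p.Prime).pos)]
  push_cast
  rfl

/-- Natural tuples that are small enough are determined by their value modulo `p^f - 1`. -/
theorem natExp_unique {a b : ZMod f → ℕ} (ha : ∀ i, a i + 1 ≤ p) (ha' : ∃ i, a i + 1 ≠ p)
    (hb : ∀ i, b i + 1 ≤ p) (hb' : ∃ i, b i + 1 ≠ p)
    (h : natExp p a ≡ natExp p b [MOD p ^ f - 1]) : a = b := by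
  have h1 : detExp p (fun i => (a i : ℤ)) ≡ detExp p (fun i => (b i : ℤ))
      [ZMOD (p : ℤ) ^ f - 1] := by
    rw [← cast_natExp, ← cast_natExp, ← cast_pow_sub_one]
    exact_mod_cast (Int.natCast_modEq_iff.2 h)
  have h2 := digits_unique (b := 0) (Fact.out : p.Prime).one_lt
    (fun i => ⟨by positivity, by have := ha i; omega⟩)
    (by obtain ⟨i, hi⟩ := ha'; exact ⟨i, by omega⟩)
    (fun i => ⟨by positivity, by have := hb i; omega⟩)
    (by obtain ⟨i, hi⟩ := hb'; exact ⟨i, by omega⟩) h1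
  ext i
  exact_mod_cast congrFun h2 i

theorem single_unique (hf : 1 < f) {s : ZMod f → ℕ} (hs : ∀ i, s i + 2 ≤ p) (i : ZMod f)
    (a : ZMod f → ℕ) (ha : ∀ l, a l ≤ s l)
    (h : natExp p a ≡ p ^ (f - 1 - i.val) [MOD p ^ f - 1]) : a = Pi.single i 1 := by
  have hp := (Fact.out : p.Prime).two_le
  refine natExp_unique (p := p) (fun l => ?_) ⟨0, ?_⟩ (fun l => ?_) ⟨i + 1, ?_⟩ ?_
  · have := ha l
    have := hs l
    omega
  · have := ha 0
    have := hs 0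
    omega
  · by_cases hl : l = i
    · subst hl
      rw [Pi.single_eq_same]
      omega
    · rw [Pi.single_eq_of_ne hl]
      omega
  · rw [Pi.single_eq_of_ne (ne_add_one hf i)]
    omega
  · rwa [natExp_single, mul_one]

theorem prod_choose_single (n : ZMod f → ℕ) (i : ZMod f) :
    ∏ l, ((n l).choose ((Pi.single i 1 : ZMod f → ℕ) l) : Fbar p) = n i := by
  rw [Finset.prod_eq_single i]
  · simp
  · intro l _ hl
    simp [hl]
  · simp

theorem modeOp_apply (σ : k →+* Fbar p) (i : ZMod f) {M N : Type*} [AddCommMonoid M]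
    [Module (Fbar p) M] [AddCommMonoid N] [Module (Fbar p) N] (u : k → M →ₗ[Fbar p] N) (v : M) :
    modeOp σ i u v = modeOp σ i (fun x => u x v) := by
  simp [modeOp]

theorem map_modeOp (σ : k →+* Fbar p) (i : ZMod f) {M N : Type*} [AddCommMonoid M]
    [Module (Fbar p) M] [AddCommMonoid N] [Module (Fbar p) N] (φ : M →ₗ[Fbar p] N) (u : k → M) :
    φ (modeOp σ i u) = modeOp σ i (fun x => φ (u x)) := by
  simp [modeOp]

theorem modeOp_const (σ : k →+* Fbar p) (hk : Fintype.card k = p ^ f) (hf : 1 < f) (i : ZMod f)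
    {M : Type*} [AddCommMonoid M] [Module (Fbar p) M] (v : M) :
    modeOp σ i (fun _ => v) = 0 := by
  unfold modeOp
  rw [← Finset.sum_smul, sum_emb_inv σ hk hf, zero_smul]

theorem natCast_ne_zero_of_lt {a : ℕ} (h0 : a ≠ 0) (h : a < p) : (a : Fbar p) ≠ 0 := by
  intro h1
  rw [CharP.cast_eq_zero_iff (Fbar p) p] at h1
  exact absurd (Nat.le_of_dvd (Nat.pos_of_ne_zero h0) h1) (by omega)

/-- A family of operators acting on monomials like the modes of the upper unipotent matrices. -/
def IsUpperModes (s : ZMod f → ℕ) (Z : ZMod f → Module.End (Fbar p) (WeightSpace p s)) : Prop :=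
  ∀ i n, Z i (mono p s n) = -((s i - n i : ℕ) : Fbar p) • mono p s (n + Pi.single i 1)

theorem IsUpperModes.mem_of_stable {s : ZMod f → ℕ}
    {Z : ZMod f → Module.End (Fbar p) (WeightSpace p s)} (hs : ∀ i, s i + 2 ≤ p) (hZ : IsUpperModes s Z)
    (M : Submodule (Fbar p) (WeightSpace p s)) (hM : ∀ i, ∀ v ∈ M, Z i v ∈ M)
    (h0 : mono p s 0 ∈ M) (v : WeightSpace p s) : v ∈ M := by
  have key : ∀ N : ℕ, ∀ n : ZMod f → ℕ, (∀ i, n i ≤ s i) → ∑ i, n i = N → mono p s n ∈ M := by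
    intro N
    induction N with
    | zero =>
      intro n _ hN
      have : n = 0 := funext fun i => (Finset.sum_eq_zero_iff.1 hN) i (Finset.mem_univ i)
      rwa [this]
    | succ N ih =>
      intro n hn hN
      obtain ⟨i, hi⟩ : ∃ i, n i ≠ 0 := by
        by_contra! h
        simp [h] at hN
      have e : n - Pi.single i 1 + Pi.single i 1 = n := by
        ext l
        by_cases hl : l = i
        · subst hl
          simp
          omega
        · simp [hl]
      have h1 : mono p s (n - Pi.single i 1) ∈ M := by
        refine ih _ (fun l => ?_) ?_
        · have := hn l
          simp only [Pi.sub_apply]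
          omega
        · rw [← e] at hN
          simp only [Pi.add_apply, Finset.sum_add_distrib] at hN
          have h5 : ∑ l, (Pi.single i 1 : ZMod f → ℕ) l = 1 := by simp
          omega
      have h2 := hZ i (n - Pi.single i 1)
      rw [e] at h2
      have h3 := hM i _ h1
      rw [h2] at h3
      have h4 : -((s i - (n - Pi.single i 1 : ZMod f → ℕ) i : ℕ) : Fbar p) ≠ 0 := by
        rw [neg_ne_zero]
        have := hn i
        have := hs i
        refine natCast_ne_zero_of_lt ?_ ?_ <;> simp only [Pi.sub_apply, Pi.single_eq_same] <;> omega
      exact (M.smul_mem_iff h4).1 h3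
  rw [sum_monoCoeff v]
  exact M.sum_mem fun n hn => M.smul_mem _ (key _ n (mem_box.1 hn) rfl)

variable (σ : k →+* Fbar p) (hk : Fintype.card k = p ^ f) (hf : 1 < f)
  {s : ZMod f → ℕ} (hs : ∀ i, s i + 2 ≤ p) (d : ZMod f → ℤ)

include hk hf hs

theorem modeOp_upper_small (i : ZMod f) (n : ZMod f → ℕ) :
    modeOp σ i (fun x => weightRep p σ d s (upper x) (mono p s n)) =
      -((s i - n i : ℕ) : Fbar p) • mono p s (n + Pi.single i 1) := by
  rw [modeOp_upper σ hk d (α := Pi.single i 1) (by rw [natExp_single, mul_one])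
    (single_unique hf hs i)]
  congr 2
  exact prod_choose_single (fun l => s l - n l) i

theorem isUpperModes :
    IsUpperModes s fun i => modeOp σ i (fun x => weightRep p σ d s (upper x)) := fun i n => by
  rw [modeOp_apply]
  exact modeOp_upper_small σ hk hf hs d i n

theorem modeOp_lower_small (i : ZMod f) {n : ZMod f → ℕ} (hn : ∀ l, n l ≤ s l) :
    modeOp σ i (fun x => weightRep p σ d s (lower x) (mono p s n)) =
      -(n i : Fbar p) • mono p s (n - Pi.single i 1) := by
  rw [modeOp_lower σ hk d (α := Pi.single i 1) (by rw [natExp_single, mul_one])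
    (single_unique hf hs i) hn]
  congr 2
  exact prod_choose_single n i

/-- The vectors fixed by the lower unipotent matrices form a line. -/
theorem eq_smul_of_fixed {v : WeightSpace p s}
    (hv : ∀ x, weightRep p σ d s (lower x) v = v) : v = monoCoeff v 0 • mono p s 0 := by
  refine eq_smul_mono fun m hm h0 => ?_
  by_contra hm0
  obtain ⟨i, hi⟩ : ∃ i, m i ≠ 0 := by
    by_contra! h
    exact hm0 (funext h)
  have h1 : modeOp σ i (fun x => weightRep p σ d s (lower x) v) = 0 := by
    simp only [hv]
    exact modeOp_const σ hk hf i v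
  rw [← modeOp_apply, sum_monoCoeff v, map_sum] at h1
  have h2 := congrArg (monoCoeffHom (m - Pi.single i 1)) h1
  rw [map_sum, map_zero, Finset.sum_eq_single m] at h2
  · rw [map_smul, modeOp_apply, modeOp_lower_small σ hk hf hs d i hm, map_smul, map_smul] at h2
    have h3 : monoCoeffHom (m - Pi.single i 1) (mono p s (m - Pi.single i 1)) = 1 := by
      refine (monoCoeff_mono fun l => ?_).trans (if_pos rfl)
      have := hm l
      simp only [Pi.sub_apply]
      omega
    rw [h3, smul_eq_mul, smul_eq_mul, mul_one, mul_neg, neg_eq_zero, mul_eq_zero] at h2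
    rcases h2 with h2 | h2
    · exact h0 h2
    · refine natCast_ne_zero_of_lt hi ?_ h2
      have := hm i
      have := hs i
      omega
  · intro n hn hnm
    rw [map_smul, modeOp_apply, modeOp_lower_small σ hk hf hs d i (mem_box.1 hn), map_smul,
      map_smul]
    by_cases hni : n i = 0
    · rw [hni]
      simp
    · have h3 : monoCoeffHom (m - Pi.single i 1) (mono p s (n - Pi.single i 1)) = 0 := by
        refine (monoCoeff_mono fun l => ?_).trans (if_neg fun h => hnm ?_)
        · have := mem_box.1 hn l
          simp only [Pi.sub_apply]
          omega
        · ext l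
          have h4 := congrFun h l
          simp only [Pi.sub_apply] at h4
          by_cases hl : l = i
          · subst hl
            rw [Pi.single_eq_same] at h4
            omega
          · rw [Pi.single_eq_of_ne hl] at h4
            omega
      rw [h3, smul_zero, smul_zero]
  · intro h
    exact absurd (mem_box.2 hm) h

/-- The vector `⨂ y^{s_i}` generates the representation under the upper unipotent matrices. -/
theorem mem_of_upper_stable (M : Submodule (Fbar p) (WeightSpace p s))
    (hM : ∀ x, ∀ v ∈ M, weightRep p σ d s (upper x) v ∈ M) (h0 : mono p s 0 ∈ M)
    (v : WeightSpace p s) : v ∈ M := by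
  refine (isUpperModes σ hk hf hs d).mem_of_stable hs M (fun i v hv => ?_) h0 v
  rw [modeOp_apply]
  exact M.sum_mem fun x _ => M.smul_mem _ (hM x _ hv)

omit hf hs in
theorem zpow_eq_iff {m n : ℤ} :
    (∀ x : kˣ, σ x ^ m = σ x ^ n) ↔ m ≡ n [ZMOD (p : ℤ) ^ f - 1] := by
  constructor
  · intro h
    obtain ⟨g, hg⟩ := IsCyclic.exists_generator (α := kˣ)
    have h1 := h g
    rw [← map_zpow₀, ← map_zpow₀] at h1
    have h2 := σ.injective h1
    rw [← Units.val_zpow_eq_zpow_val, ← Units.val_zpow_eq_zpow_val, Units.val_inj] at h2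
    have h3 := zpow_eq_zpow_iff_modEq.1 h2
    rwa [orderOf_eq_card_of_forall_mem_zpowers hg, Nat.card_units, Nat.card_eq_fintype_card, hk,
      cast_pow_sub_one] at h3
  · intro h x
    exact map_zpow_eq_of_modEq σ (by rw [Nat.card_eq_fintype_card, hk]) h x

omit [Fintype k] hk hf hs in
theorem monoCoeff_torus (N : ZMod f → ℕ) (v : WeightSpace p N) {m : ZMod f → ℕ}
    (hm : ∀ i, m i ≤ N i) (a b : kˣ) :
    monoCoeff (weightRep p σ d N (torus a b) v) m =
      (σ a ^ (detExp p d + natExp p m) * σ b ^ (detExp p d + natExp p N - natExp p m)) *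
        monoCoeff v m := by
  have : (monoCoeffHom m).comp (weightRep p σ d N (torus a b)) =
      (σ a ^ (detExp p d + natExp p m) * σ b ^ (detExp p d + natExp p N - natExp p m)) •
        monoCoeffHom m := by
    refine hom_ext_mono fun n hn => ?_
    rw [LinearMap.comp_apply, weightRep_torus σ d N hn, map_smul, LinearMap.smul_apply]
    have h1 : monoCoeffHom m (mono p N n) = if m = n then 1 else 0 := monoCoeff_mono hn
    rw [h1]
    split_ifs with h
    · rw [h]
    · rw [smul_zero, smul_zero]
  exact DFunLike.congr_fun this v

omit hf hs in
/-- The weight of the first coordinate of the torus determines the possible monomials. -/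
theorem modEq_of_monoCoeff {N : ZMod f → ℕ} {v : WeightSpace p N} {A : ℤ}
    (hv : ∀ a : kˣ, weightRep p σ d N (torus a 1) v = σ a ^ A • v) {m : ZMod f → ℕ}
    (hm : ∀ i, m i ≤ N i) (h0 : monoCoeff v m ≠ 0) :
    A ≡ detExp p d + natExp p m [ZMOD (p : ℤ) ^ f - 1] := by
  rw [← zpow_eq_iff σ hk]
  intro x
  have h1 := monoCoeff_torus σ d N v hm x 1
  rw [hv, monoCoeff_smul] at h1
  simpa using mul_right_cancel₀ h0 h1

omit hf in
theorem eq_smul_mono_of_weight {v : WeightSpace p s} {A : ℤ}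
    (hv : ∀ a : kˣ, weightRep p σ d s (torus a 1) v = σ a ^ A • v) {n : ZMod f → ℕ}
    (hn : ∀ i, n i + 1 ≤ p) (hn' : ∃ i, n i + 1 ≠ p)
    (hA : A ≡ detExp p d + natExp p n [ZMOD (p : ℤ) ^ f - 1]) : v = monoCoeff v n • mono p s n := by
  refine eq_smul_mono fun m hm h0 => ?_
  have h1 := (modEq_of_monoCoeff σ hk d hv hm h0).symm.trans hA
  refine natExp_unique (p := p) (fun i => ?_) ⟨0, ?_⟩ hn hn' ?_
  · have := hm i
    have := hs i
    omega
  · have := hm 0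
    have := hs 0
    omega
  · have := Int.ModEq.add_left_cancel' _ h1
    rw [← cast_pow_sub_one] at this
    exact Int.natCast_modEq_iff.1 this

omit hs in
/-- An additive function on `k` that is an eigenfunction for `kˣ` has one of the weights of the
embeddings. -/
theorem exists_of_additive_eigenfunction (c : k →+ Fbar p) (h1 : c 1 ≠ 0) {A : ℤ}
    (hA : ∀ x : kˣ, c x = σ x ^ A * c 1) :
    ∃ i : ZMod f, A ≡ (p : ℤ) ^ (f - 1 - i.val) [ZMOD (p : ℤ) ^ f - 1] := by
  have hq := pow_sub_one_pos (f := f) (Fact.out : p.Prime).one_lt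
  obtain ⟨m, hm0, hm⟩ : ∃ m : ℕ, m ≠ 0 ∧ (m : ℤ) ≡ A [ZMOD (p : ℤ) ^ f - 1] := by
    obtain ⟨n, hn⟩ := Int.eq_ofNat_of_zero_le (Int.emod_nonneg A hq.ne')
    have h3 : ((n : ℕ) : ℤ) ≡ A [ZMOD (p : ℤ) ^ f - 1] := hn ▸ Int.mod_modEq _ _
    refine ⟨n + (p ^ f - 1), ?_, ?_⟩
    · have := cast_pow_sub_one p f
      omega
    · push_cast [cast_pow_sub_one]
      simpa using h3
  have hc : ∀ x : k, c x = σ x ^ m * c 1 := by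
    intro x
    by_cases hx : x = 0
    · rw [hx, map_zero, map_zero, zero_pow hm0, zero_mul]
    · have h2 := hA (Units.mk0 x hx)
      rw [← (zpow_eq_iff σ hk).2 hm (Units.mk0 x hx), zpow_natCast] at h2
      exact h2
  by_contra! hne
  apply h1
  have h2 := eq_neg_sum_emb_smul σ hk hf c 1
  rw [h2, neg_eq_zero]
  refine Finset.sum_eq_zero fun i _ => ?_
  have h3 : modeOp σ i c = 0 := by
    unfold modeOp
    have : ∀ x : k, (emb p σ i x)⁻¹ • c x = ((emb p σ i x)⁻¹ * σ x ^ m) * c 1 := fun x => by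
      rw [hc x, smul_eq_mul, mul_assoc]
    rw [Finset.sum_congr rfl fun x _ => this x, ← Finset.sum_mul, sum_emb_inv_mul_pow σ hk,
      if_neg, zero_mul]
    intro hmod
    apply hne i
    refine hm.symm.trans ?_
    have := Int.natCast_modEq_iff.2 hmod
    rw [cast_pow_sub_one] at this
    exact_mod_cast this
  rw [h3, smul_zero]

end SmallWeights

section Congruence

variable {p : ℕ} [Fact p.Prime] {K : Type*} [Field K] [Algebra ℚ_[p] K]
  [FiniteDimensional ℚ_[p] K] [Algebra ℤ_[p] K] [IsScalarTower ℤ_[p] ℚ_[p] K]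

theorem mem_congrSub {n : ℕ} {g : GLO p K} :
    g ∈ congrSub p K n ↔ ∀ i j, g i j - (1 : Matrix (Fin 2) (Fin 2) (OK p K)) i j ∈
      IsLocalRing.maximalIdeal (OK p K) ^ n := by
  unfold congrSub
  rw [MonoidHom.mem_ker, Units.ext_iff, ← Matrix.ext_iff]
  refine forall_congr' fun i => forall_congr' fun j => ?_
  rw [← Ideal.Quotient.eq]
  by_cases h : i = j
  · subst h
    simp [Matrix.GeneralLinearGroup.map_apply]
  · simp [Matrix.GeneralLinearGroup.map_apply, Matrix.one_apply_ne h]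

theorem lower_mem_congrSub {n : ℕ} {x : OK p K} :
    lower x ∈ congrSub p K n ↔ x ∈ IsLocalRing.maximalIdeal (OK p K) ^ n := by
  rw [mem_congrSub]
  simp [Fin.forall_fin_two]

theorem upper_mem_congrSub {n : ℕ} {x : OK p K} :
    upper x ∈ congrSub p K n ↔ x ∈ IsLocalRing.maximalIdeal (OK p K) ^ n := by
  rw [mem_congrSub]
  simp [Fin.forall_fin_two]

theorem torus_mem_congrSub {n : ℕ} {a b : (OK p K)ˣ} :
    torus a b ∈ congrSub p K n ↔ (a : OK p K) - 1 ∈ IsLocalRing.maximalIdeal (OK p K) ^ n ∧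
      (b : OK p K) - 1 ∈ IsLocalRing.maximalIdeal (OK p K) ^ n := by
  rw [mem_congrSub]
  simp [Fin.forall_fin_two]

theorem congrSub_antitone {m n : ℕ} (h : m ≤ n) : congrSub p K n ≤ congrSub p K m := fun _ hg =>
  mem_congrSub.2 fun i j => Ideal.pow_le_pow_right h (mem_congrSub.1 hg i j)

theorem red_upper (x : OK p K) :
    red p K (upper x) = upper (IsLocalRing.residue (OK p K) x) := map_upper _ x

theorem red_lower (x : OK p K) :
    red p K (lower x) = lower (IsLocalRing.residue (OK p K) x) := map_lower _ x

theorem red_torus (a b : (OK p K)ˣ) : red p K (torus a b) =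
    torus (Units.map (IsLocalRing.residue (OK p K) : OK p K →* ResK p K) a)
      (Units.map (IsLocalRing.residue (OK p K) : OK p K →* ResK p K) b) := map_torus _ a b

theorem isUnit_of_sub_one_mem {a : OK p K}
    (h : a - 1 ∈ IsLocalRing.maximalIdeal (OK p K)) : IsUnit a := by
  by_contra ha
  have h2 := Ideal.sub_mem _ ((IsLocalRing.mem_maximalIdeal a).2 ha) h
  rw [sub_sub_cancel] at h2
  exact (Ideal.ne_top_iff_one _).1 (IsLocalRing.maximalIdeal.isMaximal _).ne_top h2

theorem eq_lower_mul_torus_mul_upper {R : Type*} [CommRing R] (g : GL (Fin 2) R) {a b : Rˣ}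
    (ha : (a : R) = g 0 0) (hb : (b : R) = g 1 1 - ↑a⁻¹ * g 0 1 * g 1 0) :
    g = lower (g 1 0 * ↑a⁻¹) * torus a b * upper (↑a⁻¹ * g 0 1) := by
  have h2 : (↑a⁻¹ : R) * a = 1 := a.inv_mul
  ext i j
  fin_cases i <;> fin_cases j <;>
    simp [Matrix.mul_apply, Fin.sum_univ_two, ha.symm]
  rw [hb]
  ring

/-- The Iwahori decomposition of the first congruence subgroup. -/
theorem exists_iwahori {g : GLO p K} (hg : g ∈ congrSub p K 1) :
    ∃ a b : (OK p K)ˣ, (a : OK p K) = g 0 0 ∧ lower (g 1 0 * ↑a⁻¹) ∈ congrSub p K 1 ∧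
      torus a b ∈ congrSub p K 1 ∧ upper (↑a⁻¹ * g 0 1) ∈ congrSub p K 1 ∧
      g = lower (g 1 0 * ↑a⁻¹) * torus a b * upper (↑a⁻¹ * g 0 1) := by
  have h := mem_congrSub.1 hg
  simp only [pow_one] at h
  have h00 := h 0 0
  have h01 := h 0 1
  have h10 := h 1 0
  have h11 := h 1 1
  simp only [Matrix.one_apply_eq, ne_eq, zero_ne_one, one_ne_zero, not_false_eq_true,
    Matrix.one_apply_ne, sub_zero] at h00 h01 h10 h11
  obtain ⟨a, ha⟩ := isUnit_of_sub_one_mem h00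
  have hb : g 1 1 - ↑a⁻¹ * g 0 1 * g 1 0 - 1 ∈ IsLocalRing.maximalIdeal (OK p K) := by
    have : g 1 1 - ↑a⁻¹ * g 0 1 * g 1 0 - 1 = (g 1 1 - 1) - ↑a⁻¹ * g 0 1 * g 1 0 := by ring
    rw [this]
    exact Ideal.sub_mem _ h11 (Ideal.mul_mem_left _ _ h10)
  obtain ⟨b, hb'⟩ := isUnit_of_sub_one_mem hb
  refine ⟨a, b, ha, ?_, ?_, ?_, ?_⟩
  · rw [lower_mem_congrSub, pow_one]
    exact Ideal.mul_mem_right _ _ h10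
  · rw [torus_mem_congrSub, pow_one]
    exact ⟨by rwa [ha], by rwa [hb']⟩
  · rw [upper_mem_congrSub, pow_one]
    exact Ideal.mul_mem_left _ _ h01
  · exact eq_lower_mul_torus_mul_upper g ha hb'

/-- A condition that fails somewhere on `𝔪` but holds deep enough fails at some element whose
`𝔪`-multiples satisfy it. -/
theorem exists_socle {C : OK p K → Prop}
    (hC : ∃ n, ∀ x ∈ IsLocalRing.maximalIdeal (OK p K) ^ n,
      x ∈ IsLocalRing.maximalIdeal (OK p K) → C x)
    (h : ∃ x ∈ IsLocalRing.maximalIdeal (OK p K), ¬ C x) :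
    ∃ x ∈ IsLocalRing.maximalIdeal (OK p K), ¬ C x ∧
      ∀ y ∈ IsLocalRing.maximalIdeal (OK p K), C (y * x) := by
  classical
  obtain ⟨x0, hx0, hC0⟩ := h
  have hspec := Nat.find_spec hC
  have hpos : Nat.find hC ≠ 0 := fun h0 => hC0 (hspec x0 (by rw [h0]; simp) hx0)
  have hmin := Nat.find_min hC (Nat.sub_one_lt hpos)
  push Not at hmin
  obtain ⟨x, hx, hxm, hCx⟩ := hmin
  refine ⟨x, hxm, hCx, fun y hy => hspec _ ?_ (Ideal.mul_mem_right _ _ hy)⟩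
  obtain ⟨m, hm⟩ := Nat.exists_eq_succ_of_ne_zero hpos
  rw [hm] at hx ⊢
  rw [pow_succ']
  exact Ideal.mul_mem_mul hy (by simpa using hx)

end Congruence

section Eigen

variable {p : ℕ} [Fact p.Prime] {K : Type*} [Field K] [Algebra ℚ_[p] K]
  [FiniteDimensional ℚ_[p] K] [Algebra ℤ_[p] K] [IsScalarTower ℤ_[p] ℚ_[p] K]
  {f : ℕ} [NeZero f] (σ : ResK p K →+* Fbar p)

/-- The weights of an additive function on `𝔪` that is an eigenfunction for the units. -/
theorem exists_weight_of_additive (hk : Fintype.card (ResK p K) = p ^ f) (hf : 1 < f)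
    (c : OK p K → Fbar p)
    (hadd : ∀ x ∈ IsLocalRing.maximalIdeal (OK p K), ∀ y ∈ IsLocalRing.maximalIdeal (OK p K),
      c (x + y) = c x + c y) {x : OK p K} (hx : x ∈ IsLocalRing.maximalIdeal (OK p K))
    (h0 : c x ≠ 0) (hsoc : ∀ y ∈ IsLocalRing.maximalIdeal (OK p K), c (y * x) = 0) {A B : ℤ}
    (hA : ∀ a : (OK p K)ˣ, c (a * x) = σ (IsLocalRing.residue _ (a : OK p K)) ^ A * c x)
    (hB : ∀ a : (OK p K)ˣ, c (a * x) = σ (IsLocalRing.residue _ (a : OK p K)) ^ B * c x) :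
    ∃ i : ZMod f, A ≡ (p : ℤ) ^ (f - 1 - i.val) [ZMOD (p : ℤ) ^ f - 1] ∧
      B ≡ (p : ℤ) ^ (f - 1 - i.val) [ZMOD (p : ℤ) ^ f - 1] := by
  have hres : ∀ a : (ResK p K)ˣ, ∃ u : (OK p K)ˣ, (u : OK p K) = teich p K a ∧
      IsLocalRing.residue _ (u : OK p K) = a := fun a =>
    ⟨Units.map (teich p K) a, rfl, residue_teich p K a⟩
  have hm : ∀ y : OK p K, y * x ∈ IsLocalRing.maximalIdeal (OK p K) := fun y =>
    Ideal.mul_mem_left _ _ hx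
  have hA' : ∀ a : (ResK p K)ˣ, c (teich p K a * x) = σ a ^ A * c x := fun a => by
    obtain ⟨u, hu, hu'⟩ := hres a
    rw [← hu, hA, hu']
  have hB' : ∀ a : (ResK p K)ˣ, c (teich p K a * x) = σ a ^ B * c x := fun a => by
    obtain ⟨u, hu, hu'⟩ := hres a
    rw [← hu, hB, hu']
  have hAB : A ≡ B [ZMOD (p : ℤ) ^ f - 1] := (zpow_eq_iff σ hk).1 fun a =>
    mul_right_cancel₀ h0 ((hA' a).symm.trans (hB' a))
  let c' : ResK p K →+ Fbar p := AddMonoidHom.mk' (fun l => c (teich p K l * x)) (by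
    intro a b
    have h1 : teich p K (a + b) - (teich p K a + teich p K b) ∈
        IsLocalRing.maximalIdeal (OK p K) := by
      rw [← IsLocalRing.residue_eq_zero_iff, RingHom.map_sub, RingHom.map_add, residue_teich,
        residue_teich, residue_teich, sub_self]
    have h2 := hadd _ (hm (teich p K a)) _ (hm (teich p K b))
    have h3 := hadd _ (hm (teich p K a + teich p K b)) _
      (hm (teich p K (a + b) - (teich p K a + teich p K b)))
    rw [hsoc _ h1, add_zero, ← add_mul, add_sub_cancel, add_mul, h2] at h3
    exact h3)
  have h1 : c' 1 = c x := by
    change c (teich p K 1 * x) = c x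
    rw [map_one, one_mul]
  obtain ⟨i, hi⟩ := exists_of_additive_eigenfunction σ hk hf c' (by rwa [h1]) (A := A)
    (fun a => by rw [h1]; exact hA' a)
  exact ⟨i, hi, hAB.symm.trans hi⟩

theorem crit_of_weights (hf : 1 < f) {d d' : ZMod f → ℤ} {s s' : ZMod f → ℕ}
    (hs : ∀ i, s i + 2 ≤ p) (hs' : ∀ i, s' i + 2 ≤ p) {i : ZMod f}
    (h1 : detExp p d - detExp p d' ≡ (p : ℤ) ^ (f - 1 - i.val) [ZMOD (p : ℤ) ^ f - 1])
    (h2 : detExp p d' + natExp p s' - (detExp p d + natExp p s) ≡ (p : ℤ) ^ (f - 1 - i.val)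
      [ZMOD (p : ℤ) ^ f - 1]) :
    CritOne p i d s d' s' ∨ CritTwo p i d s d' s' := by
  have h3 : detExp p d' ≡ detExp p d - (p : ℤ) ^ (f - 1 - i.val) [ZMOD (p : ℤ) ^ f - 1] := by
    have := (h1.neg).add_left (detExp p d)
    rwa [neg_sub, add_sub_cancel, ← sub_eq_add_neg] at this
  have h4 : ((p : ℤ) ^ f - 1) ∣
      detExp p ((fun j => (s' j : ℤ)) - (fun j => (s j : ℤ)) - Pi.single i 2) := by
    rw [detExp_sub, detExp_sub, detExp_single, ← cast_natExp, ← cast_natExp]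
    have := (h1.add h2).symm.dvd
    convert this using 1; ring
  rcases of_carry_two (Fact.out : p.Prime).two_le hf hs hs' h4 with ⟨h5, h6⟩ | ⟨h5, h6⟩
  · exact Or.inr ⟨by have := hs' i; omega, h5, h6, h3⟩
  · refine Or.inl ⟨h5, ?_⟩
    rw [h6]
    simpa using h3

end Eigen

section Dichotomy

variable {p : ℕ} [Fact p.Prime] {K : Type*} [Field K] [Algebra ℚ_[p] K]
  [FiniteDimensional ℚ_[p] K] [Algebra ℤ_[p] K] [IsScalarTower ℤ_[p] ℚ_[p] K]
  {f : ℕ} [NeZero f] (σ : ResK p K →+* Fbar p)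

/-- An equivariant family of smooth homomorphisms from the first congruence subgroup to a weight,
parametrised by another weight. -/
structure IsEquivariantFamily (d : ZMod f → ℤ) (s : ZMod f → ℕ) (d' : ZMod f → ℤ)
    (s' : ZMod f → ℕ) (Φ : GLO p K → WeightSpace p s →ₗ[Fbar p] WeightSpace p s') : Prop where
  mul : ∀ v, ∀ g ∈ congrSub p K 1, ∀ h ∈ congrSub p K 1, Φ (g * h) v = Φ g v + Φ h v
  conj : ∀ x, ∀ g ∈ congrSub p K 1, ∀ v,
    Φ (x * g * x⁻¹) (weightRep p σ d s (red p K x) v) = weightRep p σ d' s' (red p K x) (Φ g v)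
  smooth : ∀ v, ∃ n, ∀ g ∈ congrSub p K n, g ∈ congrSub p K 1 → Φ g v = 0

theorem weightRep_lower_mono_zero (d : ZMod f → ℤ) (s : ZMod f → ℕ) {k : Type*} [Field k]
    (σ : k →+* Fbar p) (x : k) : weightRep p σ d s (lower x) (mono p s 0) = mono p s 0 := by
  rw [weightRep_lower σ d (n := 0) (fun i => Nat.zero_le _), Finset.sum_eq_single 0]
  · simp [natExp]
  · intro a _ ha
    obtain ⟨i, hi⟩ : ∃ i, a i ≠ 0 := by
      by_contra! h
      exact ha (funext h)
    rw [Finset.prod_eq_zero (Finset.mem_univ i), zero_mul, zero_smul]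
    simp [Nat.choose_eq_zero_of_lt (Nat.pos_of_ne_zero hi)]
  · intro h
    exact absurd (mem_box.2 fun i => Nat.zero_le _) h

variable {σ} {d : ZMod f → ℤ} {s : ZMod f → ℕ} {d' : ZMod f → ℤ}
    {s' : ZMod f → ℕ} {Φ : GLO p K → WeightSpace p s →ₗ[Fbar p] WeightSpace p s'}
    (hΦ : IsEquivariantFamily σ d s d' s' Φ)

include hΦ

theorem IsEquivariantFamily.torus_mono (a b : (OK p K)ˣ) {g h : GLO p K}
    (hg : g ∈ congrSub p K 1) (hgh : torus a b * g * (torus a b)⁻¹ = h) {c c' : Fbar p}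
    (hc : Φ g (mono p s 0) = c • mono p s' 0) (hc' : Φ h (mono p s 0) = c' • mono p s' 0) :
    (σ (IsLocalRing.residue _ (a : OK p K)) ^ detExp p d *
      σ (IsLocalRing.residue _ (b : OK p K)) ^ (detExp p d + natExp p s)) * c' =
    (σ (IsLocalRing.residue _ (a : OK p K)) ^ detExp p d' *
      σ (IsLocalRing.residue _ (b : OK p K)) ^ (detExp p d' + natExp p s')) * c := by
  have h1 := hΦ.conj (torus a b) g hg (mono p s 0)
  rw [hgh, red_torus, weightRep_torus σ d s (n := 0) (fun i => Nat.zero_le _), map_smul, hc, hc', map_smul,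
    weightRep_torus σ d' s' (n := 0) (fun i => Nat.zero_le _)] at h1
  have h2 : natExp p (0 : ZMod f → ℕ) = 0 := by simp [natExp]
  rw [h2, smul_smul, smul_smul] at h1
  have h3 := smul_left_injective (Fbar p) (mono_ne_zero (p := p) (N := s') (n := 0)
    (fun i => Nat.zero_le _)) h1
  simp only [Nat.cast_zero, add_zero, sub_zero] at h3
  exact h3.trans (mul_comm _ _)

theorem IsEquivariantFamily.conj_lower (y : OK p K) {g : GLO p K} (hg : g ∈ congrSub p K 1) :
    Φ (lower y * g * (lower y)⁻¹) (mono p s 0) =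
      weightRep p σ d' s' (lower (IsLocalRing.residue _ y)) (Φ g (mono p s 0)) := by
  rw [← red_lower, ← hΦ.conj _ g hg, red_lower, weightRep_lower_mono_zero]

variable (hf : f = resF p K) (hf1 : 1 < f) (hs : ∀ i, s i + 2 ≤ p) (hs' : ∀ i, s' i + 2 ≤ p)

omit [NeZero f] hΦ in
include hf in
theorem card_resK_eq : Fintype.card (ResK p K) = p ^ f := by
  rw [← Nat.card_eq_fintype_card, card_resK, hf]

include hf hf1 hs'

theorem IsEquivariantFamily.eq_smul_of_fixed {g : GLO p K} (hg : g ∈ congrSub p K 1)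
    (h : ∀ y, Φ (lower y * g * (lower y)⁻¹) (mono p s 0) = Φ g (mono p s 0)) :
    Φ g (mono p s 0) = monoCoeff (Φ g (mono p s 0)) 0 • mono p s' 0 := by
  refine SerreExt.eq_smul_of_fixed σ (card_resK_eq hf) hf1 hs' d' fun x => ?_
  obtain ⟨y, rfl⟩ := IsLocalRing.residue_surjective x
  rw [← hΦ.conj_lower y hg, h]

theorem IsEquivariantFamily.lower_eq {x : OK p K} (hx : x ∈ IsLocalRing.maximalIdeal (OK p K)) :
    Φ (lower x) (mono p s 0) = monoCoeff (Φ (lower x) (mono p s 0)) 0 • mono p s' 0 := by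
  refine hΦ.eq_smul_of_fixed hf hf1 hs' (lower_mem_congrSub.2 (by simpa using hx)) fun y => ?_
  rw [← lower_add, add_comm, lower_add, mul_inv_cancel_right]

include hs

theorem IsEquivariantFamily.crit_of_lower
    (h : ∃ x ∈ IsLocalRing.maximalIdeal (OK p K), Φ (lower x) (mono p s 0) ≠ 0) :
    ∃ i, CritOne p i d s d' s' ∨ CritTwo p i d s d' s' := by
  have hk := card_resK_eq hf
  have hmem : ∀ x ∈ IsLocalRing.maximalIdeal (OK p K), lower x ∈ congrSub p K 1 := fun x hx =>
    lower_mem_congrSub.2 (by simpa using hx)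
  obtain ⟨x, hx, h0, hsoc⟩ := exists_socle (C := fun x => Φ (lower x) (mono p s 0) = 0) (by
    obtain ⟨n, hn⟩ := hΦ.smooth (mono p s 0)
    exact ⟨n, fun x hx hx' => hn _ (lower_mem_congrSub.2 hx) (hmem x hx')⟩) h
  set c : OK p K → Fbar p := fun x => monoCoeff (Φ (lower x) (mono p s 0)) 0 with hc
  have hcx : ∀ x ∈ IsLocalRing.maximalIdeal (OK p K), Φ (lower x) (mono p s 0) =
      c x • mono p s' 0 := fun x hx => hΦ.lower_eq hf hf1 hs' hx
  have hne : ∀ (a : (OK p K)ˣ), σ (IsLocalRing.residue _ (a : OK p K)) ≠ 0 := fun a =>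
    ((a.isUnit.map (IsLocalRing.residue (OK p K))).map σ).ne_zero
  have htor : ∀ a b : (OK p K)ˣ, (σ (IsLocalRing.residue _ (a : OK p K)) ^ detExp p d *
      σ (IsLocalRing.residue _ (b : OK p K)) ^ (detExp p d + natExp p s)) * c (b * x * ↑a⁻¹) =
      (σ (IsLocalRing.residue _ (a : OK p K)) ^ detExp p d' *
      σ (IsLocalRing.residue _ (b : OK p K)) ^ (detExp p d' + natExp p s')) * c x := fun a b => by
    refine hΦ.torus_mono a b (hmem x hx) ?_ (hcx _ hx)
      (hcx _ (Ideal.mul_mem_right _ _ (Ideal.mul_mem_left _ _ hx)))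
    rw [torus_mul_lower, mul_inv_cancel_right]
  obtain ⟨i, hi1, hi2⟩ := exists_weight_of_additive σ hk hf1 c (fun a ha b hb => by
      simp only [hc]
      rw [lower_add, hΦ.mul _ _ (hmem _ ha) _ (hmem _ hb), monoCoeff_add]) hx
    (fun h => h0 (by rw [hcx x hx, h, zero_smul]))
    (fun y hy => by simp only [hc]; rw [hsoc y hy]; exact map_zero (monoCoeffHom 0))
    (A := detExp p d - detExp p d')
    (B := detExp p d' + natExp p s' - (detExp p d + natExp p s)) (fun a => by
      have := htor a⁻¹ 1
      have h1 : σ (IsLocalRing.residue _ ((a⁻¹ : (OK p K)ˣ) : OK p K)) =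
          (σ (IsLocalRing.residue _ (a : OK p K)))⁻¹ := by
        refine eq_inv_of_mul_eq_one_left ?_
        rw [← map_mul, ← map_mul, Units.inv_mul, map_one, map_one]
      simp only [h1, Units.val_one, map_one, one_zpow, mul_one, one_mul, inv_inv, inv_zpow'] at this
      rw [mul_comm (a : OK p K)]
      rw [zpow_neg, zpow_neg, inv_mul_eq_iff_eq_mul₀ (zpow_ne_zero _ (hne a))] at this
      rw [this, zpow_sub₀ (hne a)]
      ring) (fun b => by
      have := htor 1 b
      simp only [Units.val_one, map_one, one_zpow, mul_one, one_mul, inv_one] at this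
      rw [zpow_sub₀ (hne b), div_mul_eq_mul_div, eq_div_iff (zpow_ne_zero _ (hne b)), ← this,
        mul_comm])
  exact ⟨i, crit_of_weights hf1 hs hs' hi1 hi2⟩

variable (hlow : ∀ x ∈ IsLocalRing.maximalIdeal (OK p K), Φ (lower x) (mono p s 0) = 0)
  (hne : IsEmpty ((weightRep p σ d s).Equiv (weightRep p σ d' s')))

include hlow hne

theorem IsEquivariantFamily.torus_eq_zero {a b : (OK p K)ˣ} (hab : torus a b ∈ congrSub p K 1) :
    Φ (torus a b) (mono p s 0) = 0 := by
  have hk := card_resK_eq hf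
  have h1 := hΦ.eq_smul_of_fixed hf hf1 hs' hab fun y => by
    have e : lower y * torus a b * (lower y)⁻¹ =
        torus a b * lower (↑b⁻¹ * y * a - y) := by
      rw [mul_inv_eq_iff_eq_mul, mul_assoc, ← lower_add, sub_add_cancel, torus_mul_lower]
      congr 2
      rw [← mul_assoc, ← mul_assoc, Units.mul_inv, one_mul, mul_assoc, Units.mul_inv, mul_one]
    have h2 : (↑b⁻¹ * y * a - y : OK p K) ∈ IsLocalRing.maximalIdeal (OK p K) := by
      rw [torus_mem_congrSub, pow_one] at hab
      have : (↑b⁻¹ * y * a - y : OK p K) = ↑b⁻¹ * y * ((a - 1) - (b - 1)) := by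
        linear_combination y * b.inv_mul
      rw [this]
      exact Ideal.mul_mem_left _ _ (Ideal.sub_mem _ hab.1 hab.2)
    rw [e, hΦ.mul _ _ hab _ (lower_mem_congrSub.2 (by simpa using h2)), hlow _ h2, add_zero]
  set c := monoCoeff (Φ (torus a b) (mono p s 0)) 0
  by_contra h0
  have hc : c ≠ 0 := fun h => h0 (by rw [h1, h, zero_smul])
  have htor : ∀ u v : (OK p K)ˣ, _ := fun u v => hΦ.torus_mono u v hab
    (by rw [← torus_mul, mul_comm u, mul_comm v, torus_mul, mul_inv_cancel_right]) h1 h1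
  have hlift : ∀ x : (ResK p K)ˣ, ∃ u : (OK p K)ˣ, IsLocalRing.residue _ (u : OK p K) = x :=
    fun x => ⟨Units.map (teich p K) x, residue_teich p K x⟩
  have hd : detExp p d ≡ detExp p d' [ZMOD (p : ℤ) ^ f - 1] := (zpow_eq_iff σ hk).1 fun x => by
    obtain ⟨u, hu⟩ := hlift x
    have := mul_right_cancel₀ hc (htor u 1)
    simpa [hu] using this
  have hds : detExp p d + natExp p s ≡ detExp p d' + natExp p s' [ZMOD (p : ℤ) ^ f - 1] :=
    (zpow_eq_iff σ hk).1 fun x => by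
      obtain ⟨u, hu⟩ := hlift x
      have := mul_right_cancel₀ hc (htor 1 u)
      simpa [hu] using this
  have hss : s = s' := by
    refine eq_of_detExp_modEq (Fact.out : p.Prime).two_le hs hs' ?_
    rw [← cast_natExp, ← cast_natExp]
    exact Int.ModEq.add_left_cancel hd hds
  subst hss
  have e : weightRep p σ d s = weightRep p σ d' s :=
    MonoidHom.ext fun g => weightRep_congr σ s (by rw [Nat.card_eq_fintype_card, hk]) hd g
  rw [e] at hne
  exact hne.false (Representation.Equiv.refl _)

theorem IsEquivariantFamily.crit_of_upper
    (h : ∃ x ∈ IsLocalRing.maximalIdeal (OK p K), Φ (upper x) (mono p s 0) ≠ 0) :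
    ∃ i, CritOne p i d' s' d s ∨ CritTwo p i d' s' d s := by
  have hk := card_resK_eq hf
  have hmem : ∀ x ∈ IsLocalRing.maximalIdeal (OK p K), upper x ∈ congrSub p K 1 := fun x hx =>
    upper_mem_congrSub.2 (by simpa using hx)
  obtain ⟨x, hx, h0, hsoc⟩ := exists_socle (C := fun x => Φ (upper x) (mono p s 0) = 0) (by
    obtain ⟨n, hn⟩ := hΦ.smooth (mono p s 0)
    exact ⟨n, fun x hx hx' => hn _ (upper_mem_congrSub.2 hx) (hmem x hx')⟩) h
  have hfix := hΦ.eq_smul_of_fixed hf hf1 hs' (hmem x hx) fun y => by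
    have hg : lower y * upper x * (lower y)⁻¹ ∈ congrSub p K 1 :=
      Subgroup.Normal.conj_mem inferInstance _ (hmem x hx) _
    obtain ⟨a, b, ha, hc, hab, hz, e⟩ := exists_iwahori hg
    set g := lower y * upper x * (lower y)⁻¹ with hgdef
    have hinv : (lower y)⁻¹ = lower (-y) := by
      rw [inv_eq_iff_mul_eq_one, ← lower_add, add_neg_cancel, lower_zero]
    have h00 : g 0 0 = 1 - x * y := by
      rw [hgdef, hinv]
      simp [Matrix.mul_apply, Fin.sum_univ_two]
      ring
    have h01 : g 0 1 = x := by
      rw [hgdef, hinv]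
      simp [Matrix.mul_apply, Fin.sum_univ_two]
    have hzx : ↑a⁻¹ * g 0 1 = x + (↑a⁻¹ * y * x) * x := by
      rw [h01]
      rw [h00] at ha
      linear_combination x * a.inv_mul - ↑a⁻¹ * x * ha
    have hm : ↑a⁻¹ * y * x ∈ IsLocalRing.maximalIdeal (OK p K) := Ideal.mul_mem_left _ _ hx
    rw [e, hΦ.mul _ _ (mul_mem hc hab) _ hz, hΦ.mul _ _ hc _ hab,
      hΦ.torus_eq_zero hf hf1 hs hs' hlow hne hab,
      hlow _ (by simpa using lower_mem_congrSub.1 hc), add_zero, zero_add, hzx, upper_add,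
      hΦ.mul _ _ (hmem _ hx) _ (hmem _ (Ideal.mul_mem_left _ _ hx)), hsoc _ hm, add_zero]
  set c : OK p K → Fbar p := fun x => monoCoeff (Φ (upper x) (mono p s 0)) 0 with hc
  have hne' : ∀ (a : (OK p K)ˣ), σ (IsLocalRing.residue _ (a : OK p K)) ≠ 0 := fun a =>
    ((a.isUnit.map (IsLocalRing.residue (OK p K))).map σ).ne_zero
  have hinv : ∀ a : (OK p K)ˣ, σ (IsLocalRing.residue _ ((a⁻¹ : (OK p K)ˣ) : OK p K)) =
      (σ (IsLocalRing.residue _ (a : OK p K)))⁻¹ := fun a => by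
    refine eq_inv_of_mul_eq_one_left ?_
    rw [← map_mul, ← map_mul, Units.inv_mul, map_one, map_one]
  have hfix' : ∀ a b : (OK p K)ˣ, Φ (upper (a * x * ↑b⁻¹)) (mono p s 0) =
      c (a * x * ↑b⁻¹) • mono p s' 0 := fun a b => by
    have h1 := hΦ.conj (torus a b) _ (hmem x hx) (mono p s 0)
    rw [torus_mul_upper, mul_inv_cancel_right, red_torus,
      weightRep_torus σ d s (n := 0) (fun i => Nat.zero_le _), map_smul, hfix, map_smul,
      weightRep_torus σ d' s' (n := 0) (fun i => Nat.zero_le _), smul_smul] at h1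
    have h2 := congrArg (fun v => (σ (IsLocalRing.residue _ (a : OK p K)) ^
      (detExp p d + natExp p (0 : ZMod f → ℕ)) * σ (IsLocalRing.residue _ (b : OK p K)) ^
      (detExp p d + natExp p s - natExp p (0 : ZMod f → ℕ)))⁻¹ • v) h1
    have h3 : σ (IsLocalRing.residue _ (a : OK p K)) ^
      (detExp p d + natExp p (0 : ZMod f → ℕ)) * σ (IsLocalRing.residue _ (b : OK p K)) ^
      (detExp p d + natExp p s - natExp p (0 : ZMod f → ℕ)) ≠ 0 :=
      mul_ne_zero (zpow_ne_zero _ (hne' a)) (zpow_ne_zero _ (hne' b))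
    have h4 := (inv_smul_smul₀ h3 _).symm.trans h2
    rw [smul_smul] at h4
    simp only [hc]
    rw [h4, monoCoeff_smul, monoCoeff_mono (n := 0) (fun i => Nat.zero_le _), if_pos rfl, mul_one]
  have htor : ∀ a b : (OK p K)ˣ, (σ (IsLocalRing.residue _ (a : OK p K)) ^ detExp p d *
      σ (IsLocalRing.residue _ (b : OK p K)) ^ (detExp p d + natExp p s)) * c (a * x * ↑b⁻¹) =
      (σ (IsLocalRing.residue _ (a : OK p K)) ^ detExp p d' *
      σ (IsLocalRing.residue _ (b : OK p K)) ^ (detExp p d' + natExp p s')) * c x := fun a b => by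
    refine hΦ.torus_mono a b (hmem x hx) ?_ hfix (hfix' a b)
    rw [torus_mul_upper, mul_inv_cancel_right]
  obtain ⟨i, hi1, hi2⟩ := exists_weight_of_additive σ hk hf1 c (fun a ha b hb => by
      simp only [hc]
      rw [upper_add, hΦ.mul _ _ (hmem _ ha) _ (hmem _ hb), monoCoeff_add]) hx
    (fun h => h0 (by rw [hfix]; exact (congrArg (· • mono p s' 0) h).trans (zero_smul _ _)))
    (fun y hy => by simp only [hc]; rw [hsoc y hy]; exact map_zero (monoCoeffHom 0))
    (A := detExp p d' - detExp p d)
    (B := detExp p d + natExp p s - (detExp p d' + natExp p s')) (fun a => by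
      have := htor a 1
      simp only [Units.val_one, map_one, one_zpow, mul_one, inv_one] at this
      rw [zpow_sub₀ (hne' a), div_mul_eq_mul_div, eq_div_iff (zpow_ne_zero _ (hne' a)), ← this,
        mul_comm]) (fun b => by
      have := htor 1 b⁻¹
      simp only [hinv, Units.val_one, map_one, one_zpow, one_mul, inv_inv, inv_zpow'] at this
      rw [mul_comm (b : OK p K)]
      rw [zpow_neg, zpow_neg, inv_mul_eq_iff_eq_mul₀ (zpow_ne_zero _ (hne' b))] at this
      rw [this, zpow_sub₀ (hne' b)]
      ring)
  exact ⟨i, crit_of_weights hf1 hs' hs hi1 hi2⟩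

theorem IsEquivariantFamily.eq_zero
    (hup : ∀ x ∈ IsLocalRing.maximalIdeal (OK p K), Φ (upper x) (mono p s 0) = 0)
    {g : GLO p K} (hg : g ∈ congrSub p K 1) : Φ g = 0 := by
  let M : Submodule (Fbar p) (WeightSpace p s) := ⨅ g ∈ congrSub p K 1, LinearMap.ker (Φ g)
  have hM : ∀ v, v ∈ M ↔ ∀ g ∈ congrSub p K 1, Φ g v = 0 := fun v => by
    simp [M, Submodule.mem_iInf]
  refine LinearMap.ext fun v => ?_
  refine (hM v).1 (mem_of_upper_stable σ (card_resK_eq hf) hf1 hs d M ?_ ?_ v) g hg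
  · intro x v hv
    obtain ⟨y, rfl⟩ := IsLocalRing.residue_surjective x
    refine (hM _).2 fun g hg => ?_
    have h1 : (upper y)⁻¹ * g * upper y ∈ congrSub p K 1 := by
      simpa using Subgroup.Normal.conj_mem inferInstance g hg (upper y)⁻¹
    have h2 := hΦ.conj (upper y) _ h1 v
    rw [(hM v).1 hv _ h1, map_zero, red_upper] at h2
    rwa [show upper y * ((upper y)⁻¹ * g * upper y) * (upper y)⁻¹ = g by group] at h2
  · refine (hM _).2 fun g hg => ?_
    obtain ⟨a, b, -, hc, hab, hx, e⟩ := exists_iwahori hg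
    rw [e, hΦ.mul _ _ (mul_mem hc hab) _ hx, hΦ.mul _ _ hc _ hab,
      hΦ.torus_eq_zero hf hf1 hs hs' hlow hne hab,
      hlow _ (by simpa using lower_mem_congrSub.1 hc), 
      hup _ (by simpa using upper_mem_congrSub.1 hx),
      add_zero, add_zero]

end Dichotomy

section General

variable {F V W : Type} [Field F] [AddCommMonoid V] [Module F V] [AddCommMonoid W] [Module F W]
  {G : Type*} [Group G] {ρ : Representation F G V} {ρ' : Representation F G W}
  (X : RepExtension ρ ρ')

theorem RepExtension.exists_lift {M : Type*} [AddCommMonoid M] [Module F M] (g : M →ₗ[F] X.E)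
    (hg : ∀ m, X.proj (g m) = 0) : ∃ h : M →ₗ[F] W, ∀ m, X.incl (h m) = g m := by
  let e := LinearEquiv.ofInjective X.incl.toLinearMap X.incl_injective
  have hmem : ∀ m, g m ∈ LinearMap.range X.incl.toLinearMap := fun m =>
    (X.exact (g m)).1 (hg m)
  refine ⟨e.symm.toLinearMap.comp (g.codRestrict _ hmem), fun m => ?_⟩
  exact congrArg Subtype.val (e.apply_symm_apply (g.codRestrict _ hmem m))

/-- An extension that splits over a subgroup of finite index invertible in the coefficient field
splits. -/
theorem RepExtension.splits_of_subgroup (H : Subgroup G) [H.FiniteIndex]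
    (hH : (H.index : F) ≠ 0) (S : V →ₗ[F] X.E) (hS : ∀ v, X.proj (S v) = v)
    (hSH : ∀ h ∈ H, ∀ v, S (ρ h v) = X.rep h (S v)) : X.Splits := by
  classical
  let _ : Fintype (G ⧸ H) := Fintype.ofFinite _
  let φ : G → V →ₗ[F] X.E := fun g => (X.rep g).comp (S.comp (ρ g⁻¹))
  have hφ : ∀ g, ∀ h ∈ H, φ (g * h) = φ g := fun g h hh => by
    ext v
    simp only [φ, LinearMap.comp_apply, map_mul, mul_inv_rev, Module.End.mul_apply]
    rw [← hSH h hh, ← Module.End.mul_apply (ρ h), ← map_mul, mul_inv_cancel, map_one,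
      Module.End.one_apply]
  have hφ' : ∀ g g' : G, (g : G ⧸ H) = g' → φ g = φ g' := fun g g' h => by
    have := hφ g _ (QuotientGroup.eq.1 h)
    rwa [mul_inv_cancel_left, eq_comm] at this
  have hmul : ∀ g x v, φ (g * x) (ρ g v) = X.rep g (φ x v) := fun g x v => by
    simp only [φ, LinearMap.comp_apply, map_mul, mul_inv_rev, Module.End.mul_apply]
    rw [← Module.End.mul_apply (ρ g⁻¹), ← map_mul, inv_mul_cancel, map_one, Module.End.one_apply]
  let R : V →ₗ[F] X.E := (H.index : F)⁻¹ • ∑ q : G ⧸ H, φ q.out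
  have hR : ∀ g v, R (ρ g v) = X.rep g (R v) := fun g v => by
    simp only [R, LinearMap.smul_apply, LinearMap.sum_apply, map_smul, map_sum]
    congr 1
    rw [← Equiv.sum_comp (MulAction.toPerm g)]
    refine Finset.sum_congr rfl fun q _ => ?_
    rw [← hmul]
    congr 1
    apply hφ'
    rw [QuotientGroup.out_eq', MulAction.toPerm_apply]
    conv_lhs => rw [← QuotientGroup.out_eq' q]
    rfl
  refine ⟨⟨R, fun g => LinearMap.ext (hR g)⟩, fun v => ?_⟩
  change X.proj (R v) = v
  have h1 : ∀ q : G ⧸ H, X.proj (φ q.out v) = v := fun q => by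
    simp only [φ, LinearMap.comp_apply]
    rw [X.proj.isIntertwining, hS, ← Module.End.mul_apply, ← map_mul, mul_inv_cancel, map_one,
      Module.End.one_apply]
  simp only [R, LinearMap.smul_apply, LinearMap.sum_apply, map_smul, map_sum, h1]
  rw [Finset.sum_const, Finset.card_univ, ← Nat.card_eq_fintype_card, ← Subgroup.index,
    ← Nat.cast_smul_eq_nsmul F, smul_smul, inv_mul_cancel₀ hH, one_smul]

theorem RepExtension.exists_incl_eq_sub {a b : X.E} (h : X.proj a = X.proj b) :
    ∃ w, X.incl w = a - b := by
  refine (X.exact _).1 ?_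
  rw [sub_eq_add_neg, ← neg_one_smul F b, map_add, map_smul, h]
  nth_rw 1 [← one_smul F (X.proj b)]
  rw [← add_smul, add_neg_cancel, zero_smul]

variable (N : Subgroup G) [N.Normal] (hW : ∀ g ∈ N, ∀ w, ρ' g w = w)
  {S : V →ₗ[F] X.E} (hS : ∀ v, X.proj (S v) = v)

include hW hS

theorem RepExtension.exists_hom_family (hV : ∀ g ∈ N, ∀ v, ρ g v = v) :
    ∃ Φ : G → V →ₗ[F] W, (∀ v, ∀ g ∈ N, ∀ h ∈ N, Φ (g * h) v = Φ g v + Φ h v) ∧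
      (∀ x, ∀ g ∈ N, ∀ v, Φ (x * g * x⁻¹) (ρ x v) = ρ' x (Φ g v)) ∧
      ∀ g ∈ N, ∀ v, X.incl (Φ g v) = X.rep g (S v) - S v := by
  classical
  have h1 : ∀ g ∈ N, ∃ h : V →ₗ[F] W, ∀ v, X.incl (h v) = X.rep g (S v) - S v := fun g hg =>
    X.exists_lift ((X.rep g).comp S - S) fun v => by
      obtain ⟨w, hw⟩ := X.exists_incl_eq_sub (a := X.rep g (S v)) (b := S v)
        (by rw [X.proj.isIntertwining, hS, hV g hg])
      exact (X.exact _).2 ⟨w, hw⟩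
  choose h hh using h1
  refine ⟨fun g => if hg : g ∈ N then h g hg else 0, ?_, ?_, ?_⟩
  · intro v a ha b hb
    simp only [dif_pos ha, dif_pos hb, dif_pos (mul_mem ha hb)]
    apply X.incl_injective
    rw [map_add, hh, hh, hh, map_mul, Module.End.mul_apply]
    have h2 : X.rep b (S v) = X.incl (h b hb v) + S v := by rw [hh, sub_add_cancel]
    rw [h2, map_add, ← X.incl.isIntertwining, hW a ha]
    abel
  · intro x g hg v
    have hg' : x * g * x⁻¹ ∈ N := Subgroup.Normal.conj_mem inferInstance _ hg _
    simp only [dif_pos hg, dif_pos hg']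
    apply X.incl_injective
    obtain ⟨w, hw⟩ := X.exists_incl_eq_sub (a := S (ρ x v)) (b := X.rep x (S v))
      (by rw [X.proj.isIntertwining, hS, hS])
    have e1 : S (ρ x v) = X.incl w + X.rep x (S v) := by
      rw [hw, sub_add_cancel]
    rw [hh, e1, map_add, ← X.incl.isIntertwining, hW _ hg', X.incl.isIntertwining,
      hh, map_sub, ← Module.End.mul_apply, ← map_mul, inv_mul_cancel_right, map_mul,
      Module.End.mul_apply]
    abel
  · intro g hg v
    simp only [dif_pos hg, hh]

theorem RepExtension.eq_of_fixes_section {g : G} (hg : g ∈ N) (h : ∀ v, X.rep g (S v) = S v)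
    (e : X.E) : X.rep g e = e := by
  obtain ⟨w, hw⟩ := X.exists_incl_eq_sub (a := e) (b := S (X.proj e)) (by rw [hS])
  have e1 : e = X.incl w + S (X.proj e) := by rw [hw, sub_add_cancel]
  rw [e1, map_add, h, ← X.incl.isIntertwining, hW g hg]

end General

section Weight

variable {p : ℕ} [Fact p.Prime] {f : ℕ} [NeZero f]

theorem exists_linear_section {s : ZMod f → ℕ} {E : Type*} [AddCommMonoid E] [Module (Fbar p) E]
    (π : E →ₗ[Fbar p] WeightSpace p s) (hπ : Function.Surjective π) :
    ∃ S : WeightSpace p s →ₗ[Fbar p] E, ∀ v, π (S v) = v := by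
  choose g hg using hπ
  refine ⟨(weightBasis p s).constr (Fbar p) fun n => g (weightBasis p s n), fun v => ?_⟩
  have : π.comp ((weightBasis p s).constr (Fbar p) fun n => g (weightBasis p s n)) = LinearMap.id :=
    (weightBasis p s).ext fun n => by simp [hg]
  exact DFunLike.congr_fun this v

end Weight

section Family

variable {p : ℕ} [Fact p.Prime] {K : Type*} [Field K] [Algebra ℚ_[p] K]
  [FiniteDimensional ℚ_[p] K] [Algebra ℤ_[p] K] [IsScalarTower ℤ_[p] ℚ_[p] K]
  {f : ℕ} [NeZero f] {σ : ResK p K →+* Fbar p} {d : ZMod f → ℤ} {s : ZMod f → ℕ}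
  {d' : ZMod f → ℤ} {s' : ZMod f → ℕ}

theorem red_of_mem_congrSub {g : GLO p K} (hg : g ∈ congrSub p K 1) : red p K g = 1 := by
  ext i j
  have h := mem_congrSub.1 hg i j
  rw [pow_one, ← IsLocalRing.residue_eq_zero_iff, map_sub, sub_eq_zero] at h
  have h2 : red p K g i j = IsLocalRing.residue (OK p K) (g i j) := rfl
  rw [h2, h]
  by_cases hij : i = j
  · subst hij
    simp
  · simp [Matrix.one_apply_ne hij]

theorem infl_apply_of_mem {V : Type} [AddCommMonoid V] [Module (Fbar p) V]
    (ρ : Representation (Fbar p) (GLk p K) V) {g : GLO p K} (hg : g ∈ congrSub p K 1) (v : V) :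
    infl p K ρ g v = v := by
  change ρ (red p K g) v = v
  rw [red_of_mem_congrSub hg, map_one, Module.End.one_apply]

variable (X : RepExtension (infl p K (weightRep p σ d s)) (infl p K (weightRep p σ d' s')))

/-- The first congruence subgroup acts on a smooth extension of two weights through an equivariant
family of homomorphisms. -/
theorem exists_equivariantFamily (hX : IsSmooth p K X.rep) (S : WeightSpace p s →ₗ[Fbar p] X.E)
    (hS : ∀ v, X.proj (S v) = v) :
    ∃ Φ : GLO p K → WeightSpace p s →ₗ[Fbar p] WeightSpace p s',
      IsEquivariantFamily σ d s d' s' Φ ∧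
      ∀ g ∈ congrSub p K 1, ∀ v, X.incl (Φ g v) = X.rep g (S v) - S v := by
  obtain ⟨Φ, h1, h2, h3⟩ := X.exists_hom_family (congrSub p K 1)
    (fun g hg v => infl_apply_of_mem _ hg v) hS (fun g hg v => infl_apply_of_mem _ hg v)
  refine ⟨Φ, ⟨h1, h2, fun v => ?_⟩, h3⟩
  obtain ⟨n, hn⟩ := hX (S v)
  refine ⟨n, fun g hg hg1 => X.incl_injective ?_⟩
  rw [h3 g hg1, hn g hg, sub_self, map_zero]

end Family

section Modes

variable {p : ℕ} [Fact p.Prime] {f : ℕ} [NeZero f]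

theorem exists_multiPow {ι R F : Type*} [Fintype ι] [DecidableEq ι] [Field F] [Ring R] [Algebra F R]
    (X : ι → R) (hX : ∀ i j, X i * X j = X j * X i) :
    ∃ P : (ι → ℕ) → R, P 0 = 1 ∧ (∀ i n, P (n + Pi.single i 1) = X i * P n) ∧
      ∀ i n m, P (n + Pi.single i m) = P n * X i ^ m := by
  have hcomm : ∀ a ∈ Set.range X, ∀ b ∈ Set.range X, a * b = b * a := by
    rintro _ ⟨i, rfl⟩ _ ⟨j, rfl⟩
    exact hX i j
  let A := Algebra.adjoin F (Set.range X)
  have : IsMulCommutative A := Algebra.isMulCommutative_adjoin F hcomm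
  let X' : ι → A := fun i => ⟨X i, Algebra.subset_adjoin ⟨i, rfl⟩⟩
  have key : ∃ P : (ι → ℕ) → A, P 0 = 1 ∧ (∀ i n, P (n + Pi.single i 1) = X' i * P n) ∧
      ∀ i n m, P (n + Pi.single i m) = P n * X' i ^ m := by
    open scoped IsMulCommutative in
    have h1 : ∀ (i : ι) (n : ι → ℕ) (m : ℕ), ∏ l, X' l ^ (n + Pi.single i m : ι → ℕ) l =
        (∏ l, X' l ^ n l) * X' i ^ m := fun i n m => by
      simp only [Pi.add_apply, pow_add, Finset.prod_mul_distrib]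
      congr 1
      rw [Finset.prod_eq_single i]
      · simp
      · intro j _ hj
        simp [hj]
      · simp
    refine ⟨fun n => ∏ l, X' l ^ n l, by simp, fun i n => ?_, h1⟩
    beta_reduce
    rw [h1, pow_one, mul_comm]
  obtain ⟨P, h0, h1, h2⟩ := key
  exact ⟨fun n => P n, by simp [h0], fun i n => by simp [h1, X'], fun i n m => by simp [h2, X']⟩

variable {s : ZMod f → ℕ} {Z : ZMod f → Module.End (Fbar p) (WeightSpace p s)}

theorem IsUpperModes.pow (hZ : IsUpperModes s Z) (i : ZMod f) (m : ℕ) (n : ZMod f → ℕ) :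
    (Z i ^ m) (mono p s n) = ((-1) ^ m * ((s i - n i).descFactorial m : Fbar p)) •
      mono p s (n + Pi.single i m) := by
  induction m with
  | zero => simp
  | succ m ih =>
    rw [pow_succ', Module.End.mul_apply, ih, map_smul, hZ, smul_smul, add_assoc, ← Pi.single_add,
      Nat.descFactorial_succ, Pi.add_apply, Pi.single_eq_same, Nat.sub_sub, Nat.cast_mul, pow_succ]
    congr 1
    ring

theorem descFactorial_ne_zero {a m : ℕ} (h : m ≤ a) (ha : a < p) :
    ((a.descFactorial m : ℕ) : Fbar p) ≠ 0 := by
  rw [Ne, CharP.cast_eq_zero_iff (Fbar p) p]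
  intro h1
  have h2 : p ∣ a.factorial := by
    rw [← Nat.factorial_mul_descFactorial h]
    exact h1.mul_left _
  exact absurd (((Fact.out : p.Prime).dvd_factorial).1 h2) (by omega)

/-- A vector killed by the relevant powers of commuting operators generates a copy of the weight. -/
theorem IsUpperModes.exists_hom (hs : ∀ i, s i + 2 ≤ p) (hZ : IsUpperModes s Z)
    {E : Type*} [AddCommGroup E] [Module (Fbar p) E]
    (Y : ZMod f → Module.End (Fbar p) E) (hY : ∀ i j, Y i * Y j = Y j * Y i) (e : E)
    (he : ∀ i, (Y i ^ (s i + 1)) e = 0) :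
    ∃ S : WeightSpace p s →ₗ[Fbar p] E, S (mono p s 0) = e ∧ ∀ i v, S (Z i v) = Y i (S v) := by
  obtain ⟨P, hP0, hP1, hP2⟩ := exists_multiPow (F := Fbar p) Y hY
  let γ : (ZMod f → ℕ) → Fbar p := fun n =>
    ∏ l, ((-1) ^ n l * ((s l).descFactorial (n l) : Fbar p))
  have hγ0 : ∀ n, (∀ i, n i ≤ s i) → γ n ≠ 0 := fun n hn => by
    refine Finset.prod_ne_zero_iff.2 fun l _ => mul_ne_zero (by simp) (descFactorial_ne_zero (hn l) ?_)
    have := hs l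
    omega
  have hγ1 : ∀ n i, γ (n + Pi.single i 1) = -((s i - n i : ℕ) : Fbar p) * γ n := fun n i => by
    simp only [γ]
    rw [← Finset.mul_prod_erase _ _ (Finset.mem_univ i),
      ← Finset.mul_prod_erase Finset.univ (fun l => (-1) ^ n l * ((s l).descFactorial (n l) : Fbar p))
        (Finset.mem_univ i), ← mul_assoc]
    congr 1
    · simp only [Pi.add_apply, Pi.single_eq_same, Nat.descFactorial_succ, Nat.cast_mul, pow_succ]
      ring
    · refine Finset.prod_congr rfl fun l hl => ?_
      simp [Finset.ne_of_mem_erase hl]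
  have hPz : ∀ n i, s i < n i → P n e = 0 := fun n i h => by
    have : n = (n - Pi.single i (s i + 1)) + Pi.single i (s i + 1) := by
      ext l
      by_cases hl : l = i
      · subst hl
        simp
        omega
      · simp [hl]
    rw [this, hP2, Module.End.mul_apply, he, map_zero]
  let S : WeightSpace p s →ₗ[Fbar p] E :=
    (weightBasis p s).constr (Fbar p) fun n => (γ fun l => n l)⁻¹ • P (fun l => n l) e
  have hS : ∀ n, (∀ i, n i ≤ s i) → S (mono p s n) = (γ n)⁻¹ • P n e := fun n hn => by
    have h1 := weightBasis_apply (p := p) s (fun i => ⟨n i, Nat.lt_succ_of_le (hn i)⟩)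
    simp only at h1
    rw [← h1]
    simp only [S, Module.Basis.constr_basis]
  refine ⟨S, ?_, fun i v => ?_⟩
  · rw [hS 0 fun i => Nat.zero_le _, hP0]
    simp [γ]
  · have : S.comp (Z i) = (Y i).comp S := by
      refine hom_ext_mono fun n hn => ?_
      rw [LinearMap.comp_apply, LinearMap.comp_apply, hZ, map_smul, hS n hn, map_smul,
        ← Module.End.mul_apply, ← hP1]
      rcases Nat.lt_or_ge (n i) (s i) with h | h
      · have hn' : ∀ l, (n + Pi.single i 1 : ZMod f → ℕ) l ≤ s l := fun l => by
          by_cases hl : l = i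
          · subst hl
            simpa using h
          · simpa [hl] using hn l
        rw [hS _ hn', smul_smul, hγ1]
        congr 1
        have h1 := hγ0 _ hn'
        rw [hγ1] at h1
        rw [mul_inv, ← mul_assoc, mul_inv_cancel₀ (left_ne_zero_of_mul h1), one_mul]
      · rw [hPz _ i (by simpa using Nat.lt_succ_of_le h), Nat.sub_eq_zero_of_le h]
        simp
    exact DFunLike.congr_fun this v

end Modes

section Lifting

variable {p : ℕ} [Fact p.Prime] {f : ℕ} [NeZero f]

omit [Fact p.Prime] in
theorem pow_val_sub_one_modEq (i : ZMod f) :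
    (p : ℤ) ^ (f - 1 - (i - 1).val) ≡ p * (p : ℤ) ^ (f - 1 - i.val) [ZMOD (p : ℤ) ^ f - 1] := by
  have h1 := detExp_single p (i - 1) 1
  have h2 := detExp_single p i (p : ℤ)
  rw [Int.modEq_iff_dvd, mul_comm, ← h2, ← mul_one ((p : ℤ) ^ (f - 1 - (i - 1).val)), ← h1,
    ← detExp_sub]
  refine dvd_detExp_of_carry (c := Pi.single (i - 1) 1) fun j => ?_
  rw [Pi.sub_apply, add_sub_cancel]
  by_cases hj : j = i
  · subst hj
    simp
  · have : j - 1 ≠ i - 1 := fun h => hj (sub_left_injective h)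
    simp [hj, this]

variable {s s' : ZMod f → ℕ} {Z' : ZMod f → Module.End (Fbar p) (WeightSpace p s')}
  {E : Type*} [AddCommGroup E] [Module (Fbar p) E] {ι : WeightSpace p s' →ₗ[Fbar p] E}
  {Y : ZMod f → Module.End (Fbar p) E}

theorem IsUpperModes.pow_comp (hZ : IsUpperModes s' Z') (hY : ∀ i w, Y i (ι w) = ι (Z' i w))
    (i : ZMod f) (m : ℕ) (n : ZMod f → ℕ) :
    (Y i ^ m) (ι (mono p s' n)) = ((-1) ^ m * ((s' i - n i).descFactorial m : Fbar p)) •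
      ι (mono p s' (n + Pi.single i m)) := by
  have : ∀ w, (Y i ^ m) (ι w) = ι ((Z' i ^ m) w) := by
    induction m with
    | zero => simp
    | succ m ih => intro w; rw [pow_succ', pow_succ', Module.End.mul_apply, Module.End.mul_apply, ih, hY]
  rw [this, hZ.pow, map_smul]

variable (hs' : ∀ i, s' i + 2 ≤ p) (hZ : IsUpperModes s' Z')
  (hcomm : ∀ i j, Y i * Y j = Y j * Y i) (hY : ∀ i w, Y i (ι w) = ι (Z' i w))
  (hι : Function.Injective ι)

include hs' hZ hcomm hY hι in
theorem exists_correction {e : E} {nw : ZMod f → ℕ} (hnw : ∀ i, nw i ≤ s' i) {c : ZMod f → Fbar p}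
    (hc : ∀ i, (Y i ^ (s i + 1)) e = c i • ι (mono p s' (nw + Pi.single i (s i + 1)))) :
    ∃ w, ∀ i, (Y i ^ (s i + 1)) (e + ι w) = 0 := by
  set γ : ZMod f → Fbar p :=
    fun i => (-1) ^ (s i + 1) * ((s' i - nw i).descFactorial (s i + 1) : Fbar p) with hγ
  have hnwY : ∀ i, (Y i ^ (s i + 1)) (ι (mono p s' nw)) =
    γ i • ι (mono p s' (nw + Pi.single i (s i + 1))) := fun i => hZ.pow_comp hY i _ _
  have hzero : ∀ i, s' i < nw i + (s i + 1) → mono p s' (nw + Pi.single i (s i + 1)) = 0 :=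
    fun i h => mono_eq_zero (i := i) (by simpa using h)
  have hγ0 : ∀ i, nw i + (s i + 1) ≤ s' i → γ i ≠ 0 := fun i h =>
    mul_ne_zero (by simp) (descFactorial_ne_zero (by omega) (by have := hs' i; omega))
  by_cases hex : ∃ i, nw i + (s i + 1) ≤ s' i
  · obtain ⟨i, hi⟩ := hex
    refine ⟨-(c i * (γ i)⁻¹) • mono p s' nw, fun j => ?_⟩
    rw [map_add, map_smul, map_smul, hc, hnwY, smul_smul, ← add_smul]
    rcases Nat.lt_or_ge (s' j) (nw j + (s j + 1)) with hj | hj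
    · rw [hzero j hj, map_zero, smul_zero]
    rw [smul_eq_zero]
    left
    by_cases hij : j = i
    · subst hij
      rw [neg_mul, mul_assoc, inv_mul_cancel₀ (hγ0 j hj), mul_one, add_neg_cancel]
    · have hcom : Y i ^ (s i + 1) * Y j ^ (s j + 1) = Y j ^ (s j + 1) * Y i ^ (s i + 1) :=
        (Commute.pow_pow (hcomm i j) _ _)
      have h1 := DFunLike.congr_fun hcom e
      rw [Module.End.mul_apply, Module.End.mul_apply, hc, hc, map_smul, map_smul,
        hZ.pow_comp hY, hZ.pow_comp hY, smul_smul, smul_smul, Pi.add_apply, Pi.add_apply,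
        Pi.single_eq_of_ne (Ne.symm hij), Pi.single_eq_of_ne hij, add_zero, add_zero,
        add_right_comm] at h1
      have h2 : ι (mono p s' (nw + Pi.single i (s i + 1) + Pi.single j (s j + 1))) ≠ 0 := by
        rw [Ne, map_eq_zero_iff ι hι]
        refine mono_ne_zero fun l => ?_
        by_cases hl : l = i
        · subst hl
          simpa [Ne.symm hij] using hi
        · by_cases hl' : l = j
          · subst hl'
            simpa [hij] using hj
          · simpa [hl, hl'] using hnw l
      have h3 : c j * γ i = c i * γ j := smul_left_injective (Fbar p) h2 h1
      rw [neg_mul, mul_right_comm, ← h3, mul_assoc, mul_inv_cancel₀ (hγ0 i hi), mul_one,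
        add_neg_cancel]
  · push Not at hex
    refine ⟨0, fun j => ?_⟩
    rw [map_zero, add_zero, hc, hzero j (hex j), map_zero, smul_zero]

variable (hf : 1 < f) (hs : ∀ i, s i + 2 ≤ p) {d d' : ZMod f → ℤ}
  (hcrit : ∀ i, ¬ CritOne p i d s d' s' ∧ ¬ CritOne p i d' s' d s)

include hs' hZ hcomm hY hι hf hs hcrit in
/-- The lift of the lowest weight vector can be chosen to be killed by the same powers of the modes
as the lowest weight vector itself, unless the first criterion holds. -/
theorem exists_good_lift {e : E} {c : ZMod f → Fbar p} {nn : ZMod f → ZMod f → ℕ}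
    (hc : ∀ i, (Y i ^ (s i + 1)) e = c i • ι (mono p s' (nn i)))
    (hnn : ∀ i l, nn i l + 1 ≤ p) (hnn' : ∀ i, ∃ l, nn i l + 1 ≠ p)
    (hw : ∀ i, detExp p d' + natExp p (nn i) ≡
      detExp p d + ((s i : ℤ) + 1) * (p : ℤ) ^ (f - 1 - i.val) [ZMOD (p : ℤ) ^ f - 1])
    (hw' : ∀ i, (Y i ^ (s i + 1)) e ≠ 0 → detExp p d + natExp p s - ((s i : ℤ) + 1) *
      (p : ℤ) ^ (f - 1 - i.val) ≡ detExp p d' + natExp p s' - natExp p (nn i)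
        [ZMOD (p : ℤ) ^ f - 1])
    (hp : (∀ i, Y i ^ p = 0) ∨ ∃ nw : ZMod f → ℕ, (∀ i, nw i ≤ s' i) ∧
      detExp p d ≡ detExp p d' + natExp p nw [ZMOD (p : ℤ) ^ f - 1] ∧
      ∀ i, nw i + s i + 2 ≤ p) :
    ∃ w, ∀ i, (Y i ^ (s i + 1)) (e + ι w) = 0 := by
  have hp1 := (Fact.out : p.Prime).one_lt
  have hle : ∀ i, (Y i ^ (s i + 1)) e ≠ 0 → c i ≠ 0 ∧ ∀ l, nn i l ≤ s' l := fun i hi => by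
    rw [hc] at hi
    refine ⟨left_ne_zero_of_smul hi, fun l => ?_⟩
    by_contra! hl
    exact right_ne_zero_of_smul hi (by rw [mono_eq_zero hl, map_zero])
  have htop : ∀ i, (Y i ^ (s i + 1)) e ≠ 0 → Y i ^ p = 0 → s' i + s i + 2 ≤ p + nn i i :=
    fun i hi hpi => by
    by_contra! hlt
    have hsi := hs i
    have h1 : (Y i ^ (p - (s i + 1))) ((Y i ^ (s i + 1)) e) = 0 := by
      rw [← Module.End.mul_apply, ← pow_add, Nat.sub_add_cancel (by omega), hpi,
        LinearMap.zero_apply]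
    obtain ⟨h0, hl⟩ := hle i hi
    rw [hc, map_smul, hZ.pow_comp hY, smul_smul, smul_eq_zero, map_eq_zero_iff ι hι] at h1
    rcases h1 with h1 | h1
    · refine mul_ne_zero h0 (mul_ne_zero (by simp) (descFactorial_ne_zero ?_ ?_)) h1
      · have := hl i; omega
      · have := hs' i; omega
    · refine mono_ne_zero (fun l => ?_) h1
      by_cases hli : l = i
      · subst hli
        simp only [Pi.add_apply, Pi.single_eq_same]
        omega
      · simpa [hli] using hl l
  by_cases hnw : ∃ nw : ZMod f → ℕ, (∀ i, nw i ≤ s' i) ∧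
      detExp p d ≡ detExp p d' + natExp p nw [ZMOD (p : ℤ) ^ f - 1]
  · obtain ⟨nw, hnw, hd, hp'⟩ : ∃ nw : ZMod f → ℕ, (∀ i, nw i ≤ s' i) ∧
      detExp p d ≡ detExp p d' + natExp p nw [ZMOD (p : ℤ) ^ f - 1] ∧
      ((∀ i, Y i ^ p = 0) ∨ ∀ i, nw i + s i + 2 ≤ p) := by
      rcases hp with hp | ⟨nw, h1, h2, h3⟩
      · obtain ⟨nw, h1, h2⟩ := hnw
        exact ⟨nw, h1, h2, Or.inl hp⟩
      · exact ⟨nw, h1, h2, Or.inr h3⟩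
    have hn : ∀ i, ((natExp p (nn i) : ℕ) : ℤ) ≡ natExp p nw +
        ((s i : ℤ) + 1) * (p : ℤ) ^ (f - 1 - i.val) [ZMOD (p : ℤ) ^ f - 1] := fun i => by
      have := (hw i).trans (hd.add_right _)
      rw [add_assoc] at this
      exact Int.ModEq.add_left_cancel' _ this
    have key : ∀ i, (Y i ^ (s i + 1)) e ≠ 0 → nn i = nw + Pi.single i (s i + 1) := by
      intro i hi
      by_cases hsmall : nw i + s i + 2 ≤ p
      · refine natExp_unique (p := p) (hnn i) (hnn' i) (fun l => ?_) ⟨i + 1, ?_⟩ ?_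
        · by_cases hl : l = i
          · subst hl
            simp only [Pi.add_apply, Pi.single_eq_same]
            omega
          · have := hnw l
            have := hs' l
            simp only [Pi.add_apply, Pi.single_eq_of_ne hl]
            omega
        · have := hnw (i + 1)
          have := hs' (i + 1)
          simp only [Pi.add_apply, Pi.single_eq_of_ne (ne_add_one hf i)]
          omega
        · rw [← Int.natCast_modEq_iff, cast_pow_sub_one, natExp_add, natExp_single]
          push_cast
          rw [mul_comm ((p : ℤ) ^ _)]
          exact hn i
      · exfalso
        have hp0 : Y i ^ p = 0 := (hp'.resolve_right fun h => hsmall (h i)) i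
        have h1 := htop i hi hp0
        have hnwi := hnw i
        have hnwi' := hnw (i - 1)
        have hsi' := hs' i
        have hsi := hs i
        have hsi'' := hs' (i - 1)
        have h2 : nn i = Function.update nw i (nw i + s i + 1 - p) + Pi.single (i - 1) 1 := by
          have hv : ∀ l, (Function.update nw i (nw i + s i + 1 - p) + Pi.single (i - 1) 1 :
              ZMod f → ℕ) l = if l = i then nw i + s i + 1 - p else
                if l = i - 1 then nw (i - 1) + 1 else nw l := fun l => by
            by_cases hl : l = i
            · subst hl
              simp [ne_sub_one hf l]
            · by_cases hl' : l = i - 1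
              · subst hl'
                simp [hl]
              · simp [hl, hl']
          refine natExp_unique (p := p) (hnn i) (hnn' i) (fun l => ?_) ⟨i, ?_⟩ ?_
          · rw [hv]
            have := hnw l
            have := hs' l
            split_ifs <;> omega
          · rw [hv, if_pos rfl]
            omega
          · rw [← Int.natCast_modEq_iff, cast_pow_sub_one, natExp_add, natExp_single, mul_one]
            refine (hn i).trans ?_
            have h3 : natExp p (Function.update nw i (nw i + s i + 1 - p)) +
                p ^ (f - 1 - i.val) * p =
                natExp p nw + p ^ (f - 1 - i.val) * (s i + 1) := by
              rw [← natExp_single, ← natExp_single, ← natExp_add, ← natExp_add]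
              congr 1
              ext l
              by_cases hl : l = i
              · subst hl
                simp only [Pi.add_apply, Function.update_self, Pi.single_eq_same]
                omega
              · simp [hl]
            have h4 := congrArg (Nat.cast : ℕ → ℤ) h3
            push_cast at h4 ⊢
            have h5 := (pow_val_sub_one_modEq (p := p) i).symm.add_left
              (natExp p (Function.update nw i (nw i + s i + 1 - p)) : ℤ)
            rw [mul_comm (p : ℤ), h4, mul_comm ((p : ℤ) ^ _)] at h5
            exact h5
        rw [h2] at h1
        simp [ne_sub_one hf i] at h1
        omega
    obtain ⟨c', hc'⟩ : ∃ c' : ZMod f → Fbar p, ∀ i, (Y i ^ (s i + 1)) e =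
        c' i • ι (mono p s' (nw + Pi.single i (s i + 1))) := by
      classical
      refine ⟨fun i => if (Y i ^ (s i + 1)) e = 0 then 0 else c i, fun i => ?_⟩
      beta_reduce
      split_ifs with h
      · rw [h, zero_smul]
      · rw [← key i h, hc]
    exact exists_correction hs' hZ hcomm hY hι hnw hc'
  · refine ⟨0, fun i => ?_⟩
    rw [map_zero, add_zero]
    by_contra hi
    have hp0 : ∀ i, Y i ^ p = 0 := hp.resolve_right fun ⟨nw, h1, h2, _⟩ => hnw ⟨nw, h1, h2⟩
    obtain ⟨hci, hle1⟩ := hle i hi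
    have hni : nn i i ≤ s i := by
      by_contra! hlt
      refine hnw ⟨nn i - Pi.single i (s i + 1), fun l => ?_, ?_⟩
      · have := hle1 l
        simp only [Pi.sub_apply]
        omega
      · have h1 : nn i - Pi.single i (s i + 1) + Pi.single i (s i + 1) = nn i := by
          ext l
          by_cases hl : l = i
          · subst hl
            simp only [Pi.add_apply, Pi.sub_apply, Pi.single_eq_same]
            omega
          · simp [hl]
        have h2 := congrArg (natExp p) h1
        rw [natExp_add, natExp_single] at h2
        have h3 := hw i
        rw [← h2] at h3
        push_cast at h3
        rw [mul_comm ((s i : ℤ) + 1), ← add_assoc] at h3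
        exact (Int.ModEq.add_right_cancel' _ h3).symm
    have hnj : ∀ j, j ≠ i → s' j ≤ s j + nn i j := by
      intro j hj
      by_contra! hlt
      have hcom : Y j ^ (s j + 1) * Y i ^ (s i + 1) = Y i ^ (s i + 1) * Y j ^ (s j + 1) :=
        (Commute.pow_pow (hcomm j i) _ _)
      have h1 := DFunLike.congr_fun hcom e
      rw [Module.End.mul_apply, Module.End.mul_apply, hc, hc, map_smul, map_smul,
        hZ.pow_comp hY, hZ.pow_comp hY, smul_smul, smul_smul] at h1
      have hm : ∀ l, (nn i + Pi.single j (s j + 1) : ZMod f → ℕ) l ≤ s' l := fun l => by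
        by_cases hl : l = j
        · subst hl
          simp only [Pi.add_apply, Pi.single_eq_same]
          omega
        · simpa [hl] using hle1 l
      have hne0 : c i * ((-1) ^ (s j + 1) * ((s' j - nn i j).descFactorial (s j + 1) : Fbar p)) ≠ 0 :=
        mul_ne_zero hci (mul_ne_zero (by simp)
          (descFactorial_ne_zero (by omega) (by have := hs' j; omega)))
      have h2 : monoCoeff (mono p s' (nn j + Pi.single i (s i + 1)))
          (nn i + Pi.single j (s j + 1)) ≠ 0 := by
        intro h0
        rw [← map_smul, ← map_smul] at h1
        have h3 := congrArg (fun v => monoCoeff v (nn i + Pi.single j (s j + 1))) (hι h1)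
        simp only [monoCoeff_smul] at h3
        rw [h0, mul_zero, monoCoeff_mono hm, if_pos rfl, mul_one] at h3
        exact hne0 h3
      have hm' : ∀ l, (nn j + Pi.single i (s i + 1) : ZMod f → ℕ) l ≤ s' l := by
        by_contra! h
        obtain ⟨l, hl⟩ := h
        rw [mono_eq_zero hl] at h2
        exact h2 (map_zero (monoCoeffHom _))
      rw [monoCoeff_mono hm'] at h2
      have h4 : nn i + Pi.single j (s j + 1) = nn j + Pi.single i (s i + 1) := by
        by_contra h
        exact h2 (if_neg h)
      have h5 := congrFun h4 i
      simp only [Pi.add_apply, Pi.single_eq_of_ne (Ne.symm hj), Pi.single_eq_same] at h5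
      omega
    have hwi := hw i
    have hobs : ((p : ℤ) ^ f - 1) ∣ detExp p ((fun j => (s' j : ℤ)) - (fun j => (s j : ℤ)) -
      (2 : ℤ) • (fun j => (nn i j : ℤ)) + Pi.single i (2 * ((s i : ℤ) + 1))) := by
      rw [detExp_add, detExp_sub, detExp_sub, detExp_smul, detExp_single, ← cast_natExp,
        ← cast_natExp, ← cast_natExp]
      have h1 := (hw' i hi).dvd
      have h2 := hwi.dvd
      refine (dvd_add h1 h2).trans (dvd_of_eq ?_)
      ring
    obtain ⟨h1, h2, h3, h4⟩ := of_carry_obstruction hp1 hf hs hs' hle1 hni hnj (htop i hi (hp0 i)) hobs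
    have hnn0 : ∀ l, l ≠ i - 1 → nn i l = 0 := fun l hl => by
      by_cases hli : l = i
      · rw [hli, h2]
      · exact (h3 l hli hl).2
    have hexp : natExp p (nn i) = p ^ (f - 1 - (i - 1).val) * nn i (i - 1) := by
      rw [← natExp_single]
      congr 1
      ext l
      by_cases hl : l = i - 1
      · subst hl
        simp
      · simp [hl, hnn0 l hl]
    have hsi := hs i
    have hsi' := hs' i
    rw [hexp] at hwi
    rcases h4 with ⟨h5, h6⟩ | ⟨h5, h6⟩
    · refine (hcrit i).1 ⟨⟨hsi, hs _, by omega, h5, fun l hl hl' => (h3 l hl hl').1⟩, ?_⟩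
      rw [h6, mul_one] at hwi
      push_cast at hwi
      have h7 := (pow_val_sub_one_modEq (p := p) i)
      have h8 := hwi.sub h7
      rw [add_sub_cancel_right] at h8
      convert h8 using 1
      have : (s' i : ℤ) = p - s i - 2 := by omega
      rw [this]
      ring
    · refine (hcrit i).2 ⟨⟨hsi', hs' _, by omega, h5, fun l hl hl' => (h3 l hl hl').1.symm⟩, ?_⟩
      rw [h6, mul_zero, Nat.cast_zero, add_zero] at hwi
      have h8 := (hwi.sub_right (((s i : ℤ) + 1) * (p : ℤ) ^ (f - 1 - i.val))).symm
      rw [add_sub_cancel_right] at h8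
      rwa [add_comm (1 : ℤ)]

end Lifting

section CharP

variable {p : ℕ} [Fact p.Prime] {A : Type*} [Ring A] [Algebra (Fbar p) A]

theorem natCast_eq_zero_of_algebra : (p : A) = 0 := by
  rw [← map_natCast (algebraMap (Fbar p) A), CharP.cast_eq_zero, map_zero]

theorem sum_pow_char_of_commute {ι : Type*} (t : Finset ι) (g : ι → A)
    (h : ∀ i j, Commute (g i) (g j)) : (∑ i ∈ t, g i) ^ p = ∑ i ∈ t, g i ^ p := by
  classical
  induction t using Finset.induction_on with
  | empty => simp [(Fact.out : p.Prime).ne_zero]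
  | insert a t ha ih =>
    rw [Finset.sum_insert ha, Finset.sum_insert ha, ← ih]
    obtain ⟨r, hr⟩ := (Commute.sum_right t g (g a) fun i _ => h a i).exists_add_pow_prime_eq
      (Fact.out : p.Prime)
    rw [hr, natCast_eq_zero_of_algebra, zero_mul, zero_mul, zero_mul, add_zero]

theorem sub_one_pow_char (x : A) : (x - 1) ^ p = x ^ p - 1 := by
  have h : ((Polynomial.X - 1 : Polynomial (Fbar p))) ^ p = Polynomial.X ^ p - 1 := by
    rw [sub_pow_char, one_pow]
  simpa using congrArg (Polynomial.aeval x) h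

end CharP

section Splitting

variable {p : ℕ} [Fact p.Prime] {K : Type*} [Field K] [Algebra ℚ_[p] K]
  [FiniteDimensional ℚ_[p] K] [Algebra ℤ_[p] K] [IsScalarTower ℤ_[p] ℚ_[p] K]
  {f : ℕ} [NeZero f] {σ : ResK p K →+* Fbar p} {d : ZMod f → ℤ} {s : ZMod f → ℕ}
  {d' : ZMod f → ℤ} {s' : ZMod f → ℕ}

/-- The Teichmüller torus. -/
noncomputable def teichTorus (a b : (ResK p K)ˣ) : GLO p K :=
  torus (Units.map (teich p K) a) (Units.map (teich p K) b)

theorem teichTorus_mul (a b a' b' : (ResK p K)ˣ) : teichTorus (p := p) (a * a') (b * b') =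
    teichTorus a b * teichTorus a' b' := by
  unfold teichTorus
  rw [map_mul, map_mul, torus_mul]

theorem red_teichTorus (a b : (ResK p K)ˣ) : red p K (teichTorus a b) = torus a b := by
  unfold teichTorus
  rw [red_torus]
  congr 1 <;> exact Units.ext (residue_teich p K _)

variable (X : RepExtension (infl p K (weightRep p σ d s)) (infl p K (weightRep p σ d' s')))

/-- The modes of the upper unipotent matrices on an extension. -/
noncomputable def extMode (i : ZMod f) : Module.End (Fbar p) X.E :=
  modeOp σ i fun l => X.rep (upper (teich p K l))

theorem extMode_apply (i : ZMod f) (e : X.E) :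
    extMode X i e = modeOp σ i fun l => X.rep (upper (teich p K l)) e := modeOp_apply σ i _ e

theorem rep_upper_commute (x y : OK p K) : Commute (X.rep (upper x)) (X.rep (upper y)) := by
  unfold Commute SemiconjBy
  rw [← map_mul, ← map_mul, ← upper_add, ← upper_add, add_comm]

theorem extMode_comm (i j : ZMod f) : extMode X i * extMode X j = extMode X j * extMode X i := by
  unfold extMode modeOp
  refine (Commute.sum_left _ _ _ fun l _ => Commute.sum_right _ _ _ fun m _ => ?_)
  exact ((rep_upper_commute X _ _).smul_left _).smul_right _

theorem infl_upper_teich (d : ZMod f → ℤ) (s : ZMod f → ℕ) (l : ResK p K) (v : WeightSpace p s) :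
    infl p K (weightRep p σ d s) (upper (teich p K l)) v = weightRep p σ d s (upper l) v := by
  change weightRep p σ d s (red p K (upper (teich p K l))) v = _
  rw [red_upper, residue_teich]

theorem infl_teichTorus (d : ZMod f → ℤ) (s : ZMod f → ℕ) (a b : (ResK p K)ˣ)
    (v : WeightSpace p s) :
    infl p K (weightRep p σ d s) (teichTorus a b) v = weightRep p σ d s (torus a b) v := by
  change weightRep p σ d s (red p K (teichTorus a b)) v = _
  rw [red_teichTorus]

theorem proj_extMode (i : ZMod f) (e : X.E) : X.proj (extMode X i e) =
    modeOp σ i (fun x => weightRep p σ d s (upper x)) (X.proj e) := by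
  rw [extMode_apply, modeOp_apply]
  refine (map_modeOp σ i X.proj.toLinearMap _).trans ?_
  unfold modeOp
  refine Finset.sum_congr rfl fun l _ => ?_
  congr 1
  exact (Representation.IntertwiningMap.isIntertwining _ _ X.proj _ _).trans (infl_upper_teich d s l _)

theorem extMode_incl (i : ZMod f) (w : WeightSpace p s') : extMode X i (X.incl w) =
    X.incl (modeOp σ i (fun x => weightRep p σ d' s' (upper x)) w) := by
  rw [extMode_apply, modeOp_apply]
  refine Eq.trans ?_ (map_modeOp σ i X.incl.toLinearMap _).symm
  unfold modeOp
  refine Finset.sum_congr rfl fun l _ => ?_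
  congr 1
  exact (Representation.IntertwiningMap.isIntertwining _ _ X.incl _ _).symm.trans (congrArg X.incl (infl_upper_teich d' s' l _))

theorem teichTorus_mul_upper (a b : (ResK p K)ˣ) (l : ResK p K) :
    teichTorus a b * upper (teich p K l) =
      upper (teich p K (a * l * ↑b⁻¹)) * teichTorus (p := p) a b := by
  unfold teichTorus
  rw [torus_mul_upper]
  congr 2
  simp only [map_mul, Units.coe_map, ← map_inv]

theorem rep_torus_extMode (a b : (ResK p K)ˣ) (i : ZMod f) (e : X.E) :
    X.rep (teichTorus a b) (extMode X i e) =
      emb p σ i (a * ↑b⁻¹) • extMode X i (X.rep (teichTorus a b) e) := by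
  rw [extMode_apply, extMode_apply]
  unfold modeOp
  rw [map_sum, Finset.smul_sum]
  let φ : ResK p K ≃ ResK p K := (Units.mulLeft a).trans (Units.mulRight b⁻¹)
  conv_rhs => rw [← Equiv.sum_comp φ]
  refine Finset.sum_congr rfl fun l _ => ?_
  have h1 : φ l = a * l * ↑b⁻¹ := rfl
  rw [map_smul, ← Module.End.mul_apply, ← map_mul, teichTorus_mul_upper, map_mul,
    Module.End.mul_apply, smul_smul, h1]
  congr 1
  have ha : emb p σ i (a : ResK p K) ≠ 0 := (a.isUnit.map (emb p σ i)).ne_zero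
  have hb : emb p σ i ((b⁻¹ : (ResK p K)ˣ) : ResK p K) ≠ 0 := ((b⁻¹).isUnit.map (emb p σ i)).ne_zero
  simp only [map_mul, mul_inv]
  field_simp

theorem rep_torus_extMode_pow (a b : (ResK p K)ˣ) (i : ZMod f) (m : ℕ) (e : X.E) :
    X.rep (teichTorus a b) ((extMode X i ^ m) e) =
      emb p σ i (a * ↑b⁻¹) ^ m • (extMode X i ^ m) (X.rep (teichTorus a b) e) := by
  induction m with
  | zero => simp
  | succ m ih =>
    rw [pow_succ', Module.End.mul_apply, rep_torus_extMode, ih, map_smul, smul_smul, pow_succ']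
    rfl

variable (hf : f = resF p K) (hf1 : 1 < f) (hs : ∀ i, s i + 2 ≤ p) (hs' : ∀ i, s' i + 2 ≤ p)

include hf in
theorem exists_torus_lift : ∃ e : X.E, X.proj e = mono p s 0 ∧ ∀ a b : (ResK p K)ˣ,
    X.rep (teichTorus a b) e = (σ a ^ detExp p d * σ b ^ (detExp p d + natExp p s)) • e := by
  classical
  obtain ⟨e0, he0⟩ := X.proj_surjective (mono p s 0)
  let χ : (ResK p K)ˣ × (ResK p K)ˣ → Fbar p := fun x =>
    σ x.1 ^ detExp p d * σ x.2 ^ (detExp p d + natExp p s)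
  have hne : ∀ a : (ResK p K)ˣ, σ (a : ResK p K) ≠ 0 := fun a => (a.isUnit.map σ).ne_zero
  have hχ0 : ∀ x, χ x ≠ 0 := fun x => mul_ne_zero (zpow_ne_zero _ (hne _)) (zpow_ne_zero _ (hne _))
  have hχ : ∀ x y, χ (x * y) = χ x * χ y := fun x y => by
    simp only [χ, Prod.fst_mul, Prod.snd_mul, Units.val_mul, map_mul, mul_zpow]
    ring
  let t : (ResK p K)ˣ × (ResK p K)ˣ → GLO p K := fun x => teichTorus x.1 x.2
  have ht : ∀ x y, t (x * y) = t x * t y := fun x y => teichTorus_mul _ _ _ _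
  have hv : ∀ x, X.proj (X.rep (t x) e0) = χ x • mono p s 0 := fun x => by
    rw [X.proj.isIntertwining, he0, infl_teichTorus, weightRep_torus σ d s (n := 0)
      fun i => Nat.zero_le _]
    simp [χ, natExp]
  refine ⟨∑ x, (χ x)⁻¹ • X.rep (t x) e0, ?_, fun a b => ?_⟩
  · rw [map_sum]
    have h1 : ∀ x, X.proj ((χ x)⁻¹ • X.rep (t x) e0) = mono p s 0 := fun x => by
      rw [map_smul, hv, inv_smul_smul₀ (hχ0 x)]
    simp only [h1, Finset.sum_const, Finset.card_univ, Fintype.card_prod]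
    rw [← Nat.cast_smul_eq_nsmul (Fbar p), Fintype.card_units, card_resK_eq hf]
    have h2 : ((p ^ f - 1 : ℕ) : Fbar p) = -1 := by
      rw [Nat.cast_sub (Nat.one_le_pow _ _ (Fact.out : p.Prime).pos), Nat.cast_pow,
        CharP.cast_eq_zero, zero_pow (NeZero.ne f)]
      simp
    rw [Nat.cast_mul, h2]
    simp
  · rw [map_sum, Finset.smul_sum, ← Equiv.sum_comp (Equiv.mulLeft (a, b))
      (fun x => (σ a ^ detExp p d * σ b ^ (detExp p d + natExp p s)) • (χ x)⁻¹ • X.rep (t x) e0)]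
    refine Finset.sum_congr rfl fun x _ => ?_
    rw [map_smul, Equiv.coe_mulLeft, hχ, ht, map_mul, Module.End.mul_apply]
    change (χ x)⁻¹ • X.rep (t (a, b)) _ = χ (a, b) • (χ (a, b) * χ x)⁻¹ • X.rep (t (a, b)) _
    rw [smul_smul, mul_inv (χ (a, b)) (χ x), mul_inv_cancel_left₀ (hχ0 _)]

theorem extMode_pow_char (hK : ∀ g ∈ congrSub p K 1, ∀ e, X.rep g e = e) (hf : f = resF p K)
    (hf1 : 1 < f) (i : ZMod f) : extMode X i ^ p = 0 := by
  unfold extMode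
  change (∑ l, (emb p σ i l)⁻¹ • X.rep (upper (teich p K l))) ^ p = 0
  rw [sum_pow_char_of_commute]
  · have h1 : ∀ l, X.rep (upper (teich p K l)) ^ p = 1 := fun l => by
      rw [← map_pow]
      have : upper (teich p K l) ^ p = upper ((p : OK p K) * teich p K l) := by
        have h : ∀ m : ℕ, upper (teich p K l) ^ m = upper ((m : OK p K) * teich p K l) := fun m => by
          induction m with
          | zero => simp [upper_zero]
          | succ m ih => rw [pow_succ, ih, ← upper_add]; push_cast; ring_nf
        exact h p
      rw [this]
      refine LinearMap.ext fun e => hK _ (upper_mem_congrSub.2 ?_) e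
      rw [pow_one]
      exact Ideal.mul_mem_right _ _ (natCast_mem_maximalIdeal p K)
    simp only [smul_pow, h1]
    rw [← Finset.sum_smul, ← sum_pow_char_of_commute _ _ fun i j => Commute.all _ _,
      sum_emb_inv σ (card_resK_eq hf) hf1, zero_pow (Fact.out : p.Prime).ne_zero, zero_smul]
  · intro l m
    exact ((rep_upper_commute X _ _).smul_left _).smul_right _

end Splitting

section Reduction

/-- The group of upper unipotent matrices. -/
def upperSubgroup (R : Type*) [CommRing R] : Subgroup (GL (Fin 2) R) :=
  MonoidHom.range (G := Multiplicative R)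
    { toFun := fun x => upper x.toAdd
      map_one' := upper_zero
      map_mul' := fun x y => upper_add x.toAdd y.toAdd }

theorem mem_upperSubgroup {R : Type*} [CommRing R] {g : GL (Fin 2) R} :
    g ∈ upperSubgroup R ↔ ∃ x, upper x = g := Iff.rfl

theorem upper_injective {R : Type*} [CommRing R] : Function.Injective (upper : R → GL (Fin 2) R) :=
  fun x y h => by
    have := congrArg (fun g : GL (Fin 2) R => g 0 1) h
    simpa using this

theorem index_upperSubgroup (k : Type*) [Field k] [Fintype k] :
    (upperSubgroup k).index = (Fintype.card k ^ 2 - 1) * (Fintype.card k - 1) := by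
  classical
  have h1 : Nat.card (upperSubgroup k) = Fintype.card k := by
    rw [← Nat.card_eq_fintype_card]
    exact (Nat.card_congr (Equiv.ofInjective (upper : k → GL (Fin 2) k) upper_injective)).symm
  have h2 := (upperSubgroup k).index_mul_card
  rw [h1, Matrix.card_GL_field, Fin.prod_univ_two] at h2
  simp only [Fin.val_zero, Fin.val_one, pow_zero, pow_one] at h2
  have hq : 0 < Fintype.card k := Fintype.card_pos
  refine Nat.eq_of_mul_eq_mul_right hq (h2.trans ?_)
  rw [mul_assoc]
  congr 1
  rw [Nat.sub_mul, one_mul, pow_two]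

variable {p : ℕ} [Fact p.Prime] {K : Type*} [Field K] [Algebra ℚ_[p] K]
  [FiniteDimensional ℚ_[p] K] [Algebra ℤ_[p] K] [IsScalarTower ℤ_[p] ℚ_[p] K]

theorem red_surjective : Function.Surjective (red p K) := by
  intro g
  choose h hh using fun i j => IsLocalRing.residue_surjective (R := OK p K) (g i j)
  have hmap : (IsLocalRing.residue (OK p K)).mapMatrix (Matrix.of h) = g := by
    ext i j
    exact hh i j
  have hdet : IsUnit (Matrix.of h).det := by
    rw [← IsLocalRing.notMem_maximalIdeal, ← IsLocalRing.residue_eq_zero_iff, RingHom.map_det, hmap]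
    exact (Matrix.isUnits_det_units g).ne_zero
  refine ⟨Matrix.GeneralLinearGroup.mk'' _ hdet, ?_⟩
  ext i j
  exact hh i j

theorem red_eq_one_iff {g : GLO p K} : red p K g = 1 ↔ g ∈ congrSub p K 1 := by
  refine ⟨fun h => mem_congrSub.2 fun i j => ?_, red_of_mem_congrSub⟩
  have h2 : red p K g i j = IsLocalRing.residue (OK p K) (g i j) := rfl
  rw [pow_one, ← IsLocalRing.residue_eq_zero_iff, map_sub, ← h2, h, sub_eq_zero]
  by_cases hij : i = j
  · subst hij
    simp
  · simp [Matrix.one_apply_ne hij]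

end Reduction

section Splitting

variable {p : ℕ} [Fact p.Prime] {K : Type*} [Field K] [Algebra ℚ_[p] K]
  [FiniteDimensional ℚ_[p] K] [Algebra ℤ_[p] K] [IsScalarTower ℤ_[p] ℚ_[p] K]
  {f : ℕ} [NeZero f] {σ : ResK p K →+* Fbar p} {d : ZMod f → ℤ} {s : ZMod f → ℕ}
  {d' : ZMod f → ℤ} {s' : ZMod f → ℕ}

theorem exists_natDigits (N : ℤ) : ∃ n : ZMod f → ℕ, (∀ i, n i + 1 ≤ p) ∧ (∃ i, n i + 1 ≠ p) ∧
    N ≡ natExp p n [ZMOD (p : ℤ) ^ f - 1] := by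
  obtain ⟨m, h1, h2, h3⟩ := exists_digits (f := f) (Fact.out : p.Prime).one_lt 0 N
  have h4 : ∀ i, ((m i).toNat : ℤ) = m i := fun i => Int.toNat_of_nonneg (h1 i).1
  refine ⟨fun i => (m i).toNat, fun i => ?_, ?_, ?_⟩
  · have := h1 i
    have := h4 i
    beta_reduce
    omega
  · obtain ⟨i, hi⟩ := h2
    refine ⟨i, ?_⟩
    have := h4 i
    beta_reduce
    omega
  · rw [cast_natExp]
    simpa only [h4] using h3

variable (X : RepExtension (infl p K (weightRep p σ d s)) (infl p K (weightRep p σ d' s')))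

theorem finite_ext {S : WeightSpace p s →ₗ[Fbar p] X.E} (hS : ∀ v, X.proj (S v) = v) :
    Module.Finite (Fbar p) X.E := by
  have h1 : Module.Finite (Fbar p) (WeightSpace p s) := Module.Finite.of_basis (weightBasis p s)
  have h2 : Module.Finite (Fbar p) (WeightSpace p s') := Module.Finite.of_basis (weightBasis p s')
  refine Module.Finite.of_surjective (X.incl.toLinearMap.coprod S) fun e => ?_
  obtain ⟨w, hw⟩ := X.exists_incl_eq_sub (a := e) (b := S (X.proj e)) (by rw [hS])
  refine ⟨(w, X.proj e), ?_⟩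
  rw [LinearMap.coprod_apply]
  change X.incl w + _ = _
  rw [hw, sub_add_cancel]

theorem isNilpotent_rep_upper (x : OK p K) : IsNilpotent (X.rep (upper x) - 1) := by
  refine ⟨p * 2, ?_⟩
  have h : ∀ m : ℕ, upper x ^ m = upper ((m : OK p K) * x) := fun m => by
    induction m with
    | zero => simp [upper_zero]
    | succ m ih => rw [pow_succ, ih, ← upper_add]; push_cast; ring_nf
  rw [pow_mul, sub_one_pow_char, ← map_pow, h, pow_two]
  have hg : upper ((p : OK p K) * x) ∈ congrSub p K 1 := upper_mem_congrSub.2 (by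
    rw [pow_one]
    exact Ideal.mul_mem_right _ _ (natCast_mem_maximalIdeal p K))
  refine LinearMap.ext fun e => ?_
  rw [Module.End.mul_apply, LinearMap.sub_apply, LinearMap.sub_apply, Module.End.one_apply,
    Module.End.one_apply]
  obtain ⟨w, hw⟩ := X.exists_incl_eq_sub (a := X.rep (upper ((p : OK p K) * x)) e) (b := e) (by
    rw [X.proj.isIntertwining, infl_apply_of_mem _ hg])
  rw [← hw, ← X.incl.isIntertwining, infl_apply_of_mem _ hg, sub_self, LinearMap.zero_apply]

variable (hf : f = resF p K) (hf1 : 1 < f) (hs : ∀ i, s i + 2 ≤ p) (hs' : ∀ i, s' i + 2 ≤ p)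
  (hcrit : ∀ i, ¬ CritOne p i d s d' s' ∧ ¬ CritOne p i d' s' d s)

include hf hf1 hs hs' hcrit

theorem exists_mode_section
    (hp : (∀ g ∈ congrSub p K 1, ∀ e, X.rep g e = e) ∨ ∃ nw : ZMod f → ℕ, (∀ i, nw i ≤ s' i) ∧
      detExp p d ≡ detExp p d' + natExp p nw [ZMOD (p : ℤ) ^ f - 1] ∧
      ∀ i, nw i + s i + 2 ≤ p) :
    ∃ S : WeightSpace p s →ₗ[Fbar p] X.E, (∀ v, X.proj (S v) = v) ∧
      ∀ i v, S (modeOp σ i (fun x => weightRep p σ d s (upper x)) v) = extMode X i (S v) := by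
  have hk := card_resK_eq hf
  have hZ := isUpperModes σ hk hf1 hs d
  have hZ' := isUpperModes σ hk hf1 hs' d'
  obtain ⟨e, he, het⟩ := exists_torus_lift X hf
  have hne : ∀ a : (ResK p K)ˣ, σ (a : ResK p K) ≠ 0 := fun a => (a.isUnit.map σ).ne_zero
  have hproj : ∀ i m v, X.proj ((extMode X i ^ m) v) =
      ((modeOp σ i fun x => weightRep p σ d s (upper x)) ^ m) (X.proj v) := fun i m v => by
    induction m with
    | zero => simp
    | succ m ih => rw [pow_succ', pow_succ', Module.End.mul_apply, Module.End.mul_apply,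
        proj_extMode, ih]
  have hw : ∀ i, ∃ w, X.incl w = (extMode X i ^ (s i + 1)) e := fun i => by
    refine (X.exact _).1 ?_
    rw [hproj, he, hZ.pow i]
    simp
  choose w hw using hw
  have hwt : ∀ i (a b : (ResK p K)ˣ), weightRep p σ d' s' (torus a b) (w i) =
      (σ a ^ (detExp p d + ((s i : ℤ) + 1) * (p : ℤ) ^ (f - 1 - i.val)) *
        σ b ^ (detExp p d + natExp p s - ((s i : ℤ) + 1) * (p : ℤ) ^ (f - 1 - i.val))) •
        w i := fun i a b => by
    apply X.incl_injective
    rw [← infl_teichTorus, X.incl.isIntertwining, hw, rep_torus_extMode_pow, het, map_smul,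
      smul_smul, map_smul, hw]
    congr 1
    rw [emb_apply, map_mul, map_units_inv, zpow_add₀ (hne a), zpow_sub₀ (hne b), ← pow_mul, mul_pow,
      inv_pow, mul_comm (p ^ (f - 1 - i.val))]
    have h1 : ((s i : ℤ) + 1) * (p : ℤ) ^ (f - 1 - i.val) =
        (((s i + 1) * p ^ (f - 1 - i.val) : ℕ) : ℤ) := by push_cast; rfl
    rw [h1, zpow_natCast, zpow_natCast, div_eq_mul_inv]
    ring
  choose nn hnn hnn' hnw using fun i : ZMod f => exists_natDigits (p := p) (f := f)
    (detExp p d + ((s i : ℤ) + 1) * (p : ℤ) ^ (f - 1 - i.val) - detExp p d')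
  have hwn : ∀ i, detExp p d + ((s i : ℤ) + 1) * (p : ℤ) ^ (f - 1 - i.val) ≡
      detExp p d' + natExp p (nn i) [ZMOD (p : ℤ) ^ f - 1] := fun i => by
    simpa using (hnw i).add_left (detExp p d')
  have hwc : ∀ i, w i = monoCoeff (w i) (nn i) • mono p s' (nn i) := fun i => by
    refine eq_smul_mono_of_weight σ hk hs' d' (fun a => ?_) (hnn i) (hnn' i) (hwn i)
    simpa using hwt i a 1
  obtain ⟨w0, hw0⟩ := exists_good_lift (Z' := _) (ι := X.incl.toLinearMap) (Y := extMode X) hs' hZ'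
    (extMode_comm X) (fun i v => extMode_incl X i v) X.incl_injective hf1 hs hcrit (e := e)
    (c := fun i => monoCoeff (w i) (nn i)) (nn := nn) (fun i => by
      rw [← hw, ← map_smul, ← hwc]
      rfl) hnn hnn' (fun i => (hwn i).symm) (fun i hi => by
      rw [← hw] at hi
      have hcoef : monoCoeff (w i) (nn i) ≠ 0 := fun h => hi (by
        rw [hwc i, h, zero_smul, map_zero])
      have hle : ∀ l, nn i l ≤ s' l := fun l => by
        by_contra! hl
        exact hi (by rw [hwc i, mono_eq_zero hl, smul_zero, map_zero])
      refine (zpow_eq_iff σ hk).1 fun b => ?_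
      have h1 := monoCoeff_torus σ d' s' (w i) hle 1 b
      rw [hwt, monoCoeff_smul] at h1
      simpa using mul_right_cancel₀ hcoef h1)
    (hp.imp (fun h i => extMode_pow_char X h hf hf1 i) id)
  obtain ⟨S, hS0, hS⟩ := hZ.exists_hom hs (extMode X) (extMode_comm X) _ hw0
  refine ⟨S, fun v => ?_, hS⟩
  let M : Submodule (Fbar p) (WeightSpace p s) :=
    LinearMap.eqLocus (X.proj.toLinearMap.comp S) LinearMap.id
  refine hZ.mem_of_stable hs M (fun i v hv => ?_) ?_ v
  · have hv' : X.proj (S v) = v := hv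
    change X.proj (S _) = _
    rw [hS, proj_extMode, hv']
    rfl
  · change X.proj (S _) = _
    rw [hS0, map_add, he]
    have : X.proj (X.incl.toLinearMap w0) = 0 := (X.exact _).2 ⟨w0, rfl⟩
    rw [this, add_zero]
    rfl

theorem exists_upper_section
    (hker : ∀ x ∈ IsLocalRing.maximalIdeal (OK p K), X.rep (upper x) = 1 ∨ ∃ y, x = p • y)
    (hp : (∀ g ∈ congrSub p K 1, ∀ e, X.rep g e = e) ∨ ∃ nw : ZMod f → ℕ, (∀ i, nw i ≤ s' i) ∧
      detExp p d ≡ detExp p d' + natExp p nw [ZMOD (p : ℤ) ^ f - 1] ∧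
      ∀ i, nw i + s i + 2 ≤ p) :
    ∃ S : WeightSpace p s →ₗ[Fbar p] X.E, (∀ v, X.proj (S v) = v) ∧
      ∀ x v, S (infl p K (weightRep p σ d s) (upper x) v) = X.rep (upper x) (S v) := by
  obtain ⟨S, hS, hSZ⟩ := exists_mode_section X hf hf1 hs hs' hcrit hp
  refine ⟨S, hS, fun x v => ?_⟩
  have hfin := finite_ext X hS
  have hmem := unipotent_mem_adjoin (IsLocalRing.residue (OK p K)).toAddMonoidHom (teich p K) σ
    (card_resK_eq hf) hf1 (residue_teich p K) (fun x => X.rep (upper x))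
    (fun x y => by rw [upper_add, map_mul])
    (fun x hx => hker x ((IsLocalRing.residue_eq_zero_iff x).1 hx)) (isNilpotent_rep_upper X) x
  let A : Subalgebra (Fbar p) (Module.End (Fbar p) X.E) :=
    { carrier := {Q | ∀ v, Q (S v) ∈ LinearMap.range S}
      mul_mem' := by
        intro Q R hQ hR v
        obtain ⟨w, hw⟩ := hR v
        rw [Module.End.mul_apply, ← hw]
        exact hQ w
      add_mem' := fun hQ hR v => Submodule.add_mem _ (hQ v) (hR v)
      algebraMap_mem' := fun c v => Submodule.smul_mem _ c ⟨v, rfl⟩ }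
  have hA : Algebra.adjoin (Fbar p) (Set.range fun i : ZMod f => extMode X i) ≤ A :=
    Algebra.adjoin_le (by
      rintro _ ⟨i, rfl⟩ v
      exact ⟨_, hSZ i v⟩)
  obtain ⟨w, hw⟩ := hA hmem v
  have h1 : w = infl p K (weightRep p σ d s) (upper x) v := by
    rw [← hS w, hw, X.proj.isIntertwining, hS]
  rw [← h1, hw]

theorem splits_of_trivial (hK : ∀ g ∈ congrSub p K 1, ∀ e, X.rep g e = e) : X.Splits := by
  obtain ⟨S, hS, hSu⟩ := exists_upper_section X hf hf1 hs hs' hcrit (fun x hx => Or.inl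
    (LinearMap.ext fun e => hK _ (upper_mem_congrSub.2 (by simpa using hx)) e)) (Or.inl hK)
  let H : Subgroup (GLO p K) := (upperSubgroup (ResK p K)).comap (red p K)
  have hidx : H.index = ((p ^ f) ^ 2 - 1) * (p ^ f - 1) := by
    change (Subgroup.comap (red p K) _).index = _
    rw [Subgroup.index_comap_of_surjective (f := red p K) _ red_surjective, index_upperSubgroup, card_resK_eq hf]
  have hq : 1 < p ^ f := Nat.one_lt_pow (NeZero.ne f) (Fact.out : p.Prime).one_lt
  have hq2 : 1 < (p ^ f) ^ 2 := Nat.one_lt_pow two_ne_zero hq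
  have hfin : H.FiniteIndex := ⟨by
    rw [hidx]
    exact mul_ne_zero (by omega) (by omega)⟩
  refine X.splits_of_subgroup H ?_ S hS ?_
  · rw [hidx, Nat.cast_mul, Nat.cast_sub hq.le, Nat.cast_sub hq2.le]
    simp [NeZero.ne f]
  · intro h hh v
    obtain ⟨l, hl⟩ := mem_upperSubgroup.1 hh
    obtain ⟨y, rfl⟩ := IsLocalRing.residue_surjective l
    obtain ⟨g, rfl⟩ : ∃ g, upper y * g = h := ⟨(upper y)⁻¹ * h, mul_inv_cancel_left _ _⟩
    have h1 : g ∈ congrSub p K 1 := by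
      rw [← red_eq_one_iff]
      rwa [map_mul, red_upper, hl, eq_comm, mul_eq_left] at hl
    rw [map_mul, map_mul, Module.End.mul_apply, Module.End.mul_apply, infl_apply_of_mem _ h1,
      hK _ h1, hSu]

/-- The nonsplit smooth extensions of two different weights. -/
theorem crit_of_smoothExtNeZero (hne : IsEmpty ((weightRep p σ d s).Equiv (weightRep p σ d' s')))
    (hX : IsSmooth p K X.rep) (hsplit : ¬ X.Splits) :
    ∃ i, CritTwo p i d s d' s' ∨ CritTwo p i d' s' d s := by
  by_contra! hcrit2
  obtain ⟨S, hS⟩ := exists_linear_section X.proj.toLinearMap X.proj_surjective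
  obtain ⟨Φ, hΦ, hΦS⟩ := exists_equivariantFamily X hX S hS
  have hlow : ∀ x ∈ IsLocalRing.maximalIdeal (OK p K), Φ (lower x) (mono p s 0) = 0 := by
    by_contra! h
    obtain ⟨i, h | h⟩ := hΦ.crit_of_lower hf hf1 hs hs' h
    · exact (hcrit i).1 h
    · exact (hcrit2 i).1 h
  have hup : ∀ x ∈ IsLocalRing.maximalIdeal (OK p K), Φ (upper x) (mono p s 0) = 0 := by
    by_contra! h
    obtain ⟨i, h | h⟩ := hΦ.crit_of_upper hf hf1 hs hs' hlow hne h
    · exact (hcrit i).2 h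
    · exact (hcrit2 i).2 h
  refine hsplit (splits_of_trivial X hf hf1 hs hs' hcrit fun g hg e => ?_)
  refine X.eq_of_fixes_section (congrSub p K 1) (fun g hg v => infl_apply_of_mem _ hg v) hS hg
    (fun v => ?_) e
  rw [← sub_eq_zero, ← hΦS g hg, hΦ.eq_zero hf hf1 hs hs' hlow hne hup hg, LinearMap.zero_apply,
    map_zero]

/-- In the unramified case the second criterion does not give rise to extensions. -/
theorem splits_of_critTwo (hne : IsEmpty ((weightRep p σ d s).Equiv (weightRep p σ d' s')))
    (hX : IsSmooth p K X.rep) (he : ramE p K = 1) {i : ZMod f} (h2 : CritTwo p i d s d' s') :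
    X.Splits := by
  obtain ⟨S, hS, hSu⟩ := exists_upper_section X hf hf1 hs hs' hcrit (fun x hx => by
      obtain ⟨y, hy⟩ := mem_maximalIdeal_of_ramE_eq_one p K he hx
      exact Or.inr ⟨y, by rw [hy, nsmul_eq_mul]⟩)
    (Or.inr ⟨Pi.single i 1, fun l => by
      by_cases hl : l = i
      · subst hl
        rw [Pi.single_eq_same, h2.2.1]
        omega
      · simp [hl], by
      rw [natExp_single, mul_one]
      simpa using (h2.2.2.2.add_right ((p : ℤ) ^ (f - 1 - i.val))).symm, fun l => by
      by_cases hl : l = i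
      · subst hl
        have := hs' l
        rw [h2.2.1] at this
        rw [Pi.single_eq_same]
        omega
      · simpa [hl] using hs l⟩)
  obtain ⟨Φ, hΦ, hΦS⟩ := exists_equivariantFamily X hX S hS
  have hup : ∀ x ∈ IsLocalRing.maximalIdeal (OK p K), ∀ v, Φ (upper x) v = 0 := fun x hx v => by
    have hx' : upper x ∈ congrSub p K 1 := upper_mem_congrSub.2 (by simpa using hx)
    apply X.incl_injective
    rw [hΦS _ hx', ← hSu, infl_apply_of_mem _ hx', sub_self, map_zero]
  let w : GLO p K := ⟨!![0, 1; 1, 0], !![0, 1; 1, 0], by simp [Matrix.one_fin_two],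
    by simp [Matrix.one_fin_two]⟩
  have hw : ∀ x : OK p K, w * upper x * w⁻¹ = lower x := fun x => by
    rw [mul_inv_eq_iff_eq_mul]
    ext i j
    fin_cases i <;> fin_cases j <;> simp [w, Matrix.mul_apply, Fin.sum_univ_two]
  have hlow : ∀ x ∈ IsLocalRing.maximalIdeal (OK p K), Φ (lower x) (mono p s 0) = 0 :=
    fun x hx => by
    have hx' : upper x ∈ congrSub p K 1 := upper_mem_congrSub.2 (by simpa using hx)
    have h1 := hΦ.conj w _ hx' (weightRep p σ d s (red p K w)⁻¹ (mono p s 0))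
    rwa [hw, hup x hx, map_zero, ← Module.End.mul_apply, ← map_mul, mul_inv_cancel, map_one,
      Module.End.one_apply] at h1
  refine splits_of_trivial X hf hf1 hs hs' hcrit fun g hg e => ?_
  refine X.eq_of_fixes_section (congrSub p K 1) (fun g hg v => infl_apply_of_mem _ hg v) hS hg
    (fun v => ?_) e
  rw [← sub_eq_zero, ← hΦS g hg,
    hΦ.eq_zero hf hf1 hs hs' hlow hne (fun x hx => hup x hx _) hg, LinearMap.zero_apply, map_zero]

end Splitting

section Dual

variable {F V W : Type} [Field F] [AddCommMonoid V] [Module F V] [AddCommMonoid W] [Module F W]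
  {G : Type*} [Group G] {ρ : Representation F G V} {ρ' : Representation F G W}

/-- An anti-involution of a group. -/
structure AntiInvolution (G : Type*) [Group G] where
  toFun : G → G
  one : toFun 1 = 1
  mul : ∀ g h, toFun (g * h) = toFun h * toFun g
  invol : ∀ g, toFun (toFun g) = g

variable (τ : AntiInvolution G)

/-- The dual of a representation with respect to an anti-involution. -/
def AntiInvolution.dual {E : Type} [AddCommMonoid E] [Module F E] (ρ : Representation F G E) :
    Representation F G (Module.Dual F E) where
  toFun g := (ρ (τ.toFun g)).dualMap
  map_one' := by
    rw [τ.one, map_one]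
    rfl
  map_mul' g h := by
    rw [τ.mul, map_mul]
    rfl

variable (X : RepExtension ρ ρ') (B : V ≃ₗ[F] Module.Dual F V) (B' : W ≃ₗ[F] Module.Dual F W)
  (hB : ∀ g v w, B (ρ g v) w = B v (ρ (τ.toFun g) w))
  (hB' : ∀ g v w, B' (ρ' g v) w = B' v (ρ' (τ.toFun g) w))
  {S : V →ₗ[F] X.E} (hS : ∀ v, X.proj (S v) = v)

/-- The dual of an extension of representations that carry nondegenerate invariant forms. -/
noncomputable def RepExtension.dual : RepExtension ρ' ρ where
  E := Module.Dual F X.E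
  rep := τ.dual X.rep
  incl := ⟨X.proj.toLinearMap.dualMap.comp B.toLinearMap, fun g => by
    refine LinearMap.ext fun v => LinearMap.ext fun e => ?_
    change B (ρ g v) (X.proj e) = B v (X.proj (X.rep (τ.toFun g) e))
    rw [hB, X.proj.isIntertwining]⟩
  proj := ⟨B'.symm.toLinearMap.comp X.incl.toLinearMap.dualMap, fun g => by
    refine LinearMap.ext fun φ => B'.injective (LinearMap.ext fun w => ?_)
    change B' (B'.symm _) w = B' (ρ' g (B'.symm _)) w
    rw [hB', LinearEquiv.apply_symm_apply, LinearEquiv.apply_symm_apply]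
    change φ (X.rep (τ.toFun g) (X.incl w)) = φ (X.incl (ρ' (τ.toFun g) w))
    rw [X.incl.isIntertwining]⟩
  incl_injective := by
    refine Function.Injective.comp (g := X.proj.toLinearMap.dualMap) ?_ B.injective
    intro φ ψ h
    refine LinearMap.ext fun v => ?_
    obtain ⟨e, rfl⟩ := X.proj_surjective v
    exact DFunLike.congr_fun h e
  proj_surjective := by
    refine Function.Surjective.comp (g := B'.symm) B'.symm.surjective ?_
    intro φ
    obtain ⟨r, hr⟩ := X.exists_lift (LinearMap.id - S.comp X.proj.toLinearMap) fun e => by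
      obtain ⟨w, hw⟩ := X.exists_incl_eq_sub (a := e) (b := S (X.proj e)) (by rw [hS])
      exact (X.exact _).2 ⟨w, hw⟩
    refine ⟨φ.comp r, LinearMap.ext fun w => ?_⟩
    change φ (r (X.incl w)) = φ w
    congr 1
    apply X.incl_injective
    rw [hr]
    change X.incl w - S (X.proj (X.incl w)) = _
    rw [(X.exact _).2 ⟨w, rfl⟩, map_zero, sub_zero]
  exact φ := by
    constructor
    · intro h
      have h1 : ∀ w, φ (X.incl w) = 0 := fun w => by
        have h2 : B'.symm (φ.comp X.incl.toLinearMap) = 0 := h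
        rw [LinearEquiv.map_eq_zero_iff] at h2
        exact DFunLike.congr_fun h2 w
      refine ⟨B.symm (φ.comp S), LinearMap.ext fun e => ?_⟩
      change B (B.symm _) (X.proj e) = _
      rw [LinearEquiv.apply_symm_apply]
      obtain ⟨w, hw⟩ := X.exists_incl_eq_sub (a := e) (b := S (X.proj e)) (by rw [hS])
      have h3 := h1 w
      rw [hw, map_sub, sub_eq_zero] at h3
      exact h3.symm
    · rintro ⟨v, rfl⟩
      change B'.symm _ = 0
      rw [LinearEquiv.map_eq_zero_iff]
      refine LinearMap.ext fun w => ?_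
      change B v (X.proj (X.incl w)) = 0
      rw [(X.exact _).2 ⟨w, rfl⟩, map_zero]

theorem RepExtension.splits_of_retraction (hS : ∀ v, X.proj (S v) = v) (R : X.E →ₗ[F] W)
    (hR : ∀ w, R (X.incl w) = w) (hRg : ∀ g e, R (X.rep g e) = ρ' g (R e)) : X.Splits := by
  let T : X.E →ₗ[F] X.E := LinearMap.id - X.incl.toLinearMap.comp R
  have hT : ∀ e, T e = e - X.incl (R e) := fun e => rfl
  have hTi : ∀ w, T (X.incl w) = 0 := fun w => by rw [hT, hR, sub_self]
  refine ⟨⟨T.comp S, fun g => LinearMap.ext fun v => ?_⟩, fun v => ?_⟩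
  · change T (S (ρ g v)) = X.rep g (T (S v))
    obtain ⟨w, hw⟩ := X.exists_incl_eq_sub (a := S (ρ g v)) (b := X.rep g (S v))
      (by rw [X.proj.isIntertwining, hS, hS])
    have h1 := hTi w
    rw [hw, map_sub, sub_eq_zero] at h1
    rw [h1, hT, hT, map_sub, hRg, X.incl.isIntertwining]
  · change X.proj (T (S v)) = v
    obtain ⟨w, hw⟩ : ∃ w, X.incl w = S v - T (S v) := ⟨R (S v), by rw [hT]; abel⟩
    have h1 : S v = X.incl w + T (S v) := by rw [hw, sub_add_cancel]
    have h2 := hS v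
    rwa [h1, map_add, (X.exact _).2 ⟨w, rfl⟩, zero_add] at h2

theorem RepExtension.splits_of_dual (hsymm : ∀ v w, B' v w = B' w v)
    (h : (X.dual τ B B' hB hB' hS).Splits) : X.Splits := by
  obtain ⟨r, hr⟩ := h
  let r' : W →ₗ[F] Module.Dual F X.E := r.toLinearMap
  have hr1 : ∀ w w0, r' w (X.incl w0) = B' w w0 := fun w w0 => by
    have h1 : B'.symm ((r' w).comp X.incl.toLinearMap) = w := hr w
    rw [LinearEquiv.symm_apply_eq] at h1
    exact DFunLike.congr_fun h1 w0
  have hr2 : ∀ g w e, r' (ρ' g w) e = r' w (X.rep (τ.toFun g) e) := fun g w e =>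
    DFunLike.congr_fun (F := Module.Dual F X.E) 
      (Representation.IntertwiningMap.isIntertwining _ _ r g w) e
  refine X.splits_of_retraction hS (B'.symm.toLinearMap.comp r'.flip) (fun w => ?_) fun g e => ?_
  · apply B'.injective
    refine LinearMap.ext fun w' => ?_
    change B' (B'.symm _) w' = _
    rw [LinearEquiv.apply_symm_apply, hsymm w]
    exact hr1 w' w
  · apply B'.injective
    refine LinearMap.ext fun w' => ?_
    change B' (B'.symm _) w' = B' (ρ' g (B'.symm _)) w'
    rw [hB', LinearEquiv.apply_symm_apply, LinearEquiv.apply_symm_apply]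
    change r' w' (X.rep g e) = r' (ρ' (τ.toFun g) w') e
    rw [hr2, τ.invol]

end Dual

section Transpose

/-- The transpose of invertible matrices. -/
def glTranspose (R : Type*) [CommRing R] : AntiInvolution (GL (Fin 2) R) where
  toFun g := ⟨(g : Matrix (Fin 2) (Fin 2) R).transpose,
    (↑g⁻¹ : Matrix (Fin 2) (Fin 2) R).transpose, by
      rw [← Matrix.transpose_mul, Units.inv_mul, Matrix.transpose_one], by
      rw [← Matrix.transpose_mul, Units.mul_inv, Matrix.transpose_one]⟩
  one := Units.ext (Matrix.transpose_one)
  mul g h := Units.ext (Matrix.transpose_mul _ _)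
  invol g := Units.ext (Matrix.transpose_transpose _)

variable {R : Type*} [CommRing R]

theorem glTranspose_upper (x : R) : (glTranspose R).toFun (upper x) = lower x := by
  apply Units.ext
  ext i j
  fin_cases i <;> fin_cases j <;> rfl

theorem glTranspose_lower (x : R) : (glTranspose R).toFun (lower x) = upper x := by
  apply Units.ext
  ext i j
  fin_cases i <;> fin_cases j <;> rfl

theorem glTranspose_torus (a b : Rˣ) : (glTranspose R).toFun (torus a b) = torus a b := by
  apply Units.ext
  ext i j
  fin_cases i <;> fin_cases j <;> rfl

theorem gl_induction {k : Type*} [Field k] {P : GL (Fin 2) k → Prop} (hu : ∀ x, P (upper x))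
    (hl : ∀ x, P (lower x)) (ht : ∀ a b, P (torus a b)) (hmul : ∀ g h, P g → P h → P (g * h))
    (g : GL (Fin 2) k) : P g := by
  have hdet : ∀ g : GL (Fin 2) k, g 0 0 * g 1 1 - g 0 1 * g 1 0 ≠ 0 := fun g => by
    rw [← Matrix.det_fin_two]
    exact (Matrix.isUnits_det_units g).ne_zero
  have key : ∀ g : GL (Fin 2) k, g 0 0 ≠ 0 → P g := fun g h0 => by
    have hb : g 1 1 - (g 0 0)⁻¹ * g 0 1 * g 1 0 ≠ 0 := fun h => hdet g (by
      field_simp at h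
      linear_combination h)
    rw [eq_lower_mul_torus_mul_upper g (a := Units.mk0 _ h0) (b := Units.mk0 _ hb) rfl (by simp)]
    exact hmul _ _ (hmul _ _ (hl _) (ht _ _)) (hu _)
  by_cases h0 : g 0 0 = 0
  · have h1 : g 1 0 ≠ 0 := fun h1 => hdet g (by rw [h0, h1]; ring)
    have h2 := hmul _ _ (hu (-1)) (key (upper 1 * g) (by
      simp [Matrix.mul_apply, Fin.sum_univ_two, h0, h1]))
    rwa [← mul_assoc, ← upper_add, neg_add_cancel, upper_zero, one_mul] at h2
  · exact key g h0

end Transpose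

section Pairing

variable {p : ℕ} [Fact p.Prime] {f : ℕ} [NeZero f]

/-- The norms of the monomials. -/
def monoNorm (s n : ZMod f → ℕ) : ℕ := ∏ i, (n i).factorial * (s i - n i).factorial

theorem monoNorm_ne_zero {s : ZMod f → ℕ} (hs : ∀ i, s i + 2 ≤ p) {n : ZMod f → ℕ}
    (hn : ∀ i, n i ≤ s i) : (monoNorm s n : Fbar p) ≠ 0 := by
  have hp : p.Prime := Fact.out
  rw [Ne, CharP.cast_eq_zero_iff (Fbar p) p, monoNorm, hp.prime.dvd_finsetProd_iff]
  rintro ⟨i, -, h⟩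
  rw [hp.dvd_mul, hp.dvd_factorial, hp.dvd_factorial] at h
  have := hs i
  have := hn i
  omega

/-- The invariant form on a weight. -/
noncomputable def pairing (p : ℕ) [Fact p.Prime] (s : ZMod f → ℕ) :
    WeightSpace p s →ₗ[Fbar p] Module.Dual (Fbar p) (WeightSpace p s) :=
  ∑ n ∈ box s, (monoNorm s n : Fbar p) • (monoCoeffHom n).smulRight (monoCoeffHom n)

theorem pairing_apply {s : ZMod f → ℕ} (v w : WeightSpace p s) :
    pairing p s v w = ∑ n ∈ box s, (monoNorm s n : Fbar p) * (monoCoeff v n * monoCoeff w n) := by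
  simp only [pairing, LinearMap.sum_apply, LinearMap.smul_apply, LinearMap.smulRight_apply,
    smul_eq_mul]
  rfl

theorem pairing_symm {s : ZMod f → ℕ} (v w : WeightSpace p s) :
    pairing p s v w = pairing p s w v := by
  simp only [pairing_apply, mul_comm (monoCoeff v _)]

theorem pairing_mono {s n : ZMod f → ℕ} (hn : ∀ i, n i ≤ s i) (w : WeightSpace p s) :
    pairing p s (mono p s n) w = monoNorm s n * monoCoeff w n := by
  rw [pairing_apply, Finset.sum_eq_single n]
  · rw [monoCoeff_mono hn, if_pos rfl, one_mul]
  · intro m _ hm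
    rw [monoCoeff_mono hn, if_neg hm, zero_mul, mul_zero]
  · intro h
    exact absurd (mem_box.2 hn) h

theorem pairing_mono_of_ne {s n m : ZMod f → ℕ} (h : n ≠ m) :
    pairing p s (mono p s n) (mono p s m) = 0 := by
  by_cases hn : ∀ i, n i ≤ s i
  · by_cases hm : ∀ i, m i ≤ s i
    · rw [pairing_mono hn, monoCoeff_mono hm, if_neg h, mul_zero]
    · push Not at hm
      obtain ⟨i, hi⟩ := hm
      rw [mono_eq_zero hi, map_zero]
  · push Not at hn
    obtain ⟨i, hi⟩ := hn
    rw [mono_eq_zero hi, map_zero, LinearMap.zero_apply]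

theorem pairing_mono_self {s n : ZMod f → ℕ} (hn : ∀ i, n i ≤ s i) :
    pairing p s (mono p s n) (mono p s n) = monoNorm s n := by
  rw [pairing_mono hn, monoCoeff_mono hn, if_pos rfl, mul_one]

/-- The invariant form on a weight, as an isomorphism. -/
noncomputable def pairingEquiv {s : ZMod f → ℕ} (hs : ∀ i, s i + 2 ≤ p) :
    WeightSpace p s ≃ₗ[Fbar p] Module.Dual (Fbar p) (WeightSpace p s) :=
  LinearEquiv.ofBijective (pairing p s) ⟨fun v w h => by
    rw [sum_monoCoeff v, sum_monoCoeff w]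
    refine Finset.sum_congr rfl fun n hn => ?_
    have h1 := DFunLike.congr_fun h (mono p s n)
    rw [pairing_symm, pairing_symm w, pairing_mono (mem_box.1 hn), pairing_mono (mem_box.1 hn)] at h1
    rw [mul_left_cancel₀ (monoNorm_ne_zero hs (mem_box.1 hn)) h1], fun φ => by
    refine ⟨∑ n ∈ box s, ((monoNorm s n : Fbar p)⁻¹ * φ (mono p s n)) • mono p s n,
      hom_ext_mono fun m hm => ?_⟩
    rw [map_sum, LinearMap.sum_apply, Finset.sum_eq_single m]
    · rw [map_smul, LinearMap.smul_apply, pairing_mono_self hm, smul_eq_mul, mul_right_comm,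
        inv_mul_cancel₀ (monoNorm_ne_zero hs hm), one_mul]
    · intro n _ hn
      rw [map_smul, LinearMap.smul_apply, pairing_mono_of_ne hn, smul_zero]
    · intro h
      exact absurd (mem_box.2 hm) h⟩

variable {k : Type*} [Field k] (σ : k →+* Fbar p) (d : ZMod f → ℤ) (s : ZMod f → ℕ)

theorem pairing_upper (x : k) (v w : WeightSpace p s) :
    pairing p s (weightRep p σ d s (upper x) v) w =
      pairing p s v (weightRep p σ d s (lower x) w) := by
  have : (pairing p s).comp (weightRep p σ d s (upper x)) =
      (weightRep p σ d s (lower x)).dualMap.comp (pairing p s) := by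
    refine hom_ext_mono fun n hn => hom_ext_mono fun m hm => ?_
    change pairing p s (weightRep p σ d s (upper x) (mono p s n)) (mono p s m) =
      pairing p s (mono p s n) (weightRep p σ d s (lower x) (mono p s m))
    rw [weightRep_upper, weightRep_lower σ d hm, map_sum, map_sum, LinearMap.sum_apply]
    refine Finset.sum_congr rfl fun a _ => ?_
    rw [map_smul, map_smul, LinearMap.smul_apply, smul_eq_mul, smul_eq_mul]
    suffices h0 : (∏ i, ((s i - n i).choose (a i) : Fbar p)) *
        pairing p s (mono p s (n + a)) (mono p s m) =
        (∏ i, ((m i).choose (a i) : Fbar p)) * pairing p s (mono p s n) (mono p s (m - a)) by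
      linear_combination σ x ^ natExp p a * h0
    by_cases h : n + a = m
    · subst h
      rw [pairing_mono_self hm, add_tsub_cancel_right, pairing_mono_self hn]
      unfold monoNorm
      rw [← Nat.cast_prod, ← Nat.cast_prod, ← Nat.cast_mul, ← Nat.cast_mul,
        ← Finset.prod_mul_distrib, ← Finset.prod_mul_distrib]
      congr 1
      refine Finset.prod_congr rfl fun i _ => ?_
      have h1 := hm i
      rw [Pi.add_apply] at h1 ⊢
      have h2 := Nat.choose_mul_factorial_mul_factorial (n := s i - n i) (k := a i) (by omega)
      have h3 := Nat.choose_mul_factorial_mul_factorial (n := n i + a i) (k := a i) (by omega)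
      rw [Nat.add_sub_cancel] at h3
      rw [Nat.sub_sub] at h2
      refine Nat.eq_of_mul_eq_mul_left (Nat.factorial_pos (a i)) ?_
      calc _ = ((s i - n i).choose (a i) * (a i).factorial * (s i - (n i + a i)).factorial) *
            (n i + a i).factorial := by ring
        _ = ((n i + a i).choose (a i) * (a i).factorial * (n i).factorial) *
            (s i - n i).factorial := by rw [h2, h3, mul_comm]
        _ = _ := by ring
    · rw [pairing_mono_of_ne h, mul_zero]
      by_cases ha : ∀ i, a i ≤ m i
      · rw [pairing_mono_of_ne, mul_zero]
        rintro rfl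
        exact h (tsub_add_cancel_of_le ha)
      · push Not at ha
        obtain ⟨i, hi⟩ := ha
        rw [Finset.prod_eq_zero (Finset.mem_univ i), zero_mul]
        rw [Nat.choose_eq_zero_of_lt hi, Nat.cast_zero]
  exact DFunLike.congr_fun (DFunLike.congr_fun this v) w

theorem pairing_torus (a b : kˣ) (v w : WeightSpace p s) :
    pairing p s (weightRep p σ d s (torus a b) v) w =
      pairing p s v (weightRep p σ d s (torus a b) w) := by
  have : (pairing p s).comp (weightRep p σ d s (torus a b)) =
      (weightRep p σ d s (torus a b)).dualMap.comp (pairing p s) := by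
    refine hom_ext_mono fun n hn => hom_ext_mono fun m hm => ?_
    change pairing p s (weightRep p σ d s (torus a b) (mono p s n)) (mono p s m) =
      pairing p s (mono p s n) (weightRep p σ d s (torus a b) (mono p s m))
    rw [weightRep_torus σ d s hn, weightRep_torus σ d s hm, map_smul, map_smul,
      LinearMap.smul_apply]
    by_cases h : n = m
    · rw [h]
    · rw [pairing_mono_of_ne h, smul_zero, smul_zero]
  exact DFunLike.congr_fun (DFunLike.congr_fun this v) w

theorem pairing_weightRep (g : GL (Fin 2) k) (v w : WeightSpace p s) :
    pairing p s (weightRep p σ d s g v) w =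
      pairing p s v (weightRep p σ d s ((glTranspose k).toFun g) w) := by
  induction g using gl_induction generalizing v w with
  | hu x => rw [glTranspose_upper, pairing_upper]
  | hl x => rw [glTranspose_lower, pairing_symm, ← pairing_upper, pairing_symm]
  | ht a b => rw [glTranspose_torus, pairing_torus]
  | hmul g h hg hh =>
    rw [map_mul, Module.End.mul_apply, hg, hh, (glTranspose k).mul, map_mul, Module.End.mul_apply]

end Pairing

section Symmetry

variable {p : ℕ} [Fact p.Prime] {f : ℕ} [NeZero f] {d : ZMod f → ℤ} {s : ZMod f → ℕ}
  {d' : ZMod f → ℤ} {s' : ZMod f → ℕ} (hs : ∀ i, s i + 2 ≤ p) (hs' : ∀ i, s' i + 2 ≤ p)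

include hs hs'

theorem extNeZero_symm {k : Type*} [Field k] {σ : k →+* Fbar p}
    (h : ExtNeZero (weightRep p σ d s) (weightRep p σ d' s')) :
    ExtNeZero (weightRep p σ d' s') (weightRep p σ d s) := by
  obtain ⟨X, hX⟩ := h
  obtain ⟨S, hS⟩ := exists_linear_section X.proj.toLinearMap X.proj_surjective
  refine ⟨X.dual (glTranspose k) (pairingEquiv hs) (pairingEquiv hs') (pairing_weightRep σ d s)
    (pairing_weightRep σ d' s') hS, fun h => hX ?_⟩
  exact X.splits_of_dual _ _ _ _ _ hS pairing_symm h

variable {K : Type*} [Field K] [Algebra ℚ_[p] K]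
  [FiniteDimensional ℚ_[p] K] [Algebra ℤ_[p] K] [IsScalarTower ℤ_[p] ℚ_[p] K]
  {σ : ResK p K →+* Fbar p}

omit hs hs' in
theorem glTranspose_mem_congrSub {n : ℕ} {g : GLO p K} (hg : g ∈ congrSub p K n) :
    (glTranspose (OK p K)).toFun g ∈ congrSub p K n := by
  rw [mem_congrSub] at hg ⊢
  intro i j
  rw [← Matrix.transpose_one]
  exact hg j i

omit hs hs' in
theorem exists_uniform_level
    (X : RepExtension (infl p K (weightRep p σ d s)) (infl p K (weightRep p σ d' s')))
    (hX : IsSmooth p K X.rep) : ∃ n, ∀ g ∈ congrSub p K n, ∀ e, X.rep g e = e := by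
  obtain ⟨S, hS⟩ := exists_linear_section X.proj.toLinearMap X.proj_surjective
  obtain ⟨t, ht⟩ := (finite_ext X hS).fg_top
  choose n hn using hX
  refine ⟨t.sup n, fun g hg e => ?_⟩
  have h1 : (⊤ : Submodule (Fbar p) X.E) ≤ LinearMap.eqLocus (X.rep g) LinearMap.id := by
    rw [← ht, Submodule.span_le]
    intro e he
    exact hn e g (congrSub_antitone (Finset.le_sup he) hg)
  exact h1 trivial

/-- A smooth extension of weights has a smooth dual extension, which splits only if the original
one does. -/
theorem exists_dual_extension
    (X : RepExtension (infl p K (weightRep p σ d s)) (infl p K (weightRep p σ d' s')))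
    (hX : IsSmooth p K X.rep) :
    ∃ Y : RepExtension (infl p K (weightRep p σ d' s')) (infl p K (weightRep p σ d s)),
      IsSmooth p K Y.rep ∧ (Y.Splits → X.Splits) := by
  obtain ⟨S, hS⟩ := exists_linear_section X.proj.toLinearMap X.proj_surjective
  obtain ⟨n, hn⟩ := exists_uniform_level X hX
  refine ⟨X.dual (glTranspose (OK p K)) (pairingEquiv hs) (pairingEquiv hs')
    (fun g => pairing_weightRep σ d s (red p K g))
    (fun g => pairing_weightRep σ d' s' (red p K g)) hS, fun (φ : Module.Dual (Fbar p) X.E) => ⟨n, fun g hg => ?_⟩,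
    X.splits_of_dual _ _ _ _ _ hS pairing_symm⟩
  refine LinearMap.ext fun e => ?_
  change φ (X.rep _ e) = φ e
  rw [hn _ (glTranspose_mem_congrSub hg)]

theorem smoothExtNeZero_symm
    (h : SmoothExtNeZero p K (infl p K (weightRep p σ d s)) (infl p K (weightRep p σ d' s'))) :
    SmoothExtNeZero p K (infl p K (weightRep p σ d' s')) (infl p K (weightRep p σ d s)) := by
  obtain ⟨X, hX, h⟩ := h
  obtain ⟨Y, hY, hYX⟩ := exists_dual_extension hs hs' X hX
  exact ⟨Y, hY, fun h2 => h (hYX h2)⟩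

end Symmetry

section ModeCommute

variable {p : ℕ} [Fact p.Prime] {f : ℕ} [NeZero f] {k : Type*} [Field k] [Fintype k]

/-- A linear map that commutes with the modes of two additive families commutes with the
families. -/
theorem comm_of_modes (σ : k →+* Fbar p) (hk : Fintype.card k = p ^ f) (hf : 1 < f)
    {M N : Type*} [AddCommGroup M] [Module (Fbar p) M] [Module.Finite (Fbar p) M]
    [AddCommGroup N] [Module (Fbar p) N] [Module.Finite (Fbar p) N]
    {u : k → Module.End (Fbar p) M} {u' : k → Module.End (Fbar p) N}
    (hu : ∀ x y, u (x + y) = u x * u y) (hu' : ∀ x y, u' (x + y) = u' x * u' y)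
    (h0 : u 0 = 1) (h0' : u' 0 = 1) (φ : M →ₗ[Fbar p] N)
    (h : ∀ (i : ZMod f) v, φ (modeOp σ i fun x => u x v) = modeOp σ i fun x => u' x (φ v))
    (x : k) (v : M) : φ (u x v) = u' x (φ v) := by
  have : CharP k p := (RingHom.charP_iff σ σ.injective p).2 inferInstance
  have hmul : ∀ x y, (u (x + y), u' (x + y)) = (u x, u' x) * (u y, u' y) := fun x y => by
    rw [hu, hu', Prod.mk_mul_mk]
  have hmem := unipotent_mem_adjoin (AddMonoidHom.id k) id σ hk hf (fun _ => rfl)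
    (fun x => (u x, u' x)) hmul
    (fun x hx => Or.inl (by rw [show x = 0 from hx, h0, h0']; rfl)) (fun x => ⟨p, by
      have hpow : ∀ m : ℕ, (u x, u' x) ^ m = (u (m * x), u' (m * x)) := fun m => by
        induction m with
        | zero => rw [pow_zero, Nat.cast_zero, zero_mul, h0, h0']; rfl
        | succ m ih => rw [pow_succ, ih, ← hmul]; push_cast; ring_nf
      rw [sub_one_pow_char, hpow, CharP.cast_eq_zero, zero_mul, h0, h0']
      exact sub_self _⟩) x
  let A : Subalgebra (Fbar p) (Module.End (Fbar p) M × Module.End (Fbar p) N) :=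
    { carrier := {Q | ∀ v, φ (Q.1 v) = Q.2 (φ v)}
      mul_mem' := by
        intro Q R hQ hR v
        change φ (Q.1 (R.1 v)) = Q.2 (R.2 (φ v))
        rw [hQ, hR]
      add_mem' := by
        intro Q R hQ hR v
        change φ (Q.1 v + R.1 v) = Q.2 (φ v) + R.2 (φ v)
        rw [map_add, hQ, hR]
      algebraMap_mem' := fun c v => φ.map_smul c v }
  have hA : Algebra.adjoin (Fbar p) (Set.range fun i : ZMod f =>
      modeOp σ i (fun l => (u (id l), u' (id l)))) ≤ A := Algebra.adjoin_le (by
    rintro _ ⟨i, rfl⟩ v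
    have e1 : (modeOp σ i (fun l => (u l, u' l))).1 = modeOp σ i u :=
      map_modeOp σ i (LinearMap.fst (Fbar p) _ _) _
    have e2 : (modeOp σ i (fun l => (u l, u' l))).2 = modeOp σ i u' :=
      map_modeOp σ i (LinearMap.snd (Fbar p) _ _) _
    change φ ((modeOp σ i (fun l => (u l, u' l))).1 v) = (modeOp σ i (fun l => (u l, u' l))).2 (φ v)
    rw [e1, e2, modeOp_apply, modeOp_apply, h])
  exact hA hmem v

variable {k : Type*} [Field k] [Fintype k]

/-- A linear map of weight representations that commutes with the modes of the unipotent matrices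
and with the diagonal matrices is equivariant. -/
theorem weightRep_comm (σ : k →+* Fbar p) (hk : Fintype.card k = p ^ f) (hf : 1 < f)
    {t t' : ZMod f → ℤ} {N N' : ZMod f → ℕ} (φ : WeightSpace p N →ₗ[Fbar p] WeightSpace p N')
    (hup : ∀ (i : ZMod f) n, (∀ l, n l ≤ N l) →
      φ (modeOp σ i fun x => weightRep p σ t N (upper x) (mono p N n)) =
        modeOp σ i fun x => weightRep p σ t' N' (upper x) (φ (mono p N n)))
    (hlow : ∀ (i : ZMod f) n, (∀ l, n l ≤ N l) →
      φ (modeOp σ i fun x => weightRep p σ t N (lower x) (mono p N n)) =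
        modeOp σ i fun x => weightRep p σ t' N' (lower x) (φ (mono p N n)))
    (ht : ∀ a b n, (∀ l, n l ≤ N l) → φ (weightRep p σ t N (torus a b) (mono p N n)) =
      weightRep p σ t' N' (torus a b) (φ (mono p N n))) (g : GL (Fin 2) k) (v : WeightSpace p N) :
    φ (weightRep p σ t N g v) = weightRep p σ t' N' g (φ v) := by
  have : Module.Finite (Fbar p) (WeightSpace p N) := Module.Finite.of_basis (weightBasis p N)
  have : Module.Finite (Fbar p) (WeightSpace p N') := Module.Finite.of_basis (weightBasis p N')
  have hmode : ∀ u : k → GL (Fin 2) k, (∀ (i : ZMod f) n, (∀ l, n l ≤ N l) →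
      φ (modeOp σ i fun x => weightRep p σ t N (u x) (mono p N n)) =
        modeOp σ i fun x => weightRep p σ t' N' (u x) (φ (mono p N n))) → ∀ (i : ZMod f) v,
      φ (modeOp σ i fun x => weightRep p σ t N (u x) v) =
        modeOp σ i fun x => weightRep p σ t' N' (u x) (φ v) := fun u h i v => by
    have : φ.comp (modeOp σ i fun x => weightRep p σ t N (u x)) =
        (modeOp σ i fun x => weightRep p σ t' N' (u x)).comp φ :=
      hom_ext_mono fun n hn => by
        rw [LinearMap.comp_apply, LinearMap.comp_apply, modeOp_apply, modeOp_apply, h i n hn]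
    have h2 := DFunLike.congr_fun this v
    rwa [LinearMap.comp_apply, LinearMap.comp_apply, modeOp_apply, modeOp_apply] at h2
  induction g using gl_induction generalizing v with
  | hu x =>
    exact comm_of_modes σ hk hf (M := WeightSpace p N) (N := WeightSpace p N') (u := fun x => weightRep p σ t N (upper x))
      (u' := fun x => weightRep p σ t' N' (upper x)) (fun x y => by rw [upper_add, map_mul])
      (fun x y => by rw [upper_add, map_mul]) (by rw [upper_zero, map_one])
      (by rw [upper_zero, map_one]) φ (hmode _ hup) x v
  | hl x =>
    exact comm_of_modes σ hk hf (M := WeightSpace p N) (N := WeightSpace p N') (u := fun x => weightRep p σ t N (lower x))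
      (u' := fun x => weightRep p σ t' N' (lower x)) (fun x y => by rw [lower_add, map_mul])
      (fun x y => by rw [lower_add, map_mul]) (by rw [lower_zero, map_one])
      (by rw [lower_zero, map_one]) φ (hmode _ hlow) x v
  | ht a b =>
    have : φ.comp (weightRep p σ t N (torus a b)) = (weightRep p σ t' N' (torus a b)).comp φ :=
      hom_ext_mono fun n hn => ht a b n hn
    exact DFunLike.congr_fun this v
  | hmul g h hg hh => rw [map_mul, Module.End.mul_apply, hg, hh, map_mul, Module.End.mul_apply]

end ModeCommute

section Fold

variable {p : ℕ} {f : ℕ} (j : ZMod f)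

/-- The exponents `n` with the `(j-1)`-st one carried over to the `j`-th one. -/
def fold (p : ℕ) (j : ZMod f) (n : ZMod f → ℕ) : ZMod f → ℕ :=
  fun l => if l = j then n j + p * n (j - 1) else if l = j - 1 then 0 else n l

/-- The exponents with the multiples of `p` in the `j`-th one moved to the `(j-1)`-st one. -/
def unfold (p : ℕ) (j : ZMod f) (n : ZMod f → ℕ) : ZMod f → ℕ :=
  fun l => if l = j then n j % p else if l = j - 1 then n j / p else n l

theorem fold_add (a b : ZMod f → ℕ) : fold p j (a + b) = fold p j a + fold p j b := by
  ext l
  simp only [fold, Pi.add_apply]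
  split_ifs <;> ring

theorem sub_one_ne (hf : 1 < f) : j - 1 ≠ j := by
  have : Fact (1 < f) := ⟨hf⟩
  simp

theorem fold_self (a : ZMod f → ℕ) : fold p j a j = a j + p * a (j - 1) := by simp [fold]

theorem fold_of_ne (a : ZMod f → ℕ) {l : ZMod f} (h : l ≠ j) (h' : l ≠ j - 1) :
    fold p j a l = a l := by simp [fold, h, h']

variable (hf : 1 < f)
include hf

theorem fold_sub_one (a : ZMod f → ℕ) : fold p j a (j - 1) = 0 := by
  simp [fold, sub_one_ne j hf]

theorem fold_single_self : fold p j (Pi.single j 1) = Pi.single j 1 := by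
  have hne := sub_one_ne j hf
  ext l
  by_cases h1 : l = j
  · subst h1
    simp [fold_self, hne]
  · by_cases h2 : l = j - 1
    · subst h2
      simp [fold_sub_one _ hf, hne]
    · simp [fold_of_ne j _ h1 h2]

theorem fold_single_sub_one : fold p j (Pi.single (j - 1) 1) = Pi.single j p := by
  have hne := sub_one_ne j hf
  ext l
  by_cases h1 : l = j
  · subst h1
    simp [fold_self, hne.symm]
  · by_cases h2 : l = j - 1
    · subst h2
      simp [fold_sub_one _ hf, hne]
    · simp [fold_of_ne j _ h1 h2, h1, h2]

omit hf in
theorem fold_single_of_ne {i : ZMod f} (h : i ≠ j) (h' : i ≠ j - 1) :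
    fold p j (Pi.single i 1) = Pi.single i 1 := by
  ext l
  by_cases h1 : l = j
  · subst h1
    simp [fold_self, h.symm, h'.symm]
  · by_cases h2 : l = j - 1
    · subst h2
      simp [fold, h1, h'.symm]
    · simp [fold_of_ne j _ h1 h2]

variable [Fact p.Prime]

theorem unfold_fold {a : ZMod f → ℕ} (h : a j < p) : unfold p j (fold p j a) = a := by
  have hp := (Fact.out : p.Prime).pos
  have := sub_one_ne j hf
  ext l
  unfold unfold
  rw [fold_self]
  split_ifs with h1 h2
  · rw [h1, Nat.add_mul_mod_self_left, Nat.mod_eq_of_lt h]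
  · rw [h2, Nat.add_mul_div_left _ _ hp, Nat.div_eq_of_lt h, zero_add]
  · rw [fold_of_ne j a h1 h2]

omit [Fact p.Prime] in
theorem fold_unfold {a : ZMod f → ℕ} (h : a (j - 1) = 0) : fold p j (unfold p j a) = a := by
  have := sub_one_ne j hf
  ext l
  simp only [fold, unfold, if_neg this]
  split_ifs with h1 h2
  · subst h1
    simp [Nat.mod_add_div]
  · rw [h2, h]
  · rfl

omit hf in
theorem unfold_self_lt (a : ZMod f → ℕ) : unfold p j a j < p := by
  simp only [unfold, if_true]
  exact Nat.mod_lt _ (Fact.out : p.Prime).pos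

variable [NeZero f]

omit [Fact p.Prime] in
theorem natExp_fold (a : ZMod f → ℕ) : (natExp p (fold p j a) : ℤ) ≡ natExp p a
    [ZMOD (p : ℤ) ^ f - 1] := by
  have hne := sub_one_ne j hf
  have h1 : fold p j a + Pi.single (j - 1) (a (j - 1)) = a + Pi.single j (p * a (j - 1)) := by
    ext l
    rw [Pi.add_apply, Pi.add_apply]
    by_cases h1 : l = j
    · subst h1
      rw [fold_self, Pi.single_eq_same, Pi.single_eq_of_ne hne.symm, add_zero]
    · by_cases h2 : l = j - 1
      · subst h2
        rw [fold_sub_one j hf, Pi.single_eq_same, Pi.single_eq_of_ne h1, add_comm]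
      · rw [fold_of_ne j a h1 h2, Pi.single_eq_of_ne h1, Pi.single_eq_of_ne h2]
  have h2 := congrArg (fun n => (natExp p n : ℤ)) h1
  simp only [natExp_add, natExp_single] at h2
  have h3 := (pow_val_sub_one_modEq (p := p) j).mul_right (a (j - 1) : ℤ)
  rw [Int.modEq_iff_dvd] at h3 ⊢
  refine (dvd_neg.2 h3).trans (dvd_of_eq ?_)
  push_cast at h2
  linear_combination h2

theorem natExp_fold_nat (a : ZMod f → ℕ) : natExp p (fold p j a) ≡ natExp p a [MOD p ^ f - 1] := by
  have := natExp_fold (p := p) j hf a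
  rw [← cast_pow_sub_one] at this
  exact Int.natCast_modEq_iff.1 this

theorem prod_choose_fold {b : ZMod f → ℕ} (hb : b j < p) (i : ZMod f) :
    ∏ l, ((fold p j b l).choose (fold p j (Pi.single i 1) l) : Fbar p) = b i := by
  have hne := sub_one_ne j hf
  have hp : p.Prime := Fact.out
  have key : ∀ (i' : ZMod f) (c : ℕ), ∏ l, ((fold p j b l).choose ((Pi.single i' c : ZMod f → ℕ) l) :
      Fbar p) = (fold p j b i').choose c := fun i' c => by
    rw [Finset.prod_eq_single i']
    · rw [Pi.single_eq_same]
    · intro l _ hl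
      simp [hl]
    · simp
  by_cases h1 : i = j
  · subst h1
    rw [fold_single_self i hf, key, Nat.choose_one_right, fold_self]
    simp
  · by_cases h2 : i = j - 1
    · subst h2
      rw [fold_single_sub_one j hf, key, fold_self]
      have h3 := Choose.choose_modEq_choose_mod_mul_choose_div_nat (p := p)
        (n := b j + p * b (j - 1)) (k := p)
      rw [Nat.mod_self, Nat.choose_zero_right, one_mul, Nat.div_self hp.pos, Nat.choose_one_right,
        Nat.add_mul_div_left _ _ hp.pos, Nat.div_eq_of_lt hb, zero_add] at h3
      exact (CharP.natCast_eq_natCast (Fbar p) p).2 h3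
    · rw [fold_single_of_ne j h1 h2, key, Nat.choose_one_right, fold_of_ne j b h1 h2]

/-- Exponents below `fold p j n` are determined by their class. -/
theorem eq_fold_of_modEq {n : ZMod f → ℕ} (hn : ∀ i, n i + 2 ≤ p) {b : ZMod f → ℕ}
    (hb : ∀ i, b i + 1 ≤ p) (hb' : ∃ i, b i + 1 ≠ p) {a : ZMod f → ℕ}
    (ha : ∀ i, a i ≤ fold p j n i) (h : natExp p a ≡ natExp p b [MOD p ^ f - 1]) :
    a = fold p j b := by
  have hne := sub_one_ne j hf
  have hp : p.Prime := Fact.out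
  have h0 : a (j - 1) = 0 := by
    have := ha (j - 1)
    rw [fold_sub_one j hf] at this
    omega
  have h1 : a j / p ≤ n (j - 1) := by
    have h2 := Nat.div_le_div_right (c := p) (ha j)
    rw [fold_self, Nat.add_mul_div_left _ _ hp.pos,
      Nat.div_eq_of_lt (show n j < p by have := hn j; omega), zero_add] at h2
    exact h2
  have h2 : unfold p j a = b := by
    refine natExp_unique (p := p) (fun i => ?_) ⟨j - 1, ?_⟩ hb hb' ?_
    · by_cases h2 : i = j
      · subst h2
        exact unfold_self_lt i a
      · by_cases h3 : i = j - 1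
        · subst h3
          simp only [unfold, if_neg h2, if_true]
          have := hn (j - 1)
          omega
        · simp only [unfold, if_neg h2, if_neg h3]
          have h4 := ha i
          rw [fold_of_ne j n h2 h3] at h4
          have := hn i
          omega
    · simp only [unfold, if_neg hne, if_true]
      have := hn (j - 1)
      omega
    · refine Nat.ModEq.trans ?_ h
      nth_rw 2 [← fold_unfold j hf h0]
      exact (natExp_fold_nat (p := p) j hf _).symm
  rw [← h2, fold_unfold j hf h0]

end Fold

section CarryExtension

variable {p : ℕ} [Fact p.Prime] {f : ℕ} [NeZero f] (j : ZMod f) (s s' : ZMod f → ℕ)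

/-- The inclusion of a weight into the symmetric power obtained by multiplying one factor with the
Frobenius twist of the preceding one. -/
noncomputable def carryIncl (p : ℕ) [Fact p.Prime] (j : ZMod f) (s' : ZMod f → ℕ) :
    WeightSpace p s' →ₗ[Fbar p] WeightSpace p (fold p j s') :=
  (weightBasis p s').constr (Fbar p) fun n => mono p (fold p j s') (fold p j fun i => n i)

/-- The projection of the same symmetric power to another weight. -/
noncomputable def carryProj (p : ℕ) [Fact p.Prime] (j : ZMod f) (s s' : ZMod f → ℕ) :
    WeightSpace p (fold p j s') →ₗ[Fbar p] WeightSpace p s :=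
  (weightBasis p (fold p j s')).constr (Fbar p) fun m =>
    ((unfold p j (fun i => m i) j).choose (s' j + 1) : Fbar p) •
      mono p s (unfold p j (fun i => m i) - Pi.single j (s' j + 1))

theorem carryIncl_mono {s' n : ZMod f → ℕ} (hn : ∀ i, n i ≤ s' i) :
    carryIncl p j s' (mono p s' n) = mono p (fold p j s') (fold p j n) := by
  have h1 : mono p s' n = weightBasis p s' (fun i => ⟨n i, Nat.lt_succ_of_le (hn i)⟩) := by
    rw [weightBasis_apply]
  rw [h1, carryIncl, Module.Basis.constr_basis]

omit [Fact p.Prime] [NeZero f] in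
theorem fold_le {n s' : ZMod f → ℕ} (hn : ∀ i, n i ≤ s' i) (i : ZMod f) :
    fold p j n i ≤ fold p j s' i := by
  unfold fold
  split_ifs
  · exact Nat.add_le_add (hn _) (Nat.mul_le_mul_left _ (hn _))
  · rfl
  · exact hn i

omit [Fact p.Prime] [NeZero f] in
theorem fold_sub {s' n : ZMod f → ℕ} (hn : ∀ i, n i ≤ s' i) :
    fold p j s' - fold p j n = fold p j (s' - n) := by
  have : s' = (s' - n) + n := by
    ext i
    simp [hn i]
  nth_rw 1 [this]
  rw [fold_add, add_tsub_cancel_right]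

variable (hf : 1 < f) {s s'} (hs' : ∀ i, s' i + 2 ≤ p) (hsh : ShapeOne p j s s')
include hf

include hs' hsh

theorem carryProj_mono {n : ZMod f → ℕ} (hn : n j ≤ p) :
    carryProj p j s s' (mono p (fold p j s') (fold p j n)) =
      ((n j).choose (s' j + 1) : Fbar p) • mono p s (n - Pi.single j (s' j + 1)) := by
  have hne := sub_one_ne j hf
  have hp : p.Prime := Fact.out
  obtain ⟨h1, h2, h3, h4, h5⟩ := hsh
  have hs'j := hs' j
  have key : ∀ n : ZMod f → ℕ, n j < p → carryProj p j s s' (mono p (fold p j s') (fold p j n)) =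
      ((n j).choose (s' j + 1) : Fbar p) • mono p s (n - Pi.single j (s' j + 1)) := fun n hn => by
    by_cases hle : ∀ i, fold p j n i ≤ fold p j s' i
    · have e1 : mono p (fold p j s') (fold p j n) = weightBasis p (fold p j s')
          (fun i => ⟨fold p j n i, Nat.lt_succ_of_le (hle i)⟩) := by
        rw [weightBasis_apply]
      rw [e1, carryProj, Module.Basis.constr_basis]
      dsimp only
      rw [unfold_fold j hf hn]
    · push Not at hle
      obtain ⟨i, hi⟩ := hle
      rw [mono_eq_zero hi, map_zero]
      by_cases hi1 : i = j
      · subst hi1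
        rw [fold_self, fold_self] at hi
        by_cases hr : n i < s' i + 1
        · rw [Nat.choose_eq_zero_of_lt hr, Nat.cast_zero, zero_smul]
        · rw [mono_eq_zero (i := i - 1), smul_zero]
          rw [Pi.sub_apply, Pi.single_eq_of_ne hne]
          by_contra! h
          have : p * (n (i - 1) + 1) ≤ p * s' (i - 1) := Nat.mul_le_mul_left _ (by omega)
          rw [mul_add] at this
          omega
      · by_cases hi2 : i = j - 1
        · subst hi2
          rw [fold_sub_one j hf, fold_sub_one j hf] at hi
          omega
        · rw [mono_eq_zero (i := i), smul_zero]
          rw [fold_of_ne j _ hi1 hi2, fold_of_ne j _ hi1 hi2] at hi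
          rw [Pi.sub_apply, Pi.single_eq_of_ne hi1, ← h5 i hi1 hi2]
          exact hi
  rcases hn.lt_or_eq with hn | hn
  · exact key n hn
  · have e1 : ((n j).choose (s' j + 1) : Fbar p) = 0 := by
      rw [hn, CharP.cast_eq_zero_iff (Fbar p) p]
      exact hp.dvd_choose_self (by omega) (by omega)
    have e2 : fold p j n = fold p j (fun l => if l = j then 0 else if l = j - 1 then n l + 1
        else n l) := by
      ext l
      by_cases hi1 : l = j
      · subst hi1
        rw [fold_self, fold_self, if_pos rfl, if_neg hne, if_pos rfl, hn]
        ring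
      · by_cases hi2 : l = j - 1
        · subst hi2
          rw [fold_sub_one j hf, fold_sub_one j hf]
        · rw [fold_of_ne j _ hi1 hi2, fold_of_ne j _ hi1 hi2, if_neg hi1, if_neg hi2]
    rw [e1, zero_smul, e2, key _ (by rw [if_pos rfl]; exact hp.pos), if_pos rfl,
      Nat.choose_eq_zero_of_lt (Nat.succ_pos _), Nat.cast_zero, zero_smul]

omit hsh [Fact p.Prime] [NeZero f] hf in
/-- The exponents below `fold p j s'`. -/
theorem le_or_lt_of_fold_le {n : ZMod f → ℕ}
    (h : ∀ i, fold p j n i ≤ fold p j s' i) :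
    (∀ i, i ≠ j → n i ≤ s' i) ∧ (s' j < n j → n (j - 1) < s' (j - 1)) := by
  have hs'j := hs' j
  have hj := h j
  rw [fold_self, fold_self] at hj
  have aux : ∀ c, s' (j - 1) + c ≤ n (j - 1) → s' j + p * s' (j - 1) + c * p ≤
      s' j + p * n (j - 1) := fun c hc => by
    have := Nat.mul_le_mul_left p hc
    rw [mul_add, mul_comm p c] at this
    omega
  refine ⟨fun i hi => ?_, fun h1 => ?_⟩
  · by_cases hi2 : i = j - 1
    · subst hi2
      by_contra! h2
      have := aux 1 h2
      omega
    · have := h i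
      rwa [fold_of_ne j _ hi hi2, fold_of_ne j _ hi hi2] at this
  · by_contra! h2
    have := aux 0 h2
    omega

variable {k : Type*} [Field k] [Fintype k] (σ : k →+* Fbar p) (hk : Fintype.card k = p ^ f)
  (t : ZMod f → ℤ)
include hk

omit hsh in
theorem modeOp_upper_fold (i : ZMod f) {n b : ZMod f → ℕ} (hb : b j < p)
    (hnb : fold p j s' - fold p j n = fold p j b) :
    modeOp σ i (fun x => weightRep p σ t (fold p j s') (upper x)
      (mono p (fold p j s') (fold p j n))) =
      -(b i : Fbar p) • mono p (fold p j s') (fold p j (n + Pi.single i 1)) := by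
  have hp : p.Prime := Fact.out
  have hmod : natExp p (fold p j (Pi.single i 1)) ≡ p ^ (f - 1 - i.val) [MOD p ^ f - 1] := by
    refine (natExp_fold_nat j hf _).trans ?_
    rw [natExp_single, mul_one]
  rw [modeOp_upper σ hk t hmod (fun a ha h => eq_fold_of_modEq j hf hs' (fun l => ?_) ⟨i + 1, ?_⟩ ha
    (h.trans ?_)), ← fold_add, ← prod_choose_fold j hf hb i, ← hnb]
  · rfl
  · by_cases hl : l = i
    · subst hl
      rw [Pi.single_eq_same]
      exact hp.two_le
    · rw [Pi.single_eq_of_ne hl]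
      exact hp.one_lt.le
  · have : Fact (1 < f) := ⟨hf⟩
    rw [Pi.single_eq_of_ne (by simp)]
    exact hp.one_lt.ne
  · rw [natExp_single, mul_one]

omit hsh in
theorem modeOp_lower_fold (i : ZMod f) {n : ZMod f → ℕ} (hn : n j < p)
    (hle : ∀ l, fold p j n l ≤ fold p j s' l) :
    modeOp σ i (fun x => weightRep p σ t (fold p j s') (lower x)
      (mono p (fold p j s') (fold p j n))) =
      -(n i : Fbar p) • mono p (fold p j s') (fold p j (n - Pi.single i 1)) := by
  have hp : p.Prime := Fact.out
  have hmod : natExp p (fold p j (Pi.single i 1)) ≡ p ^ (f - 1 - i.val) [MOD p ^ f - 1] := by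
    refine (natExp_fold_nat j hf _).trans ?_
    rw [natExp_single, mul_one]
  rw [modeOp_lower σ hk t hmod (fun a ha h => eq_fold_of_modEq j hf hs' (fun l => ?_) ⟨i + 1, ?_⟩ ha
    (h.trans ?_)) hle, prod_choose_fold j hf hn i]
  · by_cases hi : n i = 0
    · rw [hi, Nat.cast_zero, neg_zero, zero_smul, zero_smul]
    · have e : n = n - Pi.single i 1 + Pi.single i 1 := by
        ext l
        by_cases hl : l = i
        · subst hl
          simp
          omega
        · simp [hl]
      nth_rw 2 [e]
      rw [fold_add, add_tsub_cancel_right]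
  · by_cases hl : l = i
    · subst hl
      rw [Pi.single_eq_same]
      exact hp.two_le
    · rw [Pi.single_eq_of_ne hl]
      exact hp.one_lt.le
  · have : Fact (1 < f) := ⟨hf⟩
    rw [Pi.single_eq_of_ne (by simp)]
    exact hp.one_lt.ne
  · rw [natExp_single, mul_one]

omit hsh in
theorem carryIncl_comm (g : GL (Fin 2) k) (v : WeightSpace p s') :
    carryIncl p j s' (weightRep p σ t s' g v) =
      weightRep p σ t (fold p j s') g (carryIncl p j s' v) := by
  have hlt : ∀ n : ZMod f → ℕ, (∀ l, n l ≤ s' l) → n j < p := fun n hn => by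
    have := hn j
    have := hs' j
    omega
  refine weightRep_comm σ hk hf _ (fun i n hn => ?_) (fun i n hn => ?_) (fun a b n hn => ?_) g v
  · rw [modeOp_upper_small σ hk hf hs' t, carryIncl_mono j hn,
      modeOp_upper_fold j hf hs' σ hk t i (b := s' - n)
      (hlt _ fun l => Nat.sub_le _ _) (fold_sub j hn), map_smul]
    by_cases hi : n i < s' i
    · rw [carryIncl_mono]
      · rfl
      · intro l
        by_cases hl : l = i
        · subst hl
          simpa using hi
        · simpa [hl] using hn l
    · have : s' i - n i = 0 := by omega
      rw [Pi.sub_apply, this, Nat.cast_zero, neg_zero, zero_smul, zero_smul]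
  · rw [modeOp_lower_small σ hk hf hs' t i hn, carryIncl_mono j hn,
      modeOp_lower_fold j hf hs' σ hk t i (hlt n hn) (fold_le j hn), map_smul, carryIncl_mono]
    intro l
    exact (Nat.sub_le _ _).trans (hn l)
  · rw [weightRep_torus σ t s' hn, map_smul, carryIncl_mono j hn,
      weightRep_torus σ t _ (fold_le j hn)]
    have h1 := (natExp_fold (p := p) j hf n).symm
    have h2 := (natExp_fold (p := p) j hf s').symm
    have hk' : Nat.card k = p ^ f := by rw [Nat.card_eq_fintype_card, hk]
    rw [map_zpow_eq_of_modEq σ hk' (h1.add_left _) a,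
      map_zpow_eq_of_modEq σ hk' ((h2.add_left _).sub h1) b]

variable {t} {t' : ZMod f → ℤ}

omit hs' hsh hf hk in
theorem modeOp_smul (i : ZMod f) {M N : Type*} [AddCommMonoid M] [Module (Fbar p) M]
    [AddCommMonoid N] [Module (Fbar p) N] (u : k → M →ₗ[Fbar p] N) (c : Fbar p) (v : M) :
    modeOp σ i (fun x => u x (c • v)) = c • modeOp σ i (fun x => u x v) := by
  rw [← modeOp_apply, ← modeOp_apply, map_smul]

theorem carryProj_modeOp_upper (hs : ∀ i, s i + 2 ≤ p) (i : ZMod f) {n : ZMod f → ℕ} (hn : n j < p)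
    (hle : ∀ l, fold p j n l ≤ fold p j s' l) :
    carryProj p j s s' (modeOp σ i fun x => weightRep p σ t (fold p j s') (upper x)
      (mono p (fold p j s') (fold p j n))) =
    modeOp σ i fun x => weightRep p σ t' s (upper x)
      (carryProj p j s s' (mono p (fold p j s') (fold p j n))) := by
  have hne := sub_one_ne j hf
  obtain ⟨hle1, hle2⟩ := le_or_lt_of_fold_le j hs' hle
  have hmono := fun n hn => carryProj_mono j hf hs' hsh (n := n) hn
  obtain ⟨h1, h2, h3, h4, h5⟩ := hsh
  have hs'j := hs' j
  rw [hmono n hn.le, modeOp_smul, modeOp_upper_small σ hk hf hs t']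
  have hn1 : (n + Pi.single i 1 : ZMod f → ℕ) j ≤ p := by
    by_cases hi : i = j
    · subst hi
      simpa using hn
    · simpa [Ne.symm hi] using hn.le
  by_cases hr : n j < s' j + 1
  · have hns : ∀ l, n l ≤ s' l := fun l => by
      by_cases hl : l = j
      · subst hl
        omega
      · exact hle1 l hl
    rw [modeOp_upper_fold j hf hs' σ hk t i (b := s' - n) (by rw [Pi.sub_apply]; omega)
      (fold_sub j hns), map_smul, hmono _ hn1, Nat.choose_eq_zero_of_lt hr, Nat.cast_zero, zero_smul]
    by_cases hi : i = j
    · subst hi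
      rcases (Nat.lt_succ_iff.1 hr).lt_or_eq with h | h
      · rw [Nat.choose_eq_zero_of_lt (by simpa using h), Nat.cast_zero, zero_smul, smul_zero]
      · rw [Pi.sub_apply, h, Nat.sub_self, Nat.cast_zero, neg_zero, zero_smul]
    · rw [Nat.choose_eq_zero_of_lt (by simpa [Ne.symm hi] using hr), Nat.cast_zero, zero_smul,
        smul_zero]
  · push Not at hr
    have hlt := hle2 hr
    let b : ZMod f → ℕ := fun l => if l = j then p + s' j - n j else if l = j - 1 then
      s' l - 1 - n l else s' l - n l
    have hbj : b j = p + s' j - n j := if_pos rfl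
    have hbj1 : b (j - 1) = s' (j - 1) - 1 - n (j - 1) := by simp only [b, if_neg hne, if_true]
    have hb : ∀ l, l ≠ j → l ≠ j - 1 → b l = s' l - n l := fun l h h' => by
      simp only [b, if_neg h, if_neg h']
    have hnb : fold p j s' - fold p j n = fold p j b := by
      refine tsub_eq_of_eq_add ?_
      rw [← fold_add]
      ext l
      by_cases hl : l = j
      · subst hl
        rw [fold_self, fold_self, Pi.add_apply, Pi.add_apply, hbj, hbj1]
        have e1 : s' (l - 1) = s' (l - 1) - 1 - n (l - 1) + n (l - 1) + 1 := by omega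
        generalize s' (l - 1) - 1 - n (l - 1) + n (l - 1) = z at e1 ⊢
        rw [e1, mul_add, mul_one]
        omega
      · by_cases hl2 : l = j - 1
        · subst hl2
          rw [fold_sub_one j hf, fold_sub_one j hf]
        · rw [fold_of_ne j _ hl hl2, fold_of_ne j _ hl hl2, Pi.add_apply, hb l hl hl2]
          have := hle1 l hl
          omega
    rw [modeOp_upper_fold j hf hs' σ hk t i (b := b) (by rw [hbj]; omega) hnb, map_smul,
      hmono _ hn1, smul_smul, smul_smul]
    have e : n + Pi.single i 1 - Pi.single j (s' j + 1) =
        n - Pi.single j (s' j + 1) + Pi.single i 1 := by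
      rw [tsub_add_eq_add_tsub]
      intro l
      by_cases hl : l = j
      · subst hl
        simpa using hr
      · simp [hl]
    rw [e]
    congr 1
    by_cases hi : i = j
    · subst hi
      rw [hbj, Pi.add_apply, Pi.single_eq_same, Pi.sub_apply, Pi.single_eq_same]
      have e1 := Nat.choose_mul_succ_eq (n i) (s' i + 1)
      have e2 : ((n i + 1 - (s' i + 1) : ℕ) : Fbar p) = n i - s' i := by
        rw [Nat.add_sub_add_right, Nat.cast_sub (by omega)]
      have e3 : ((p + s' i - n i : ℕ) : Fbar p) = s' i - n i := by
        rw [Nat.cast_sub (by omega), Nat.cast_add, CharP.cast_eq_zero, zero_add]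
      have e4 : ((s i - (n i - (s' i + 1)) : ℕ) : Fbar p) = -(n i + 1) := by
        have : s i - (n i - (s' i + 1)) + (n i + 1) = p := by omega
        have h6 := congrArg (fun z : ℕ => (z : Fbar p)) this
        simp only [Nat.cast_add, CharP.cast_eq_zero] at h6
        exact eq_neg_of_add_eq_zero_left (by exact_mod_cast h6)
      have e5 := congrArg (fun z : ℕ => (z : Fbar p)) e1
      simp only [Nat.cast_mul] at e5
      rw [e2] at e5
      rw [e3, e4]
      push_cast at e5
      linear_combination -e5
    · rw [Pi.add_apply, Pi.single_eq_of_ne (Ne.symm hi), add_zero, Pi.sub_apply,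
        Pi.single_eq_of_ne hi, Nat.sub_zero, mul_comm]
      congr 3
      by_cases hi2 : i = j - 1
      · subst hi2
        rw [hbj1]
        omega
      · rw [hb i hi hi2, h5 i hi hi2]

theorem carryProj_modeOp_lower (hs : ∀ i, s i + 2 ≤ p) (i : ZMod f) {n : ZMod f → ℕ} (hn : n j < p)
    (hle : ∀ l, fold p j n l ≤ fold p j s' l) :
    carryProj p j s s' (modeOp σ i fun x => weightRep p σ t (fold p j s') (lower x)
      (mono p (fold p j s') (fold p j n))) =
    modeOp σ i fun x => weightRep p σ t' s (lower x)
      (carryProj p j s s' (mono p (fold p j s') (fold p j n))) := by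
  obtain ⟨hle1, hle2⟩ := le_or_lt_of_fold_le j hs' hle
  have hmono := fun n hn => carryProj_mono j hf hs' hsh (n := n) hn
  obtain ⟨h1, h2, h3, h4, h5⟩ := hsh
  rw [modeOp_lower_fold j hf hs' σ hk t i hn hle, map_smul, hmono n hn.le,
    hmono _ ((Nat.sub_le _ _).trans hn.le), modeOp_smul]
  by_cases hr : n j < s' j + 1
  · rw [Nat.choose_eq_zero_of_lt hr, Nat.choose_eq_zero_of_lt
      (show (n - Pi.single i 1 : ZMod f → ℕ) j < s' j + 1 from (Nat.sub_le _ _).trans_lt hr),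
      Nat.cast_zero, zero_smul, smul_zero, zero_smul]
  · push Not at hr
    rw [modeOp_lower_small σ hk hf hs t' i, smul_smul, smul_smul, tsub_right_comm]
    · congr 1
      rw [mul_neg, neg_mul, neg_inj]
      by_cases hi : i = j
      · subst hi
        rw [Pi.sub_apply, Pi.single_eq_same, Pi.sub_apply, Pi.single_eq_same, ← Nat.cast_mul,
          ← Nat.cast_mul]
        congr 1
        have e1 := Nat.choose_mul_succ_eq (n i - 1) (s' i + 1)
        have e2 : n i - 1 + 1 = n i := by omega
        rw [e2] at e1
        rw [← e1, mul_comm]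
      · rw [Pi.sub_apply, Pi.single_eq_of_ne (Ne.symm hi), Nat.sub_zero, Pi.sub_apply,
          Pi.single_eq_of_ne hi, Nat.sub_zero, mul_comm]
    · intro l
      by_cases hl : l = j
      · subst hl
        rw [Pi.sub_apply, Pi.single_eq_same]
        omega
      · rw [Pi.sub_apply, Pi.single_eq_of_ne hl, Nat.sub_zero]
        by_cases hl2 : l = j - 1
        · subst hl2
          have := hle2 hr
          omega
        · rw [← h5 l hl hl2]
          exact hle1 l hl

theorem carryProj_comm (hs : ∀ i, s i + 2 ≤ p)
    (ht : detExp p t ≡ detExp p t' - (1 + (s' j : ℤ)) * (p : ℤ) ^ (f - 1 - j.val)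
      [ZMOD (p : ℤ) ^ f - 1]) (g : GL (Fin 2) k) (v : WeightSpace p (fold p j s')) :
    carryProj p j s s' (weightRep p σ t (fold p j s') g v) =
      weightRep p σ t' s g (carryProj p j s s' v) := by
  have hex : ∀ m : ZMod f → ℕ, (∀ l, m l ≤ fold p j s' l) → ∃ n, n j < p ∧ m = fold p j n :=
    fun m hm => ⟨unfold p j m, unfold_self_lt j m, (fold_unfold j hf (by
      have := hm (j - 1)
      rw [fold_sub_one j hf] at this
      omega)).symm⟩
  refine weightRep_comm σ hk hf _ (fun i m hm => ?_) (fun i m hm => ?_) (fun a b m hm => ?_) g v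
  · obtain ⟨n, hn, rfl⟩ := hex m hm
    exact carryProj_modeOp_upper j hf hs' hsh σ hk hs i hn hm
  · obtain ⟨n, hn, rfl⟩ := hex m hm
    exact carryProj_modeOp_lower j hf hs' hsh σ hk hs i hn hm
  · obtain ⟨n, hn, rfl⟩ := hex m hm
    obtain ⟨hle1, hle2⟩ := le_or_lt_of_fold_le j hs' hm
    rw [weightRep_torus σ t _ hm, map_smul, carryProj_mono j hf hs' hsh hn.le, map_smul]
    by_cases hr : n j < s' j + 1
    · rw [Nat.choose_eq_zero_of_lt hr, Nat.cast_zero, zero_smul, smul_zero, zero_smul]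
    push Not at hr
    have hne := sub_one_ne j hf
    have hdvd := hsh.dvd hf
    obtain ⟨h1, h2, h3, h4, h5⟩ := hsh
    have hns : ∀ l, (n - Pi.single j (s' j + 1) : ZMod f → ℕ) l ≤ s l := fun l => by
      by_cases hl : l = j
      · subst hl
        rw [Pi.sub_apply, Pi.single_eq_same]
        omega
      · rw [Pi.sub_apply, Pi.single_eq_of_ne hl, Nat.sub_zero]
        by_cases hl2 : l = j - 1
        · subst hl2
          have := hle2 hr
          omega
        · rw [← h5 l hl hl2]
          exact hle1 l hl
    rw [weightRep_torus σ t' s hns, smul_comm]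
    congr 2
    have hk' : Nat.card k = p ^ f := by rw [Nat.card_eq_fintype_card, hk]
    have e1 : (natExp p n : ℤ) = natExp p (n - Pi.single j (s' j + 1)) +
        (1 + (s' j : ℤ)) * (p : ℤ) ^ (f - 1 - j.val) := by
      have : n = n - Pi.single j (s' j + 1) + Pi.single j (s' j + 1) := by
        ext l
        by_cases hl : l = j
        · subst hl
          simp
          omega
        · simp [hl]
      nth_rw 1 [this]
      rw [natExp_add, natExp_single]
      push_cast
      ring
    have e2 := natExp_fold (p := p) j hf n
    have e3 := natExp_fold (p := p) j hf s'
    have e4 := hdvd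
    rw [detExp_sub, detExp_sub, detExp_single, ← cast_natExp, ← cast_natExp] at e4
    rw [e1] at e2
    have e5 : detExp p t + natExp p (fold p j n) ≡
        detExp p t' + natExp p (n - Pi.single j (s' j + 1)) [ZMOD (p : ℤ) ^ f - 1] := by
      have := ht.add e2
      ring_nf at this ⊢
      exact this
    have e6 : detExp p t + natExp p (fold p j s') - natExp p (fold p j n) ≡
        detExp p t' + natExp p s - natExp p (n - Pi.single j (s' j + 1))
        [ZMOD (p : ℤ) ^ f - 1] := by
      have := ((ht.add e3).sub e2).sub ((Int.modEq_zero_iff_dvd).2 e4).symm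
      ring_nf at this ⊢
      exact this
    rw [map_zpow_eq_of_modEq σ hk' e5 a, map_zpow_eq_of_modEq σ hk' e6 b]

end CarryExtension

section CarryExtension

variable {p : ℕ} [Fact p.Prime] {f : ℕ} [NeZero f] (j : ZMod f) {s s' : ZMod f → ℕ}

theorem choose_ne_zero_of_lt {n m : ℕ} (h : n < p) (hm : m ≤ n) : (n.choose m : Fbar p) ≠ 0 := by
  rw [Ne, CharP.cast_eq_zero_iff (Fbar p) p]
  exact (Fact.out : p.Prime).coprime_iff_not_dvd.1
    (Nat.Prime.coprime_choose_of_lt Fact.out h hm)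

variable (hf : 1 < f) (hs' : ∀ i, s' i + 2 ≤ p) (hsh : ShapeOne p j s s')
include hf hs' hsh

theorem monoCoeff_carryProj {n : ZMod f → ℕ} (hn : ∀ i, n i ≤ s i)
    (e : WeightSpace p (fold p j s')) :
    monoCoeff (carryProj p j s s' e) n = ((n j + (s' j + 1)).choose (s' j + 1) : Fbar p) *
      monoCoeff e (fold p j (n + Pi.single j (s' j + 1))) := by
  have hmono := fun n hn => carryProj_mono j hf hs' hsh (n := n) hn
  obtain ⟨h1, h2, h3, h4, h5⟩ := hsh
  have hnj := hn j
  have hnp : (n + Pi.single j (s' j + 1) : ZMod f → ℕ) j < p := by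
    rw [Pi.add_apply, Pi.single_eq_same]
    omega
  have : (monoCoeffHom n).comp (carryProj p j s s') =
      ((n j + (s' j + 1)).choose (s' j + 1) : Fbar p) •
        monoCoeffHom (fold p j (n + Pi.single j (s' j + 1))) := hom_ext_mono fun m hm => by
    change monoCoeff (carryProj p j s s' (mono p _ m)) n = _ * monoCoeff (mono p _ m) _
    obtain ⟨n', hn', rfl⟩ : ∃ n', n' j < p ∧ m = fold p j n' :=
      ⟨unfold p j m, unfold_self_lt j m, (fold_unfold j hf (by
        have := hm (j - 1)
        rw [fold_sub_one j hf] at this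
        omega)).symm⟩
    rw [hmono n' hn'.le, monoCoeff_smul, monoCoeff_mono hm]
    by_cases hr : n' j < s' j + 1
    · rw [Nat.choose_eq_zero_of_lt hr, if_neg, Nat.cast_zero, zero_mul, mul_zero]
      intro h
      have h6 := congrArg (fun a => unfold p j a j) h
      simp only [unfold_fold j hf hn', unfold_fold j hf hnp, Pi.add_apply, Pi.single_eq_same] at h6
      omega
    · push Not at hr
      have hadd : n' - Pi.single j (s' j + 1) + Pi.single j (s' j + 1) = n' := by
        refine tsub_add_cancel_of_le fun l => ?_
        by_cases hl : l = j
        · subst hl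
          rwa [Pi.single_eq_same]
        · simp [hl]
      by_cases h : n = n' - Pi.single j (s' j + 1)
      · rw [if_pos (by rw [h, hadd]), h, monoCoeff_mono (by rwa [← h]), if_pos rfl]
        congr 2
        rw [Pi.sub_apply, Pi.single_eq_same]
        congr 1
        omega
      · rw [if_neg, mul_zero]
        · by_cases hle : ∀ i, (n' - Pi.single j (s' j + 1) : ZMod f → ℕ) i ≤ s i
          · rw [monoCoeff_mono hle, if_neg h, mul_zero]
          · push Not at hle
            obtain ⟨i, hi⟩ := hle
            rw [mono_eq_zero hi]
            exact mul_eq_zero_of_right _ ((monoCoeffHom n).map_zero)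
        · intro h6
          have h7 := congrArg (unfold p j) h6
          rw [unfold_fold j hf hn', unfold_fold j hf hnp] at h7
          exact h (by rw [← h7, add_tsub_cancel_right])
  exact DFunLike.congr_fun this e

theorem carry_exact : Function.Exact (carryIncl p j s') (carryProj p j s s') := by
  have hmono := fun n hn => carryProj_mono j hf hs' hsh (n := n) hn
  have hcoeff := fun n hn e => monoCoeff_carryProj j hf hs' hsh (n := n) hn e
  obtain ⟨h1, h2, h3, h4, h5⟩ := hsh
  have hs'j := hs' j
  intro e
  constructor
  · intro he
    change e ∈ LinearMap.range (carryIncl p j s')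
    rw [sum_monoCoeff e]
    refine Submodule.sum_mem _ fun m hm => ?_
    rw [mem_box] at hm
    obtain ⟨n, hn, rfl⟩ : ∃ n, n j < p ∧ m = fold p j n :=
      ⟨unfold p j m, unfold_self_lt j m, (fold_unfold j hf (by
        have := hm (j - 1)
        rw [fold_sub_one j hf] at this
        omega)).symm⟩
    obtain ⟨hle1, hle2⟩ := le_or_lt_of_fold_le j hs' hm
    by_cases hr : n j < s' j + 1
    · refine Submodule.smul_mem _ _ ⟨mono p s' n, carryIncl_mono j fun l => ?_⟩
      by_cases hl : l = j
      · subst hl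
        omega
      · exact hle1 l hl
    · push Not at hr
      have hle : ∀ l, (n - Pi.single j (s' j + 1) : ZMod f → ℕ) l ≤ s l := fun l => by
        by_cases hl : l = j
        · subst hl
          rw [Pi.sub_apply, Pi.single_eq_same]
          omega
        · rw [Pi.sub_apply, Pi.single_eq_of_ne hl, Nat.sub_zero]
          by_cases hl2 : l = j - 1
          · subst hl2
            have := hle2 hr
            omega
          · rw [← h5 l hl hl2]
            exact hle1 l hl
      have h6 := hcoeff _ hle e
      rw [he, tsub_add_cancel_of_le (a := (Pi.single j (s' j + 1) : ZMod f → ℕ))] at h6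
      · have h7 : monoCoeff e (fold p j n) = 0 := by
          refine (mul_eq_zero.1 (h6.symm.trans ((monoCoeffHom _).map_zero))).resolve_left ?_
          refine choose_ne_zero_of_lt ?_ (Nat.le_add_left _ _)
          rw [Pi.sub_apply, Pi.single_eq_same]
          omega
        rw [h7, zero_smul]
        exact Submodule.zero_mem _
      · intro l
        by_cases hl : l = j
        · subst hl
          rwa [Pi.single_eq_same]
        · simp [hl]
  · rintro ⟨v, rfl⟩
    have : (carryProj p j s s').comp (carryIncl p j s') = 0 := hom_ext_mono fun n hn => by
      have := hn j
      rw [LinearMap.comp_apply, carryIncl_mono j hn, hmono n (by omega),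
        Nat.choose_eq_zero_of_lt (by omega), Nat.cast_zero, zero_smul, LinearMap.zero_apply]
    exact DFunLike.congr_fun this v

omit hsh in
theorem carryIncl_injective : Function.Injective (carryIncl p j s') := by
  have h : ∀ n, (∀ i, n i ≤ s' i) → ∀ v, monoCoeff (carryIncl p j s' v) (fold p j n) =
      monoCoeff v n := fun n hn v => by
    have : (monoCoeffHom (fold p j n)).comp (carryIncl p j s') = monoCoeffHom n :=
      hom_ext_mono fun m hm => by
        change monoCoeff (carryIncl p j s' (mono p s' m)) _ = monoCoeff (mono p s' m) n
        have hmj := hm j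
        have hnj := hn j
        have := hs' j
        rw [carryIncl_mono j hm, monoCoeff_mono (fold_le j hm), monoCoeff_mono hm]
        refine if_congr ⟨fun h => ?_, fun h => by rw [h]⟩ rfl rfl
        have h2 := congrArg (unfold p j) h
        rwa [unfold_fold j hf (by omega), unfold_fold j hf (by omega)] at h2
    exact DFunLike.congr_fun this v
  intro v w hvw
  rw [sum_monoCoeff v, sum_monoCoeff w]
  refine Finset.sum_congr rfl fun n hn => ?_
  rw [← h n (mem_box.1 hn), ← h n (mem_box.1 hn), hvw]

theorem carryProj_surjective : Function.Surjective (carryProj p j s s') := by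
  have hmono := fun n hn => carryProj_mono j hf hs' hsh (n := n) hn
  obtain ⟨h1, h2, h3, h4, h5⟩ := hsh
  rw [← LinearMap.range_eq_top, eq_top_iff, ← span_mono, Submodule.span_le]
  rintro _ ⟨n, rfl⟩
  by_cases hn : ∀ i, n i ≤ s i
  · have hnj := hn j
    have h6 := hmono (n + Pi.single j (s' j + 1)) (by
      rw [Pi.add_apply, Pi.single_eq_same]
      omega)
    rw [add_tsub_cancel_right, Pi.add_apply, Pi.single_eq_same] at h6
    have h7 := choose_ne_zero_of_lt (p := p) (show n j + (s' j + 1) < p by omega)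
      (Nat.le_add_left _ _)
    exact ⟨_, by rw [map_smul, h6, smul_smul, inv_mul_cancel₀ h7, one_smul]⟩
  · push Not at hn
    obtain ⟨i, hi⟩ := hn
    beta_reduce
    rw [mono_eq_zero hi]
    exact Submodule.zero_mem _

variable {k : Type*} [Field k] [Fintype k] (σ : k →+* Fbar p) (hk : Fintype.card k = p ^ f)
  {d d' : ZMod f → ℤ} (hs : ∀ i, s i + 2 ≤ p)
include hk hs

omit hsh in
/-- The first criterion gives rise to nonsplit extensions of representations of `GL₂(k)`. -/
theorem extNeZero_of_critOne (h : CritOne p j d s d' s') :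
    ExtNeZero (weightRep p σ d s) (weightRep p σ d' s') := by
  obtain ⟨hsh, hD⟩ := h
  let X : RepExtension (weightRep p σ d s) (weightRep p σ d' s') :=
    { E := WeightSpace p (fold p j s')
      rep := weightRep p σ d' (fold p j s')
      incl := ⟨carryIncl p j s', fun g => LinearMap.ext (carryIncl_comm j hf hs' σ hk d' g)⟩
      proj := ⟨carryProj p j s s', fun g =>
        LinearMap.ext (carryProj_comm j hf hs' hsh σ hk hs hD g)⟩
      incl_injective := carryIncl_injective j hf hs'
      proj_surjective := carryProj_surjective j hf hs' hsh
      exact := carry_exact j hf hs' hsh }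
  refine ⟨X, ?_⟩
  rintro ⟨r, hr⟩
  have hp : p.Prime := Fact.out
  have hj := hs' j
  let e : WeightSpace p (fold p j s') := r (mono p s 0)
  have hre : ∀ g, weightRep p σ d' (fold p j s') g e = r (weightRep p σ d s g (mono p s 0)) :=
    fun g => (Representation.IntertwiningMap.isIntertwining _ _ r g _).symm
  have hsingle : ∀ l, (Pi.single j (s' j + 1) : ZMod f → ℕ) l + 1 ≤ p := fun l => by
    by_cases hl : l = j
    · subst hl
      rw [Pi.single_eq_same]
      omega
    · rw [Pi.single_eq_of_ne hl]
      exact hp.one_lt.le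
  have he : e = monoCoeff e (fold p j (Pi.single j (s' j + 1))) •
      mono p (fold p j s') (fold p j (Pi.single j (s' j + 1))) := by
    refine eq_smul_mono fun m hm h0 => ?_
    have h1 := modEq_of_monoCoeff σ hk d' (A := detExp p d) (fun a => by
      rw [hre, weightRep_torus σ d s (n := 0) fun i => Nat.zero_le _, map_smul]
      simp [natExp, e]) hm h0
    refine eq_fold_of_modEq j hf hs' hsingle ⟨j + 1, ?_⟩ hm ?_
    · have : Fact (1 < f) := ⟨hf⟩
      rw [Pi.single_eq_of_ne (by simp)]
      exact hp.one_lt.ne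
    · rw [natExp_single, ← Int.natCast_modEq_iff, cast_pow_sub_one]
      have h2 := (h1.symm.sub hD)
      push_cast
      ring_nf at h2 ⊢
      exact h2
  have hle : ∀ l, fold p j (Pi.single j (s' j + 1)) l ≤ fold p j s' l := fun l => by
    have hne := sub_one_ne j hf
    by_cases hl : l = j
    · subst hl
      rw [fold_self, fold_self, Pi.single_eq_same, Pi.single_eq_of_ne hne, hsh.2.2.2.1]
      have := hp.pos
      rw [mul_add]
      omega
    · by_cases hl2 : l = j - 1
      · subst hl2
        rw [fold_sub_one j hf]
        exact Nat.zero_le _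
      · rw [fold_of_ne j _ hl hl2, Pi.single_eq_of_ne hl]
        exact Nat.zero_le _
  have h1 : modeOp σ j (fun x => weightRep p σ d' (fold p j s') (lower x) e) = 0 := by
    simp only [hre, weightRep_lower_mono_zero]
    exact modeOp_const σ hk hf j _
  rw [he, modeOp_smul, modeOp_lower_fold j hf hs' σ hk d' j (by rw [Pi.single_eq_same]; omega) hle,
    Pi.single_eq_same, smul_smul, show (Pi.single j (s' j + 1) - Pi.single j 1 : ZMod f → ℕ) =
      Pi.single j (s' j) by
        ext l
        by_cases hl : l = j
        · subst hl
          simp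
        · simp [hl]] at h1
  have h2 : mono p (fold p j s') (fold p j (Pi.single j (s' j))) ≠ 0 :=
    mono_ne_zero (fold_le j fun l => by
      by_cases hl : l = j
      · subst hl
        rw [Pi.single_eq_same]
      · rw [Pi.single_eq_of_ne hl]
        exact Nat.zero_le _)
  have h3 : monoCoeff e (fold p j (Pi.single j (s' j + 1))) = 0 := by
    rcases smul_eq_zero.1 h1 with h | h
    · refine (mul_eq_zero.1 h).resolve_right (neg_ne_zero.2 (natCast_ne_zero_of_lt ?_ ?_)) <;> omega
    · exact absurd h h2
  rw [h3, zero_smul] at he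
  have h4 := hr (mono p s 0)
  change carryProj p j s s' e = _ at h4
  rw [he, map_zero] at h4
  exact mono_ne_zero (fun i => Nat.zero_le _) h4.symm

end CarryExtension

section Derivation

variable (p : ℕ) [Fact p.Prime] (K : Type*) [Field K] [Algebra ℚ_[p] K]
  [FiniteDimensional ℚ_[p] K] [Algebra ℤ_[p] K] [IsScalarTower ℤ_[p] ℚ_[p] K]

/-- The reduction modulo the square of the maximal ideal is a ring of dual numbers if `K` is
ramified. -/
theorem exists_derivation (he : 1 < ramE p K) : ∃ δ : OK p K → ResK p K,
    (∀ x y, δ (x + y) = δ x + δ y) ∧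
    (∀ x y, δ (x * y) = δ x * IsLocalRing.residue _ y + IsLocalRing.residue _ x * δ y) ∧
    (∀ x ∈ IsLocalRing.maximalIdeal (OK p K) ^ 2, δ x = 0) ∧
    ∃ π ∈ IsLocalRing.maximalIdeal (OK p K), δ π ≠ 0 := by
  obtain ⟨π, hπ⟩ := IsDiscreteValuationRing.exists_irreducible (OK p K)
  have hp : p.Prime := Fact.out
  have hm := hπ.maximalIdeal_eq
  set q := p ^ resF p K with hq
  have hcard : Fintype.card (ResK p K) = q := card_resK_eq rfl
  have hq1 : q ≠ 0 := pow_ne_zero _ hp.ne_zero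
  have hf0 : resF p K ≠ 0 := fun h => by
    rw [hq, h, pow_zero] at hcard
    exact absurd Fintype.one_lt_card (by rw [hcard]; exact lt_irrefl _)
  have hdvd : ∀ x : OK p K, ∃ c, x - x ^ q = π * c := fun x => by
    rw [← dvd_def, ← Ideal.mem_span_singleton, ← hm, ← IsLocalRing.residue_eq_zero_iff, map_sub,
      map_pow, ← hcard, FiniteField.pow_card, sub_self]
  choose D hD using hdvd
  have hcancel : ∀ x y : OK p K, π * x = π * y → x = y := fun x y h =>
    mul_left_cancel₀ hπ.ne_zero h
  have hres : ∀ x : OK p K, x ∈ IsLocalRing.maximalIdeal (OK p K) →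
      IsLocalRing.residue _ x = 0 := fun x hx => (IsLocalRing.residue_eq_zero_iff x).2 hx
  have hfrob : ∀ x y : OK p K, ∃ c, (x + y) ^ q = x ^ q + y ^ q + π * (π * c) := fun x y => by
    obtain ⟨c, hc⟩ := exists_add_pow_prime_pow_eq hp x y (resF p K)
    rw [← hq] at hc
    have h2 := natCast_mem_sq p K he
    rw [hm, Ideal.span_singleton_pow, Ideal.mem_span_singleton] at h2
    obtain ⟨b, hb⟩ := h2
    refine ⟨b * x * y * c, ?_⟩
    rw [hb] at hc
    linear_combination hc
  refine ⟨fun x => IsLocalRing.residue _ (D x), fun x y => ?_, fun x y => ?_, fun x hx => ?_, π, ?_,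
    ?_⟩
  · obtain ⟨c, hc⟩ := hfrob x y
    have : D (x + y) = D x + D y - π * c := hcancel _ _ (by
      linear_combination hD x + hD y - hD (x + y) - hc)
    beta_reduce
    rw [this, map_sub, map_add, map_mul, hres π (by rw [hm]; exact Ideal.mem_span_singleton_self _),
      zero_mul, sub_zero]
  · have : D (x * y) = D x * y ^ q + x * D y := hcancel _ _ (by
      have h3 := hD (x * y)
      rw [mul_pow] at h3
      linear_combination -h3 + y ^ q * hD x + x * hD y)
    beta_reduce
    rw [this, map_add, map_mul, map_mul, map_pow, ← hcard, FiniteField.pow_card]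
  · rw [hm, Ideal.span_singleton_pow, Ideal.mem_span_singleton] at hx
    obtain ⟨y, rfl⟩ := hx
    obtain ⟨r, hr⟩ : ∃ r, q = r + 1 := Nat.exists_eq_succ_of_ne_zero hq1
    have : D (π ^ 2 * y) = π * (y * (1 - (π ^ 2 * y) ^ r)) := hcancel _ _ (by
      rw [← hD, hr]
      ring)
    beta_reduce
    rw [this, map_mul, hres π (by rw [hm]; exact Ideal.mem_span_singleton_self _), zero_mul]
  · rw [hm]
    exact Ideal.mem_span_singleton_self _
  · obtain ⟨r, hr⟩ : ∃ r, q = r + 1 := Nat.exists_eq_succ_of_ne_zero hq1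
    have hr0 : r ≠ 0 := by
      rintro rfl
      have := Nat.one_lt_pow hf0 hp.one_lt
      omega
    have : D π = 1 - π ^ r := hcancel _ _ (by
      rw [← hD, hr]
      ring)
    beta_reduce
    rw [this, map_sub, map_one, map_pow, hres π (by rw [hm]; exact Ideal.mem_span_singleton_self _),
      zero_pow hr0, sub_zero]
    exact one_ne_zero

end Derivation

section Quadratic

variable {F : Type} [Field F]

/-- The binary quadratic form attached to a matrix. -/
noncomputable def quadForm (A : Matrix (Fin 2) (Fin 2) F) : MvPolynomial (Fin 2) F :=
  MvPolynomial.C (-A 0 1) * MvPolynomial.X 0 ^ 2 +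
    MvPolynomial.C (A 0 0 - A 1 1) * (MvPolynomial.X 0 * MvPolynomial.X 1) +
    MvPolynomial.C (A 1 0) * MvPolynomial.X 1 ^ 2

theorem quadForm_add (A B : Matrix (Fin 2) (Fin 2) F) :
    quadForm (A + B) = quadForm A + quadForm B := by
  simp only [quadForm, Matrix.add_apply, map_add, map_sub, map_neg]
  ring

theorem quadForm_smul (c : F) (A : Matrix (Fin 2) (Fin 2) F) :
    quadForm (c • A) = c • quadForm A := by
  rw [MvPolynomial.smul_eq_C_mul]
  simp only [quadForm, Matrix.smul_apply, smul_eq_mul, map_sub, map_neg, map_mul]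
  ring

theorem isHomogeneous_quadForm (A : Matrix (Fin 2) (Fin 2) F) : (quadForm A).IsHomogeneous 2 := by
  have hX := MvPolynomial.isHomogeneous_X F (σ := Fin 2)
  have hC := MvPolynomial.isHomogeneous_C (Fin 2) (R := F)
  refine ((?_ : MvPolynomial.IsHomogeneous _ 2).add ?_).add ?_
  · simpa using (hC (-A 0 1)).mul ((hX 0).pow 2)
  · simpa using (hC (A 0 0 - A 1 1)).mul ((hX 0).mul (hX 1))
  · simpa using (hC (A 1 0)).mul ((hX 1).pow 2)

theorem linSubst_quadForm (g A : Matrix (Fin 2) (Fin 2) F) :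
    linSubst g (quadForm A) = quadForm (g * A * g.adjugate) := by
  simp only [linSubst, quadForm, map_add, map_mul, map_pow, MvPolynomial.aeval_X,
    MvPolynomial.aeval_C, MvPolynomial.algebraMap_eq, Fin.sum_univ_two, Matrix.adjugate_fin_two,
    Matrix.mul_apply, Matrix.of_apply, Matrix.cons_val', Matrix.cons_val_zero, Matrix.cons_val_one,
    Matrix.cons_val_fin_one, map_sub, map_neg]
  ring

theorem linSubst_quadForm_conj (g : GL (Fin 2) F) (A : Matrix (Fin 2) (Fin 2) F) :
    linSubst g.1 (quadForm A) = g.1.det • quadForm (g.1 * A * (g⁻¹).1) := by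
  rw [linSubst_quadForm, ← quadForm_smul]
  congr 1
  have h : g.1.adjugate = g.1.det • (g⁻¹).1 := by
    calc g.1.adjugate = g.1.adjugate * (g.1 * (g⁻¹).1) := by
          rw [Units.mul_inv g, mul_one]
      _ = _ := by rw [← mul_assoc, Matrix.adjugate_mul, smul_mul_assoc, one_mul]
  rw [h, mul_smul_comm]

/-- Multiplication by a polynomial on homogeneous polynomials. -/
noncomputable def mulSym (n m : ℕ) (Q : MvPolynomial (Fin 2) F) :
    MvPolynomial.homogeneousSubmodule (Fin 2) F n →ₗ[F]
      MvPolynomial.homogeneousSubmodule (Fin 2) F m :=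
  open Classical in
  if h : ∀ P ∈ MvPolynomial.homogeneousSubmodule (Fin 2) F n,
    LinearMap.mulLeft F Q P ∈ MvPolynomial.homogeneousSubmodule (Fin 2) F m then
    (LinearMap.mulLeft F Q).restrict h else 0

theorem coe_mulSym {n m c : ℕ} {Q : MvPolynomial (Fin 2) F} (hQ : Q.IsHomogeneous c)
    (h : m = n + c) (P : MvPolynomial.homogeneousSubmodule (Fin 2) F n) :
    (mulSym n m Q P : MvPolynomial (Fin 2) F) = Q * P := by
  rw [mulSym, dif_pos]
  · rfl
  · intro P hP
    rw [h, add_comm]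
    exact hQ.mul hP

theorem mulSym_add {n m c : ℕ} {Q R : MvPolynomial (Fin 2) F} (hQ : Q.IsHomogeneous c)
    (hR : R.IsHomogeneous c) (h : m = n + c) : mulSym n m (Q + R) = mulSym n m Q + mulSym n m R := by
  refine LinearMap.ext fun P => Subtype.ext ?_
  rw [coe_mulSym (hQ.add hR) h, LinearMap.add_apply, Submodule.coe_add, coe_mulSym hQ h,
    coe_mulSym hR h, add_mul]

theorem mulSym_smul {n m c : ℕ} {Q : MvPolynomial (Fin 2) F} (hQ : Q.IsHomogeneous c)
    (h : m = n + c) (a : F) : mulSym n m (a • Q) = a • mulSym n m Q := by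
  refine LinearMap.ext fun P => Subtype.ext ?_
  have ha : (a • Q).IsHomogeneous c := Submodule.smul_mem
    (MvPolynomial.homogeneousSubmodule (Fin 2) F c) a hQ
  rw [coe_mulSym ha h, LinearMap.smul_apply, Submodule.coe_smul, coe_mulSym hQ h, smul_mul_assoc]

theorem isHomogeneous_linSubst (M : Matrix (Fin 2) (Fin 2) F) {n : ℕ}
    {P : MvPolynomial (Fin 2) F} (hP : P.IsHomogeneous n) : (linSubst M P).IsHomogeneous n :=
  linSubst_mem M n P hP

theorem symRep_mulSym {n m c : ℕ} {Q : MvPolynomial (Fin 2) F} (hQ : Q.IsHomogeneous c)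
    (h : m = n + c) (g : GL (Fin 2) F) (P : MvPolynomial.homogeneousSubmodule (Fin 2) F n) :
    symRep F m g (mulSym n m Q P) = mulSym n m (linSubst g.1 Q) (symRep F n g P) := by
  apply Subtype.ext
  rw [coe_symRep_apply, coe_mulSym hQ h, map_mul, coe_mulSym (isHomogeneous_linSubst _ hQ) h,
    coe_symRep_apply]

end Quadratic

section Twist

variable {p : ℕ} [Fact p.Prime] {f : ℕ} [NeZero f] (j : ZMod f) (s s' : ZMod f → ℕ)

/-- Multiplication by a polynomial in the `j`-th factor. -/
noncomputable def mulFactor (Q : MvPolynomial (Fin 2) (Fbar p)) :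
    WeightSpace p s →ₗ[Fbar p] WeightSpace p s' :=
  PiTensorProduct.map (Function.update (fun i => mulSym (s i) (s' i) 1) j (mulSym (s j) (s' j) Q))

variable {s s'} (h : s' j = s j + 2) (h' : ∀ i, i ≠ j → s' i = s i)
include h

omit [NeZero f] in
theorem mulFactor_add {Q R : MvPolynomial (Fin 2) (Fbar p)} (hQ : Q.IsHomogeneous 2)
    (hR : R.IsHomogeneous 2) : mulFactor j s s' (Q + R) = mulFactor j s s' Q + mulFactor j s s' R := by
  unfold mulFactor
  rw [mulSym_add hQ hR h, PiTensorProduct.map_update_add]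

omit [NeZero f] in
theorem mulFactor_smul {Q : MvPolynomial (Fin 2) (Fbar p)} (hQ : Q.IsHomogeneous 2) (a : Fbar p) :
    mulFactor j s s' (a • Q) = a • mulFactor j s s' Q := by
  unfold mulFactor
  rw [mulSym_smul hQ h, PiTensorProduct.map_update_smul]

include h'

theorem weightRep_mulFactor {k : Type*} [Field k] (σ : k →+* Fbar p) (d : ZMod f → ℤ)
    {Q : MvPolynomial (Fin 2) (Fbar p)} (hQ : Q.IsHomogeneous 2) (g : GL (Fin 2) k)
    (v : WeightSpace p s) :
    weightRep p σ d s' g (mulFactor j s s' Q v) =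
      mulFactor j s s' (linSubst (Matrix.GeneralLinearGroup.map (emb p σ j) g).1 Q)
        (weightRep p σ d s g v) := by
  have : (weightRep p σ d s' g).comp (mulFactor j s s' Q) =
      (mulFactor j s s' (linSubst (Matrix.GeneralLinearGroup.map (emb p σ j) g).1 Q)).comp
        (weightRep p σ d s g) := by
    apply PiTensorProduct.ext
    apply MultilinearMap.ext
    intro v
    rw [LinearMap.compMultilinearMap_apply, LinearMap.compMultilinearMap_apply,
      LinearMap.comp_apply, LinearMap.comp_apply, weightRep_tprod, map_smul]
    unfold mulFactor
    rw [PiTensorProduct.map_tprod, PiTensorProduct.map_tprod, weightRep_tprod]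
    congr 2
    ext1 i
    by_cases hi : i = j
    · subst hi
      rw [Function.update_self, Function.update_self, symRep_mulSym hQ h]
    · rw [Function.update_of_ne hi, Function.update_of_ne hi,
        symRep_mulSym (MvPolynomial.isHomogeneous_one _ _) (by rw [h' i hi, add_zero]), map_one]
  exact DFunLike.congr_fun this v

omit [NeZero f] in
theorem mulFactor_mono_zero :
    mulFactor j s s' (MvPolynomial.X 0 ^ 2) (mono p s 0) = mono p s' (Pi.single j 2) := by
  unfold mulFactor mono
  rw [PiTensorProduct.map_tprod]
  congr 1
  ext1 i
  apply Subtype.ext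
  by_cases hi : i = j
  · subst hi
    rw [Function.update_self, coe_mulSym (MvPolynomial.isHomogeneous_X_pow _ _) h,
      Pi.zero_apply, coe_symMono (Nat.zero_le _), Pi.single_eq_same, coe_symMono (by omega), h,
      Nat.add_sub_cancel, pow_zero, one_mul, Nat.sub_zero]
  · rw [Function.update_of_ne hi, coe_mulSym (MvPolynomial.isHomogeneous_one _ _)
      (by rw [h' i hi, add_zero]), Pi.single_eq_of_ne hi, h' i hi, one_mul]
    rfl

variable {K : Type*} [Field K] [Algebra ℚ_[p] K]
  [FiniteDimensional ℚ_[p] K] [Algebra ℤ_[p] K] [IsScalarTower ℤ_[p] ℚ_[p] K]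
  {σ : ResK p K →+* Fbar p} (hf : f = resF p K) {d d' : ZMod f → ℤ}

omit h h' in
/-- The multiplication operator attached to a matrix. -/
noncomputable def twist (σ : ResK p K →+* Fbar p) (j : ZMod f) (s s' : ZMod f → ℕ)
    (A : Matrix (Fin 2) (Fin 2) (ResK p K)) : WeightSpace p s →ₗ[Fbar p] WeightSpace p s' :=
  mulFactor j s s' (quadForm (A.map (emb p σ j)))

omit h' [NeZero f] in
theorem twist_add (A B : Matrix (Fin 2) (Fin 2) (ResK p K)) :
    twist σ j s s' (A + B) = twist σ j s s' A + twist σ j s s' B := by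
  unfold twist
  rw [Matrix.map_add _ (map_add _), quadForm_add,
    mulFactor_add j h (isHomogeneous_quadForm _) (isHomogeneous_quadForm _)]

include hf in
theorem weightRep_twist (hD : detExp p d' ≡ detExp p d - (p : ℤ) ^ (f - 1 - j.val)
    [ZMOD (p : ℤ) ^ f - 1]) (g : GLk p K) (A : Matrix (Fin 2) (Fin 2) (ResK p K))
    (v : WeightSpace p s) :
    weightRep p σ d' s' g (twist σ j s s' A v) =
      twist σ j s s' (g.1 * A * (g⁻¹).1) (weightRep p σ d s g v) := by
  have hk : Nat.card (ResK p K) = p ^ f := by rw [Nat.card_eq_fintype_card, card_resK_eq hf]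
  have hdet : weightRep p σ d' s g v =
      (σ (Matrix.GeneralLinearGroup.det g : ResK p K) ^ (-(p : ℤ) ^ (f - 1 - j.val))) •
        weightRep p σ d s g v := by
    have hne : σ (Matrix.GeneralLinearGroup.det g : ResK p K) ≠ 0 :=
      (Units.map (σ : ResK p K →* Fbar p) _).ne_zero
    have : weightRep p σ d' s g =
        (σ (Matrix.GeneralLinearGroup.det g : ResK p K) ^ (-(p : ℤ) ^ (f - 1 - j.val))) •
          weightRep p σ d s g := by
      apply PiTensorProduct.ext
      apply MultilinearMap.ext
      intro v
      rw [LinearMap.compMultilinearMap_apply, LinearMap.compMultilinearMap_apply,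
        LinearMap.smul_apply, weightRep_tprod, weightRep_tprod, smul_smul, ← zpow_add₀ hne,
        map_zpow_eq_of_modEq σ hk hD]
      congr 2
      ring
    rw [this, LinearMap.smul_apply]
  have hmap : (Matrix.GeneralLinearGroup.map (emb p σ j) g).1 * A.map (emb p σ j) *
      ((Matrix.GeneralLinearGroup.map (emb p σ j) g)⁻¹).1 =
      (g.1 * A * (g⁻¹).1).map (emb p σ j) := by
    rw [← map_inv, Matrix.map_mul, Matrix.map_mul]
    rfl
  have hdet2 : (Matrix.GeneralLinearGroup.map (emb p σ j) g).1.det =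
      σ (Matrix.GeneralLinearGroup.det g : ResK p K) ^ ((p : ℤ) ^ (f - 1 - j.val)) := by
    have h1 : ((p : ℤ) ^ (f - 1 - j.val)) = ((p ^ (f - 1 - j.val) : ℕ) : ℤ) := by push_cast; rfl
    rw [h1, zpow_natCast, ← emb_apply]
    exact ((emb p σ j).map_det _).symm
  unfold twist
  rw [weightRep_mulFactor j h h' σ d' (isHomogeneous_quadForm _), linSubst_quadForm_conj,
    mulFactor_smul j h (isHomogeneous_quadForm _), hmap, hdet, map_smul, LinearMap.smul_apply,
    smul_smul, hdet2, zpow_neg, inv_mul_cancel₀, one_smul]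
  exact zpow_ne_zero _ ((Units.map (σ : ResK p K →* Fbar p) _).ne_zero)

end Twist

section Entries

theorem map_upper_of_zero {R S : Type*} [CommRing R] [Zero S] (δ : R → S) (h1 : δ 1 = 0)
    (h0 : δ 0 = 0) (x : R) : (upper x).1.map δ = !![0, δ x; 0, 0] := by
  ext i j
  fin_cases i <;> fin_cases j <;> simp [h0, h1]

theorem quadForm_upper {R : Type*} [Zero R] {F : Type} [Field F] (φ : R → F) (x : R)
    (h0 : φ 0 = 0) : quadForm ((!![0, x; 0, 0] : Matrix (Fin 2) (Fin 2) R).map φ) =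
      MvPolynomial.C (-φ x) * MvPolynomial.X 0 ^ 2 := by
  simp [quadForm, h0]

end Entries

section TwistedExtension

variable {p : ℕ} [Fact p.Prime] {f : ℕ} [NeZero f] (j : ZMod f) {s s' : ZMod f → ℕ}
  {K : Type*} [Field K] [Algebra ℚ_[p] K]
  [FiniteDimensional ℚ_[p] K] [Algebra ℤ_[p] K] [IsScalarTower ℤ_[p] ℚ_[p] K]
  {σ : ResK p K →+* Fbar p} (hf : f = resF p K) {d d' : ZMod f → ℤ}

include hf

/-- The second criterion gives rise to nonsplit smooth extensions if `K` is ramified. -/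
theorem smoothExtNeZero_of_critTwo (he : 1 < ramE p K) (hcrit : CritTwo p j d s d' s') :
    SmoothExtNeZero p K (infl p K (weightRep p σ d s)) (infl p K (weightRep p σ d' s')) := by
  obtain ⟨-, h, h', hD⟩ := hcrit
  obtain ⟨δ, hadd, hmul, hsq, π, hπ, hδπ⟩ := exists_derivation p K he
  have hδ1 : δ 1 = 0 := by
    have := hmul 1 1
    rw [mul_one, map_one, one_mul, mul_one] at this
    simpa using this
  have hδ0 : δ 0 = 0 := hsq 0 (Submodule.zero_mem _)
  let A : GLO p K → Matrix (Fin 2) (Fin 2) (ResK p K) := fun g =>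
    g.1.map δ * ((red p K g)⁻¹).1
  have hA1 : A 1 = 0 := by
    have : (1 : Matrix (Fin 2) (Fin 2) (OK p K)).map δ = 0 := by
      ext i j
      rw [Matrix.map_apply, Matrix.one_apply]
      split_ifs
      · exact hδ1
      · exact hδ0
    change (1 : Matrix (Fin 2) (Fin 2) (OK p K)).map δ * _ = 0
    rw [this, zero_mul]
  have hA : ∀ g g', A (g * g') = A g + (red p K g).1 * A g' * ((red p K g)⁻¹).1 := fun g g' => by
    have h1 : (g.1 * g'.1).map δ = g.1.map δ * (red p K g').1 + (red p K g).1 * g'.1.map δ := by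
      ext i l
      simp only [Matrix.map_apply, Matrix.add_apply, Matrix.mul_apply, Fin.sum_univ_two, hadd, hmul]
      change _ = (_ * IsLocalRing.residue _ (g'.1 0 l) + _ * IsLocalRing.residue _ (g'.1 1 l)) +
        (IsLocalRing.residue _ (g.1 i 0) * _ + IsLocalRing.residue _ (g.1 i 1) * _)
      ring
    change (g.1 * g'.1).map δ * _ = g.1.map δ * _ + _
    rw [h1, map_mul, mul_inv_rev, Units.val_mul, add_mul]
    congr 1
    · rw [mul_assoc, ← mul_assoc (red p K g').1, Units.mul_inv, one_mul]
    · simp only [A, mul_assoc]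
  have hcomm := fun g B v => weightRep_twist (σ := σ) (s := s) j h h' hf (d := d) (d' := d') hD g B v
  have hadd' := twist_add (σ := σ) j h
  have hzero : twist σ j s s' 0 = 0 := by
    have h0 : (0 : Matrix (Fin 2) (Fin 2) (ResK p K)).map (emb p σ j) = (0 : Fbar p) • 0 := by
      ext
      simp
    unfold twist
    rw [h0, quadForm_smul, mulFactor_smul j h (isHomogeneous_quadForm _), zero_smul]
  let ρ := weightRep p σ d s
  let ρ' := weightRep p σ d' s'
  let R : GLO p K → WeightSpace p s' × WeightSpace p s →ₗ[Fbar p]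
      WeightSpace p s' × WeightSpace p s := fun g =>
    ((ρ' (red p K g)).comp (LinearMap.fst _ _ _) +
      ((twist σ j s s' (A g)).comp (ρ (red p K g))).comp (LinearMap.snd _ _ _)).prod
      ((ρ (red p K g)).comp (LinearMap.snd _ _ _))
  have hR : ∀ g w v, R g (w, v) =
      (ρ' (red p K g) w + twist σ j s s' (A g) (ρ (red p K g) v), ρ (red p K g) v) :=
    fun g w v => rfl
  let T : Representation (Fbar p) (GLO p K) (WeightSpace p s' × WeightSpace p s) :=
    { toFun := R
      map_one' := by
        refine LinearMap.ext fun ⟨w, v⟩ => ?_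
        rw [hR, hA1, hzero, map_one, map_one, map_one, LinearMap.zero_apply, add_zero]
        rfl
      map_mul' := fun g g' => by
        refine LinearMap.ext fun ⟨w, v⟩ => ?_
        rw [Module.End.mul_apply, hR, hR, hR, map_mul, map_mul, map_mul, Module.End.mul_apply,
          Module.End.mul_apply, hA, hadd', LinearMap.add_apply, map_add, hcomm]
        refine Prod.ext ?_ rfl
        change _ + (_ + _) = (_ + _) + _
        rw [add_assoc, add_comm (twist σ j s s' (A g) _)] }
  let X : RepExtension (infl p K (weightRep p σ d s)) (infl p K (weightRep p σ d' s')) :=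
    { E := WeightSpace p s' × WeightSpace p s
      rep := T
      incl := ⟨LinearMap.inl _ _ _, fun g => by
        refine LinearMap.ext fun w => ?_
        change (_, _) = R g (w, 0)
        rw [hR, map_zero, map_zero, add_zero]
        rfl⟩
      proj := ⟨LinearMap.snd _ _ _, fun g => LinearMap.ext fun e => rfl⟩
      incl_injective := LinearMap.inl_injective
      proj_surjective := LinearMap.snd_surjective
      exact := Function.Exact.inl_snd }
  have hsm : ∀ e, ∀ g ∈ congrSub p K 2, R g e = e := by
    rintro ⟨w, v⟩ g hg
    have hg1 := red_of_mem_congrSub (congrSub_antitone one_le_two hg)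
    have hAg : g.1.map δ = 0 := by
      ext i l
      have h1 := mem_congrSub.1 hg i l
      have h2 := hadd (g i l - (1 : Matrix (Fin 2) (Fin 2) (OK p K)) i l)
        ((1 : Matrix (Fin 2) (Fin 2) (OK p K)) i l)
      rw [sub_add_cancel, hsq _ h1, zero_add] at h2
      rw [Matrix.map_apply, Matrix.zero_apply, h2, Matrix.one_apply]
      split_ifs
      · exact hδ1
      · exact hδ0
    have hAg' : A g = 0 := by simp only [A, hAg, zero_mul]
    rw [hR, hg1, hAg', hzero, map_one, map_one, LinearMap.zero_apply, add_zero]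
    rfl
  refine ⟨X, fun e => ⟨2, hsm e⟩, ?_⟩
  · rintro ⟨r, hr⟩
    have hg : upper π ∈ congrSub p K 1 := upper_mem_congrSub.2 (by simpa using hπ)
    have h1 : R (upper π) (r (mono p s 0)) = r (mono p s 0) := by
      have := Representation.IntertwiningMap.isIntertwining _ _ r (upper π) (mono p s 0)
      rw [infl_apply_of_mem _ hg] at this
      exact this.symm
    obtain ⟨w, v, hwv⟩ : ∃ w v, r (mono p s 0) = ((w, v) : WeightSpace p s' × WeightSpace p s) :=
      ⟨_, _, rfl⟩
    have hv : v = mono p s 0 := by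
      have h2 := hr (mono p s 0)
      rw [hwv] at h2
      exact h2
    rw [hwv, hR, red_of_mem_congrSub hg, map_one, map_one] at h1
    have h2 : twist σ j s s' (A (upper π)) v = 0 := by
      have h3 := (Prod.ext_iff.1 h1).1
      change w + twist σ j s s' (A (upper π)) v = w at h3
      let _ : AddCommGroup (WeightSpace p s') := inferInstance
      simpa using congrArg (fun z => z - w) h3
    have hQ : quadForm ((A (upper π)).map (emb p σ j)) =
        (-emb p σ j (δ π)) • (MvPolynomial.X 0 ^ 2) := by
      have h4 : A (upper π) = !![0, δ π; 0, 0] := by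
        change (upper π).1.map δ * _ = _
        rw [red_of_mem_congrSub hg, inv_one, Units.val_one, mul_one, map_upper_of_zero δ hδ1 hδ0]
      rw [h4, quadForm_upper _ _ (map_zero _), MvPolynomial.smul_eq_C_mul]
    unfold twist at h2
    rw [hQ, mulFactor_smul j h (MvPolynomial.isHomogeneous_X_pow _ _), LinearMap.smul_apply, hv,
      mulFactor_mono_zero j h h'] at h2
    rcases smul_eq_zero.1 h2 with h3 | h3
    · exact hδπ ((map_eq_zero _).1 (neg_eq_zero.1 h3))
    · refine mono_ne_zero (fun i => ?_) h3
      by_cases hi : i = j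
      · subst hi
        rw [Pi.single_eq_same, h]
        exact Nat.le_add_left _ _
      · rw [Pi.single_eq_of_ne hi]
        exact Nat.zero_le _

end TwistedExtension

section Inflation

variable {p : ℕ} [Fact p.Prime] {K : Type*} [Field K] [Algebra ℚ_[p] K]
  [FiniteDimensional ℚ_[p] K] [Algebra ℤ_[p] K] [IsScalarTower ℤ_[p] ℚ_[p] K]
  {V W : Type} [AddCommMonoid V] [Module (Fbar p) V] [AddCommMonoid W] [Module (Fbar p) W]
  {ρ : Representation (Fbar p) (GLk p K) V} {ρ' : Representation (Fbar p) (GLk p K) W}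

theorem smoothExtNeZero_of_extNeZero (h : ExtNeZero ρ ρ') :
    SmoothExtNeZero p K (infl p K ρ) (infl p K ρ') := by
  obtain ⟨X, hX⟩ := h
  let Y : RepExtension (infl p K ρ) (infl p K ρ') :=
    { E := X.E
      rep := infl p K X.rep
      incl := ⟨X.incl.toLinearMap, fun g => LinearMap.ext fun v =>
        Representation.IntertwiningMap.isIntertwining _ _ X.incl (red p K g) v⟩
      proj := ⟨X.proj.toLinearMap, fun g => LinearMap.ext fun v =>
        Representation.IntertwiningMap.isIntertwining _ _ X.proj (red p K g) v⟩
      incl_injective := X.incl_injective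
      proj_surjective := X.proj_surjective
      exact := X.exact }
  refine ⟨Y, fun v => ⟨1, fun g hg => infl_apply_of_mem _ hg v⟩, ?_⟩
  rintro ⟨r, hr⟩
  refine hX ⟨⟨r.toLinearMap, fun g => LinearMap.ext fun v => ?_⟩, hr⟩
  obtain ⟨x, rfl⟩ := red_surjective g
  exact Representation.IntertwiningMap.isIntertwining _ _ r x v

theorem extNeZero_of_trivial (X : RepExtension (infl p K ρ) (infl p K ρ')) (hX : ¬ X.Splits)
    (hK : ∀ g ∈ congrSub p K 1, X.rep g = 1) : ExtNeZero ρ ρ' := by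
  have hred : ∀ x y, red p K x = red p K y → X.rep x = X.rep y := fun x y hxy => by
    rw [← mul_inv_cancel_left y x, map_mul, hK (y⁻¹ * x), mul_one]
    rw [← red_eq_one_iff, map_mul, map_inv, hxy, inv_mul_cancel]
  have hinv := Function.surjInv_eq (red_surjective (p := p) (K := K))
  let T : Representation (Fbar p) (GLk p K) X.E :=
    { toFun := fun g => X.rep (Function.surjInv red_surjective g)
      map_one' := by
        rw [← map_one X.rep]
        exact hred _ _ (by rw [hinv, map_one])
      map_mul' := fun g h => by
        rw [← map_mul]
        exact hred _ _ (by rw [map_mul, hinv, hinv, hinv]) }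
  have hT : ∀ g, T (red p K g) = X.rep g := fun g =>
    hred _ _ (Function.surjInv_eq red_surjective _)
  let Y : RepExtension ρ ρ' :=
    { E := X.E
      rep := T
      incl := ⟨X.incl.toLinearMap, fun g => by
        obtain ⟨x, rfl⟩ := red_surjective g
        rw [hT]
        exact LinearMap.ext fun v => Representation.IntertwiningMap.isIntertwining _ _ X.incl x v⟩
      proj := ⟨X.proj.toLinearMap, fun g => by
        obtain ⟨x, rfl⟩ := red_surjective g
        rw [hT]
        exact LinearMap.ext fun v => Representation.IntertwiningMap.isIntertwining _ _ X.proj x v⟩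
      incl_injective := X.incl_injective
      proj_surjective := X.proj_surjective
      exact := X.exact }
  refine ⟨Y, ?_⟩
  rintro ⟨r, hr⟩
  refine hX ⟨⟨r.toLinearMap, fun g => LinearMap.ext fun v => ?_⟩, hr⟩
  have := Representation.IntertwiningMap.isIntertwining _ _ r (red p K g) v
  change r (ρ (red p K g) v) = T (red p K g) (r v) at this
  rw [hT] at this
  exact this

end Inflation

section Cohomology

variable {p : ℕ} [Fact p.Prime] {K : Type*} [Field K] [Algebra ℚ_[p] K]
  [FiniteDimensional ℚ_[p] K] [Algebra ℤ_[p] K] [IsScalarTower ℤ_[p] ℚ_[p] K]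
  {f : ℕ} [NeZero f] {σ : ResK p K →+* Fbar p} {d : ZMod f → ℤ} {s : ZMod f → ℕ}
  {d' : ZMod f → ℤ} {s' : ZMod f → ℕ}

theorem B1_eq_bot {W : Type} [AddCommGroup W] [Module (Fbar p) W]
    (ρ : Representation (Fbar p) (GLk p K) W) : B1 p K (infl p K ρ) = ⊥ := by
  rw [eq_bot_iff]
  rintro c ⟨w, hw⟩
  rw [Submodule.mem_bot]
  refine Subtype.ext (funext fun g => ?_)
  rw [hw, infl_apply_of_mem _ g.2, sub_self]
  rfl

section Generic

variable {V W : Type} [AddCommMonoid V] [Module (Fbar p) V] [AddCommGroup W] [Module (Fbar p) W]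
  {ρ : Representation (Fbar p) (GLk p K) V} {ρ' : Representation (Fbar p) (GLk p K) W}

theorem nontrivial_hom_of_family {Φ : GLO p K → V →ₗ[Fbar p] W}
    (hmul : ∀ v, ∀ g ∈ congrSub p K 1, ∀ h ∈ congrSub p K 1, Φ (g * h) v = Φ g v + Φ h v)
    (hconj : ∀ x, ∀ g ∈ congrSub p K 1, ∀ v,
      Φ (x * g * x⁻¹) (ρ (red p K x) v) = ρ' (red p K x) (Φ g v))
    (hsmooth : ∀ v, ∃ n, ∀ g ∈ congrSub p K n, g ∈ congrSub p K 1 → Φ g v = 0)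
    (h : ∃ g ∈ congrSub p K 1, Φ g ≠ 0) :
    Nontrivial ((infl p K ρ).IntertwiningMap (H1rep p K (infl p K ρ'))) := by
  let c : V →ₗ[Fbar p] Z1 p K (infl p K ρ') :=
    { toFun := fun v => ⟨fun g => Φ g v, fun g g' => by
        rw [infl_apply_of_mem _ g.2]
        exact hmul v g g.2 g' g'.2, by
        obtain ⟨n, hn⟩ := hsmooth v
        refine ⟨n, fun g g' hg' => ?_⟩
        change Φ (g * g' : GLO p K) v = _
        rw [hmul v g g.2 g' g'.2, hn _ hg' g'.2, add_zero]⟩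
      map_add' := fun v w => Subtype.ext (funext fun g => (Φ g).map_add v w)
      map_smul' := fun a v => Subtype.ext (funext fun g => (Φ g).map_smul a v) }
  let F : (infl p K ρ).IntertwiningMap (H1rep p K (infl p K ρ')) :=
    ⟨(Submodule.mkQ _).comp c, fun x => LinearMap.ext fun v => by
      refine congrArg (Submodule.mkQ _) (Subtype.ext (funext fun g => ?_))
      change Φ g (ρ (red p K x) v) = ρ' (red p K x) (Φ (MulAut.conjNormal x⁻¹ g) v)
      rw [← hconj _ _ (MulAut.conjNormal x⁻¹ g).2, MulAut.conjNormal_apply]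
      congr 2
      group⟩
  refine ⟨F, 0, fun hF => ?_⟩
  obtain ⟨g, hg, hne⟩ := h
  refine hne (LinearMap.ext fun v => ?_)
  have h1 : (Submodule.mkQ (B1 p K (infl p K ρ'))) (c v) = 0 := DFunLike.congr_fun hF v
  rw [Submodule.mkQ_apply, Submodule.Quotient.mk_eq_zero, B1_eq_bot, Submodule.mem_bot] at h1
  exact congrFun (congrArg Subtype.val h1) ⟨g, hg⟩

theorem exists_family_of_hom (F : (infl p K ρ).IntertwiningMap (H1rep p K (infl p K ρ')))
    (hF : F ≠ 0) :
    ∃ Φ : GLO p K → V →ₗ[Fbar p] W,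
      (∀ v, ∀ g ∈ congrSub p K 1, ∀ h ∈ congrSub p K 1, Φ (g * h) v = Φ g v + Φ h v) ∧
      (∀ x, ∀ g ∈ congrSub p K 1, ∀ v,
        Φ (x * g * x⁻¹) (ρ (red p K x) v) = ρ' (red p K x) (Φ g v)) ∧
      (∀ v, ∃ n, ∀ g ∈ congrSub p K n, g ∈ congrSub p K 1 → Φ g v = 0) ∧
      ∃ g ∈ congrSub p K 1, Φ g ≠ 0 := by
  classical
  let e : H1 p K (infl p K ρ') ≃ₗ[Fbar p] Z1 p K (infl p K ρ') :=
    Submodule.quotEquivOfEqBot _ (B1_eq_bot _)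
  have he : ∀ z, e (Submodule.Quotient.mk z) = z := fun z =>
    Submodule.quotEquivOfEqBot_apply_mk _ _ z
  have hact : ∀ x c, e (H1rep p K (infl p K ρ') x c) = actZ1 p K (infl p K ρ') x (e c) :=
    fun x c => by
      obtain ⟨z, rfl⟩ := Submodule.Quotient.mk_surjective _ c
      rw [he]
      exact he _
  let C : V →ₗ[Fbar p] Z1 p K (infl p K ρ') := e.toLinearMap.comp F.toLinearMap
  have hC : ∀ x v, C (ρ (red p K x) v) = actZ1 p K (infl p K ρ') x (C v) := fun x v => by
    refine Eq.trans ?_ (hact x _)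
    exact congrArg e (Representation.IntertwiningMap.isIntertwining _ _ F x v)
  let Φ : GLO p K → V →ₗ[Fbar p] W := fun g =>
    if hg : g ∈ congrSub p K 1 then
      { toFun := fun v => (C v).1 ⟨g, hg⟩
        map_add' := fun v w => by rw [map_add]; rfl
        map_smul' := fun a v => by rw [map_smul]; rfl }
    else 0
  have hΦ : ∀ g, ∀ hg : g ∈ congrSub p K 1, ∀ v, Φ g v = (C v).1 ⟨g, hg⟩ := fun g hg v => by
    simp only [Φ, dif_pos hg]
    rfl
  refine ⟨Φ, fun v g hg g' hg' => ?_, fun x g hg v => ?_, fun v => ?_, ?_⟩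
  · have h1 := (C v).2.1 ⟨g, hg⟩ ⟨g', hg'⟩
    rw [hΦ _ (mul_mem hg hg'), hΦ _ hg, hΦ _ hg']
    refine h1.trans ?_
    congr 1
    exact infl_apply_of_mem _ hg _
  · have hg' : x * g * x⁻¹ ∈ congrSub p K 1 := Subgroup.Normal.conj_mem inferInstance _ hg _
    rw [hΦ _ hg', hΦ _ hg, hC]
    change ρ' (red p K x) ((C v).1 (MulAut.conjNormal x⁻¹ ⟨_, hg'⟩)) = _
    refine congrArg (fun g => ρ' (red p K x) ((C v).1 g)) (Subtype.ext ?_)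
    rw [MulAut.conjNormal_apply]
    change x⁻¹ * (x * g * x⁻¹) * x⁻¹⁻¹ = g
    group
  · obtain ⟨n, hn⟩ := (C v).2.2
    refine ⟨n, fun g hg hg1 => ?_⟩
    have h0 := (C v).2.1 1 1
    rw [mul_one, infl_apply_of_mem _ (1 : congrSub p K 1).2, left_eq_add] at h0
    have h2 := hn 1 ⟨g, hg1⟩ hg
    rw [one_mul, h0] at h2
    rw [hΦ g hg1, h2]
  · by_contra! h
    apply hF
    refine DFunLike.ext _ _ fun v => e.injective ?_
    change C v = e 0
    rw [map_zero]
    refine Subtype.ext (funext fun g => ?_)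
    have := hΦ g g.2 v
    rw [h g g.2] at this
    exact this.symm

end Generic

variable (hf : f = resF p K) (hf1 : 1 < f) (hs : ∀ i, s i + 2 ≤ p) (hs' : ∀ i, s' i + 2 ≤ p)
  (hne : IsEmpty ((weightRep p σ d s).Equiv (weightRep p σ d' s')))
include hf hf1 hs hs' hne

theorem IsEquivariantFamily.exists_crit
    {Φ : GLO p K → WeightSpace p s →ₗ[Fbar p] WeightSpace p s'}
    (hΦ : IsEquivariantFamily σ d s d' s' Φ) (h : ∃ g ∈ congrSub p K 1, Φ g ≠ 0) :
    (∃ i, CritOne p i d s d' s' ∨ CritOne p i d' s' d s) ∨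
      ∃ i, CritTwo p i d s d' s' ∨ CritTwo p i d' s' d s := by
  by_contra! hcrit
  obtain ⟨h1, h2⟩ := hcrit
  have hlow : ∀ x ∈ IsLocalRing.maximalIdeal (OK p K), Φ (lower x) (mono p s 0) = 0 := by
    by_contra! h
    obtain ⟨i, h | h⟩ := hΦ.crit_of_lower hf hf1 hs hs' h
    · exact (h1 i).1 h
    · exact (h2 i).1 h
  have hup : ∀ x ∈ IsLocalRing.maximalIdeal (OK p K), Φ (upper x) (mono p s 0) = 0 := by
    by_contra! h
    obtain ⟨i, h | h⟩ := hΦ.crit_of_upper hf hf1 hs hs' hlow hne h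
    · exact (h1 i).2 h
    · exact (h2 i).2 h
  obtain ⟨g, hg, hg0⟩ := h
  exact hg0 (hΦ.eq_zero hf hf1 hs hs' hlow hne hup hg)

/-- Smooth extensions of weights are governed by the two criteria. -/
theorem smoothExtNeZero_iff :
    SmoothExtNeZero p K (infl p K (weightRep p σ d s)) (infl p K (weightRep p σ d' s')) ↔
      ((∃ j, CritOne p j d s d' s' ∨ CritOne p j d' s' d s) ∨
        (1 < ramE p K ∧ ∃ j, CritTwo p j d s d' s' ∨ CritTwo p j d' s' d s)) := by
  have hk := card_resK_eq hf
  have hne' : IsEmpty ((weightRep p σ d' s').Equiv (weightRep p σ d s)) :=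
    ⟨fun e => hne.false e.symm⟩
  constructor
  · rintro ⟨X, hX, hsplit⟩
    by_contra! hcon
    obtain ⟨h1, h2⟩ := hcon
    obtain ⟨i, hi⟩ := crit_of_smoothExtNeZero X hf hf1 hs hs' h1 hne hX hsplit
    have he : ramE p K = 1 := by
      by_contra he
      have := h2 (by have := ramE_pos p K; omega) i
      exact hi.elim this.1 this.2
    rcases hi with hi | hi
    · exact hsplit (splits_of_critTwo X hf hf1 hs hs' h1 hne hX he hi)
    · obtain ⟨Y, hY, hYX⟩ := exists_dual_extension hs hs' X hX
      exact hsplit (hYX (splits_of_critTwo Y hf hf1 hs' hs (fun i => (h1 i).symm) hne' hY he hi))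
  · rintro (⟨j, h | h⟩ | ⟨he, j, h | h⟩)
    · exact smoothExtNeZero_of_extNeZero (extNeZero_of_critOne j hf1 hs' σ hk hs h)
    · exact smoothExtNeZero_of_extNeZero
        (extNeZero_symm hs' hs (extNeZero_of_critOne j hf1 hs σ hk hs' h))
    · exact smoothExtNeZero_of_critTwo j hf he h
    · exact smoothExtNeZero_symm hs' hs (smoothExtNeZero_of_critTwo j hf he h)

/-- The same criteria in terms of extensions of representations of `GL₂(k)` and of the cohomology
of the first congruence subgroup. -/
theorem extNeZero_or_nontrivial_iff :
    (ExtNeZero (weightRep p σ d s) (weightRep p σ d' s') ∨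
        (1 < ramE p K ∧
          Nontrivial ((infl p K (weightRep p σ d s)).IntertwiningMap
            (H1rep p K (W := WeightSpace p s') (infl p K (weightRep p σ d' s')))))) ↔
      ((∃ j, CritOne p j d s d' s' ∨ CritOne p j d' s' d s) ∨
        (1 < ramE p K ∧ ∃ j, CritTwo p j d s d' s' ∨ CritTwo p j d' s' d s)) := by
  have hk := card_resK_eq hf
  constructor
  · rintro (h | ⟨he, h⟩)
    · exact (smoothExtNeZero_iff hf hf1 hs hs' hne).1 (smoothExtNeZero_of_extNeZero h)
    · obtain ⟨F, hF⟩ := exists_ne (0 : (infl p K (weightRep p σ d s)).IntertwiningMap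
        (H1rep p K (W := WeightSpace p s') (infl p K (weightRep p σ d' s'))))
      obtain ⟨Φ, h1, h2, h3, hg⟩ := exists_family_of_hom (W := WeightSpace p s') F hF
      have hΦ : IsEquivariantFamily σ d s d' s' Φ := ⟨h1, h2, h3⟩
      exact (hΦ.exists_crit hf hf1 hs hs' hne hg).imp_right fun h => ⟨he, h⟩
  · rintro (⟨j, h | h⟩ | ⟨he, h⟩)
    · exact Or.inl (extNeZero_of_critOne j hf1 hs' σ hk hs h)
    · exact Or.inl (extNeZero_symm hs' hs (extNeZero_of_critOne j hf1 hs σ hk hs' h))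
    · obtain ⟨X, hX, hsplit⟩ := (smoothExtNeZero_iff hf hf1 hs hs' hne).2 (Or.inr ⟨he, h⟩)
      obtain ⟨S, hS⟩ := exists_linear_section X.proj.toLinearMap X.proj_surjective
      obtain ⟨Φ, hΦ, hΦS⟩ := exists_equivariantFamily X hX S hS
      by_cases h0 : ∃ g ∈ congrSub p K 1, Φ g ≠ 0
      · exact Or.inr ⟨he, nontrivial_hom_of_family (W := WeightSpace p s') hΦ.mul hΦ.conj hΦ.smooth h0⟩
      · push Not at h0
        refine Or.inl (extNeZero_of_trivial X hsplit fun g hg => LinearMap.ext fun e => ?_)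
        refine X.eq_of_fixes_section (congrSub p K 1) (fun g hg v => infl_apply_of_mem _ hg v) hS hg
          (fun v => ?_) e
        rw [← sub_eq_zero, ← hΦS g hg, h0 g hg, LinearMap.zero_apply, map_zero]

end Cohomology

end SerreExt

open SerreExt in
theorem corollary5p6 (p : ℕ) [Fact p.Prime]
    (K : Type*) [Field K] [Algebra ℚ_[p] K] [FiniteDimensional ℚ_[p] K]
    [Algebra ℤ_[p] K] [IsScalarTower ℤ_[p] ℚ_[p] K]
    (f : ℕ) [NeZero f] (hf : f = resF p K) (hf1 : 1 < f)
    (σ : ResK p K →+* Fbar p)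
    (ϖ : AlgebraicClosure K)
    (hϖ : ∃ π : OK p K, Irreducible π ∧
      ϖ ^ (p ^ f - 1) = algebraMap K (AlgebraicClosure K) (π : K))
    (d d' : ZMod f → ℤ) (s s' : ZMod f → ℕ)
    (hs : ∀ i, s i + 2 ≤ p) (hs' : ∀ i, s' i + 2 ≤ p)
    (hne : IsEmpty ((weightRep p σ d s).Equiv (weightRep p σ d' s'))) :
    (HasTypeI p K σ ϖ d s d' s' ↔
      ((∃ j, CritOne p j d s d' s' ∨ CritOne p j d' s' d s) ∨
        (1 < ramE p K ∧ ∃ j, CritTwo p j d s d' s' ∨ CritTwo p j d' s' d s))) ∧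
    (HasTypeI p K σ ϖ d s d' s' ↔
      (ExtNeZero (weightRep p σ d s) (weightRep p σ d' s') ∨
        (1 < ramE p K ∧
          Nontrivial ((infl p K (weightRep p σ d s)).IntertwiningMap
            (H1rep p K (W := WeightSpace p s') (infl p K (weightRep p σ d' s'))))))) ∧
    (HasTypeI p K σ ϖ d s d' s' ↔
      SmoothExtNeZero p K (infl p K (weightRep p σ d s))
        (infl p K (weightRep p σ d' s'))) ∧
    (HasTypeI p K σ ϖ d s d' s' → (typeIFamilies p K σ ϖ d s d' s').ncard = 1) ∧
    (f = 2 → 2 * s 1 + 1 = p → 2 * s 0 + 3 = p → 2 * s' 1 + 3 = p → 2 * s' 0 + 1 = p →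
      ShapeOne p 1 s s' ∧ ShapeOne p 0 s' s ∧
        ¬ (CritOne p 1 d s d' s' ∧ CritOne p 0 d' s' d s)) := by
  obtain ⟨π, hπ, hϖ⟩ := hϖ
  rw [hf] at hϖ
  have hAB := hasTypeI_iff (σ := σ) (d := d) (d' := d') hf hπ hϖ hf1 hs hs'
  exact ⟨hAB, hAB.trans (extNeZero_or_nontrivial_iff hf hf1 hs hs' hne).symm,
    hAB.trans (smoothExtNeZero_iff hf hf1 hs hs' hne).symm,
    ncard_typeIFamilies hf hπ hϖ hf1 hs hs', shapes_of_two⟩
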